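/- Notation. For $a\in\mathbb C$, $k\in\mathbb Z$ let $(a)_k=\Gamma(a+k)/\Gamma(a)$ be the Pochhammer symbol. Let ${}_2F_1(a,b;c;z)$ denote the Gauss hypergeometric function, continued analytically from $|z|<1$ to $\mathbb C\setminus[1,\infty)$, and let ${}_2F_1(a,b;c;X\pm i0)$ be its boundary values at $X>1$. Horn's function is $$H_2(a,b,c,d,e;x,y)=\sum_{i,j\ge0}\frac{(a)_{i-j}(b)_i(c)_j(d)_j}{(e)_i\,i!\,j!}x^iy^j\qquad\Big(|x|<1,\ |y|<\tfrac1{1+|x|}\Big),$$ continued analytically to the union of its convergence region with $\{(x,y)\in\mathbb C^2: |x|+|y||1-x|<|1-x|\}$, which contains all real $(x,y)$ with $x\le0$ and $|y|(1-x)<1$. Olsson's function is $$F_P(a,b_1,b_2,c_1,c_2;x,y)=\sum_{i,j\ge0}\frac{(a)_{i+j}(a-c_2+1)_i(b_1)_i(b_2)_j}{(a+b_2-c_2+1)_{i+j}(c_1)_i\,i!\,j!}x^i(1-y)^j\qquad(|x|,|y-1|<1),$$ continued analytically to $x\notin[1,\infty)$, $y\notin(-\infty,0]$. Let $a,b_1,b_2,c_1,c_2\in\mathbb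 C$ with $c_1\notin\mathbb Z_{\le0}$, and let $x,y\in\mathbb R$ with $x<0$, $x+y>1$. For $0<p<1<R$ and $(y-1)^{-1}<r<(-x)^{-1}$ let $L$ be the Pochhammer double loop $(1+,0+,1-,0-)$ that starts at $p$ with $\arg u=\arg(1-u)=0$ and whose loops around $1$ and $0$ are the circles symmetric about the real axis through $p,R$ and through $-r,p$, respectively (so $0$ and $(1-y)^{-1}$ are inside the second circle and $x^{-1}$ is outside). Put $$I(x,y)=\frac{\Gamma(c_1)}{\Gamma(a-b_2)\Gamma(-a+b_2+c_1)}\frac{y^{-b_2}}{(1-e^{2\pi i(a-b_2)})(1-e^{2\pi i(-a+b_2+c_1)})}\int_L u^{a-b_2-1}(1-u)^{-a+b_2+c_1-1}(1-xu)^{-b_1}\,{}_2F_1\big(b_2,b_2-c_2+1;-a+b_2+c_1;y^{-1}(1-u^{-1})\big)\,du,$$ where the powers of $u$ and $1-u$ are continued along $L$ and $(1-xu)^{-b_1}$ is the principal value, $$I_1(x,y)=\frac{\Gamma(c_1)}{\Gamma(a-b_2)\Gamma(-a+b_2+c_1)}\,y^{-b_2}\int_0^1u^{a-b_2-1}(1-u)^{-a+b_2+c_1-1}(1-xu)^{-b_1}\,{}_2F_1\big(b_2,b_2-c_2+1;-a+b_2+c_1;y^{-1}(1-u^{-1})\big)\,du,$$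 $$I_2(x,y)=\frac{\Gamma(c_1)\Gamma(-a+b_2+1)}{\Gamma(-a+b_2+c_1)}\frac{y^{-b_2}}{2\pi i}\int_{(1-y)^{-1}}^0(-u)^{a-b_2-1}(1-u)^{-a+b_2+c_1-1}(1-xu)^{-b_1}\big(f(u,+)-f(u,-)\big)\,du,$$ with $f(u,\pm)={}_2F_1\big(b_2,b_2-c_2+1;-a+b_2+c_1;y^{-1}(1-u^{-1})\pm i0\big)$. Then the following hold; all analytic continuations, boundary values and integrals that occur exist, the integrals over segments absolutely. (i) If $a-b_2,\,-a+b_2+c_1\notin\mathbb Z$, then for all such $p,r,R$ $$y^{-b_2}H_2(a-b_2,b_1,b_2,b_2-c_2+1,c_1;x,-1/y)=I(x,y).$$ (ii) If $\Re a,\ \Re(a-c_2+1),\ \Re(b_2+c_1-a)>0$ and $a+b_2-c_2+1\notin\mathbb Z_{\le0}$, then $$I_1(x,y)=\frac{\Gamma(a)\Gamma(a-c_2+1)}{\Gamma(a+b_2-c_2+1)\Gamma(a-b_2)}\,F_P(a,b_1,b_2,c_1,c_2;x,y).$$ (iii) If $\Re a,\ \Re(a-c_2+1),\ \Re(c_1+c_2-a-b_2)>0$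 and none of $a-b_2+1$, $-a+b_2+1$, $-a+b_2+c_1$ is in $\mathbb Z_{\le0}$, then $$I_2(x,y)=\frac{\Gamma(b_2-a+1)\Gamma(a)\Gamma(a-c_2+1)}{\Gamma(b_2)\Gamma(a-b_2+1)\Gamma(b_2-c_2+1)}\,(y-1)^{-a}\,F_P\Big(a,b_1,c_2-b_2,c_1,c_2;\frac x{1-y},\frac y{y-1}\Big).$$ (iv) If $a-b_2,\,-a+b_2+c_1\notin\mathbb Z$ and $\Re a,\ \Re(a-c_2+1),\ \Re(b_2+c_1-a),\ \Re(c_1+c_2-a-b_2)>0$, then $I(x,y)=I_1(x,y)+I_2(x,y)$ for all such $p,r,R$. If moreover $a+b_2-c_2+1\notin\mathbb Z_{\le0}$, then $$y^{-b_2}H_2(a-b_2,b_1,b_2,b_2-c_2+1,c_1;x,-1/y)=\frac{\Gamma(a)\Gamma(a-c_2+1)}{\Gamma(a+b_2-c_2+1)\Gamma(a-b_2)}F_P(a,b_1,b_2,c_1,c_2;x,y)+\frac{\Gamma(b_2-a+1)\Gamma(a)\Gamma(a-c_2+1)}{\Gamma(b_2)\Gamma(a-b_2+1)\Gamma(b_2-c_2+1)}(y-1)^{-a}F_P\Big(a,b_1,c_2-b_2,c_1,c_2;\frac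 x{1-y},\frac y{y-1}\Big).$$ Here $1/\Gamma$ is $0$ at the poles of $\Gamma$, and powers of positive reals are principal. -/

import Mathlib

open Filter Topology MeasureTheory

noncomputable section

/-! ### Analytic continuation -/

/-- `f`, given on `U`, extends to a function that is holomorphic on `D`. -/
def HasContinuation {E : Type*} [NormedAddCommGroup E] [NormedSpace ℂ E]
    (f : E → ℂ) (U D : Set E) : Prop :=
  ∃ g : E → ℂ, DifferentiableOn ℂ g D ∧ Set.EqOn g f U

open Classical in
/-- The holomorphic continuation to `D` of the function `f` given on `U`. In all uses below `D` is
open and connected and `U ⊆ D` is open and non-empty, so that the continuation is unique on `D`. -/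
def continuation {E : Type*} [NormedAddCommGroup E] [NormedSpace ℂ E]
    (f : E → ℂ) (U D : Set E) : E → ℂ :=
  if h : HasContinuation f U D then Classical.choose h else 0

/-! ### Gauss's hypergeometric function -/

/-- The Gauss hypergeometric function on `ℂ ∖ [1, ∞)`: the holomorphic continuation of the
hypergeometric series from the open unit disc. -/
def gauss2F1 (a b c : ℂ) : ℂ → ℂ :=
  continuation (fun z : ℂ => ordinaryHypergeometric a b c z)
    (Metric.ball 0 1) {z : ℂ | 1 - z ∈ Complex.slitPlane}

/-- The boundary value `₂F₁(a, b; c; X + i0)` on the cut, from the upper half plane. -/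
def gauss2F1Above (a b c : ℂ) (X : ℝ) : ℂ :=
  limUnder (𝓝[>] (0 : ℝ)) fun ε : ℝ => gauss2F1 a b c ((X : ℂ) + (ε : ℂ) * Complex.I)

/-- The boundary value `₂F₁(a, b; c; X - i0)` on the cut, from the lower half plane. -/
def gauss2F1Below (a b c : ℂ) (X : ℝ) : ℂ :=
  limUnder (𝓝[>] (0 : ℝ)) fun ε : ℝ => gauss2F1 a b c ((X : ℂ) - (ε : ℂ) * Complex.I)

/-! ### Horn's function `H₂` and Olsson's function `F_P` -/

/-- The Pochhammer symbol `(a)_k = Γ(a + k) / Γ(a)` for `k ∈ ℤ`. -/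
def pochZ (a : ℂ) : ℤ → ℂ
  | Int.ofNat n => (ascPochhammer ℂ n).eval a
  | Int.negSucc n => (-1) ^ (n + 1) / (ascPochhammer ℂ (n + 1)).eval (1 - a)

/-- The double power series of Horn's `H₂(a, b, c, d, e; x, y)`. -/
def hornH2Series (a b c d e : ℂ) (P : ℂ × ℂ) : ℂ :=
  ∑' k : ℕ × ℕ,
    pochZ a ((k.1 : ℤ) - (k.2 : ℤ)) * pochZ b k.1 * pochZ c k.2 * pochZ d k.2 /
      (pochZ e k.1 * (k.1.factorial : ℂ) * (k.2.factorial : ℂ)) * P.1 ^ k.1 * P.2 ^ k.2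

/-- The convergence region `|x| < 1`, `|y| < 1 / (|x| + 1)` of the `H₂` series. -/
def hornH2Disc : Set (ℂ × ℂ) :=
  {P | ‖P.1‖ < 1 ∧ ‖P.2‖ * (‖P.1‖ + 1) < 1}

/-- A connected open set that contains the convergence region of the `H₂` series and
all `(x, y)` with `|y| < 1 - |x / (x - 1)|`, in particular all real `(x, y)` with `x ≤ 0` and
`|y| (1 - x) < 1`. On it `x ∉ [1, ∞)`, and `y (x u - 1) ∉ [1, ∞)` for all `u ∈ [0, 1]`. -/
def hornH2Domain : Set (ℂ × ℂ) :=
  hornH2Disc ∪ {P | ‖P.1‖ + ‖P.2‖ * ‖1 - P.1‖ < ‖1 - P.1‖}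

/-- Horn's function `H₂`, continued holomorphically from the convergence region of its series. -/
def hornH2 (a b c d e x y : ℂ) : ℂ :=
  continuation (hornH2Series a b c d e) hornH2Disc hornH2Domain (x, y)

/-- The double power series, in powers of `x` and `1 - y`, of Olsson's
`F_P(a, b₁, b₂, c₁, c₂; x, y)`. -/
def olssonFPSeries (a b₁ b₂ c₁ c₂ : ℂ) (P : ℂ × ℂ) : ℂ :=
  ∑' k : ℕ × ℕ,
    pochZ a ((k.1 : ℤ) + (k.2 : ℤ)) * pochZ (a - c₂ + 1) k.1 * pochZ b₁ k.1 * pochZ b₂ k.2 /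
      (pochZ (a + b₂ - c₂ + 1) ((k.1 : ℤ) + (k.2 : ℤ)) * pochZ c₁ k.1 *
        (k.1.factorial : ℂ) * (k.2.factorial : ℂ)) * P.1 ^ k.1 * (1 - P.2) ^ k.2

/-- The convergence region `|x| < 1`, `|y - 1| < 1` of the `F_P` series. -/
def olssonFPDisc : Set (ℂ × ℂ) := {P | ‖P.1‖ < 1 ∧ ‖P.2 - 1‖ < 1}

/-- The region `x ∉ [1, ∞)`, `y ∉ (-∞, 0]`. -/
def olssonFPDomain : Set (ℂ × ℂ) :=
  {P | 1 - P.1 ∈ Complex.slitPlane ∧ P.2 ∈ Complex.slitPlane}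

/-- Olsson's function `F_P`, continued holomorphically from the convergence region of its
series to `x ∉ [1, ∞)`, `y ∉ (-∞, 0]`. -/
def olssonFP (a b₁ b₂ c₁ c₂ x y : ℂ) : ℂ :=
  continuation (olssonFPSeries a b₁ b₂ c₁ c₂) olssonFPDisc olssonFPDomain (x, y)

/-! ### Double loop integrals -/

/-- The continuous branch of `log γ(t)` along a piecewise continuously differentiable path `γ`
that avoids `0`, starting with the principal value at `t = 0`. -/
def logAlong (γ : ℝ → ℂ) (t : ℝ) : ℂ :=
  Complex.log (γ 0) + ∫ s in (0 : ℝ)..t, deriv γ s / γ s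

/-- The circle that is symmetric about the real axis and passes through `p` and `R`, run through
once in the positive sense while `t` grows by `1`, and being at `p` for integral `t`. -/
def circleThrough (p R : ℝ) (t : ℝ) : ℂ :=
  circleMap (((p + R) / 2 : ℝ) : ℂ) ((p - R) / 2) (2 * Real.pi * t)

/-- The Pochhammer double loop `(1+, 0+, 1-, 0-)` on the parameter interval `[0, 4]`, for
`0 < p < 1 < R` and `0 < r`. It starts at `p`, runs around `1` in the positive sense along the
circle through `p` and `R`, then around `0` in the positive sense along the circle through
`p` and `-r`, and then along the same two circles in the negative sense. -/
def doubleLoop (p r R : ℝ) (t : ℝ) : ℂ :=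
  if t ≤ 1 then circleThrough p R t
  else if t ≤ 2 then circleThrough p (-r) t
  else if t ≤ 3 then circleThrough p R (-t)
  else circleThrough p (-r) (-t)

/-- The integral of `u^(α - 1) (1 - u)^(β - 1) g(u) du` over the double loop, where
`arg u = arg (1 - u) = 0` at the starting point and the two powers are continued along the
loop. -/
def doubleLoopIntegral (p r R : ℝ) (α β : ℂ) (g : ℂ → ℂ) : ℂ :=
  ∫ t in (0 : ℝ)..4,
    Complex.exp ((α - 1) * logAlong (doubleLoop p r R) t +
        (β - 1) * logAlong (fun s => 1 - doubleLoop p r R s) t) *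
      g (doubleLoop p r R t) * deriv (doubleLoop p r R) t

/-! ### The functions `I`, `I₁` and `I₂` -/

/-- `I(x, y)`: the double loop integral with a Gauss hypergeometric function in its integrand,
over the double loop with base point `p` and further real crossing points `-r` and `R`. -/
def loopI (p r R : ℝ) (a b₁ b₂ c₁ c₂ : ℂ) (x y : ℝ) : ℂ :=
  Complex.Gamma c₁ / (Complex.Gamma (a - b₂) * Complex.Gamma (-a + b₂ + c₁)) *
    ((y : ℂ) ^ (-b₂) /
      ((1 - Complex.exp (2 * Real.pi * Complex.I * (a - b₂))) *
        (1 - Complex.exp (2 * Real.pi * Complex.I * (-a + b₂ + c₁))))) *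
    doubleLoopIntegral p r R (a - b₂) (-a + b₂ + c₁) fun u =>
      (1 - x * u) ^ (-b₁) *
        gauss2F1 b₂ (b₂ - c₂ + 1) (-a + b₂ + c₁) ((y : ℂ)⁻¹ * (1 - u⁻¹))

/-- The integrand of `I₁`, for `0 < u < 1`. -/
def integrandI₁ (a b₁ b₂ c₁ c₂ : ℂ) (x y u : ℝ) : ℂ :=
  (u : ℂ) ^ (a - b₂ - 1) * (1 - u : ℂ) ^ (-a + b₂ + c₁ - 1) * (1 - x * u : ℂ) ^ (-b₁) *
    gauss2F1 b₂ (b₂ - c₂ + 1) (-a + b₂ + c₁) ((y : ℂ)⁻¹ * (1 - (u : ℂ)⁻¹))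

/-- `I₁(x, y)`: the contribution of the segment `[0, 1]`. -/
def segmentI₁ (a b₁ b₂ c₁ c₂ : ℂ) (x y : ℝ) : ℂ :=
  Complex.Gamma c₁ / (Complex.Gamma (a - b₂) * Complex.Gamma (-a + b₂ + c₁)) *
    (y : ℂ) ^ (-b₂) * ∫ u in (0 : ℝ)..1, integrandI₁ a b₁ b₂ c₁ c₂ x y u

/-- The integrand of `I₂`, for `(1 - y)⁻¹ < u < 0`. -/
def integrandI₂ (a b₁ b₂ c₁ c₂ : ℂ) (x y u : ℝ) : ℂ :=
  (-u : ℂ) ^ (a - b₂ - 1) * (1 - u : ℂ) ^ (-a + b₂ + c₁ - 1) * (1 - x * u : ℂ) ^ (-b₁) *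
    (gauss2F1Above b₂ (b₂ - c₂ + 1) (-a + b₂ + c₁) (y⁻¹ * (1 - u⁻¹)) -
      gauss2F1Below b₂ (b₂ - c₂ + 1) (-a + b₂ + c₁) (y⁻¹ * (1 - u⁻¹)))

/-- `I₂(x, y)`: the contribution of the segment `[(1 - y)⁻¹, 0]`. -/
def segmentI₂ (a b₁ b₂ c₁ c₂ : ℂ) (x y : ℝ) : ℂ :=
  Complex.Gamma c₁ * Complex.Gamma (-a + b₂ + 1) / Complex.Gamma (-a + b₂ + c₁) *
    ((y : ℂ) ^ (-b₂) / (2 * Real.pi * Complex.I)) *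
    ∫ u in ((1 - y)⁻¹)..(0 : ℝ), integrandI₂ a b₁ b₂ c₁ c₂ x y u

/-- The constant in front of `F_P(a, b₁, b₂, c₁, c₂; x, y)`. -/
def const₁ (a b₂ c₂ : ℂ) : ℂ :=
  Complex.Gamma a * Complex.Gamma (a - c₂ + 1) /
    (Complex.Gamma (a + b₂ - c₂ + 1) * Complex.Gamma (a - b₂))

/-- The constant in front of
`(y - 1)^(-a) F_P(a, b₁, c₂ - b₂, c₁, c₂; x / (1 - y), y / (y - 1))`. -/
def const₂ (a b₂ c₂ : ℂ) : ℂ :=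
  Complex.Gamma (b₂ - a + 1) * Complex.Gamma a * Complex.Gamma (a - c₂ + 1) /
    (Complex.Gamma b₂ * Complex.Gamma (a - b₂ + 1) * Complex.Gamma (b₂ - c₂ + 1))

end

/-! The loop integral is Horn's function because its integrand can be expanded. In powers of `x` and
`1/y` the factors `(1 - x u)^(-b₁)` and `₂F₁` produce monomials `u^(i-j) (1 - u)^j`, and
Pochhammer's Beta integral (`LoopParams.loopPair_one`) turns each of them into a coefficient of
`H₂`. On a fixed loop the expansion converges only for small arguments. Therefore `(x, 1/y)` is
replaced by `(t x, t/y)`: the loop avoids all singularities for every `t ∈ [0, 1]`, both sides are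
analytic in `t`, and the identity travels from small `t` to `t = 1`
(`LoopParams.loopPair_eq_hornH2`). The continuation of `H₂` that this needs comes from applying
Pfaff's transformation to the series in `x`.

The integral over `[0, 1]` is an Euler integral of Olsson's function. Pfaff's transformation changes
the integrand into Beta weights times `(1 - u(1 - y))^(-b₂)` and a `₂F₁` of argument `(1 - u)/(1 -
u(1 - y))`. After expansion in `x`, in `1 - y` and in the hypergeometric index, the last of the
three sums is evaluated by Gauss's theorem (`hasSum_betaHyp`), and what remains is the double series
of `F_P`. Holomorphy of the integral in `(x, y)` gives the continuation (`olsson_euler`).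

The segment `[(1 - y)⁻¹, 0]` requires `₂F₁` on its cut. The Taylor coefficients of `₂F₁` are moments
of an explicit density `rho`, by a special case of the same Beta-type integral. Summing a geometric
series gives, up to a polynomial, `₂F₁` as a Stieltjes integral with kernel `1/(1 + w - z)`
(`hyp_eq_stl`, `gauss_spec_of_re`). Rotating the ray of integration away from the pole yields the
boundary values and bounds that are uniform up to the cut (`stl_rotate`,
`exists_gauss_bound_of_re`). The Plemelj formula shows that the jump across the cut is a multiple of
`rho` (`gauss_jump`). The density is itself a Gauss function with a power in front, and the
substitution `u = v/(1 - y)` turns the jump integrand into Olsson's integrand with `b₂` replaced by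
`c₂ - b₂` (`integrandI₂_eq`).

To shrink the double loop, it is split into single loops around `1` and `0`, and each half circle is
pushed onto the real axis inside its own half plane (`BoundaryData.integral_path`). The phases
cancel to the right of `1`. To the left of `(1 - y)⁻¹` there is no jump. There remain the segment
`[0, 1]` and the jump of `₂F₁` on `[(1 - y)⁻¹, 0]`, whose constants are matched by the reflection
formula (`loopI_eq_segments`). Comparing the two evaluations of the loop integral gives the
three-term relation. -/

namespace HornOlsson

/-! ### Holomorphic parameter integrals, identity theorems, termwise integration -/

section Tools

variable {E : Type*} [NormedAddCommGroup E] [NormedSpace ℂ E]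
variable {X : Type*} [MeasurableSpace X] {μ : Measure X}

/-- A directional derivative is an almost everywhere limit of difference quotients along a sequence
tending to `0`, and each quotient is measurable. In finite dimension finitely many directions
determine the whole derivative. -/
theorem aestronglyMeasurable_fderiv_param [FiniteDimensional ℂ E] {k : E → X → ℂ} {P₀ : E}
    {r : ℝ} (hr : 0 < r)
    (hmeas : ∀ P ∈ Metric.ball P₀ r, AEStronglyMeasurable (k P) μ)
    (hdiff : ∀ᵐ u ∂μ, DifferentiableOn ℂ (fun P => k P u) (Metric.ball P₀ r)) :
    AEStronglyMeasurable (fun u => fderiv ℂ (fun P => k P u) P₀) μ := by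
  have key : ∀ v : E, AEStronglyMeasurable (fun u => fderiv ℂ (fun P => k P u) P₀ v) μ := by
    intro v
    obtain ⟨δ, hδ, hδr⟩ : ∃ δ : ℝ, 0 < δ ∧ δ * ‖v‖ < r := by
      refine ⟨r / (‖v‖ + 1), by positivity, ?_⟩
      rw [div_mul_eq_mul_div, div_lt_iff₀ (by positivity)]
      nlinarith [norm_nonneg v]
    let t : ℕ → ℂ := fun n => ((δ / (n + 1 : ℝ) : ℝ) : ℂ)
    have ht0 : ∀ n, t n ≠ 0 := fun n => by
      simp only [t, ne_eq, Complex.ofReal_eq_zero]; positivity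
    have htn : ∀ n, ‖t n‖ ≤ δ := fun n => by
      simp only [t, Complex.norm_real, Real.norm_eq_abs]
      rw [abs_of_pos (by positivity)]
      exact div_le_self hδ.le (by linarith [(Nat.cast_nonneg n : (0 : ℝ) ≤ n)])
    have htl : Tendsto t atTop (𝓝[≠] 0) := by
      refine tendsto_nhdsWithin_iff.2 ⟨?_, Eventually.of_forall ht0⟩
      have : Tendsto (fun n : ℕ => δ / ((n : ℝ) + 1)) atTop (𝓝 0) := by
        simpa [div_eq_mul_inv] using
          (tendsto_one_div_add_atTop_nhds_zero_nat (𝕜 := ℝ)).const_mul δ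
      exact (Complex.continuous_ofReal.tendsto' 0 0 (by simp)).comp this
    have hmem : ∀ n, P₀ + t n • v ∈ Metric.ball P₀ r := fun n => by
      rw [Metric.mem_ball, dist_eq_norm, add_sub_cancel_left, norm_smul]
      exact (mul_le_mul_of_nonneg_right (htn n) (norm_nonneg v)).trans_lt hδr
    refine aestronglyMeasurable_of_tendsto_ae (u := (atTop : Filter ℕ))
      (f := fun n u => (t n)⁻¹ • (k (P₀ + t n • v) u - k P₀ u)) ?_ ?_
    · intro n
      exact ((hmeas _ (hmem n)).sub (hmeas _ (Metric.mem_ball_self hr))).const_smul ((t n)⁻¹)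
    · filter_upwards [hdiff] with u hu
      have h1 := ((hu.differentiableAt (Metric.ball_mem_nhds P₀ hr)).hasFDerivAt.hasLineDerivAt v)
      have h2 := (hasDerivAt_iff_tendsto_slope_zero.1 h1).comp htl
      simpa [Function.comp_def] using h2
  let b := Module.finBasis ℂ E
  have hrep : (fun u => fderiv ℂ (fun P => k P u) P₀) = fun u => ∑ i,
      (fderiv ℂ (fun P => k P u) P₀ (b i)) • LinearMap.toContinuousLinearMap (b.coord i) := by
    funext u
    ext v
    conv_lhs => rw [← b.sum_repr v, map_sum]
    simp [mul_comm]
  rw [hrep]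
  exact Finset.aestronglyMeasurable_fun_sum _ fun i _ => (key (b i)).smul_const _

/-- A dominated integral of holomorphic functions is holomorphic. -/
theorem differentiableAt_integral_of_dominated [FiniteDimensional ℂ E] {k : E → X → ℂ} {P₀ : E}
    {r : ℝ} {h : X → ℝ} (hr : 0 < r)
    (hmeas : ∀ P ∈ Metric.ball P₀ r, AEStronglyMeasurable (k P) μ)
    (hdiff : ∀ᵐ u ∂μ, DifferentiableOn ℂ (fun P => k P u) (Metric.ball P₀ r))
    (hbd : ∀ᵐ u ∂μ, ∀ P ∈ Metric.ball P₀ r, ‖k P u‖ ≤ h u) (hint : Integrable h μ) :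
    DifferentiableAt ℂ (fun P => ∫ u, k P u ∂μ) P₀ := by
  have hP0 := Metric.mem_ball_self (x := P₀) hr
  refine (hasFDerivAt_integral_of_dominated_loc_of_lip' (F := k)
    (F' := fun u => fderiv ℂ (fun P => k P u) P₀) (bound := fun u => 2 * h u / r)
    (Metric.ball_mem_nhds P₀ hr) hmeas ?_ (aestronglyMeasurable_fderiv_param hr hmeas hdiff)
    ?_ ?_ ?_).2.differentiableAt
  · exact hint.mono' (hmeas _ hP0) (hbd.mono fun u hu => hu _ hP0)
  · filter_upwards [hdiff, hbd] with u hu hb P hP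
    -- Schwarz's lemma: a holomorphic map from the ball of radius `r` into a ball of radius `2 h(u)`
    -- about its central value is Lipschitz at the centre with constant `2 h(u) / r`. Hence no
    -- separate bound on the derivative is needed.
    have := Complex.dist_le_div_mul_dist_of_mapsTo_ball (R₂ := 2 * h u) hu (fun Q hQ => by
      rw [Metric.mem_closedBall, dist_eq_norm]
      linarith [norm_sub_le (k Q u) (k P₀ u), hb Q hQ, hb P₀ hP0]) hP
    simpa [dist_eq_norm] using this
  · exact (hint.const_mul 2).div_const r
  · filter_upwards [hdiff] with u hu
    exact (hu.differentiableAt (Metric.ball_mem_nhds P₀ hr)).hasFDerivAt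

/-- A locally dominated series of holomorphic functions is holomorphic. -/
theorem differentiableAt_tsum_of_dominated [FiniteDimensional ℂ E] {ι : Type*} [Countable ι]
    {k : ι → E → ℂ} {P₀ : E} {r : ℝ} {h : ι → ℝ} (hr : 0 < r)
    (hdiff : ∀ i, DifferentiableOn ℂ (k i) (Metric.ball P₀ r))
    (hbd : ∀ i, ∀ P ∈ Metric.ball P₀ r, ‖k i P‖ ≤ h i) (hsum : Summable h) :
    DifferentiableAt ℂ (fun P => ∑' i, k i P) P₀ := by
  -- A series is an integral for the counting measure, so the result on dominated integrals applies.
  let _ : MeasurableSpace ι := ⊤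
  have : MeasurableSingletonClass ι := ⟨fun _ => trivial⟩
  have hint : Integrable h (Measure.count : Measure ι) := integrable_count_iff.2 hsum.norm
  have h1 : DifferentiableAt ℂ (fun P => ∫ i, k i P ∂(Measure.count : Measure ι)) P₀ :=
    differentiableAt_integral_of_dominated (k := fun P i => k i P) hr
      (fun P _ => (measurable_from_top).aestronglyMeasurable)
      (Eventually.of_forall hdiff) (Eventually.of_forall hbd) hint
  refine h1.congr_of_eventuallyEq ?_
  filter_upwards [Metric.ball_mem_nhds P₀ hr] with P hP
  have : Integrable (fun i => k i P) (Measure.count : Measure ι) :=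
    hint.mono' (measurable_from_top).aestronglyMeasurable
      (Eventually.of_forall fun i => hbd i P hP)
  rw [integral_countable this]
  simp

theorem analyticAt_of_eventually_differentiableAt {f : ℂ → ℂ} {z : ℂ}
    (h : ∀ᶠ w in 𝓝 z, DifferentiableAt ℂ f w) : AnalyticAt ℂ f z :=
  Complex.analyticAt_iff_eventually_differentiableAt.2 h

/-- Identity theorem on the segment `[0, 1]`. -/
theorem eq_at_one_of_analytic_on_segment {f g : ℂ → ℂ}
    (hf : ∀ t ∈ Set.Icc (0 : ℝ) 1, AnalyticAt ℂ f t)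
    (hg : ∀ t ∈ Set.Icc (0 : ℝ) 1, AnalyticAt ℂ g t)
    (heq : ∀ᶠ t : ℝ in 𝓝[>] 0, f t = g t) : f 1 = g 1 := by
  have hU : IsPreconnected ((fun t : ℝ => (t : ℂ)) '' Set.Icc (0 : ℝ) 1) :=
    isPreconnected_Icc.image _ Complex.continuous_ofReal.continuousOn
  refine AnalyticOnNhd.eqOn_of_preconnected_of_frequently_eq (𝕜 := ℂ)
    (U := (fun t : ℝ => (t : ℂ)) '' Set.Icc (0 : ℝ) 1) (z₀ := 0) ?_ ?_ hU ?_ ?_ ?_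
  · rintro _ ⟨t, ht, rfl⟩; exact hf t ht
  · rintro _ ⟨t, ht, rfl⟩; exact hg t ht
  · exact ⟨0, by simp, by simp⟩
  · have htend : Tendsto (fun t : ℝ => (t : ℂ)) (𝓝[>] 0) (𝓝[≠] 0) := by
      refine tendsto_nhdsWithin_iff.2 ⟨?_, ?_⟩
      · exact (Complex.continuous_ofReal.tendsto' 0 0 (by simp)).mono_left nhdsWithin_le_nhds
      · filter_upwards [self_mem_nhdsWithin] with t ht
        simpa using (ne_of_gt ht)
    exact htend.frequently heq.frequently
  · exact ⟨1, by simp, by simp⟩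

/-- Identity theorem along a segment. -/
theorem eq_of_segment_subset {g₁ g₂ : E → ℂ} {D : Set E} (hD : IsOpen D)
    (h₁ : DifferentiableOn ℂ g₁ D) (h₂ : DifferentiableOn ℂ g₂ D) {P₀ P : E}
    (hseg : ∀ t ∈ Set.Icc (0 : ℝ) 1, P₀ + (t : ℂ) • (P - P₀) ∈ D)
    (heq : ∀ᶠ Q in 𝓝 P₀, g₁ Q = g₂ Q) : g₁ P = g₂ P := by
  let φ : ℂ → E := fun t => P₀ + t • (P - P₀)
  have hφ : Differentiable ℂ φ := by fun_prop
  have hφ0 : φ 0 = P₀ := by simp [φ]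
  have hφ1 : φ 1 = P := by simp [φ]
  have han : ∀ g : E → ℂ, DifferentiableOn ℂ g D → ∀ t ∈ Set.Icc (0 : ℝ) 1,
      AnalyticAt ℂ (g ∘ φ) t := by
    intro g hg t ht
    apply analyticAt_of_eventually_differentiableAt
    have hmem : ∀ᶠ w in 𝓝 (t : ℂ), φ w ∈ D :=
      hφ.continuous.continuousAt.eventually (hD.mem_nhds (hseg t ht))
    filter_upwards [hmem] with w hw
    exact (hg.differentiableAt (hD.mem_nhds hw)).comp w (hφ w)
  have := eq_at_one_of_analytic_on_segment (han g₁ h₁) (han g₂ h₂) ?_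
  · simpa [hφ1] using this
  · have : Tendsto (fun t : ℝ => φ t) (𝓝[>] 0) (𝓝 P₀) := by
      have h := (hφ.continuous.comp Complex.continuous_ofReal).tendsto 0
      simp only [Function.comp_apply, Complex.ofReal_zero, hφ0] at h
      exact h.mono_left nhdsWithin_le_nhds
    exact this.eventually heq

theorem continuation_spec {f : E → ℂ} {U D : Set E} (h : HasContinuation f U D) :
    DifferentiableOn ℂ (continuation f U D) D ∧ Set.EqOn (continuation f U D) f U := by
  unfold continuation
  rw [dif_pos h]
  exact Classical.choose_spec h

/-- The identity theorem is applied along the segment from `P₀` to `P`, so connectedness of `D`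
never has to be proved. All the domains that occur are treated through such segments. -/
theorem continuation_eq_of_segment {f g : E → ℂ} {U D : Set E} (hD : IsOpen D)
    (hg : DifferentiableOn ℂ g D) (hgf : Set.EqOn g f U) {P₀ P : E} (hU : U ∈ 𝓝 P₀)
    (hseg : ∀ t ∈ Set.Icc (0 : ℝ) 1, P₀ + (t : ℂ) • (P - P₀) ∈ D) :
    continuation f U D P = g P := by
  have hs := continuation_spec (f := f) (U := U) (D := D) ⟨g, hg, hgf⟩
  refine eq_of_segment_subset hD hs.1 hg hseg ?_
  filter_upwards [hU] with Q hQ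
  rw [hs.2 hQ, hgf hQ]

/-- Termwise integration of a series whose absolute sum has an integrable majorant. -/
theorem hasSum_integral_of_tsum_norm_le {ι : Type*} [Countable ι] {f : ι → X → ℂ} {g : X → ℝ}
    (hf : ∀ i, AEStronglyMeasurable (f i) μ) (hg : Integrable g μ)
    (hsum : ∀ᵐ u ∂μ, Summable fun i => ‖f i u‖)
    (hle : ∀ᵐ u ∂μ, ∑' i, ‖f i u‖ ≤ g u) :
    HasSum (fun i => ∫ u, f i u ∂μ) (∫ u, ∑' i, f i u ∂μ) := by
  have hfin : ∑' i, ∫⁻ u, ‖f i u‖ₑ ∂μ ≠ ⊤ := by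
    rw [← lintegral_tsum fun i => (hf i).enorm]
    refine ne_of_lt (lt_of_le_of_lt (lintegral_mono_ae (g := fun u => ENNReal.ofReal (g u)) ?_) ?_)
    · filter_upwards [hsum, hle] with u hs hl
      have : ∑' i, ‖f i u‖ₑ = ENNReal.ofReal (∑' i, ‖f i u‖) := by
        rw [ENNReal.ofReal_tsum_of_nonneg (fun i => norm_nonneg _) hs]
        simp [ofReal_norm]
      rw [this]
      exact ENNReal.ofReal_le_ofReal hl
    · exact hg.lintegral_lt_top
  have hint : ∀ i, Integrable (f i) μ := fun i => by
    refine ⟨hf i, ?_⟩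
    rw [hasFiniteIntegral_iff_enorm]
    exact lt_of_le_of_lt (ENNReal.le_tsum i) (lt_top_iff_ne_top.2 hfin)
  have hsn : Summable fun i => ∫ u, ‖f i u‖ ∂μ := by
    have h1 : (fun i => ∫ u, ‖f i u‖ ∂μ) = fun i => (∫⁻ u, ‖f i u‖ₑ ∂μ).toReal := by
      funext i
      rw [integral_norm_eq_lintegral_enorm (hf i)]
    rw [h1]
    exact ENNReal.summable_toReal hfin
  exact hasSum_integral_of_summable_integral_norm hint hsn

end Tools


/-! ### Pochhammer symbols -/

/-- The Pochhammer symbol `(a)_n` for natural `n`. -/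
noncomputable def poch (a : ℂ) (n : ℕ) : ℂ := (ascPochhammer ℂ n).eval a

/-- `c` is not a pole of the Gamma function. -/
def NonPole (c : ℂ) : Prop := ∀ n : ℕ, c ≠ -(n : ℂ)

theorem nonPole_of_re_pos {c : ℂ} (h : 0 < c.re) : NonPole c := by
  intro n hn
  rw [hn] at h
  simp at h
  linarith [(Nat.cast_nonneg n : (0 : ℝ) ≤ n)]

theorem NonPole.add_nat {c : ℂ} (h : NonPole c) (k : ℕ) : NonPole (c + k) := by
  intro n hn
  apply h (n + k)
  push_cast
  linear_combination hn

theorem NonPole.Gamma_ne_zero {c : ℂ} (h : NonPole c) : Complex.Gamma c ≠ 0 :=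
  Complex.Gamma_ne_zero h

@[simp] theorem poch_zero (a : ℂ) : poch a 0 = 1 := by simp [poch]

theorem poch_succ (a : ℂ) (n : ℕ) : poch a (n + 1) = poch a n * (a + n) := by
  simp [poch, ascPochhammer_succ_eval]

theorem poch_eq_prod (a : ℂ) (n : ℕ) : poch a n = ∏ j ∈ Finset.range n, (a + j) := by
  induction n with
  | zero => simp
  | succ n ih => rw [poch_succ, ih, Finset.prod_range_succ]

theorem poch_add (a : ℂ) (m n : ℕ) : poch a (m + n) = poch a m * poch (a + m) n := by
  simp only [poch_eq_prod, Finset.prod_range_add]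
  congr 1
  refine Finset.prod_congr rfl fun j _ => ?_
  push_cast; ring

theorem poch_succ' (a : ℂ) (n : ℕ) : poch a (n + 1) = a * poch (a + 1) n := by
  rw [add_comm, poch_add]
  simp [poch_eq_prod]

theorem poch_ne_zero {a : ℂ} (h : NonPole a) (n : ℕ) : poch a n ≠ 0 := by
  rw [poch_eq_prod, Finset.prod_ne_zero_iff]
  intro j _ hj
  exact h j (by linear_combination hj)

/-- The factorwise triangle inequality. It supplies majorants with nonnegative parameters, whose
binomial series can be summed in closed form. -/
theorem norm_poch_le {a : ℂ} {x : ℝ} (h : ‖a‖ ≤ x) (n : ℕ) : ‖poch a n‖ ≤ ‖poch (x : ℂ) n‖ := by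
  have hx : 0 ≤ x := (norm_nonneg a).trans h
  simp only [poch_eq_prod, norm_prod]
  refine Finset.prod_le_prod (fun _ _ => norm_nonneg _) fun j _ => ?_
  have : ‖(x : ℂ) + j‖ = x + j := by
    rw [← Complex.ofReal_natCast, ← Complex.ofReal_add, Complex.norm_real, Real.norm_eq_abs,
      abs_of_nonneg (by positivity)]
  rw [this]
  exact (norm_add_le _ _).trans (by simpa using h)

theorem poch_ofReal_norm {x : ℝ} (hx : 0 ≤ x) (n : ℕ) : (‖poch (x : ℂ) n‖ : ℂ) = poch x n := by
  simp only [poch_eq_prod, norm_prod, Complex.ofReal_prod]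
  refine Finset.prod_congr rfl fun j _ => ?_
  rw [← Complex.ofReal_natCast, ← Complex.ofReal_add, Complex.norm_real, Real.norm_eq_abs,
    abs_of_nonneg (by positivity)]

/-- Written with the entire function `1/Γ`, the functional equation holds for every `a`; no pole has
to be excluded. -/
theorem inv_Gamma_eq_poch_mul (a : ℂ) (n : ℕ) :
    (Complex.Gamma a)⁻¹ = poch a n * (Complex.Gamma (a + n))⁻¹ := by
  induction n with
  | zero => simp
  | succ n ih =>
    rw [ih, Complex.one_div_Gamma_eq_self_mul_one_div_Gamma_add_one (a + n), poch_succ]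
    push_cast
    rw [← add_assoc]; ring

theorem Gamma_add_nat {a : ℂ} (h : NonPole a) (n : ℕ) :
    Complex.Gamma (a + n) = poch a n * Complex.Gamma a := by
  have h1 := inv_Gamma_eq_poch_mul a n
  have h2 := h.Gamma_ne_zero
  have h3 := (h.add_nat n).Gamma_ne_zero
  field_simp at h1
  rw [h1, mul_comm]

theorem pochZ_natCast (a : ℂ) (n : ℕ) : pochZ a (n : ℤ) = poch a n := rfl

theorem pochZ_neg_natCast (a : ℂ) (n : ℕ) : pochZ a (-(n : ℤ)) = (-1) ^ n / poch (1 - a) n := by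
  cases n with
  | zero => simp [pochZ, poch]
  | succ n => rfl

/-- Away from the poles this is Euler's limit. At a pole the product in the denominator of
`GammaSeq` eventually contains the factor `0`; with division by `0` giving `0`, both the reciprocals
and `1/Γ` are then `0`. -/
theorem tendsto_inv_GammaSeq (s : ℂ) :
    Tendsto (fun n : ℕ => (Complex.GammaSeq s n)⁻¹) atTop (𝓝 (Complex.Gamma s)⁻¹) := by
  by_cases hs : Complex.Gamma s = 0
  · obtain ⟨m, hm⟩ := (Complex.Gamma_eq_zero_iff s).1 hs
    refine tendsto_const_nhds.congr' ?_
    filter_upwards [eventually_ge_atTop m] with n hn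
    have : ∏ j ∈ Finset.range (n + 1), (s + j) = 0 :=
      Finset.prod_eq_zero (Finset.mem_range.2 (Nat.lt_succ_of_le hn)) (by rw [hm]; simp)
    rw [hs, Complex.GammaSeq, this]
    simp
  · exact (Complex.GammaSeq_tendsto_Gamma s).inv₀ hs

/-- Euler's limit says that `|(s)_n|` behaves like `n! n^(Re s - 1) / |Γ(s)|`. The power of `n + 1`
instead of `n` makes the resulting bounds meaningful at `n = 0`. -/
theorem tendsto_norm_poch_div (s : ℂ) :
    Tendsto (fun n : ℕ => ‖poch s n‖ / (n.factorial * ((n : ℝ) + 1) ^ (s.re - 1))) atTop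
      (𝓝 ‖Complex.Gamma s‖⁻¹) := by
  rw [← tendsto_add_atTop_iff_nat 1]
  have h1 : Tendsto (fun n : ℕ => ‖(Complex.GammaSeq s n)⁻¹‖) atTop (𝓝 ‖Complex.Gamma s‖⁻¹) := by
    rw [← norm_inv]
    exact (tendsto_inv_GammaSeq s).norm
  have h2 : Tendsto (fun n : ℕ => (n : ℝ) / (n + 1) * ((n : ℝ) / (n + 2)) ^ (s.re - 1)) atTop
      (𝓝 (1 * 1 ^ (s.re - 1))) := by
    refine (tendsto_natCast_div_add_atTop (1 : ℝ)).mul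
      ((tendsto_natCast_div_add_atTop (2 : ℝ)).rpow_const (Or.inl one_ne_zero))
  rw [Real.one_rpow, mul_one] at h2
  have h3 := h1.mul h2
  rw [mul_one] at h3
  refine h3.congr' ?_
  filter_upwards [eventually_gt_atTop 0] with n hn
  have hn' : (0 : ℝ) < n := Nat.cast_pos.2 hn
  rw [Complex.GammaSeq, ← poch_eq_prod, inv_div, norm_div, norm_mul, Complex.norm_natCast,
    Complex.norm_natCast_cpow_of_pos hn, Real.div_rpow hn'.le (by positivity),
    Nat.factorial_succ, show s.re = (s.re - 1) + 1 by ring, Real.rpow_add_one hn'.ne']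
  push_cast
  have e : (n : ℝ) + 1 + 1 = n + 2 := by ring
  rw [e]
  have h5 : (0 : ℝ) < (n : ℝ) ^ (s.re - 1) := Real.rpow_pos_of_pos hn' _
  have h6 : (0 : ℝ) < ((n : ℝ) + 2) ^ (s.re - 1) := Real.rpow_pos_of_pos (by positivity) _
  have h7 : (0 : ℝ) < n.factorial := by positivity
  simp only [add_sub_cancel_right]
  field_simp

theorem exists_norm_poch_le (s : ℂ) : ∃ K : ℝ, 0 < K ∧ ∀ n : ℕ,
    ‖poch s n‖ ≤ K * (n.factorial * ((n : ℝ) + 1) ^ (s.re - 1)) := by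
  obtain ⟨K, hK⟩ := (tendsto_norm_poch_div s).bddAbove_range
  refine ⟨max K 1, by positivity, fun n => ?_⟩
  have := hK ⟨n, rfl⟩
  rw [div_le_iff₀ (by positivity)] at this
  exact this.trans (mul_le_mul_of_nonneg_right (le_max_left _ _) (by positivity))

/-- Off the poles of `Γ` the limit of the normalised Pochhammer symbols is nonzero, so their
reciprocals converge as well and are bounded. -/
theorem exists_le_norm_poch {s : ℂ} (hs : NonPole s) : ∃ K : ℝ, 0 < K ∧ ∀ n : ℕ,
    n.factorial * ((n : ℝ) + 1) ^ (s.re - 1) ≤ K * ‖poch s n‖ := by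
  have h := (tendsto_norm_poch_div s).inv₀ (by simpa using hs.Gamma_ne_zero)
  obtain ⟨K, hK⟩ := h.bddAbove_range
  refine ⟨max K 1, by positivity, fun n => ?_⟩
  have := hK ⟨n, rfl⟩
  have hp : 0 < ‖poch s n‖ := norm_pos_iff.2 (poch_ne_zero hs n)
  simp only [inv_div] at this
  rw [div_le_iff₀ hp] at this
  exact this.trans (mul_le_mul_of_nonneg_right (le_max_left _ _) (by positivity))

/-! ### Hypergeometric series -/

/-- The coefficients of the hypergeometric series. -/
noncomputable def hcoef (a b c : ℂ) (n : ℕ) : ℂ := poch a n * poch b n / (poch c n * n.factorial)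

theorem hyp_eq_tsum (a b c z : ℂ) : ₂F₁ a b c z = ∑' n : ℕ, hcoef a b c n * z ^ n := by
  rw [ordinaryHypergeometric_eq_tsum]
  refine tsum_congr fun n => ?_
  simp only [hcoef, poch, smul_eq_mul]
  rw [div_eq_mul_inv, mul_inv]; ring

theorem hyp_comm (a b c z : ℂ) : ₂F₁ a b c z = ₂F₁ b a c z := by
  simp only [hyp_eq_tsum, hcoef, mul_comm]

@[simp] theorem hcoef_zero (a b c : ℂ) : hcoef a b c 0 = 1 := by simp [hcoef]

theorem exists_norm_hcoef_le (a b : ℂ) {c : ℂ} (hc : NonPole c) : ∃ K : ℝ, 0 < K ∧ ∀ n : ℕ,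
    ‖hcoef a b c n‖ ≤ K * ((n : ℝ) + 1) ^ ((a + b - c).re - 1) := by
  obtain ⟨Ka, hKa, ha⟩ := exists_norm_poch_le a
  obtain ⟨Kb, hKb, hb⟩ := exists_norm_poch_le b
  obtain ⟨Kc, hKc, hc'⟩ := exists_le_norm_poch hc
  refine ⟨Ka * Kb * Kc, by positivity, fun n => ?_⟩
  have hp : 0 < ‖poch c n‖ := norm_pos_iff.2 (poch_ne_zero hc n)
  rw [hcoef, norm_div, norm_mul, norm_mul, Complex.norm_natCast]
  have hn : (0 : ℝ) < n + 1 := by positivity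
  have hf : (0 : ℝ) < n.factorial := by positivity
  rw [div_le_iff₀ (by positivity)]
  have e : ((n : ℝ) + 1) ^ (a.re - 1) * ((n : ℝ) + 1) ^ (b.re - 1) =
      ((n : ℝ) + 1) ^ ((a + b - c).re - 1) * ((n : ℝ) + 1) ^ (c.re - 1) := by
    rw [← Real.rpow_add hn, ← Real.rpow_add hn]
    congr 1
    simp; ring
  calc ‖poch a n‖ * ‖poch b n‖ ≤ (Ka * (n.factorial * ((n : ℝ) + 1) ^ (a.re - 1))) *
        (Kb * (n.factorial * ((n : ℝ) + 1) ^ (b.re - 1))) :=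
        mul_le_mul (ha n) (hb n) (norm_nonneg _) (by positivity)
    _ = Ka * Kb * n.factorial * ((n : ℝ) + 1) ^ ((a + b - c).re - 1) *
        (n.factorial * ((n : ℝ) + 1) ^ (c.re - 1)) := by linear_combination (Ka * Kb * n.factorial * n.factorial) * e
    _ ≤ Ka * Kb * n.factorial * ((n : ℝ) + 1) ^ ((a + b - c).re - 1) * (Kc * ‖poch c n‖) :=
        mul_le_mul_of_nonneg_left (hc' n) (by positivity)
    _ = _ := by ring

theorem hasSum_binomial (a : ℂ) {z : ℂ} (hz : ‖z‖ < 1) :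
    HasSum (fun n : ℕ => poch a n / n.factorial * z ^ n) ((1 - z) ^ (-a)) := by
  have h := (Complex.one_div_one_sub_cpow_hasFPowerSeriesOnBall_zero a).hasSum
    (y := z) (by simpa [← ofReal_norm, ENNReal.ofReal_lt_one] using hz)
  simp only [FormalMultilinearSeries.ofScalars_apply_eq, smul_eq_mul, zero_add, one_div] at h
  rw [Complex.cpow_neg]
  have e : (fun n : ℕ => poch a n / n.factorial * z ^ n) =
      fun n : ℕ => Ring.choose (a + n - 1) n * z ^ n := by
    funext n
    rw [← Ring.multichoose_eq]
    have := Ring.factorial_nsmul_multichoose_eq_ascPochhammer a n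
    rw [nsmul_eq_mul, Polynomial.ascPochhammer_smeval_eq_eval] at this
    rw [poch, ← this, mul_div_cancel_left₀ _ (by exact_mod_cast n.factorial_ne_zero)]
  rw [e]
  exact h

theorem hasSum_norm_poch {x r : ℝ} (hx : 0 ≤ x) (hr : 0 ≤ r) (hr1 : r < 1) :
    HasSum (fun n : ℕ => ‖poch (x : ℂ) n‖ / n.factorial * r ^ n) ((1 - r) ^ (-x)) := by
  have h := hasSum_binomial x (z := r) (by simpa [abs_of_nonneg hr] using hr1)
  rw [← Complex.hasSum_ofReal]
  convert h using 2 with n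
  · push_cast
    rw [poch_ofReal_norm hx]
  · rw [Complex.ofReal_cpow (by linarith)]; push_cast; rfl

/-- Power-type growth of a series with polynomially bounded coefficients. -/
theorem exists_tsum_le {σ τ : ℝ} (h0 : 0 < τ) (h : σ ≤ τ) : ∃ K : ℝ, 0 < K ∧ ∀ r : ℝ,
    0 ≤ r → r < 1 → Summable (fun n : ℕ => ((n : ℝ) + 1) ^ (σ - 1) * r ^ n) ∧
      ∑' n : ℕ, ((n : ℝ) + 1) ^ (σ - 1) * r ^ n ≤ K * (1 - r) ^ (-τ) := by
  -- The comparison series is the binomial series of `(1 - r)^(-τ)`, whose coefficients have order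
  -- `(n + 1)^(τ - 1)`.
  obtain ⟨K, hK, hle⟩ := exists_le_norm_poch (s := (τ : ℂ)) (nonPole_of_re_pos (by simpa using h0))
  refine ⟨K, hK, fun r hr hr1 => ?_⟩
  have hs := (hasSum_norm_poch h0.le hr hr1).mul_left K
  have hterm : ∀ n : ℕ, ((n : ℝ) + 1) ^ (σ - 1) * r ^ n ≤
      K * (‖poch (τ : ℂ) n‖ / n.factorial * r ^ n) := fun n => by
    have h1 : ((n : ℝ) + 1) ^ (σ - 1) ≤ ((n : ℝ) + 1) ^ (τ - 1) :=
      Real.rpow_le_rpow_of_exponent_le (by linarith [(Nat.cast_nonneg n : (0 : ℝ) ≤ n)]) (by linarith)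
    have h2 := hle n
    simp only [Complex.ofReal_re] at h2
    have hf : (0 : ℝ) < n.factorial := by positivity
    rw [← mul_assoc]
    refine mul_le_mul_of_nonneg_right (h1.trans ?_) (by positivity)
    rw [← mul_div_assoc, le_div_iff₀ hf]
    linarith
  have hsum : Summable (fun n : ℕ => ((n : ℝ) + 1) ^ (σ - 1) * r ^ n) :=
    Summable.of_nonneg_of_le (fun n => by positivity) hterm hs.summable
  exact ⟨hsum, (hsum.tsum_le_tsum hterm hs.summable).trans_eq hs.tsum_eq⟩

/-- The coefficients have order at most `n^(Re(a + b - c) - 1)`, so the absolute series grows like a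
power of the distance to the unit circle. Requiring `τ` to be positive also covers the cases in
which the growth is logarithmic or absent. -/
theorem exists_tsum_norm_hcoef_le (a b : ℂ) {c : ℂ} (hc : NonPole c) {τ : ℝ} (h0 : 0 < τ)
    (h : (a + b - c).re ≤ τ) : ∃ K : ℝ, 0 < K ∧ ∀ r : ℝ,
    0 ≤ r → r < 1 → Summable (fun n : ℕ => ‖hcoef a b c n‖ * r ^ n) ∧
      ∑' n : ℕ, ‖hcoef a b c n‖ * r ^ n ≤ K * (1 - r) ^ (-τ) := by
  obtain ⟨K₁, hK₁, h1⟩ := exists_norm_hcoef_le a b hc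
  obtain ⟨K₂, hK₂, h2⟩ := exists_tsum_le h0 h
  refine ⟨K₁ * K₂, by positivity, fun r hr hr1 => ?_⟩
  obtain ⟨hs, hle⟩ := h2 r hr hr1
  have hterm : ∀ n : ℕ, ‖hcoef a b c n‖ * r ^ n ≤
      K₁ * (((n : ℝ) + 1) ^ ((a + b - c).re - 1) * r ^ n) := fun n => by
    rw [← mul_assoc]
    exact mul_le_mul_of_nonneg_right (h1 n) (by positivity)
  have hsum : Summable (fun n : ℕ => ‖hcoef a b c n‖ * r ^ n) :=
    Summable.of_nonneg_of_le (fun n => by positivity) hterm (hs.mul_left _)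
  refine ⟨hsum, (hsum.tsum_le_tsum hterm (hs.mul_left _)).trans ?_⟩
  rw [tsum_mul_left, mul_assoc]
  exact mul_le_mul_of_nonneg_left hle hK₁.le

theorem summable_norm_hcoef (a b : ℂ) {c : ℂ} (hc : NonPole c) {r : ℝ} (hr : 0 ≤ r) (hr1 : r < 1) :
    Summable (fun n : ℕ => ‖hcoef a b c n‖ * r ^ n) := by
  obtain ⟨K, -, h⟩ := exists_tsum_norm_hcoef_le a b hc (τ := max 1 (a + b - c).re)
    (by positivity) (le_max_right _ _)
  exact (h r hr hr1).1

theorem hasSum_hyp (a b : ℂ) {c : ℂ} (hc : NonPole c) {z : ℂ} (hz : ‖z‖ < 1) :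
    HasSum (fun n : ℕ => hcoef a b c n * z ^ n) (₂F₁ a b c z) := by
  rw [hyp_eq_tsum]
  refine Summable.hasSum (Summable.of_norm ?_)
  simpa using summable_norm_hcoef a b hc (norm_nonneg z) hz

theorem exists_norm_hyp_le (a b : ℂ) {c : ℂ} (hc : NonPole c) {τ : ℝ} (h0 : 0 < τ)
    (h : (a + b - c).re ≤ τ) : ∃ K : ℝ, 0 < K ∧ ∀ z : ℂ, ‖z‖ < 1 →
      ‖₂F₁ a b c z‖ ≤ K * (1 - ‖z‖) ^ (-τ) := by
  obtain ⟨K, hK, h1⟩ := exists_tsum_norm_hcoef_le a b hc h0 h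
  refine ⟨K, hK, fun z hz => ?_⟩
  obtain ⟨hs, hle⟩ := h1 ‖z‖ (norm_nonneg z) hz
  rw [hyp_eq_tsum]
  refine (norm_tsum_le_tsum_norm (by simpa using hs)).trans ?_
  simpa using hle

theorem differentiableOn_hyp (a b : ℂ) {c : ℂ} (hc : NonPole c) :
    DifferentiableOn ℂ (₂F₁ a b c : ℂ → ℂ) (Metric.ball 0 1) := by
  intro z hz
  rw [mem_ball_zero_iff] at hz
  obtain ⟨r, hr1, hr2⟩ := exists_between hz
  have hfun : (₂F₁ a b c : ℂ → ℂ) = fun z => ∑' n : ℕ, hcoef a b c n * z ^ n :=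
    funext fun z => hyp_eq_tsum a b c z
  rw [hfun]
  refine (differentiableAt_tsum_of_dominated (r := r - ‖z‖) (by linarith)
    (h := fun n => ‖hcoef a b c n‖ * r ^ n) (fun n => by fun_prop) (fun n w hw => ?_)
    (summable_norm_hcoef a b hc ((norm_nonneg z).trans hr1.le) hr2)).differentiableWithinAt
  rw [norm_mul, norm_pow]
  have : ‖w‖ ≤ r := by
    have h1 := mem_ball_iff_norm.1 hw
    linarith [norm_le_norm_add_norm_sub' w z]
  gcongr


theorem hasSum_congr_fun {ι : Type*} {f g : ι → ℂ} {s : ℂ} (h : ∀ i, f i = g i) (hf : HasSum f s) :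
    HasSum g s := by
  rwa [← funext h]

/-! ### Gauss's summation theorem -/

theorem summable_norm_hcoef_one {a b c : ℂ} (hc : NonPole c) (h : 0 < (c - a - b).re) :
    Summable (fun n : ℕ => ‖hcoef a b c n‖) := by
  obtain ⟨K, -, hK⟩ := exists_norm_hcoef_le a b hc
  refine Summable.of_nonneg_of_le (fun _ => norm_nonneg _) hK (Summable.mul_left _ ?_)
  have h1 : Summable fun n : ℕ => (n : ℝ) ^ ((a + b - c).re - 1) :=
    Real.summable_nat_rpow.2 (by simp at h ⊢; linarith)
  simpa using (summable_nat_add_iff 1).2 h1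

/-- The contiguous relation behind Gauss's theorem. The difference of the two sides telescopes
termwise with `n * hcoef a b c n`, a sequence that tends to `0` because `Re(c - a - b) > 0`. -/
theorem gauss_sum_step {a b c : ℂ} (hc : NonPole c) (h : 0 < (c - a - b).re) :
    c * (c - a - b) * ∑' n, hcoef a b c n = (c - a) * (c - b) * ∑' n, hcoef a b (c + 1) n := by
  have hc1 : NonPole (c + 1) := by simpa using hc.add_nat 1
  have hs := (summable_norm_hcoef_one hc h).of_norm
  have hs1 := (summable_norm_hcoef_one (a := a) (b := b) hc1 (by simp at h ⊢; linarith)).of_norm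
  have hc0 : c ≠ 0 := by simpa using hc 0
  have hcn : ∀ n : ℕ, c + n ≠ 0 := fun n hn => hc n (by linear_combination hn)
  have hterm : ∀ n : ℕ, (c - a - b) * hcoef a b c n - (c - a) * (c - b) / c * hcoef a b (c + 1) n
      = n * hcoef a b c n - (n + 1 : ℕ) * hcoef a b c (n + 1) := by
    intro n
    have e1 : poch (c + 1) n = poch c n * (c + n) / c := by
      rw [eq_div_iff hc0, ← poch_succ, poch_succ']; ring
    have hp := poch_ne_zero hc n
    have hf : (n.factorial : ℂ) ≠ 0 := by exact_mod_cast n.factorial_ne_zero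
    have hn1 : (n : ℂ) + 1 ≠ 0 := by exact_mod_cast n.succ_ne_zero
    have := hcn n
    simp only [hcoef, e1, poch_succ, Nat.factorial_succ]
    push_cast
    field_simp
    ring
  have hlim : Tendsto (fun n : ℕ => (n : ℂ) * hcoef a b c n) atTop (𝓝 0) := by
    obtain ⟨K, -, hK⟩ := exists_norm_hcoef_le a b hc
    have hz : Tendsto (fun n : ℕ => K * ((n : ℝ) + 1) ^ (-(c - a - b).re)) atTop (𝓝 (K * 0)) := by
      refine Tendsto.const_mul _ ((tendsto_rpow_neg_atTop h).comp ?_)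
      exact tendsto_atTop_add_const_right _ _ tendsto_natCast_atTop_atTop
    rw [mul_zero] at hz
    refine squeeze_zero_norm (fun n => ?_) hz
    rw [norm_mul, Complex.norm_natCast]
    calc (n : ℝ) * ‖hcoef a b c n‖ ≤ (n + 1) * (K * ((n : ℝ) + 1) ^ ((a + b - c).re - 1)) :=
          mul_le_mul (by linarith) (hK n) (norm_nonneg _) (by positivity)
      _ = _ := by
          rw [show -(c - a - b).re = ((a + b - c).re - 1) + 1 by simp; ring,
            Real.rpow_add_one (by positivity)]
          ring
  have hsm : Summable (fun n : ℕ => (n : ℂ) * hcoef a b c n - (n + 1 : ℕ) * hcoef a b c (n + 1)) :=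
    ((hs.mul_left (c - a - b)).sub (hs1.mul_left ((c - a) * (c - b) / c))).congr hterm
  have htel : HasSum (fun n : ℕ => (n : ℂ) * hcoef a b c n - (n + 1 : ℕ) * hcoef a b c (n + 1))
      ((0 : ℕ) * hcoef a b c 0 - 0) := hsm.hasSum_iff_tendsto_nat.2
      (by
        have e : ∀ N : ℕ, ∑ n ∈ Finset.range N, ((n : ℂ) * hcoef a b c n -
            (n + 1 : ℕ) * hcoef a b c (n + 1)) = (0 : ℕ) * hcoef a b c 0 - N * hcoef a b c N :=
          fun N => Finset.sum_range_sub' (fun n : ℕ => (n : ℂ) * hcoef a b c n) N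
        simp only [e]
        exact tendsto_const_nhds.sub hlim)
  have h2 := (hs.hasSum.mul_left (c - a - b)).sub (hs1.hasSum.mul_left ((c - a) * (c - b) / c))
  have h3 := (hasSum_congr_fun hterm h2).unique htel
  simp only [Nat.cast_zero, zero_mul, sub_zero] at h3
  field_simp at h3
  linear_combination h3

/-- As the lower parameter tends to infinity only the constant term survives, by dominated
convergence. -/
theorem tendsto_tsum_hcoef_add_nat (a b c : ℂ) :
    Tendsto (fun m : ℕ => ∑' n, hcoef a b (c + m) n) atTop (𝓝 1) := by
  -- The majorant has parameters `‖a‖`, `‖b‖` and `‖a‖ + ‖b‖ + 2`. The excess `2` makes its series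
  -- at argument `1` converge.
  have hx0 : NonPole ((‖a‖ + ‖b‖ + 2 : ℝ) : ℂ) := nonPole_of_re_pos (by
    rw [Complex.ofReal_re]; positivity)
  have hbs := summable_norm_hcoef_one (a := (‖a‖ : ℂ)) (b := (‖b‖ : ℂ)) hx0 (by simp; linarith)
  have hlow : ∀ m : ℕ, ‖a‖ + ‖b‖ + 2 ≤ c.re + m → ∀ n j : ℕ,
      ‖((‖a‖ + ‖b‖ + 2 : ℝ) : ℂ) + j‖ ≤ ‖c + m + j‖ := by
    intro m hm n j
    have h1 : ‖((‖a‖ + ‖b‖ + 2 : ℝ) : ℂ) + j‖ = ‖a‖ + ‖b‖ + 2 + j := by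
      rw [← Complex.ofReal_natCast, ← Complex.ofReal_add, Complex.norm_real, Real.norm_eq_abs,
        abs_of_nonneg (by positivity)]
    have h2 := Complex.re_le_norm (c + m + j)
    simp at h2
    linarith
  have hev : ∀ᶠ m : ℕ in atTop, ‖a‖ + ‖b‖ + 2 ≤ c.re + m := by
    have : Tendsto (fun m : ℕ => c.re + m) atTop atTop :=
      tendsto_atTop_add_const_left _ _ tendsto_natCast_atTop_atTop
    exact this.eventually_ge_atTop _
  have h := tendsto_tsum_of_dominated_convergence (f := fun (m : ℕ) n => hcoef a b (c + m) n)
    (g := fun n => if n = 0 then (1 : ℂ) else 0) (𝓕 := atTop) hbs ?_ ?_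
  · simpa using h
  · intro n
    cases n with
    | zero => simp
    | succ n =>
      simp only [Nat.add_eq_zero_iff, one_ne_zero, and_false, if_false]
      have hz : Tendsto (fun m : ℕ => ‖poch a (n + 1)‖ * ‖poch b (n + 1)‖ * (c.re + m)⁻¹) atTop
          (𝓝 (‖poch a (n + 1)‖ * ‖poch b (n + 1)‖ * 0)) := by
        refine Tendsto.const_mul _ (tendsto_inv_atTop_zero.comp ?_)
        exact tendsto_atTop_add_const_left _ _ tendsto_natCast_atTop_atTop
      rw [mul_zero] at hz
      refine squeeze_zero_norm' ?_ hz
      filter_upwards [hev] with m hm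
      have hpos : 0 < c.re + m := by linarith [norm_nonneg a, norm_nonneg b]
      have h1 : c.re + m ≤ ‖poch (c + m) (n + 1)‖ := by
        rw [poch_succ', norm_mul]
        have h2 : c.re + m ≤ ‖c + m‖ := by
          have := Complex.re_le_norm (c + m); simpa using this
        have h3 : 1 ≤ ‖poch (c + m + 1) n‖ := by
          rw [poch_eq_prod, norm_prod]
          refine le_of_eq_of_le (Finset.prod_const_one (s := Finset.range n)).symm
            (Finset.prod_le_prod (fun _ _ => zero_le_one) fun j _ => ?_)
          have := Complex.re_le_norm (c + m + 1 + j)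
          simp at this
          linarith [norm_nonneg a, norm_nonneg b, (Nat.cast_nonneg j : (0 : ℝ) ≤ j)]
        nlinarith
      have h4 : (1 : ℝ) ≤ (n + 1).factorial := by exact_mod_cast Nat.one_le_iff_ne_zero.2 (Nat.factorial_ne_zero _)
      rw [hcoef, norm_div, norm_mul, norm_mul, Complex.norm_natCast, div_eq_mul_inv]
      gcongr
      nlinarith
  · filter_upwards [hev] with m hm n
    simp only [hcoef, norm_div, norm_mul, Complex.norm_natCast]
    have hp : 0 < ‖poch ((‖a‖ + ‖b‖ + 2 : ℝ) : ℂ) n‖ := norm_pos_iff.2 (poch_ne_zero hx0 n)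
    have h1 : ‖poch ((‖a‖ + ‖b‖ + 2 : ℝ) : ℂ) n‖ ≤ ‖poch (c + m) n‖ := by
      simp only [poch_eq_prod, norm_prod]
      exact Finset.prod_le_prod (fun _ _ => norm_nonneg _) fun j _ => hlow m hm n j
    have h2 := norm_poch_le (le_refl ‖a‖) n
    have h3 := norm_poch_le (le_refl ‖b‖) n
    gcongr

/-- **Gauss's summation theorem**. -/
theorem hasSum_gauss {a b c : ℂ} (hc : NonPole c) (h : 0 < (c - a - b).re) :
    HasSum (hcoef a b c) (Complex.Gamma c * Complex.Gamma (c - a - b) *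
      ((Complex.Gamma (c - a))⁻¹ * (Complex.Gamma (c - b))⁻¹)) := by
  have hd : NonPole (c - a - b) := nonPole_of_re_pos h
  -- The contiguous relation, iterated `m` times, moves the lower parameter from `c` to `c + m`,
  -- where the sum tends to `1`.
  have hiter : ∀ m : ℕ, poch c m * poch (c - a - b) m * ∑' n, hcoef a b c n =
      poch (c - a) m * poch (c - b) m * ∑' n, hcoef a b (c + m) n := by
    intro m
    induction m with
    | zero => simp
    | succ m ih =>
      have hst := gauss_sum_step (a := a) (b := b) (hc.add_nat m) (by
        simp at h ⊢; linarith [(Nat.cast_nonneg m : (0 : ℝ) ≤ m)])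
      simp only [poch_succ]
      push_cast
      rw [← add_assoc]
      linear_combination ((c + m) * (c - a - b + m)) * ih + poch (c - a) m * poch (c - b) m * hst
  -- The ratio of Pochhammer symbols is rewritten by Euler's sequences. The powers of `n` cancel
  -- because `c + (c - a - b) = (c - a) + (c - b)`. Reciprocal sequences are used for `c - a` and `c
  -- - b`, which may be poles.
  have hlim : Tendsto (fun n : ℕ => Complex.GammaSeq c n * Complex.GammaSeq (c - a - b) n *
      ((Complex.GammaSeq (c - a) n)⁻¹ * (Complex.GammaSeq (c - b) n)⁻¹) *
        ∑' k, hcoef a b (c + (n + 1 : ℕ)) k) atTop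
      (𝓝 (Complex.Gamma c * Complex.Gamma (c - a - b) *
      ((Complex.Gamma (c - a))⁻¹ * (Complex.Gamma (c - b))⁻¹) * 1)) :=
    (((Complex.GammaSeq_tendsto_Gamma _).mul (Complex.GammaSeq_tendsto_Gamma _)).mul
      ((tendsto_inv_GammaSeq _).mul (tendsto_inv_GammaSeq _))).mul
      ((tendsto_add_atTop_iff_nat 1).2 (tendsto_tsum_hcoef_add_nat a b c))
  rw [mul_one] at hlim
  have hconst : Tendsto (fun _ : ℕ => ∑' n, hcoef a b c n) atTop
      (𝓝 (Complex.Gamma c * Complex.Gamma (c - a - b) *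
      ((Complex.Gamma (c - a))⁻¹ * (Complex.Gamma (c - b))⁻¹))) := by
    refine hlim.congr' ?_
    filter_upwards [eventually_gt_atTop 0] with n hn
    have hn0 : (n : ℂ) ≠ 0 := by exact_mod_cast hn.ne'
    have hi := hiter (n + 1)
    have h1 := poch_ne_zero hc (n + 1)
    have h2 := poch_ne_zero hd (n + 1)
    simp only [Complex.GammaSeq, ← poch_eq_prod, inv_div]
    have e : (n : ℂ) ^ c * (n : ℂ) ^ (c - a - b) = (n : ℂ) ^ (c - a) * (n : ℂ) ^ (c - b) := by
      rw [← Complex.cpow_add _ _ hn0, ← Complex.cpow_add _ _ hn0]; congr 1; ring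
    have hq1 : (n : ℂ) ^ (c - a) ≠ 0 := by simp [Complex.cpow_eq_zero_iff, hn0]
    have hq2 : (n : ℂ) ^ (c - b) ≠ 0 := by simp [Complex.cpow_eq_zero_iff, hn0]
    have hf : (n.factorial : ℂ) ≠ 0 := by exact_mod_cast n.factorial_ne_zero
    field_simp
    linear_combination ((n : ℂ) ^ (c - a) * (n : ℂ) ^ (c - b)) * (-hi) +
      (poch (c - a) (n + 1) * poch (c - b) (n + 1) * ∑' k, hcoef a b (c + (n + 1 : ℕ)) k) * e
  rw [tendsto_nhds_unique hconst tendsto_const_nhds]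
  exact (summable_norm_hcoef_one hc h).of_norm.hasSum

/-! ### Pfaff's transformation -/

/-- The Chu–Vandermonde identity, by induction on `N`. Pascal's rule pairs the terms so that each
pair contains the factor `(c + n) - (d + n) = c - d`, and the remaining sum is the identity for `c +
1`. -/
theorem sum_choose_poch (c d : ℂ) (N : ℕ) : ∑ n ∈ Finset.range (N + 1),
    (N.choose n : ℂ) * (-1) ^ n * poch d n * poch (c + n) (N - n) = poch (c - d) N := by
  induction N generalizing c with
  | zero => simp
  | succ N ih =>
    have e1 : ∑ n ∈ Finset.range (N + 1 + 1),
        ((N + 1).choose n : ℂ) * (-1) ^ n * poch d n * poch (c + n) (N + 1 - n) =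
        ∑ n ∈ Finset.range (N + 1), (N.choose n : ℂ) * (-1) ^ n * poch d n *
          poch (c + n) (N + 1 - n) +
        ∑ n ∈ Finset.range (N + 1), (N.choose n : ℂ) * (-1) ^ (n + 1) * poch d (n + 1) *
          poch (c + (n + 1 : ℕ)) (N - n) := by
      rw [Finset.sum_range_succ']
      simp only [Nat.choose_succ_succ, Nat.cast_add, add_mul, Finset.sum_add_distrib,
        Nat.add_sub_add_right]
      have e2 : ∑ n ∈ Finset.range (N + 1), (N.choose n : ℂ) * (-1) ^ n * poch d n *
          poch (c + n) (N + 1 - n) = ∑ n ∈ Finset.range (N + 1), (N.choose (n + 1) : ℂ) *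
          (-1) ^ (n + 1) * poch d (n + 1) * poch (c + (n + 1 : ℕ)) (N - n) +
          poch c (N + 1) := by
        rw [Finset.sum_range_succ' _ N, Finset.sum_range_succ _ N]
        simp
      rw [e2]
      simp
      ring
    rw [e1, ← Finset.sum_add_distrib, poch_succ', show c - d + 1 = (c + 1) - d by ring, ← ih,
      Finset.mul_sum]
    refine Finset.sum_congr rfl fun n hn => ?_
    have hn' : n ≤ N := Nat.lt_succ_iff.1 (Finset.mem_range.1 hn)
    rw [Nat.succ_sub hn', poch_succ', poch_succ, pow_succ]
    push_cast
    rw [show c + (n : ℂ) + 1 = c + 1 + n by ring, show c + ((n : ℂ) + 1) = c + 1 + n by ring]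
    ring

theorem summable_prod_of_hasSum {G : ℕ × ℕ → ℝ} {S : ℕ → ℝ} (h0 : ∀ p, 0 ≤ G p)
    (h1 : ∀ n, HasSum (fun m => G (n, m)) (S n)) (hS : Summable S) : Summable G := by
  rw [summable_prod_of_nonneg h0]
  exact ⟨fun n => (h1 n).summable, by simpa [fun n => (h1 n).tsum_eq] using hS⟩

theorem poch_mul_choose {a : ℂ} (n m : ℕ) :
    poch a n / n.factorial * (poch (a + n) m / m.factorial) =
      poch a (n + m) / (n + m).factorial * ((n + m).choose n) := by
  rw [poch_add, Nat.cast_choose ℂ (Nat.le_add_right n m), Nat.add_sub_cancel_left]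
  have h1 : (n.factorial : ℂ) ≠ 0 := by exact_mod_cast n.factorial_ne_zero
  have h2 : (m.factorial : ℂ) ≠ 0 := by exact_mod_cast m.factorial_ne_zero
  have h3 : ((n + m).factorial : ℂ) ≠ 0 := by exact_mod_cast (n + m).factorial_ne_zero
  field_simp

/-- Each `(1 - z)^(-a - n)` on the right is expanded by the binomial series, and the double series
is rearranged along antidiagonals, where Chu–Vandermonde evaluates the finite sums. The condition
`‖z‖ < 1/2` makes `‖z‖ / (1 - ‖z‖) < 1`, which is what absolute convergence of the double series
requires. -/
theorem pfaff_small (a b : ℂ) {c z : ℂ} (hc : NonPole c) (hz : ‖z‖ < 1 / 2) :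
    ₂F₁ a b c z = (1 - z) ^ (-a) * ₂F₁ a (c - b) c (z / (z - 1)) := by
  have hz1 : ‖z‖ < 1 := by linarith
  have h1z : 1 - z ≠ 0 := by
    intro h
    have : z = 1 := by linear_combination -h
    rw [this] at hz1; simp at hz1
  have hz1' : (0 : ℝ) < 1 - ‖z‖ := by linarith
  set q := ‖z‖ / (1 - ‖z‖) with hq
  have hq0 : 0 ≤ q := by positivity
  have hq1 : q < 1 := by rw [hq, div_lt_one hz1']; linarith
  have hw : ‖z / (z - 1)‖ < 1 := by
    rw [norm_div]
    refine lt_of_le_of_lt ?_ hq1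
    have : 1 - ‖z‖ ≤ ‖z - 1‖ := by
      have := norm_sub_norm_le 1 z
      rw [norm_one, norm_sub_rev] at this; exact this
    rw [hq]; gcongr
  let g : ℕ × ℕ → ℂ := fun p => hcoef a (c - b) c p.1 * (-1) ^ p.1 * z ^ p.1 *
    (poch (a + p.1) p.2 / p.2.factorial * z ^ p.2)
  have hG : Summable fun p : ℕ × ℕ => ‖hcoef a (c - b) c p.1‖ * ‖z‖ ^ p.1 *
      (‖poch ((‖a‖ + p.1 : ℝ) : ℂ) p.2‖ / p.2.factorial * ‖z‖ ^ p.2) := by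
    refine summable_prod_of_hasSum (fun p => by positivity)
      (S := fun n => ‖hcoef a (c - b) c n‖ * ‖z‖ ^ n * (1 - ‖z‖) ^ (-(‖a‖ + n : ℝ)))
      (fun n => (hasSum_norm_poch (by positivity) (norm_nonneg z) hz1).mul_left _) ?_
    have := (summable_norm_hcoef a (c - b) hc hq0 hq1).mul_right ((1 - ‖z‖) ^ (-‖a‖))
    refine this.congr fun n => ?_
    rw [neg_add, Real.rpow_add hz1', Real.rpow_neg hz1'.le n, Real.rpow_natCast, hq, div_pow]
    ring
  have hg : Summable g := by
    refine Summable.of_norm (Summable.of_nonneg_of_le (fun _ => norm_nonneg _) (fun p => ?_) hG)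
    have hb := norm_poch_le (a := a + p.1) (x := ‖a‖ + p.1)
      ((norm_add_le _ _).trans (by simp)) p.2
    simp only [g, norm_mul, norm_div, norm_pow, norm_neg, norm_one, one_pow, mul_one,
      Complex.norm_natCast]
    gcongr
  have hA : HasSum (fun n => (1 - z) ^ (-a) * (hcoef a (c - b) c n * (z / (z - 1)) ^ n))
      (∑' p, g p) := by
    refine (hg.hasSum.prod_fiberwise fun n => ?_)
    have := (hasSum_binomial (a + n) hz1).mul_left (hcoef a (c - b) c n * (-1) ^ n * z ^ n)
    refine (congrArg (HasSum _) ?_).mp this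
    rw [neg_add, Complex.cpow_add _ _ h1z, Complex.cpow_neg _ (n : ℂ), Complex.cpow_natCast,
      div_pow, show z - 1 = (-1) * (1 - z) by ring, mul_pow]
    have h2 : ((-1 : ℂ)) ^ n * (-1) ^ n = 1 := by rw [← mul_pow]; simp
    have h3 : ((-1 : ℂ)) ^ n ≠ 0 := by simp
    field_simp
    linear_combination (hcoef a (c - b) c n * z ^ n * (1 - z) ^ (-a)) * h2
  have hB : HasSum (fun N => hcoef a b c N * z ^ N) (∑' p, g p) := by
    have h1 := (Finset.HasAntidiagonal.sigmaAntidiagonalEquivProd (A := ℕ)).hasSum_iff.2 hg.hasSum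
    refine hasSum_congr_fun (fun N => ?_) (h1.sigma fun N => hasSum_fintype _)
    rw [Finset.sum_coe_sort_eq_attach]
    refine (Finset.sum_attach (Finset.HasAntidiagonal.antidiagonal N) (fun p => g p)).trans ?_
    rw [Finset.Nat.sum_antidiagonal_eq_sum_range_succ_mk]
    have h2 := sum_choose_poch c (c - b) N
    rw [sub_sub_cancel] at h2
    have hcN := poch_ne_zero hc N
    rw [hcoef, ← h2, Finset.mul_sum, Finset.sum_div, Finset.sum_mul]
    refine Finset.sum_congr rfl fun n hn => ?_
    obtain ⟨m, rfl⟩ := Nat.exists_eq_add_of_le (Nat.lt_succ_iff.1 (Finset.mem_range.1 hn))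
    have h4 := poch_mul_choose (a := a) n m
    simp only [g, Nat.add_sub_cancel_left, hcoef]
    rw [poch_add c n m] at *
    have h5 := poch_ne_zero hc n
    have h6 := poch_ne_zero (hc.add_nat n) m
    have h7 : (n.factorial : ℂ) ≠ 0 := by exact_mod_cast n.factorial_ne_zero
    have h8 : (m.factorial : ℂ) ≠ 0 := by exact_mod_cast m.factorial_ne_zero
    have h9 : ((n + m).factorial : ℂ) ≠ 0 := by exact_mod_cast (n + m).factorial_ne_zero
    field_simp at h4 ⊢
    rw [pow_add]
    linear_combination (z ^ n * z ^ m * poch (c - b) n) * h4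
  rw [← (hA.unique ((hasSum_hyp a (c - b) hc hw).mul_left _)), (hasSum_hyp a b hc hz1).unique hB]

theorem norm_lt_norm_one_sub_iff {z : ℂ} : ‖z‖ < ‖1 - z‖ ↔ z.re < 1 / 2 := by
  rw [← sq_lt_sq₀ (norm_nonneg _) (norm_nonneg _), ← Complex.normSq_eq_norm_sq,
    ← Complex.normSq_eq_norm_sq, Complex.normSq_apply, Complex.normSq_apply]
  simp
  constructor <;> intro h <;> nlinarith

theorem norm_div_sub_one_lt {z : ℂ} (h : z.re < 1 / 2) : ‖z / (z - 1)‖ < 1 := by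
  have h1 := norm_lt_norm_one_sub_iff.2 h
  rw [norm_div, norm_sub_rev, div_lt_one ((norm_nonneg z).trans_lt h1)]
  exact h1

theorem sub_one_ne_zero_of_re_lt {z : ℂ} (h : z.re < 1 / 2) : z - 1 ≠ 0 := by
  intro h0
  have : z = 1 := by linear_combination h0
  rw [this] at h; norm_num at h

theorem one_sub_mem_slitPlane_of_re_lt {z : ℂ} (h : z.re < 1 / 2) : 1 - z ∈ Complex.slitPlane :=
  Or.inl (by simp; linarith)

theorem differentiableOn_pfaff (a b : ℂ) {c : ℂ} (hc : NonPole c) :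
    DifferentiableOn ℂ (fun z => (1 - z) ^ (-a) * ₂F₁ a b c (z / (z - 1))) {z : ℂ | z.re < 1 / 2} := by
  intro z hz
  have hz' : z.re < 1 / 2 := hz
  have h1 : DifferentiableAt ℂ (fun z : ℂ => (1 - z) ^ (-a)) z :=
    (differentiableAt_id.const_sub 1).cpow_const (one_sub_mem_slitPlane_of_re_lt hz')
  have h2 : DifferentiableAt ℂ (fun z : ℂ => z / (z - 1)) z :=
    differentiableAt_id.div (differentiableAt_id.sub_const 1) (sub_one_ne_zero_of_re_lt hz')
  have h3 : DifferentiableAt ℂ (₂F₁ a b c : ℂ → ℂ) (z / (z - 1)) :=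
    (differentiableOn_hyp a b hc).differentiableAt
      (Metric.isOpen_ball.mem_nhds (by simpa using norm_div_sub_one_lt hz'))
  exact (h1.mul (h3.comp z h2)).differentiableWithinAt

theorem isOpen_re_lt_half : IsOpen {z : ℂ | z.re < 1 / 2} :=
  isOpen_lt Complex.continuous_re continuous_const

/-- **Pfaff's transformation** inside the unit disc. -/
theorem pfaff (a b : ℂ) {c z : ℂ} (hc : NonPole c) (hz : ‖z‖ < 1) (hz' : z.re < 1 / 2) :
    ₂F₁ a b c z = (1 - z) ^ (-a) * ₂F₁ a (c - b) c (z / (z - 1)) := by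
  refine eq_of_segment_subset (D := Metric.ball 0 1 ∩ {z : ℂ | z.re < 1 / 2}) (P₀ := 0)
    (Metric.isOpen_ball.inter isOpen_re_lt_half) (g₁ := ₂F₁ a b c)
    (g₂ := fun z => (1 - z) ^ (-a) * ₂F₁ a (c - b) c (z / (z - 1)))
    ((differentiableOn_hyp a b hc).mono Set.inter_subset_left)
    ((differentiableOn_pfaff a (c - b) hc).mono Set.inter_subset_right) ?_ ?_
  · intro t ht
    simp only [sub_zero, zero_add, smul_eq_mul, Set.mem_inter_iff, mem_ball_zero_iff, norm_mul,
      Complex.norm_real, Real.norm_eq_abs, abs_of_nonneg ht.1, Set.mem_ofPred_eq,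
      Complex.re_ofReal_mul]
    have := norm_nonneg z
    constructor
    · nlinarith [ht.1, ht.2]
    · rcases le_or_gt z.re 0 with h | h
      · nlinarith [ht.1, ht.2]
      · nlinarith [ht.1, ht.2]
  · filter_upwards [Metric.ball_mem_nhds (0 : ℂ) (by norm_num : (0 : ℝ) < 1 / 2)] with w hw
    exact pfaff_small a b hc (by simpa using hw)


/-! ### The Beta-type integral of a hypergeometric function -/

theorem integrableOn_beta {p q : ℝ} (hp : 0 < p) (hq : 0 < q) :
    IntegrableOn (fun u : ℝ => u ^ (p - 1) * (1 - u) ^ (q - 1)) (Set.Ioo 0 1) := by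
  have h := Complex.betaIntegral_convergent (u := p) (v := q) (by simpa) (by simpa)
  rw [intervalIntegrable_iff_integrableOn_Ioo_of_le zero_le_one] at h
  refine IntegrableOn.congr_fun (Integrable.norm h) (fun u hu => ?_) measurableSet_Ioo
  have h1 : (0 : ℝ) < 1 - u := by linarith [hu.2]
  have e : (1 : ℂ) - u = ((1 - u : ℝ) : ℂ) := by push_cast; ring
  simp only [norm_mul]
  rw [e, Complex.norm_cpow_eq_rpow_re_of_pos hu.1, Complex.norm_cpow_eq_rpow_re_of_pos h1]
  simp

theorem norm_beta_weight {u : ℝ} (hu : u ∈ Set.Ioo (0 : ℝ) 1) (P β : ℂ) :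
    ‖(u : ℂ) ^ (P - 1) * (1 - (u : ℂ)) ^ (β - 1)‖ = u ^ (P.re - 1) * (1 - u) ^ (β.re - 1) := by
  have h1 : (0 : ℝ) < 1 - u := by linarith [hu.2]
  have e : (1 : ℂ) - u = ((1 - u : ℝ) : ℂ) := by push_cast; ring
  rw [norm_mul, e, Complex.norm_cpow_eq_rpow_re_of_pos hu.1,
    Complex.norm_cpow_eq_rpow_re_of_pos h1]
  simp

/-- The terms of the expansion of `(1 - u q)^(-A) ₂F₁(A, d; β; (1 - u) / (1 - u q))`. -/
noncomputable def pfaffTerm (A d β q : ℂ) (u : ℝ) (p : ℕ × ℕ) : ℂ :=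
  hcoef A d β p.1 * (1 - (u : ℂ)) ^ p.1 * (poch (A + p.1) p.2 / p.2.factorial * (u * q) ^ p.2)

/-- After taking absolute values, the inner binomial sums are powers of `1 - ‖q‖ u`, and the outer
sum is an absolute hypergeometric series at `v = (1 - u)/(1 - ‖q‖ u)`. Since `1 - v ≥ u (1 - ‖q‖)`,
its growth at the unit circle becomes the power `u^(-τ)`. -/
theorem exists_pfaffTerm_bound (A d : ℂ) {β : ℂ} (hβ : NonPole β) {τ : ℝ} (h0 : 0 < τ)
    (h : (A + d - β).re ≤ τ) {q : ℂ} (hq : ‖q‖ < 1) : ∃ K : ℝ, 0 < K ∧ ∀ u ∈ Set.Ioo (0 : ℝ) 1,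
      Summable (fun p => ‖pfaffTerm A d β q u p‖) ∧
      ∑' p, ‖pfaffTerm A d β q u p‖ ≤ K * u ^ (-τ) := by
  obtain ⟨K, hK, hb⟩ := exists_tsum_norm_hcoef_le A d hβ h0 h
  have hq' : 0 < 1 - ‖q‖ := by linarith
  refine ⟨K * (1 - ‖q‖) ^ (-‖A‖) * (1 - ‖q‖) ^ (-τ), by positivity, fun u hu => ?_⟩
  have hu0 := hu.1
  have hu1 : 0 < 1 - u := by linarith [hu.2]
  have hqu : ‖q‖ * u ≤ ‖q‖ := mul_le_of_le_one_right (norm_nonneg _) hu.2.le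
  have hqu1 : 0 < 1 - ‖q‖ * u := by linarith
  set v := (1 - u) / (1 - ‖q‖ * u) with hv
  have hv0 : 0 ≤ v := by positivity
  have hv1 : u * (1 - ‖q‖) ≤ 1 - v := by
    rw [hv, one_sub_div hqu1.ne', le_div_iff₀ hqu1]
    have : 0 ≤ u * (1 - ‖q‖) := by positivity
    nlinarith [mul_nonneg (norm_nonneg q) hu0.le]
  have hv2 : v < 1 := by
    have : 0 < u * (1 - ‖q‖) := by positivity
    linarith
  obtain ⟨hs, hle⟩ := hb v hv0 hv2
  have hG : ∀ n, HasSum (fun j : ℕ => ‖hcoef A d β n‖ * (1 - u) ^ n *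
      (‖poch ((‖A‖ + n : ℝ) : ℂ) j‖ / j.factorial * (‖q‖ * u) ^ j))
      (‖hcoef A d β n‖ * v ^ n * (1 - ‖q‖ * u) ^ (-‖A‖)) := fun n => by
    have := (hasSum_norm_poch (x := ‖A‖ + n) (r := ‖q‖ * u) (by positivity) (by positivity)
      (by linarith)).mul_left (‖hcoef A d β n‖ * (1 - u) ^ n)
    refine (congrArg (HasSum _) ?_).mp this
    rw [neg_add, Real.rpow_add hqu1, Real.rpow_neg hqu1.le n, Real.rpow_natCast, hv, div_pow]
    ring
  have hS := hs.mul_right ((1 - ‖q‖ * u) ^ (-‖A‖))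
  have hsum := summable_prod_of_hasSum (G := fun p : ℕ × ℕ => ‖hcoef A d β p.1‖ * (1 - u) ^ p.1 *
      (‖poch ((‖A‖ + p.1 : ℝ) : ℂ) p.2‖ / p.2.factorial * (‖q‖ * u) ^ p.2))
      (fun p => by positivity) hG hS
  have hterm : ∀ p : ℕ × ℕ, ‖pfaffTerm A d β q u p‖ ≤ ‖hcoef A d β p.1‖ * (1 - u) ^ p.1 *
      (‖poch ((‖A‖ + p.1 : ℝ) : ℂ) p.2‖ / p.2.factorial * (‖q‖ * u) ^ p.2) := fun p => by
    have hbd := norm_poch_le (a := A + p.1) (x := ‖A‖ + p.1)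
      ((norm_add_le _ _).trans (by simp)) p.2
    have e : ‖(1 : ℂ) - u‖ = 1 - u := by
      rw [← Complex.ofReal_one, ← Complex.ofReal_sub, Complex.norm_real, Real.norm_eq_abs,
        abs_of_pos hu1]
    simp only [pfaffTerm, norm_mul, norm_div, norm_pow, Complex.norm_natCast, e,
      Complex.norm_real, Real.norm_eq_abs, abs_of_pos hu0]
    rw [mul_comm u]
    gcongr
  have hsn := Summable.of_nonneg_of_le (fun _ => norm_nonneg _) hterm hsum
  refine ⟨hsn, (hsn.tsum_le_tsum hterm hsum).trans ?_⟩
  have e1 := (hsum.hasSum.prod_fiberwise hG).tsum_eq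
  rw [← e1, tsum_mul_right]
  have h3 : (1 - ‖q‖ * u) ^ (-‖A‖) ≤ (1 - ‖q‖) ^ (-‖A‖) :=
    Real.rpow_le_rpow_of_nonpos hq' (by linarith) (by simp)
  have h4 : (1 - v) ^ (-τ) ≤ u ^ (-τ) * (1 - ‖q‖) ^ (-τ) := by
    rw [← Real.mul_rpow hu0.le hq'.le]
    exact Real.rpow_le_rpow_of_nonpos (by positivity) hv1 (by linarith)
  calc (∑' n, ‖hcoef A d β n‖ * v ^ n) * (1 - ‖q‖ * u) ^ (-‖A‖)
      ≤ (K * (u ^ (-τ) * (1 - ‖q‖) ^ (-τ))) * (1 - ‖q‖) ^ (-‖A‖) := by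
        refine mul_le_mul (hle.trans ?_) h3 (by positivity) (by positivity)
        gcongr
    _ = _ := by ring

theorem one_sub_ofReal_mul_norm_pos {u : ℝ} (hu : u ∈ Set.Ioo (0 : ℝ) 1) {q : ℂ} (hq : ‖q‖ < 1) :
    ‖(u : ℂ) * q‖ < 1 ∧ ‖(1 - (u : ℂ)) / (1 - u * q)‖ < 1 := by
  have hu0 := hu.1
  have hu1 : 0 < 1 - u := by linarith [hu.2]
  have h1 : ‖(u : ℂ) * q‖ = u * ‖q‖ := by simp [abs_of_pos hu0]
  have h2 : u * ‖q‖ < u := mul_lt_of_lt_one_right hu0 hq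
  have h3 : 1 - u * ‖q‖ ≤ ‖1 - (u : ℂ) * q‖ := by
    have := norm_sub_norm_le (1 : ℂ) (u * q)
    rwa [norm_one, h1] at this
  refine ⟨by rw [h1]; linarith [hu.2], ?_⟩
  have e : ‖(1 : ℂ) - u‖ = 1 - u := by
    rw [← Complex.ofReal_one, ← Complex.ofReal_sub, Complex.norm_real, Real.norm_eq_abs,
      abs_of_pos hu1]
  rw [norm_div, e, div_lt_one (by linarith)]
  linarith

theorem hasSum_pfaffTerm (A d : ℂ) {β : ℂ} (hβ : NonPole β) {q : ℂ} (hq : ‖q‖ < 1) {u : ℝ}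
    (hu : u ∈ Set.Ioo (0 : ℝ) 1) : HasSum (pfaffTerm A d β q u)
      ((1 - u * q) ^ (-A) * ₂F₁ A d β ((1 - (u : ℂ)) / (1 - u * q))) := by
  obtain ⟨K, -, hb⟩ := exists_pfaffTerm_bound A d hβ (τ := max 1 (A + d - β).re) (by positivity)
    (le_max_right _ _) hq
  obtain ⟨h1, h2⟩ := one_sub_ofReal_mul_norm_pos hu hq
  have h0 : 1 - (u : ℂ) * q ≠ 0 := by
    intro h
    rw [← sub_eq_zero.1 h] at h1; simp at h1
  have hs := (hb u hu).1.of_norm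
  have hf : ∀ n : ℕ, HasSum (fun j => pfaffTerm A d β q u (n, j))
      ((1 - u * q) ^ (-A) * (hcoef A d β n * ((1 - (u : ℂ)) / (1 - u * q)) ^ n)) := fun n => by
    have := (hasSum_binomial (A + n) h1).mul_left (hcoef A d β n * (1 - (u : ℂ)) ^ n)
    refine (congrArg (HasSum _) ?_).mp this
    rw [neg_add, Complex.cpow_add _ _ h0, Complex.cpow_neg _ (n : ℂ), Complex.cpow_natCast, div_pow]
    ring
  have := (hs.hasSum.prod_fiberwise hf).unique ((hasSum_hyp A d hβ h2).mul_left _)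
  rw [← this]
  exact hs.hasSum

/-- The integrand of the Beta-type integral. -/
noncomputable def betaHypIntegrand (A d β P b x q : ℂ) (u : ℝ) : ℂ :=
  (u : ℂ) ^ (P - 1) * (1 - (u : ℂ)) ^ (β - 1) * (1 - x * u) ^ (-b) *
    ((1 - u * q) ^ (-A) * ₂F₁ A d β ((1 - (u : ℂ)) / (1 - u * q)))

theorem integral_betaWeight {P β : ℂ} (hP : 0 < P.re) (hβ : 0 < β.re) (k n : ℕ) :
    ∫ u in Set.Ioo (0 : ℝ) 1, (u : ℂ) ^ (P - 1) * (1 - (u : ℂ)) ^ (β - 1) * (u : ℂ) ^ k *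
      (1 - (u : ℂ)) ^ n = Complex.Gamma (P + k) * Complex.Gamma (β + n) /
        Complex.Gamma (P + k + β + n) := by
  rw [add_assoc (P + k), ← Complex.betaIntegral_eq_Gamma_mul_div _ _ (by simp; positivity)
    (by simp; positivity), Complex.betaIntegral, intervalIntegral.integral_of_le zero_le_one,
    integral_Ioc_eq_integral_Ioo]
  refine setIntegral_congr_fun measurableSet_Ioo fun u hu => ?_
  have h0 : (u : ℂ) ≠ 0 := by exact_mod_cast hu.1.ne'
  have h1 : (1 - u : ℂ) ≠ 0 := by
    rw [sub_ne_zero]; exact_mod_cast hu.2.ne'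
  rw [show P + k - 1 = (P - 1) + k by ring, show β + n - 1 = (β - 1) + n by ring,
    Complex.cpow_add _ _ h0, Complex.cpow_add _ _ h1, Complex.cpow_natCast, Complex.cpow_natCast]
  ring

/-- From `(A)_n (A + n)_j = (A)_j (A + j)_n`: for fixed `j` the sum over `n` becomes a Gauss series
at argument `1` with upper parameters `A + j` and `d`. -/
theorem hcoef_shift (A d : ℂ) {β c : ℂ} {n : ℕ} (hβ : poch β n ≠ 0) (hc : poch c n ≠ 0) (j : ℕ)
    (g₁ g₂ : ℂ) : hcoef A d β n * (poch (A + n) j / j.factorial) *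
      (poch β n * g₁ / (poch c n * g₂)) =
      g₁ * g₂⁻¹ * (poch A j / j.factorial) * hcoef (A + j) d c n := by
  have h6 : poch A n * poch (A + n) j = poch A j * poch (A + j) n := by
    rw [← poch_add, ← poch_add, add_comm]
  have h4 : (j.factorial : ℂ) ≠ 0 := by exact_mod_cast j.factorial_ne_zero
  have h5 : (n.factorial : ℂ) ≠ 0 := by exact_mod_cast n.factorial_ne_zero
  rw [hcoef, hcoef, div_mul_eq_div_div, ← div_eq_mul_inv]
  field_simp
  linear_combination (poch d n * g₁ * g₂⁻¹) * h6

/-- The double series expansion of the Beta-type integral. -/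
theorem hasSum_betaHyp {A β P Q b x q : ℂ} (hβ : 0 < β.re) (hP : 0 < P.re) (hQ : 0 < Q.re)
    (hx : ‖x‖ < 1) (hq : ‖q‖ < 1) :
    IntegrableOn (betaHypIntegrand A (β - Q + P - A) β P b x q) (Set.Ioo 0 1) ∧
    HasSum (fun p : ℕ × ℕ => Complex.Gamma β * Complex.Gamma (P + p.1 + p.2) *
        Complex.Gamma (Q + p.1) * ((Complex.Gamma (P + β - A + p.1))⁻¹ *
        (Complex.Gamma (Q + A + p.1 + p.2))⁻¹) *
        (poch b p.1 * poch A p.2 / (p.1.factorial * p.2.factorial)) * x ^ p.1 * q ^ p.2)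
      (∫ u in Set.Ioo (0 : ℝ) 1, betaHypIntegrand A (β - Q + P - A) β P b x q u) := by
  have hβn := nonPole_of_re_pos hβ
  set d := β - Q + P - A with hd
  -- By the choice of `d` one has `A + d - β = P - Q`, whose real part is below `Re P` because `Re Q
  -- > 0`. So the growth `u^(-τ)` is still integrable against `u^(P - 1)`.
  obtain ⟨τ, hτ0, hτ1, hτ2⟩ : ∃ τ : ℝ, 0 < τ ∧ (A + d - β).re ≤ τ ∧ τ < P.re := by
    have : (A + d - β).re < P.re := by simp [hd]; linarith
    obtain ⟨τ, h1, h2⟩ := exists_between (max_lt hP this)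
    exact ⟨τ, (le_max_left _ _).trans_lt h1, ((le_max_right _ _).trans_lt h1).le, h2⟩
  obtain ⟨K, hK, hb⟩ := exists_pfaffTerm_bound A d hβn hτ0 hτ1 hq
  let F1 : ℕ → ℝ → ℂ := fun i u => poch b i / i.factorial * (x * u) ^ i
  let W : ℝ → ℂ := fun u => (u : ℂ) ^ (P - 1) * (1 - (u : ℂ)) ^ (β - 1)
  let f : ℕ × (ℕ × ℕ) → ℝ → ℂ := fun p u => F1 p.1 u * pfaffTerm A d β q u p.2 * W u
  let g : ℝ → ℝ := fun u => (1 - ‖x‖) ^ (-‖b‖) * K * (u ^ (P.re - τ - 1) * (1 - u) ^ (β.re - 1))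
  have hg : Integrable g (volume.restrict (Set.Ioo 0 1)) :=
    (integrableOn_beta (by linarith) hβ).const_mul _
  have hxs := hasSum_norm_poch (norm_nonneg b) (norm_nonneg x) hx
  have hF1 : ∀ u ∈ Set.Ioo (0 : ℝ) 1, ∀ i, ‖F1 i u‖ ≤
      ‖poch (‖b‖ : ℂ) i‖ / i.factorial * ‖x‖ ^ i := fun u hu i => by
    have h1 := norm_poch_le (le_refl ‖b‖) i
    have h2 : ‖x * (u : ℂ)‖ ≤ ‖x‖ := by
      rw [norm_mul, Complex.norm_real, Real.norm_eq_abs, abs_of_pos hu.1]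
      exact mul_le_of_le_one_right (norm_nonneg _) hu.2.le
    simp only [F1, norm_mul, norm_div, norm_pow, Complex.norm_natCast] at h2 ⊢
    gcongr
  have hF1s : ∀ u ∈ Set.Ioo (0 : ℝ) 1, Summable (fun i => ‖F1 i u‖) := fun u hu =>
    Summable.of_nonneg_of_le (fun _ => norm_nonneg _) (hF1 u hu) hxs.summable
  have hprod : ∀ u ∈ Set.Ioo (0 : ℝ) 1,
      Summable (fun p : ℕ × (ℕ × ℕ) => ‖F1 p.1 u‖ * ‖pfaffTerm A d β q u p.2‖) := fun u hu =>
    (hF1s u hu).mul_of_nonneg (hb u hu).1 (fun _ => norm_nonneg _) (fun _ => norm_nonneg _)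
  have hfn : ∀ u p, ‖f p u‖ = ‖F1 p.1 u‖ * ‖pfaffTerm A d β q u p.2‖ * ‖W u‖ := fun u p => by
    simp [f]
  have hmem : ∀ᵐ u ∂(volume.restrict (Set.Ioo (0 : ℝ) 1)), u ∈ Set.Ioo (0 : ℝ) 1 :=
    ae_restrict_mem measurableSet_Ioo
  have hsum : ∀ u ∈ Set.Ioo (0 : ℝ) 1, Summable fun p => ‖f p u‖ := fun u hu => by
    simpa only [hfn] using (hprod u hu).mul_right ‖W u‖
  have hle : ∀ u ∈ Set.Ioo (0 : ℝ) 1, ∑' p, ‖f p u‖ ≤ g u := by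
    intro u hu
    simp only [hfn]
    rw [tsum_mul_right, ← (hF1s u hu).tsum_mul_tsum (hb u hu).1 (hprod u hu), norm_beta_weight hu]
    have h1 : ∑' i, ‖F1 i u‖ ≤ (1 - ‖x‖) ^ (-‖b‖) :=
      ((hF1s u hu).tsum_le_tsum (hF1 u hu) hxs.summable).trans_eq hxs.tsum_eq
    have hu1 : 0 < 1 - u := by linarith [hu.2]
    have hx1 : 0 < 1 - ‖x‖ := by linarith
    calc _ ≤ ((1 - ‖x‖) ^ (-‖b‖) * (K * u ^ (-τ))) * (u ^ (P.re - 1) * (1 - u) ^ (β.re - 1)) := by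
          refine mul_le_mul_of_nonneg_right (mul_le_mul h1 (hb u hu).2 ?_ (by positivity)) ?_
          · exact tsum_nonneg fun _ => norm_nonneg _
          · have := hu.1
            positivity
      _ = g u := by
          simp only [g]
          rw [show P.re - τ - 1 = -τ + (P.re - 1) by ring, Real.rpow_add hu.1]
          ring
  have hpt : ∀ u ∈ Set.Ioo (0 : ℝ) 1, HasSum (fun p => f p u)
      (betaHypIntegrand A d β P b x q u) := by
    intro u hu
    have hxu : ‖x * (u : ℂ)‖ < 1 := by
      rw [norm_mul, Complex.norm_real, Real.norm_eq_abs, abs_of_pos hu.1]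
      exact (mul_le_of_le_one_right (norm_nonneg _) hu.2.le).trans_lt hx
    have h1 := (hasSum_binomial b hxu).mul (hasSum_pfaffTerm A d hβn hq hu)
      (Summable.of_norm (by simpa [F1, norm_mul] using hprod u hu))
    refine (congrArg (HasSum _) ?_).mp (h1.mul_right (W u))
    simp only [betaHypIntegrand, W]
    ring
  have hmeas : ∀ p, AEStronglyMeasurable (f p) (volume.restrict (Set.Ioo 0 1)) := fun p => by
    apply Measurable.aestronglyMeasurable
    simp only [f, F1, W, pfaffTerm]
    fun_prop
  have hmain := hasSum_integral_of_tsum_norm_le hmeas hg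
    (hmem.mono hsum) (hmem.mono hle)
  have hcongr : ∫ u in Set.Ioo (0 : ℝ) 1, ∑' p, f p u =
      ∫ u in Set.Ioo (0 : ℝ) 1, betaHypIntegrand A d β P b x q u :=
    setIntegral_congr_fun measurableSet_Ioo fun u hu => (hpt u hu).tsum_eq
  rw [hcongr] at hmain
  constructor
  · refine hg.mono' ?_ ?_
    · unfold betaHypIntegrand
      have hm : ContinuousOn (fun u : ℝ => (1 - u * q) ^ (-A) *
          ₂F₁ A d β ((1 - (u : ℂ)) / (1 - u * q))) (Set.Ioo 0 1) := by
        intro u hu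
        obtain ⟨h1, h2⟩ := one_sub_ofReal_mul_norm_pos hu hq
        have hsl : 1 - (u : ℂ) * q ∈ Complex.slitPlane := by
          refine Or.inl ?_
          have := (Complex.re_le_norm (u * q)).trans_lt h1
          simp at this ⊢; linarith
        have h3 : ContinuousAt (₂F₁ A d β : ℂ → ℂ) ((1 - (u : ℂ)) / (1 - u * q)) :=
          ((differentiableOn_hyp A d hβn).differentiableAt
            (Metric.isOpen_ball.mem_nhds (by simpa using h2))).continuousAt
        have h4 : ContinuousAt (fun u : ℝ => (1 - (u : ℂ)) / (1 - u * q)) u :=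
          ContinuousAt.div (by fun_prop) (by fun_prop) (Complex.slitPlane_ne_zero hsl)
        have h5 : ContinuousAt (fun u : ℝ => (1 - (u : ℂ) * q) ^ (-A)) u :=
          ContinuousAt.cpow (f := fun u : ℝ => 1 - (u : ℂ) * q) (by fun_prop) (by fun_prop) hsl
        exact (h5.mul (ContinuousAt.comp (f := fun u : ℝ => (1 - (u : ℂ)) / (1 - u * q)) h3
          h4)).continuousWithinAt
      refine AEStronglyMeasurable.mul ?_ (hm.aestronglyMeasurable measurableSet_Ioo)
      apply Measurable.aestronglyMeasurable
      fun_prop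
    · filter_upwards [hmem] with u hu
      rw [← (hpt u hu).tsum_eq]
      exact (norm_tsum_le_tsum_norm (hsum u hu)).trans (hle u hu)
  -- The triple series is summed over the hypergeometric index `n` first, for fixed powers `x^i
  -- q^j`. Gauss's theorem evaluates this inner sum; the value of `d` makes the remaining Gamma
  -- factors those of the double series.
  · let e : (ℕ × ℕ) × ℕ ≃ ℕ × (ℕ × ℕ) :=
      ⟨fun p => (p.1.1, (p.2, p.1.2)), fun p => ((p.1, p.2.2), p.2.1), fun _ => rfl, fun _ => rfl⟩
    refine ((e.hasSum_iff.2 hmain).prod_fiberwise fun p => ?_)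
    obtain ⟨i, j⟩ := p
    have hc : 0 < (P + i + j + β).re := by
      simp; linarith [(Nat.cast_nonneg i : (0 : ℝ) ≤ i), (Nat.cast_nonneg j : (0 : ℝ) ≤ j)]
    have hcn := nonPole_of_re_pos hc
    have hG := hasSum_gauss (a := A + j) (b := d) hcn (by
      simp [hd]; linarith [(Nat.cast_nonneg i : (0 : ℝ) ≤ i)])
    rw [show P + i + j + β - (A + j) = P + β - A + i by ring,
      show P + i + j + β - d = Q + A + i + j by rw [hd]; ring,
      show P + β - A + i - d = Q + i by rw [hd]; ring] at hG
    have hG2 := hG.mul_left (Complex.Gamma β * Complex.Gamma (P + i + j) *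
      (Complex.Gamma (P + i + j + β))⁻¹ *
      (poch b i * poch A j / (i.factorial * j.factorial)) * x ^ i * q ^ j)
    have hGn := hcn.Gamma_ne_zero
    refine (congrArg (HasSum _) ?_).mp (hasSum_congr_fun (fun n => ?_) hG2)
    · linear_combination (Complex.Gamma β * Complex.Gamma (P + i + j) * Complex.Gamma (Q + i) *
        ((Complex.Gamma (P + β - A + i))⁻¹ * (Complex.Gamma (Q + A + i + j))⁻¹) *
        (poch b i * poch A j / (i.factorial * j.factorial)) * x ^ i * q ^ j) *
        (inv_mul_cancel₀ hGn)
    · have hi := integral_betaWeight hP hβ (i + j) n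
      have e1 : (f ∘ e) ((i, j), n) = fun u : ℝ =>
          (poch b i / i.factorial * x ^ i * hcoef A d β n * (poch (A + n) j / j.factorial) * q ^ j) *
          ((u : ℂ) ^ (P - 1) * (1 - (u : ℂ)) ^ (β - 1) * (u : ℂ) ^ (i + j) *
            (1 - (u : ℂ)) ^ n) := by
        funext u
        simp only [Function.comp_apply, f, F1, W, pfaffTerm, e, Equiv.coe_fn_mk]
        rw [mul_pow, mul_pow, pow_add]; ring
      have e2 : (∫ u in Set.Ioo (0 : ℝ) 1, f (e ((i, j), n)) u) =
          (poch b i / i.factorial * x ^ i * hcoef A d β n * (poch (A + n) j / j.factorial) * q ^ j) *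
          (Complex.Gamma (P + (i + j : ℕ)) * Complex.Gamma (β + n) /
            Complex.Gamma (P + (i + j : ℕ) + β + n)) := by
        rw [← hi, ← integral_const_mul]
        exact congrArg (fun h : ℝ → ℂ => ∫ u in Set.Ioo (0 : ℝ) 1, h u) e1
      simp only [Function.comp_apply]
      rw [e2, Gamma_add_nat hβn, show P + ((i + j : ℕ) : ℂ) = P + i + j by push_cast; ring,
        Gamma_add_nat hcn]
      have h := hcoef_shift A d (poch_ne_zero hβn n) (poch_ne_zero hcn n) j
        (Complex.Gamma β) (Complex.Gamma (P + i + j + β))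
      linear_combination (-(poch b i / i.factorial * x ^ i * q ^ j *
        Complex.Gamma (P + i + j))) * h


/-! ### The density of the Stieltjes representation -/

/-- The substitution `u = 1/(1 + w)` carries Beta integrals on `(0, 1)` to Stieltjes integrals on
`(0, ∞)`. -/
theorem image_inv_one_add_Ioi :
    (fun w : ℝ => (1 + w)⁻¹) '' Set.Ioi 0 = Set.Ioo 0 1 := by
  ext u
  constructor
  · rintro ⟨w, hw, rfl⟩
    have hw' : 0 < w := hw
    exact ⟨by positivity, inv_lt_one_of_one_lt₀ (by linarith)⟩
  · rintro ⟨h0, h1⟩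
    exact ⟨u⁻¹ - 1, by simpa using (one_lt_inv₀ h0).2 h1, by simp⟩

theorem hasDerivWithinAt_inv_one_add {w : ℝ} (hw : w ∈ Set.Ioi (0 : ℝ)) :
    HasDerivWithinAt (fun w : ℝ => (1 + w)⁻¹) (-1 / (1 + w) ^ 2) (Set.Ioi 0) w := by
  have h0 : (1 + w) ≠ 0 := by have : 0 < w := hw; positivity
  exact (((hasDerivAt_id w).const_add 1).inv h0).hasDerivWithinAt

theorem injOn_inv_one_add : Set.InjOn (fun w : ℝ => (1 + w)⁻¹) (Set.Ioi 0) := by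
  intro a _ b _ h
  have := inv_injective h
  linarith

theorem abs_deriv_inv_one_add (w : ℝ) : |-1 / (1 + w) ^ 2| = ((1 + w) ^ 2)⁻¹ := by
  rw [abs_div, abs_neg, abs_one, one_div, abs_of_nonneg (by positivity)]

theorem integral_Ioo_eq_integral_Ioi (g : ℝ → ℂ) : ∫ u in Set.Ioo (0 : ℝ) 1, g u =
    ∫ w in Set.Ioi (0 : ℝ), ((1 + w) ^ 2)⁻¹ • g (1 + w)⁻¹ := by
  rw [← image_inv_one_add_Ioi, integral_image_eq_integral_abs_deriv_smul measurableSet_Ioi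
    (fun w hw => hasDerivWithinAt_inv_one_add hw) injOn_inv_one_add]
  simp only [abs_deriv_inv_one_add]

theorem integrableOn_Ioo_iff_Ioi {F : Type*} [NormedAddCommGroup F] [NormedSpace ℝ F]
    (g : ℝ → F) : IntegrableOn g (Set.Ioo (0 : ℝ) 1) ↔
    IntegrableOn (fun w : ℝ => ((1 + w) ^ 2)⁻¹ • g (1 + w)⁻¹) (Set.Ioi 0) := by
  rw [← image_inv_one_add_Ioi, integrableOn_image_iff_integrableOn_abs_deriv_smul measurableSet_Ioi
    (fun w hw => hasDerivWithinAt_inv_one_add hw) injOn_inv_one_add]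
  simp only [abs_deriv_inv_one_add]

theorem integrableOn_Ioi_rpow_mul {σ ε : ℝ} (hσ : -1 < σ) (hε : 0 < ε) :
    IntegrableOn (fun w : ℝ => w ^ σ * (1 + w) ^ (-σ - 1 - ε)) (Set.Ioi 0) := by
  have h := (integrableOn_Ioo_iff_Ioi _).1 (integrableOn_beta hε (q := σ + 1) (by linarith))
  refine IntegrableOn.congr_fun h (fun w hw => ?_) measurableSet_Ioi
  have hw' : 0 < w := hw
  have h1 : 0 < 1 + w := by linarith
  have e : 1 - (1 + w)⁻¹ = w / (1 + w) := by field_simp; ring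
  simp only [smul_eq_mul]
  rw [e, Real.div_rpow hw'.le h1.le, Real.inv_rpow h1.le, ← Real.rpow_neg h1.le,
    ← Real.rpow_natCast (1 + w) 2, ← Real.rpow_neg h1.le, div_eq_mul_inv, ← Real.rpow_neg h1.le,
    mul_left_comm (((1 : ℝ) + w) ^ (-(ε - 1))), mul_left_comm, ← Real.rpow_add h1,
    ← Real.rpow_add h1]
  congr 2
  · ring
  · push_cast; ring

/-- The density of the Stieltjes representation, on the half plane `Re w > 0`. -/
noncomputable def rho (A B C w : ℂ) : ℂ :=
  w ^ (C - A - B) * (1 + w) ^ (-(C - B)) * ₂F₁ (C - B) (1 - B) (C - A - B + 1) (w / (1 + w))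

theorem norm_div_one_add_lt {w : ℂ} (hw : 0 < w.re) : ‖w / (1 + w)‖ < 1 := by
  have h := norm_div_sub_one_lt (z := -w) (by simp; linarith)
  have e : -w / (-w - 1) = w / (1 + w) := by
    rw [show -w - 1 = -(1 + w) by ring, neg_div_neg_eq]
  rwa [e] at h

theorem nonPole_add_one_of_re {s : ℂ} (hs : -1 < s.re) : NonPole (s + 1) :=
  nonPole_of_re_pos (by simp; linarith)

theorem differentiableAt_rho {A B C w : ℂ} (hs : -1 < (C - A - B).re) (hw : 0 < w.re) :
    DifferentiableAt ℂ (rho A B C) w := by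
  have h1 : w ∈ Complex.slitPlane := Or.inl hw
  have h2 : 1 + w ∈ Complex.slitPlane := Or.inl (by simp; linarith)
  have h3 : DifferentiableAt ℂ (₂F₁ (C - B) (1 - B) (C - A - B + 1) : ℂ → ℂ) (w / (1 + w)) :=
    (differentiableOn_hyp _ _ (nonPole_add_one_of_re hs)).differentiableAt
      (Metric.isOpen_ball.mem_nhds (by simpa using norm_div_one_add_lt hw))
  have h4 : DifferentiableAt ℂ (fun w : ℂ => w / (1 + w)) w :=
    differentiableAt_id.div (differentiableAt_id.const_add 1) (Complex.slitPlane_ne_zero h2)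
  exact ((differentiableAt_id.cpow_const h1).mul
    ((differentiableAt_id.const_add 1).cpow_const h2)).mul (h3.comp w h4)

theorem norm_cpow_le_mul {w : ℂ} (hw : w ≠ 0) (s : ℂ) :
    ‖w ^ s‖ ≤ Real.exp (Real.pi * |s.im|) * ‖w‖ ^ s.re := by
  rw [Complex.norm_cpow_of_ne_zero hw, div_eq_mul_inv, ← Real.exp_neg, mul_comm]
  gcongr
  calc -(w.arg * s.im) ≤ |w.arg * s.im| := neg_le_abs _
    _ = |w.arg| * |s.im| := abs_mul _ _
    _ ≤ Real.pi * |s.im| := by gcongr; exact Complex.abs_arg_le_pi w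

theorem one_add_norm_le {w : ℂ} (hw : 0 < w.re) : 1 + ‖w‖ ≤ 2 * ‖1 + w‖ := by
  have h1 : ‖w‖ ≤ ‖1 + w‖ := by
    rw [← sq_le_sq₀ (norm_nonneg _) (norm_nonneg _), ← Complex.normSq_eq_norm_sq,
      ← Complex.normSq_eq_norm_sq, Complex.normSq_apply, Complex.normSq_apply]
    simp; nlinarith
  have h2 : 1 ≤ ‖1 + w‖ := by
    have := Complex.re_le_norm (1 + w)
    simp at this; linarith
  linarith

/-- Comparison of powers of comparable positive quantities. -/
theorem rpow_le_of_comparable {a b k : ℝ} (ha : 0 < a) (hk : 1 ≤ k) (hab : a ≤ k * b)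
    (hba : b ≤ k * a) (e : ℝ) : a ^ e ≤ k ^ |e| * b ^ e := by
  have hb : 0 < b := by
    by_contra h
    have : k * b ≤ 0 := mul_nonpos_of_nonneg_of_nonpos (by linarith) (not_lt.1 h)
    linarith
  have hk0 : 0 < k := by linarith
  rcases le_total 0 e with he | he
  · rw [abs_of_nonneg he, ← Real.mul_rpow hk0.le hb.le]
    exact Real.rpow_le_rpow ha.le hab he
  · rw [abs_of_nonpos he, Real.rpow_neg hk0.le, ← Real.inv_rpow hk0.le,
      ← Real.mul_rpow (by positivity) hb.le]
    refine Real.rpow_le_rpow_of_nonpos (by positivity) ?_ he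
    rw [inv_mul_le_iff₀ hk0]
    exact hba

/-- The sector in which the density is estimated. -/
def sector : Set ℂ := {w | |w.im| < 2 * w.re}

theorem isOpen_sector : IsOpen sector :=
  isOpen_lt (by fun_prop) (by fun_prop)

theorem re_pos_of_mem_sector {w : ℂ} (h : w ∈ sector) : 0 < w.re := by
  have h' : |w.im| < 2 * w.re := h
  linarith [abs_nonneg w.im]

theorem mul_mem_sector {y : ℂ} (hy : y ∈ sector) {w : ℝ} (hw : 0 < w) : y * (w : ℂ) ∈ sector := by
  have h' : |y.im| < 2 * y.re := hy
  show |(y * (w : ℂ)).im| < 2 * (y * (w : ℂ)).re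
  simp only [Complex.mul_im, Complex.mul_re, Complex.ofReal_re, Complex.ofReal_im, mul_zero,
    zero_add, sub_zero, abs_mul, abs_of_pos hw]
  nlinarith

/-- The identity `(|1 + w| - |w|)(|1 + w| + |w|) = 1 + 2 Re w` is combined with `|w| ≤ 3 Re w`,
valid in the sector. In the whole right half plane no such bound of order `1/(1 + |w|)` holds. The
sector is wide enough to contain the rays through `1 ± i` that are used for the rotation. -/
theorem one_sub_norm_div_ge {w : ℂ} (h : w ∈ sector) :
    (4 * (1 + ‖w‖))⁻¹ ≤ 1 - ‖w / (1 + w)‖ := by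
  have hre := re_pos_of_mem_sector h
  have h' : |w.im| < 2 * w.re := h
  have h0 := norm_nonneg w
  have hn : ‖w‖ ≤ 3 * w.re := (Complex.norm_le_abs_re_add_abs_im w).trans (by
    rw [abs_of_pos hre]; linarith)
  have h1 : 0 < ‖1 + w‖ := by have := one_add_norm_le hre; linarith
  have h2 : ‖1 + w‖ ≤ 1 + ‖w‖ := by simpa using norm_add_le 1 w
  have h3 : ‖1 + w‖ ^ 2 = ‖w‖ ^ 2 + 1 + 2 * w.re := by
    rw [← Complex.normSq_eq_norm_sq, ← Complex.normSq_eq_norm_sq, Complex.normSq_apply,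
      Complex.normSq_apply]
    simp; ring
  have h4 : 0 < 4 * (1 + ‖w‖) := by positivity
  rw [norm_div, one_sub_div h1.ne', inv_eq_one_div, div_le_div_iff₀ h4 h1]
  have h5 : (‖1 + w‖ - ‖w‖) * (‖1 + w‖ + ‖w‖) = 1 + 2 * w.re := by linear_combination h3
  have h6 : 0 < ‖1 + w‖ + ‖w‖ := by linarith
  by_contra hcon
  push Not at hcon
  have h7 : (‖1 + w‖ - ‖w‖) * (4 * (1 + ‖w‖)) * (‖1 + w‖ + ‖w‖) < ‖1 + w‖ * (‖1 + w‖ + ‖w‖) := by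
    rw [one_mul] at hcon
    exact mul_lt_mul_of_pos_right hcon h6
  nlinarith

/-- Bound for the density. -/
theorem exists_norm_rho_le {A B C : ℂ} (hs : -1 < (C - A - B).re) {m : ℝ} (hmA : m < A.re)
    (hmB : m < B.re) : ∃ K : ℝ, 0 < K ∧ ∀ w ∈ sector,
      ‖rho A B C w‖ ≤ K * (‖w‖ ^ (C - A - B).re * (1 + ‖w‖) ^ (-(C - A - B).re - m)) := by
  -- For this `₂F₁` the sum of the upper parameters minus the lower one is `A - B`. The exponent `Re
  -- A - m` is positive by `m < Re A` and at least `Re(A - B)` by `m < Re B`.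
  obtain ⟨K, hK, hb⟩ := exists_norm_hyp_le (C - B) (1 - B) (nonPole_add_one_of_re hs)
    (τ := A.re - m) (by linarith) (by simp; linarith)
  refine ⟨Real.exp (Real.pi * |(C - A - B).im|) * (Real.exp (Real.pi * |(-(C - B)).im|) *
    2 ^ |(-(C - B)).re|) * (K * 4 ^ (A.re - m)), by positivity, fun w hw => ?_⟩
  have hre := re_pos_of_mem_sector hw
  have hw0 : w ≠ 0 := by rintro rfl; simp at hre
  have hw1 : 1 + w ≠ 0 := by
    intro h
    have := congrArg Complex.re h
    simp at this; linarith
  have hn0 : 0 < ‖w‖ := norm_pos_iff.2 hw0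
  have hn1 : 0 < 1 + ‖w‖ := by positivity
  have h1 := norm_cpow_le_mul hw0 (C - A - B)
  have h2 := norm_cpow_le_mul hw1 (-(C - B))
  have h3 : ‖1 + w‖ ^ (-(C - B)).re ≤ 2 ^ |(-(C - B)).re| * (1 + ‖w‖) ^ (-(C - B)).re := by
    refine rpow_le_of_comparable (norm_pos_iff.2 hw1) one_le_two ?_ (one_add_norm_le hre) _
    have : ‖1 + w‖ ≤ 1 + ‖w‖ := by simpa using norm_add_le 1 w
    linarith
  have h4 := hb _ (norm_div_one_add_lt hre)
  have h5 : (1 - ‖w / (1 + w)‖) ^ (-(A.re - m)) ≤ 4 ^ (A.re - m) * (1 + ‖w‖) ^ (A.re - m) := by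
    rw [← Real.mul_rpow (by norm_num) hn1.le]
    calc (1 - ‖w / (1 + w)‖) ^ (-(A.re - m)) ≤ ((4 * (1 + ‖w‖))⁻¹) ^ (-(A.re - m)) :=
          Real.rpow_le_rpow_of_nonpos (by positivity) (one_sub_norm_div_ge hw) (by linarith)
      _ = _ := by rw [Real.inv_rpow (by positivity), Real.rpow_neg (by positivity), inv_inv]
  rw [rho, norm_mul, norm_mul]
  have e : (1 + ‖w‖) ^ (-(C - A - B).re - m) =
      (1 + ‖w‖) ^ (-(C - B)).re * (1 + ‖w‖) ^ (A.re - m) := by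
    rw [← Real.rpow_add hn1]; congr 1; simp; ring
  rw [e]
  calc _ ≤ (Real.exp (Real.pi * |(C - A - B).im|) * ‖w‖ ^ (C - A - B).re) *
        (Real.exp (Real.pi * |(-(C - B)).im|) *
          (2 ^ |(-(C - B)).re| * (1 + ‖w‖) ^ (-(C - B)).re)) *
        (K * (4 ^ (A.re - m) * (1 + ‖w‖) ^ (A.re - m))) := by
        gcongr
        · exact h2.trans (by gcongr)
        · exact h4.trans (by gcongr)
    _ = _ := by ring

/-- The moments of the density. -/
theorem integral_rho_moment {A B C : ℂ} (hs : -1 < (C - A - B).re) (n : ℤ)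
    (hA : 0 < (A + n).re) (hB : 0 < (B + n).re) :
    IntegrableOn (fun w : ℝ => rho A B C w * (1 + (w : ℂ)) ^ (-n - 1)) (Set.Ioi 0) ∧
    ∫ w in Set.Ioi (0 : ℝ), rho A B C w * (1 + (w : ℂ)) ^ (-n - 1) =
      Complex.Gamma (C - A - B + 1) * Complex.Gamma (A + n) * Complex.Gamma (B + n) *
        ((Complex.Gamma (n + 1))⁻¹ * (Complex.Gamma (C + n))⁻¹) := by
  have hβ : 0 < (C - A - B + 1).re := by simp at hs ⊢; linarith
  -- The moment is the Beta-type integral with `b = x = q = 0`, after `u = 1/(1 + w)`. Its double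
  -- series then reduces to the term `(0, 0)`. The integer `n` may be negative.
  obtain ⟨hI, hS⟩ := hasSum_betaHyp (A := C - B) (β := C - A - B + 1) (P := A + n) (Q := B + n)
    (b := 0) (x := 0) (q := 0) hβ hA hB (by simp) (by simp)
  rw [show C - A - B + 1 - (B + n) + (A + n) - (C - B) = 1 - B by ring,
    show A + n + (C - A - B + 1) - (C - B) = n + 1 by ring,
    show B + n + (C - B) = C + n by ring] at *
  have hS0 := hasSum_single (f := fun p : ℕ × ℕ => Complex.Gamma (C - A - B + 1) *
      Complex.Gamma (A + n + p.1 + p.2) *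
        Complex.Gamma (B + n + p.1) * ((Complex.Gamma (n + 1 + p.1))⁻¹ *
        (Complex.Gamma (C + n + p.1 + p.2))⁻¹) *
        (poch 0 p.1 * poch (C - B) p.2 / (p.1.factorial * p.2.factorial)) * (0 : ℂ) ^ p.1 *
          (0 : ℂ) ^ p.2) (0, 0) (by
      rintro ⟨i, j⟩ h
      by_cases hi : i = 0
      · have hj : j ≠ 0 := by rintro rfl; exact h (by rw [hi])
        simp [hj]
      · simp [hi])
  have hval := hS.unique hS0
  simp only [Nat.cast_zero, add_zero, poch_zero, Nat.factorial_zero, Nat.cast_one, mul_one,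
    div_one, pow_zero] at hval
  have hcongr : ∀ w ∈ Set.Ioi (0 : ℝ), ((1 + w) ^ 2)⁻¹ •
      betaHypIntegrand (C - B) (1 - B) (C - A - B + 1) (A + n) 0 0 0 (1 + w)⁻¹ =
      rho A B C w * (1 + (w : ℂ)) ^ (-n - 1) := by
    intro w hw
    have hw' : 0 < w := hw
    have h1 : 0 < 1 + w := by linarith
    have h1c : (1 + (w : ℂ)) ≠ 0 := by
      rw [← Complex.ofReal_one, ← Complex.ofReal_add]
      exact_mod_cast h1.ne'
    have harg : (1 + (w : ℂ)).arg ≠ Real.pi := by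
      rw [← Complex.ofReal_one, ← Complex.ofReal_add, Complex.arg_ofReal_of_nonneg h1.le]
      exact Real.pi_ne_zero.symm
    have e : 1 - ((1 + w)⁻¹ : ℂ) = w / (1 + w) := by field_simp; ring
    have e2 : ((w : ℂ) / (1 + w)) ^ (C - A - B) = (w : ℂ) ^ (C - A - B) *
        (1 + (w : ℂ)) ^ (-(C - A - B)) := by
      have h := Complex.mul_cpow_ofReal_nonneg hw'.le (inv_nonneg.2 h1.le) (C - A - B)
      push_cast at h
      rw [div_eq_mul_inv, h, Complex.inv_cpow _ _ harg, ← Complex.cpow_neg]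
    simp only [betaHypIntegrand, neg_zero, Complex.cpow_zero, mul_zero, sub_zero,
      Complex.one_cpow, one_mul, mul_one, div_one, Complex.real_smul]
    push_cast
    rw [e, add_sub_cancel_right, e2, Complex.inv_cpow _ _ harg, ← Complex.cpow_neg, rho]
    have e3 : ((1 + (w : ℂ)) ^ 2)⁻¹ = (1 + (w : ℂ)) ^ (-2 : ℂ) := by
      rw [Complex.cpow_neg]; norm_cast
    have e4 : (1 + (w : ℂ)) ^ (-n - 1 : ℤ) = (1 + (w : ℂ)) ^ (-n - 1 : ℂ) := by
      rw [← Complex.cpow_intCast]; push_cast; rfl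
    rw [e3, e4]
    have e5 : (1 + (w : ℂ)) ^ (-2 : ℂ) * (1 + (w : ℂ)) ^ (-(A + n - 1)) *
        (1 + (w : ℂ)) ^ (-(C - A - B)) = (1 + (w : ℂ)) ^ (-(C - B)) *
        (1 + (w : ℂ)) ^ (-n - 1 : ℂ) := by
      rw [← Complex.cpow_add _ _ h1c, ← Complex.cpow_add _ _ h1c, ← Complex.cpow_add _ _ h1c]
      congr 1; ring
    linear_combination ((w : ℂ) ^ (C - A - B) *
      ₂F₁ (C - B) (1 - B) (C - A - B + 1) ((w : ℂ) / (1 + w))) * e5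
  constructor
  · rw [integrableOn_Ioo_iff_Ioi] at hI
    exact hI.congr_fun hcongr measurableSet_Ioi
  · rw [integral_Ioo_eq_integral_Ioi, setIntegral_congr_fun measurableSet_Ioi hcongr] at hval
    exact hval


/-! ### Stieltjes integrals along rotated rays -/

/-- The Stieltjes integral of the density along the ray through `y`. -/
noncomputable def stl (A B C : ℂ) (N : ℤ) (y v : ℂ) : ℂ :=
  ∫ w in Set.Ioi (0 : ℝ), rho A B C (y * w) * (1 + y * w) ^ (-N) / (w - v)

theorem one_add_ne_zero_of_re_pos {w : ℂ} (hw : 0 < w.re) : 1 + w ≠ 0 := by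
  intro h
  have := congrArg Complex.re h
  simp at this; linarith

/-- Along the ray through `y` the quantities `|y w|` and `w` are comparable, with constants
depending only on `k`. Thus one integrable majorant serves for all directions in the sector with
`1/k ≤ |y| ≤ k`. -/
theorem exists_norm_weight_le {A B C : ℂ} (hs : -1 < (C - A - B).re) {m : ℝ} (hmA : m < A.re)
    (hmB : m < B.re) (N : ℤ) {k : ℝ} (hk : 1 ≤ k) : ∃ K : ℝ, 0 < K ∧ ∀ y ∈ sector, ‖y‖ ≤ k →
      1 ≤ k * ‖y‖ → ∀ w : ℝ, 0 < w → ‖rho A B C (y * w) * (1 + y * w) ^ (-N)‖ ≤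
        K * (w ^ (C - A - B).re * (1 + w) ^ (-(C - A - B).re - m - N)) := by
  obtain ⟨K, hK, hb⟩ := exists_norm_rho_le hs hmA hmB
  have hk0 : 0 < k := by linarith
  refine ⟨K * (k ^ |(C - A - B).re| * k ^ |(-(C - A - B).re - m)|) * (2 * k) ^ |(-N : ℝ)|,
    by positivity, fun y hy hy1 hy2 w hw => ?_⟩
  have hmem := mul_mem_sector hy hw
  have hre := re_pos_of_mem_sector hmem
  have hyp : 0 < ‖y‖ := by
    rcases (norm_nonneg y).eq_or_lt with h | h
    · rw [← h] at hy2; simp at hy2; linarith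
    · exact h
  have hnw : ‖y * (w : ℂ)‖ = ‖y‖ * w := by simp [abs_of_pos hw]
  have h1 := hb _ hmem
  rw [hnw] at h1
  have hw1 : 0 < 1 + w := by linarith
  have h2 : (‖y‖ * w) ^ (C - A - B).re ≤ k ^ |(C - A - B).re| * w ^ (C - A - B).re :=
    rpow_le_of_comparable (by positivity) hk (by gcongr) (by nlinarith) _
  have h3 : (1 + ‖y‖ * w) ^ (-(C - A - B).re - m) ≤
      k ^ |(-(C - A - B).re - m)| * (1 + w) ^ (-(C - A - B).re - m) :=
    rpow_le_of_comparable (by positivity) hk (by nlinarith) (by nlinarith) _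
  have h4 : ‖1 + y * (w : ℂ)‖ ^ (-N : ℝ) ≤ (2 * k) ^ |(-N : ℝ)| * (1 + w) ^ (-N : ℝ) := by
    have h5 := one_add_norm_le hre
    have h6 : ‖1 + y * (w : ℂ)‖ ≤ 1 + ‖y‖ * w := by
      rw [← hnw]; simpa using norm_add_le 1 (y * (w : ℂ))
    rw [hnw] at h5
    refine rpow_le_of_comparable (norm_pos_iff.2 (one_add_ne_zero_of_re_pos hre)) (by linarith)
      ?_ ?_ _
    · nlinarith
    · have : 1 + w ≤ k * (1 + ‖y‖ * w) := by nlinarith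
      nlinarith
  have e : ‖(1 + y * (w : ℂ)) ^ (-N)‖ = ‖1 + y * (w : ℂ)‖ ^ (-N : ℝ) := by
    rw [norm_zpow, ← Real.rpow_intCast]; push_cast; rfl
  rw [norm_mul, e, sub_eq_add_neg _ (N : ℝ), Real.rpow_add hw1]
  calc _ ≤ (K * ((k ^ |(C - A - B).re| * w ^ (C - A - B).re) *
        (k ^ |(-(C - A - B).re - m)| * (1 + w) ^ (-(C - A - B).re - m)))) *
        ((2 * k) ^ |(-N : ℝ)| * (1 + w) ^ (-N : ℝ)) := by
        gcongr
        exact h1.trans (by gcongr)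
    _ = _ := by ring

/-- For large `w` the distance is at least `w - ‖v‖`; for bounded `w` it is bounded below by the
distance of `v₀` from the ray. Shrinking the ball by half makes both estimates locally uniform in
`v`. -/
theorem exists_dist_ray_ge {v₀ : ℂ} (h : -v₀ ∈ Complex.slitPlane) : ∃ r c : ℝ, 0 < r ∧ 0 < c ∧
    ∀ v ∈ Metric.ball v₀ r, ∀ w : ℝ, 0 ≤ w → c * (1 + w) ≤ ‖(w : ℂ) - v‖ := by
  obtain ⟨δ, hδ, hball⟩ := Metric.isOpen_iff.1 Complex.isOpen_slitPlane _ h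
  have hd : ∀ w : ℝ, 0 ≤ w → δ ≤ ‖(w : ℂ) - v₀‖ := by
    intro w hw
    by_contra hlt
    push Not at hlt
    have hm : (-(w : ℂ)) ∈ Complex.slitPlane := hball (by
      rw [Metric.mem_ball, dist_eq_norm, ← norm_neg]
      simpa [sub_eq_add_neg, add_comm] using hlt)
    rw [Complex.mem_slitPlane_iff] at hm
    simp at hm
    linarith
  set M := ‖v₀‖ + δ + 1 with hM
  have hM1 : 1 ≤ M := by have := norm_nonneg v₀; linarith
  refine ⟨δ / 2, min (1 / 4) (δ / 2 / (1 + 2 * M)), by positivity, by positivity,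
    fun v hv w hw => ?_⟩
  have hv' : ‖v - v₀‖ < δ / 2 := by rwa [Metric.mem_ball, dist_eq_norm] at hv
  rcases le_or_gt (2 * M) w with h2 | h2
  · have h3 : ‖v‖ ≤ M := by
      have := norm_le_norm_add_norm_sub' v v₀
      linarith
    have h4 : w - ‖v‖ ≤ ‖(w : ℂ) - v‖ := by
      have := norm_sub_norm_le (w : ℂ) v
      rwa [Complex.norm_real, Real.norm_eq_abs, abs_of_nonneg hw] at this
    calc _ ≤ (1 / 4) * (1 + w) := by gcongr; exact min_le_left _ _
      _ ≤ _ := by linarith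
  · have h5 : δ / 2 ≤ ‖(w : ℂ) - v‖ := by
      have h6 := hd w hw
      have h7 := norm_sub_le_norm_sub_add_norm_sub (w : ℂ) v v₀
      linarith
    calc _ ≤ (δ / 2 / (1 + 2 * M)) * (1 + 2 * M) := by
          gcongr
          · exact min_le_right _ _
      _ = δ / 2 := by field_simp
      _ ≤ _ := h5

theorem differentiableAt_stl {A B C : ℂ} (hs : -1 < (C - A - B).re) {N : ℤ}
    (hA : 0 < (A + N).re) (hB : 0 < (B + N).re) {p : ℂ × ℂ} (hy : p.1 ∈ sector)
    (hv : -p.2 ∈ Complex.slitPlane) :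
    DifferentiableAt ℂ (fun q : ℂ × ℂ => stl A B C N q.1 q.2) p := by
  -- With `m + N > 0`, the weight divided by `w - v` decays like `w^(-1 - (m + N))`, which is
  -- integrable at infinity.
  obtain ⟨m, hm0, hmA, hmB⟩ : ∃ m : ℝ, -(N : ℝ) < m ∧ m < A.re ∧ m < B.re := by
    obtain ⟨m, h1, h2⟩ := exists_between (lt_min (a := -(N : ℝ)) (b := A.re) (c := B.re)
      (by simp at hA; linarith) (by simp at hB; linarith))
    exact ⟨m, h1, h2.trans_le (min_le_left _ _), h2.trans_le (min_le_right _ _)⟩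
  obtain ⟨r₁, c, hr₁, hc, hdist⟩ := exists_dist_ray_ge hv
  obtain ⟨r₂, hr₂, hsec⟩ := Metric.isOpen_iff.1 isOpen_sector _ hy
  have hyp : 0 < ‖p.1‖ := by
    have := re_pos_of_mem_sector hy
    exact norm_pos_iff.2 (by rintro h; rw [h] at this; simp at this)
  set k := max (2 * ‖p.1‖) (max 1 (2 / ‖p.1‖)) with hk
  obtain ⟨K, hK, hb⟩ := exists_norm_weight_le hs hmA hmB N (k := k)
    ((le_max_left _ _).trans (le_max_right _ _))
  set r := min r₁ (min r₂ (‖p.1‖ / 2)) with hr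
  have hr0 : 0 < r := by positivity
  have hsub : ∀ q ∈ Metric.ball p r, q.1 ∈ sector ∧ ‖q.1‖ ≤ k ∧ 1 ≤ k * ‖q.1‖ ∧
      q.2 ∈ Metric.ball p.2 r₁ := by
    intro q hq
    rw [Metric.mem_ball, Prod.dist_eq, max_lt_iff] at hq
    have h1 : dist q.1 p.1 < r₂ := hq.1.trans_le ((min_le_right _ _).trans (min_le_left _ _))
    have h2 : ‖q.1 - p.1‖ < ‖p.1‖ / 2 := by
      rw [← dist_eq_norm]
      exact hq.1.trans_le ((min_le_right _ _).trans (min_le_right _ _))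
    have h3 : ‖p.1‖ / 2 ≤ ‖q.1‖ := by
      have := norm_sub_norm_le p.1 q.1
      rw [norm_sub_rev] at this
      linarith
    refine ⟨hsec h1, ?_, ?_, hq.2.trans_le (min_le_left _ _)⟩
    · have := norm_le_norm_add_norm_sub' q.1 p.1
      exact le_trans (by linarith) (le_max_left (2 * ‖p.1‖) _)
    · have h4 : 2 / ‖p.1‖ ≤ k := (le_max_right _ _).trans (le_max_right _ _)
      calc 1 = 2 / ‖p.1‖ * (‖p.1‖ / 2) := by field_simp
        _ ≤ k * ‖q.1‖ := by gcongr
  have hmem : ∀ᵐ w ∂(volume.restrict (Set.Ioi (0 : ℝ))), w ∈ Set.Ioi (0 : ℝ) :=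
    ae_restrict_mem measurableSet_Ioi
  have hwv : ∀ q ∈ Metric.ball p r, ∀ w : ℝ, 0 < w → (w : ℂ) - q.2 ≠ 0 := by
    intro q hq w hw h0
    have := hdist q.2 (hsub q hq).2.2.2 w hw.le
    rw [h0, norm_zero] at this
    nlinarith
  have hdiffrho : ∀ q ∈ Metric.ball p r, ∀ w : ℝ, 0 < w → 0 < (q.1 * (w : ℂ)).re :=
    fun q hq w hw => re_pos_of_mem_sector (mul_mem_sector (hsub q hq).1 hw)
  refine differentiableAt_integral_of_dominated (r := r) (h := fun w : ℝ => K * c⁻¹ *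
    (w ^ (C - A - B).re * (1 + w) ^ (-(C - A - B).re - 1 - (m + N)))) hr0 ?_ ?_ ?_ ?_
  · intro q hq
    refine ContinuousOn.aestronglyMeasurable (fun w hw => ContinuousAt.continuousWithinAt ?_)
      measurableSet_Ioi
    have h1 : ContinuousAt (fun w : ℝ => q.1 * (w : ℂ)) w := by fun_prop
    have h2 : ContinuousAt (rho A B C) (q.1 * (w : ℂ)) :=
      (differentiableAt_rho hs (hdiffrho q hq w hw)).continuousAt
    have h3 : ContinuousAt (fun w : ℝ => (1 + q.1 * (w : ℂ)) ^ (-N)) w :=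
      ContinuousAt.zpow₀ (by fun_prop) _ (Or.inl (one_add_ne_zero_of_re_pos (hdiffrho q hq w hw)))
    exact ((ContinuousAt.comp (f := fun w : ℝ => q.1 * (w : ℂ)) h2 h1).mul h3).div (by fun_prop)
      (hwv q hq w hw)
  · filter_upwards [hmem] with w hw q hq
    have h2 : DifferentiableAt ℂ (rho A B C) (q.1 * (w : ℂ)) :=
      differentiableAt_rho hs (hdiffrho q hq w hw)
    have h1 : DifferentiableAt ℂ (fun q : ℂ × ℂ => q.1 * (w : ℂ)) q := by fun_prop
    have h3 : DifferentiableAt ℂ (fun q : ℂ × ℂ => (1 + q.1 * (w : ℂ)) ^ (-N)) q :=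
      (h1.const_add 1).zpow (Or.inl (one_add_ne_zero_of_re_pos (hdiffrho q hq w hw)))
    have h5 : DifferentiableAt ℂ (fun q : ℂ × ℂ => rho A B C (q.1 * (w : ℂ))) q :=
      DifferentiableAt.comp (f := fun q : ℂ × ℂ => q.1 * (w : ℂ)) q h2 h1
    have h6 : DifferentiableAt ℂ (fun q : ℂ × ℂ => (w : ℂ) - q.2) q := by fun_prop
    exact ((h5.fun_mul h3).fun_mul (h6.fun_inv (hwv q hq w hw))).differentiableWithinAt
  · filter_upwards [hmem] with w hw q hq
    have hw' : 0 < w := hw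
    have h1 := hb q.1 (hsub q hq).1 (hsub q hq).2.1 (hsub q hq).2.2.1 w hw
    have h2 := hdist q.2 (hsub q hq).2.2.2 w hw'.le
    have hw1 : 0 < 1 + w := by linarith
    rw [norm_div, div_le_iff₀ (norm_pos_iff.2 (hwv q hq w hw))]
    refine h1.trans ?_
    calc K * (w ^ (C - A - B).re * (1 + w) ^ (-(C - A - B).re - m - N))
        = K * c⁻¹ * (w ^ (C - A - B).re * (1 + w) ^ (-(C - A - B).re - 1 - (m + N))) *
          (c * (1 + w)) := by
          rw [show -(C - A - B).re - m - N = (-(C - A - B).re - 1 - (m + N)) + 1 by ring,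
            Real.rpow_add_one hw1.ne']
          field_simp
      _ ≤ _ := by gcongr
  · exact (integrableOn_Ioi_rpow_mul hs (by linarith)).const_mul _

theorem stl_ofReal (A B C : ℂ) (N : ℤ) {y : ℝ} (hy : 0 < y) (v : ℂ) :
    stl A B C N y v = stl A B C N 1 (y * v) := by
  have h := integral_comp_mul_left_Ioi (fun w : ℝ => rho A B C (1 * w) * (1 + 1 * (w : ℂ)) ^ (-N) /
    (w - y * v)) 0 hy
  rw [mul_zero] at h
  have hy0 : (y : ℂ) ≠ 0 := by exact_mod_cast hy.ne'
  rw [stl, stl, ← inv_smul_smul₀ (inv_ne_zero hy.ne') (∫ w in Set.Ioi (0 : ℝ),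
    rho A B C (1 * w) * (1 + 1 * (w : ℂ)) ^ (-N) / (w - y * v)), ← h, inv_inv, ← integral_smul]
  refine integral_congr_ae (Eventually.of_forall fun w => ?_)
  simp only [one_mul, Complex.real_smul, Complex.ofReal_mul]
  rw [← mul_sub, ← mul_div_assoc, mul_div_mul_left _ _ hy0]

/-- Rotation of the ray of integration. -/
theorem stl_rotate {A B C : ℂ} (hs : -1 < (C - A - B).re) {N : ℤ}
    (hA : 0 < (A + N).re) (hB : 0 < (B + N).re) {σ : ℝ} (hσ : |σ| = 1) {b : ℂ}
    (hb : 0 < σ * b.im) : stl A B C N 1 b =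
      stl A B C N (1 - σ * Complex.I) (b / (1 - σ * Complex.I)) := by
  have hσ2 : σ * σ = 1 := by rw [← abs_mul_abs_self, hσ, one_mul]
  -- On `D` the pole `b / y` stays off the ray of integration, so `y ↦ stl A B C N y (b / y)` is
  -- holomorphic there. The ray is turned into the half plane opposite to `b`, hence never across
  -- the pole.
  set D : Set ℂ := sector ∩ (fun y => -(b / y)) ⁻¹' Complex.slitPlane with hD
  have hDo : IsOpen D := by
    refine ContinuousOn.isOpen_inter_preimage (fun y hy => ?_) isOpen_sector
      Complex.isOpen_slitPlane
    have : y ≠ 0 := by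
      rintro rfl
      have := re_pos_of_mem_sector hy; simp at this
    exact (continuousAt_const.div continuousAt_id this).neg.continuousWithinAt
  have hdiff : DifferentiableOn ℂ (fun y => stl A B C N y (b / y)) D := by
    intro y hy
    have hy0 : y ≠ 0 := by
      rintro rfl
      have := re_pos_of_mem_sector hy.1; simp at this
    have h1 : DifferentiableAt ℂ (fun y : ℂ => (y, b / y)) y :=
      differentiableAt_id.prodMk ((differentiableAt_const b).div differentiableAt_id hy0)
    have h2 := differentiableAt_stl hs hA hB (p := (y, b / y)) hy.1 hy.2
    exact (DifferentiableAt.comp (f := fun y : ℂ => (y, b / y)) y h2 h1).differentiableWithinAt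
  have hseg : ∀ t ∈ Set.Icc (0 : ℝ) 1, (1 : ℂ) + (t : ℂ) • ((1 - σ * Complex.I) - 1) ∈ D := by
    intro t ht
    have e : (1 : ℂ) + (t : ℂ) • ((1 - σ * Complex.I) - 1) = 1 - (t * σ : ℝ) * Complex.I := by
      push_cast; simp; ring
    rw [e]
    refine ⟨?_, ?_⟩
    · show |(1 - ((t * σ : ℝ) : ℂ) * Complex.I).im| < 2 * (1 - ((t * σ : ℝ) : ℂ) * Complex.I).re
      simp only [Complex.sub_im, Complex.one_im, Complex.mul_im, Complex.ofReal_re, Complex.I_im,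
        mul_one, Complex.ofReal_im, Complex.I_re, mul_zero, add_zero, zero_sub, abs_neg,
        Complex.sub_re, Complex.one_re, Complex.mul_re, abs_mul, hσ, sub_zero]
      rw [abs_of_nonneg ht.1]
      linarith [ht.2]
    · show -(b / _) ∈ Complex.slitPlane
      by_contra hn
      rw [Complex.mem_slitPlane_iff, not_or, not_lt, not_not] at hn
      set q := b / (1 - ((t * σ : ℝ) : ℂ) * Complex.I) with hq
      have hy0 : (1 - ((t * σ : ℝ) : ℂ) * Complex.I) ≠ 0 := by
        intro h
        have := congrArg Complex.re h
        simp at this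
      have hbq : b = q * (1 - ((t * σ : ℝ) : ℂ) * Complex.I) := by
        rw [hq, div_mul_cancel₀ _ hy0]
      have hqi : q.im = 0 := by simpa using hn.2
      have hqr : 0 ≤ q.re := by simpa using hn.1
      have : b.im = -(q.re * (t * σ)) := by
        rw [hbq]
        simp [hqi]
      rw [this] at hb
      have h3 : σ * -(q.re * (t * σ)) = -(q.re * t) * (σ * σ) := by ring
      rw [h3, hσ2] at hb
      nlinarith [ht.1]
  have h1D : (1 : ℂ) ∈ D := by simpa using hseg 0 (by simp)
  -- For real `y` the value does not depend on `y`, by scaling the variable of integration. The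
  -- identity theorem makes the function constant near `1`, and then along the segment to `1 - σ i`.
  have hconst : ∀ᶠ y in 𝓝 (1 : ℂ), stl A B C N y (b / y) = stl A B C N 1 b := by
    have han : AnalyticAt ℂ (fun y => stl A B C N y (b / y)) 1 :=
      hdiff.analyticAt (hDo.mem_nhds h1D)
    refine (han.frequently_eq_iff_eventually_eq analyticAt_const).1 ?_
    have htend : Tendsto (fun t : ℝ => 1 + (t : ℂ)) (𝓝[>] 0) (𝓝[≠] 1) := by
      refine tendsto_nhdsWithin_iff.2 ⟨?_, ?_⟩
      · exact (Continuous.tendsto' (by fun_prop) 0 1 (by simp)).mono_left nhdsWithin_le_nhds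
      · filter_upwards [self_mem_nhdsWithin] with t ht
        simpa using (ne_of_gt ht)
    refine htend.frequently (Eventually.frequently ?_)
    filter_upwards [self_mem_nhdsWithin] with t ht
    have ht' : 0 < 1 + t := by have : 0 < t := ht; linarith
    have e : (1 : ℂ) + t = ((1 + t : ℝ) : ℂ) := by push_cast; rfl
    have h0 : ((1 + t : ℝ) : ℂ) ≠ 0 := by exact_mod_cast ht'.ne'
    rw [e, stl_ofReal _ _ _ _ ht', mul_div_cancel₀ _ h0]
  exact (eq_of_segment_subset hDo hdiff (differentiableOn_const _) hseg hconst).symm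

theorem one_sub_I_mem_sector {σ : ℝ} (hσ : |σ| = 1) : (1 - σ * Complex.I) ∈ sector := by
  show |(1 - (σ : ℂ) * Complex.I).im| < 2 * (1 - (σ : ℂ) * Complex.I).re
  simp [hσ]

theorem norm_one_sub_I_le {σ : ℝ} (hσ : |σ| = 1) : ‖(1 - σ * Complex.I : ℂ)‖ ≤ 2 := by
  refine (norm_sub_le _ _).trans ?_
  simp [hσ]; norm_num

/-- The point `(1 - σ i) w` has imaginary part of size `w` on the side opposite to `b`, so its
distance `d` from `b` is at least `w`. Then `‖b‖ ≤ d + 2 w ≤ 3 d`, and division by `|1 - σ i| ≤ 2`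
gives the constant `8`. Real `b` is allowed; this is what makes the later bounds uniform up to the
cut. -/
theorem norm_sub_ray_ge {σ : ℝ} (hσ : |σ| = 1) {b : ℂ} (hb : 0 ≤ σ * b.im) {w : ℝ} (hw : 0 ≤ w) :
    (w + ‖b‖) / 8 ≤ ‖(w : ℂ) - b / (1 - σ * Complex.I)‖ := by
  have hσ2 : σ * σ = 1 := by rw [← abs_mul_abs_self, hσ, one_mul]
  have hy0 : (1 - (σ : ℂ) * Complex.I) ≠ 0 := by
    intro h
    have := congrArg Complex.re h
    simp at this
  set d := ‖(1 - σ * Complex.I : ℂ) * w - b‖ with hd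
  have e : (w : ℂ) - b / (1 - σ * Complex.I) = ((1 - σ * Complex.I : ℂ) * w - b) /
      (1 - σ * Complex.I) := by
    field_simp
  have h2 := norm_one_sub_I_le hσ
  have h1 : w ≤ d := by
    have h3 := Complex.abs_im_le_norm ((1 - σ * Complex.I : ℂ) * w - b)
    simp only [Complex.sub_im, Complex.mul_im, Complex.sub_re, Complex.one_re, Complex.mul_re,
      Complex.ofReal_re, Complex.I_re, mul_zero, Complex.ofReal_im, Complex.I_im, mul_one,
      sub_self, sub_zero, Complex.one_im, zero_add, zero_sub, add_zero] at h3
    have h4 : σ * (-σ * w - b.im) ≤ 0 := by nlinarith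
    have h5 : |σ * (-σ * w - b.im)| = |-σ * w - b.im| := by rw [abs_mul, hσ, one_mul]
    have h6 := neg_le_abs (σ * (-σ * w - b.im))
    nlinarith
  have h3 : ‖b‖ ≤ d + 2 * w := by
    have h4 := norm_sub_le ((1 - σ * Complex.I : ℂ) * w) ((1 - σ * Complex.I : ℂ) * w - b)
    rw [sub_sub_cancel] at h4
    have h5 : ‖(1 - σ * Complex.I : ℂ) * w‖ ≤ 2 * w := by
      rw [norm_mul, Complex.norm_real, Real.norm_eq_abs, abs_of_nonneg hw]
      gcongr
    linarith
  rw [e, norm_div, ← hd, le_div_iff₀ (norm_pos_iff.2 hy0)]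
  have h0 : 0 ≤ (w + ‖b‖) / 8 := by positivity
  nlinarith

theorem norm_rotated_le {A B C : ℂ} {N : ℤ} {σ : ℝ} {b : ℂ} {g : ℝ → ℝ} {k : ℝ}
    (hg : IntegrableOn g (Set.Ioi 0))
    (h : ∀ w : ℝ, 0 < w → ‖rho A B C ((1 - σ * Complex.I) * w) *
      (1 + (1 - σ * Complex.I) * w) ^ (-N)‖ ≤
        k * g w * ‖(w : ℂ) - b / (1 - σ * Complex.I)‖) (hk : 0 ≤ k)
    (hg0 : ∀ w : ℝ, 0 < w → 0 ≤ g w) :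
    ‖stl A B C N (1 - σ * Complex.I) (b / (1 - σ * Complex.I))‖ ≤
      k * ∫ w in Set.Ioi (0 : ℝ), g w := by
  rw [stl, ← integral_const_mul]
  refine norm_integral_le_of_norm_le (hg.const_mul k) ?_
  filter_upwards [ae_restrict_mem measurableSet_Ioi] with w hw
  rw [norm_div]
  rcases (norm_nonneg ((w : ℂ) - b / (1 - σ * Complex.I))).eq_or_lt with h0 | h0
  · rw [← h0, div_zero]
    exact mul_nonneg hk (hg0 w hw)
  · rw [div_le_iff₀ h0]
    exact h w hw

/-- Decay of the rotated Stieltjes integral away from the branch point. -/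
theorem exists_stl_bound_far {A B C : ℂ} (hs : -1 < (C - A - B).re) {N : ℤ} {m θ : ℝ}
    (hmA : m < A.re) (hmB : m < B.re) (hθ0 : 0 ≤ θ) (hθ1 : θ ≤ 1) (hθ : θ < m + N) :
    ∃ K : ℝ, 0 < K ∧ ∀ σ : ℝ, |σ| = 1 → ∀ b : ℂ, 0 ≤ σ * b.im → 1 ≤ ‖b‖ →
      ‖stl A B C N (1 - σ * Complex.I) (b / (1 - σ * Complex.I))‖ ≤ K * ‖b‖ ^ (-θ) := by
  obtain ⟨K, hK, hb⟩ := exists_norm_weight_le hs hmA hmB N (k := 2) one_le_two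
  set g : ℝ → ℝ := fun w => w ^ (C - A - B).re * (1 + w) ^ (-(C - A - B).re - 1 - (m + N - θ))
  have hg : IntegrableOn g (Set.Ioi 0) := integrableOn_Ioi_rpow_mul hs (by linarith)
  have hg0 : ∀ w : ℝ, 0 < w → 0 ≤ g w := fun w hw => by positivity
  have hI : 0 ≤ ∫ w in Set.Ioi (0 : ℝ), g w :=
    setIntegral_nonneg measurableSet_Ioi fun w hw => hg0 w hw
  refine ⟨K * 16 * (∫ w in Set.Ioi (0 : ℝ), g w) + 1, by positivity,
    fun σ hσ b hσb hb1 => ?_⟩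
  have hb0 : 0 < ‖b‖ := by linarith
  have h1 : 1 ≤ ‖(1 - σ * Complex.I : ℂ)‖ := by
    have := Complex.re_le_norm (1 - σ * Complex.I : ℂ)
    simpa using this
  have hmain := norm_rotated_le (A := A) (B := B) (C := C) (N := N) (σ := σ) (b := b) (g := g)
    (k := K * 16 * ‖b‖ ^ (-θ)) hg ?_ (by positivity) hg0
  · refine hmain.trans ?_
    have : 0 < ‖b‖ ^ (-θ) := Real.rpow_pos_of_pos hb0 _
    nlinarith
  · intro w hw
    have hw1 : 0 < 1 + w := by linarith
    refine (hb _ (one_sub_I_mem_sector hσ) (norm_one_sub_I_le hσ) (by linarith) w hw).trans ?_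
    have h2 := norm_sub_ray_ge hσ hσb hw.le
    -- The distance `w + ‖b‖` is interpolated: the power `1 - θ` controls the integral over `w`, and
    -- the power `θ` is the decay in `‖b‖`. The integral over `w` converges at infinity since `θ < m
    -- + N`.
    have h3 : (1 + w) ^ (1 - θ) * ‖b‖ ^ θ ≤ 2 * (w + ‖b‖) := by
      have h4 : (1 + w) ^ (1 - θ) ≤ (w + ‖b‖) ^ (1 - θ) :=
        Real.rpow_le_rpow hw1.le (by linarith) (by linarith)
      have h5 : ‖b‖ ^ θ ≤ (w + ‖b‖) ^ θ := Real.rpow_le_rpow hb0.le (by linarith) hθ0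
      calc _ ≤ (w + ‖b‖) ^ (1 - θ) * (w + ‖b‖) ^ θ := by gcongr
        _ = w + ‖b‖ := by
            rw [← Real.rpow_add (by linarith), sub_add_cancel, Real.rpow_one]
        _ ≤ _ := by linarith
    calc K * (w ^ (C - A - B).re * (1 + w) ^ (-(C - A - B).re - m - N))
        = K * ‖b‖ ^ (-θ) * g w * ((1 + w) ^ (1 - θ) * ‖b‖ ^ θ) := by
          simp only [g]
          rw [show -(C - A - B).re - m - N = (-(C - A - B).re - 1 - (m + N - θ)) + (1 - θ) by ring,
            Real.rpow_add hw1, Real.rpow_neg hb0.le]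
          field_simp
      _ ≤ K * ‖b‖ ^ (-θ) * g w * (2 * (w + ‖b‖)) := by
          have := hg0 w hw
          gcongr
      _ ≤ K * ‖b‖ ^ (-θ) * g w * (16 * ‖(w : ℂ) - b / (1 - σ * Complex.I)‖) := by
          have := hg0 w hw
          exact mul_le_mul_of_nonneg_left (by linarith) (by positivity)
      _ = _ := by ring

/-- Growth of the rotated Stieltjes integral near the branch point. -/
theorem exists_stl_bound_near {A B C : ℂ} (hs : -1 < (C - A - B).re) {N : ℤ} {m θ : ℝ}
    (hmA : m < A.re) (hmB : m < B.re) (hθ0 : 0 ≤ θ) (hθ1 : θ ≤ 1) (hθs : 0 < (C - A - B).re + θ)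
    (hθ : θ < m + N) :
    ∃ K : ℝ, 0 < K ∧ ∀ σ : ℝ, |σ| = 1 → ∀ b : ℂ, b ≠ 0 → 0 ≤ σ * b.im →
      ‖stl A B C N (1 - σ * Complex.I) (b / (1 - σ * Complex.I))‖ ≤ K * ‖b‖ ^ (-θ) := by
  obtain ⟨K, hK, hb⟩ := exists_norm_weight_le hs hmA hmB N (k := 2) one_le_two
  set s := (C - A - B).re with hsdef
  set g : ℝ → ℝ := fun w => w ^ (s + θ - 1) * (1 + w) ^ (-(s + θ - 1) - 1 - (m + N - θ))
  have hg : IntegrableOn g (Set.Ioi 0) := integrableOn_Ioi_rpow_mul (by linarith) (by linarith)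
  have hg0 : ∀ w : ℝ, 0 < w → 0 ≤ g w := fun w hw => by positivity
  have hI : 0 ≤ ∫ w in Set.Ioi (0 : ℝ), g w :=
    setIntegral_nonneg measurableSet_Ioi fun w hw => hg0 w hw
  refine ⟨K * 8 * (∫ w in Set.Ioi (0 : ℝ), g w) + 1, by positivity,
    fun σ hσ b hbne hσb => ?_⟩
  have hb0 : 0 < ‖b‖ := norm_pos_iff.2 hbne
  have h1 : 1 ≤ ‖(1 - σ * Complex.I : ℂ)‖ := by
    have := Complex.re_le_norm (1 - σ * Complex.I : ℂ)
    simpa using this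
  have hmain := norm_rotated_le (A := A) (B := B) (C := C) (N := N) (σ := σ) (b := b) (g := g)
    (k := K * 8 * ‖b‖ ^ (-θ)) hg ?_ (by positivity) hg0
  · refine hmain.trans ?_
    have : 0 < ‖b‖ ^ (-θ) := Real.rpow_pos_of_pos hb0 _
    nlinarith
  · intro w hw
    have hw1 : 0 < 1 + w := by linarith
    refine (hb _ (one_sub_I_mem_sector hσ) (norm_one_sub_I_le hσ) (by linarith) w hw).trans ?_
    have h2 := norm_sub_ray_ge hσ hσb hw.le
    -- Here the power `1 - θ` is spent at `w = 0`: the singularity becomes `w^(s + θ - 1)`,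
    -- integrable because `s + θ > 0`.
    have h3 : w ^ (1 - θ) * ‖b‖ ^ θ ≤ w + ‖b‖ := by
      have h4 : w ^ (1 - θ) ≤ (w + ‖b‖) ^ (1 - θ) :=
        Real.rpow_le_rpow hw.le (by linarith) (by linarith)
      have h5 : ‖b‖ ^ θ ≤ (w + ‖b‖) ^ θ := Real.rpow_le_rpow hb0.le (by linarith) hθ0
      calc _ ≤ (w + ‖b‖) ^ (1 - θ) * (w + ‖b‖) ^ θ := by gcongr
        _ = w + ‖b‖ := by
            rw [← Real.rpow_add (by linarith), sub_add_cancel, Real.rpow_one]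
    calc K * (w ^ s * (1 + w) ^ (-s - m - N))
        = K * ‖b‖ ^ (-θ) * g w * (w ^ (1 - θ) * ‖b‖ ^ θ) := by
          simp only [g]
          rw [show -s - m - N = -(s + θ - 1) - 1 - (m + N - θ) by ring,
            Real.rpow_neg hb0.le]
          have e : w ^ s = w ^ (s + θ - 1) * w ^ (1 - θ) := by
            rw [← Real.rpow_add hw]; congr 1; ring
          rw [e]
          have := (Real.rpow_pos_of_pos hb0 θ).ne'
          field_simp
      _ ≤ K * ‖b‖ ^ (-θ) * g w * (w + ‖b‖) := by
          have := hg0 w hw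
          gcongr
      _ ≤ K * ‖b‖ ^ (-θ) * g w * (8 * ‖(w : ℂ) - b / (1 - σ * Complex.I)‖) := by
          have := hg0 w hw
          gcongr
          linarith
      _ = _ := by ring


/-! ### The continued Gauss function as a Stieltjes integral -/

/-- The plane cut along `[1, ∞)`. -/
def cutPlane : Set ℂ := {z : ℂ | 1 - z ∈ Complex.slitPlane}

theorem isOpen_cutPlane : IsOpen cutPlane :=
  Complex.isOpen_slitPlane.preimage (by fun_prop)

theorem segment_mem_cutPlane {z : ℂ} (hz : z ∈ cutPlane) {t : ℝ} (ht : t ∈ Set.Icc (0 : ℝ) 1) :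
    (t : ℂ) * z ∈ cutPlane := by
  rw [cutPlane, Set.mem_ofPred_eq, Complex.mem_slitPlane_iff] at hz ⊢
  have ht0 := ht.1
  have ht1 := ht.2
  simp only [Complex.sub_re, Complex.one_re, Complex.sub_im, Complex.one_im, zero_sub,
    Complex.re_ofReal_mul, Complex.im_ofReal_mul] at hz ⊢
  rcases ht0.eq_or_lt with rfl | h0
  · left; simp
  · rcases hz with hz | hz
    · left
      nlinarith
    · right
      simpa [h0.ne'] using hz

theorem ball_subset_cutPlane : Metric.ball (0 : ℂ) 1 ⊆ cutPlane := by
  intro z hz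
  rw [mem_ball_zero_iff] at hz
  refine Or.inl ?_
  have := Complex.re_le_norm z
  simp; linarith

theorem mem_cutPlane_of_im {z : ℂ} (h : z.im ≠ 0) : z ∈ cutPlane := by
  refine Or.inr ?_
  simpa using h

theorem mem_cutPlane_of_re {z : ℂ} (h : z.re < 1) : z ∈ cutPlane := by
  refine Or.inl ?_
  simpa using h

/-- The constant in front of the Stieltjes integral for `₂F₁(A, B; C; z)`. -/
noncomputable def stieltjesConst (A B C : ℂ) : ℂ :=
  Complex.Gamma C * (Complex.Gamma A)⁻¹ * (Complex.Gamma B)⁻¹ * (Complex.Gamma (C - A - B + 1))⁻¹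

theorem hcoef_eq_moment {A B C : ℂ} (hC : NonPole C) (hs : -1 < (C - A - B).re) {n : ℕ}
    (hA : 0 < (A + n).re) (hB : 0 < (B + n).re) :
    hcoef A B C n = stieltjesConst A B C *
      ∫ w in Set.Ioi (0 : ℝ), rho A B C w * (1 + (w : ℂ)) ^ (-(n : ℤ) - 1) := by
  rw [(integral_rho_moment hs (n : ℤ) (by simpa using hA) (by simpa using hB)).2, hcoef,
    stieltjesConst, inv_Gamma_eq_poch_mul A n, inv_Gamma_eq_poch_mul B n]
  simp only [Int.cast_natCast]
  rw [Gamma_add_nat hC, Complex.Gamma_nat_eq_factorial]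
  have h1 := hC.Gamma_ne_zero
  have h2 := poch_ne_zero hC n
  have h3 := (nonPole_of_re_pos hA).Gamma_ne_zero
  have h4 := (nonPole_of_re_pos hB).Gamma_ne_zero
  have h5 := (nonPole_add_one_of_re hs).Gamma_ne_zero
  have h6 : (n.factorial : ℂ) ≠ 0 := by exact_mod_cast n.factorial_ne_zero
  generalize Complex.Gamma (A + n) = x1 at *
  generalize Complex.Gamma (B + n) = x2 at *
  generalize Complex.Gamma (C - A - B + 1) = x3 at *
  generalize Complex.Gamma C = x4 at *
  field_simp

theorem one_add_ofReal_ne_zero {w : ℝ} (hw : 0 < w) : (1 + (w : ℂ)) ≠ 0 :=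
  one_add_ne_zero_of_re_pos (by simpa using hw)

theorem norm_one_add_ofReal {w : ℝ} (hw : 0 < w) : ‖(1 + (w : ℂ))‖ = 1 + w := by
  rw [← Complex.ofReal_one, ← Complex.ofReal_add, Complex.norm_real, Real.norm_eq_abs,
    abs_of_pos (by linarith)]

theorem re_add_natCast_pos {A : ℂ} {N : ℕ} (hA : 0 < (A + N).re) (k : ℕ) :
    0 < (A + (k + N : ℕ)).re := by
  simp at hA ⊢
  linarith [(Nat.cast_nonneg k : (0 : ℝ) ≤ k)]

/-- For `n ≥ N` the coefficients are moments of the density, and summing `(z / (1 + w))^k` produces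
the kernel `1/(1 + w - z)`, that is, the pole `v = z - 1`. The first `N` terms are split off so that
the moments exist even if `Re A` or `Re B` is not positive. -/
theorem hyp_eq_stl {A B C : ℂ} (hC : NonPole C) (hs : -1 < (C - A - B).re) {N : ℕ}
    (hA : 0 < (A + N).re) (hB : 0 < (B + N).re) {z : ℂ} (hz : ‖z‖ < 1) :
    ₂F₁ A B C z = ∑ n ∈ Finset.range N, hcoef A B C n * z ^ n +
      stieltjesConst A B C * z ^ N * stl A B C N 1 (z - 1) := by
  have hF := (hasSum_nat_add_iff' N).2 (hasSum_hyp A B hC hz)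
  have hint : ∀ k : ℕ, IntegrableOn (fun w : ℝ =>
      rho A B C w * (1 + (w : ℂ)) ^ (-((k + N : ℕ) : ℤ) - 1)) (Set.Ioi 0) := fun k =>
    (integral_rho_moment hs ((k + N : ℕ) : ℤ) (by simpa using re_add_natCast_pos hA k)
      (by simpa using re_add_natCast_pos hB k)).1
  set f : ℕ → ℝ → ℂ := fun k w => rho A B C w * (1 + (w : ℂ)) ^ (-((k + N : ℕ) : ℤ) - 1) * z ^ k
    with hf
  have hterm : ∀ w : ℝ, 0 < w → ∀ k, f k w =
      rho A B C w * (1 + (w : ℂ)) ^ (-(N : ℤ) - 1) * (z / (1 + w)) ^ k := by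
    intro w hw k
    have h0 := one_add_ofReal_ne_zero hw
    simp only [hf]
    rw [show (-((k + N : ℕ) : ℤ) - 1) = (-(N : ℤ) - 1) + -(k : ℤ) by push_cast; ring,
      zpow_add₀ h0, zpow_neg, zpow_natCast, div_pow]
    field_simp
  have hlt : ∀ w : ℝ, 0 < w → ‖z / (1 + w)‖ ≤ ‖z‖ := by
    intro w hw
    rw [norm_div, norm_one_add_ofReal hw]
    exact div_le_self (norm_nonneg _) (by linarith)
  have hS := hasSum_integral_of_tsum_norm_le (μ := volume.restrict (Set.Ioi (0 : ℝ))) (f := f)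
    (g := fun w => ‖rho A B C w * (1 + (w : ℂ)) ^ (-(N : ℤ) - 1)‖ * (1 - ‖z‖)⁻¹)
    (fun k => ((hint k).mul_const _).1) (by simpa using (hint 0).norm.mul_const _)
    (by
      filter_upwards [ae_restrict_mem measurableSet_Ioi] with w hw
      simp only [hterm w hw, norm_mul _ ((z / (1 + (w : ℂ))) ^ _), norm_pow]
      exact (summable_geometric_of_lt_one (norm_nonneg _)
        ((hlt w hw).trans_lt hz)).mul_left _)
    (by
      filter_upwards [ae_restrict_mem measurableSet_Ioi] with w hw
      simp only [hterm w hw, norm_mul _ ((z / (1 + (w : ℂ))) ^ _), norm_pow]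
      rw [tsum_mul_left, tsum_geometric_of_lt_one (norm_nonneg _) ((hlt w hw).trans_lt hz)]
      have := hlt w hw
      gcongr)
  have hval : ∫ w in Set.Ioi (0 : ℝ), ∑' k, f k w = stl A B C N 1 (z - 1) := by
    refine setIntegral_congr_fun measurableSet_Ioi fun w hw => ?_
    have hw' : 0 < w := hw
    have h0 := one_add_ofReal_ne_zero hw'
    have h1 : ‖z / (1 + w)‖ < 1 := (hlt w hw').trans_lt hz
    simp only [hterm w hw']
    rw [tsum_mul_left, tsum_geometric_of_norm_lt_one h1, one_mul, zpow_sub₀ h0, zpow_one]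
    have h2 : (1 - z / (1 + w)) ≠ 0 := by
      intro h
      rw [sub_eq_zero] at h
      rw [← h] at h1; simp at h1
    have h3 : (1 + w - z : ℂ) ≠ 0 := by
      intro h
      apply h2
      field_simp
      simpa using h
    rw [show (w : ℂ) - (z - 1) = 1 + w - z by ring]
    field_simp
  rw [hval] at hS
  have hS' := (hS.mul_left (stieltjesConst A B C * z ^ N))
  have := hF.unique ((congrArg (fun f => HasSum f _) (funext fun k => ?_)).mp hS')
  · linear_combination this
  · rw [hcoef_eq_moment hC hs (re_add_natCast_pos hA k) (re_add_natCast_pos hB k)]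
    simp only [hf]
    rw [integral_mul_const, pow_add]
    ring

theorem differentiableAt_stl_one {A B C : ℂ} (hs : -1 < (C - A - B).re) {N : ℤ}
    (hA : 0 < (A + N).re) (hB : 0 < (B + N).re) {z : ℂ} (hz : z ∈ cutPlane) :
    DifferentiableAt ℂ (fun z => stl A B C N 1 (z - 1)) z := by
  have h1 : DifferentiableAt ℂ (fun q : ℂ × ℂ => stl A B C N q.1 q.2) ((1 : ℂ), z - 1) :=
    differentiableAt_stl hs hA hB (by simp [sector])
    (by simpa [cutPlane] using hz)
  exact DifferentiableAt.comp (f := fun z : ℂ => ((1 : ℂ), z - 1)) z h1 (by fun_prop)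

theorem exists_nat_re_add_pos (A B : ℂ) : ∃ N₀ : ℕ, ∀ N : ℕ, N₀ ≤ N →
    0 < (A + N).re ∧ 0 < (B + N).re := by
  obtain ⟨N₀, h⟩ := exists_nat_gt (max (-A.re) (-B.re))
  refine ⟨N₀, fun N hN => ?_⟩
  have h1 : (N₀ : ℝ) ≤ N := by exact_mod_cast hN
  have := (le_max_left _ _).trans_lt h
  have := (le_max_right _ _).trans_lt h
  simp
  constructor <;> linarith

/-- The Stieltjes expression is holomorphic on the cut plane and equals the series in the disc. The
cut plane is star-shaped about `0`, so the continuation coincides with the expression for every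
admissible `N`. -/
theorem gauss_spec_of_re {A B C : ℂ} (hC : NonPole C) (hs : -1 < (C - A - B).re) :
    HasContinuation (fun z : ℂ => ₂F₁ A B C z) (Metric.ball 0 1) cutPlane ∧
    ∀ N : ℕ, 0 < (A + N).re → 0 < (B + N).re → ∀ z ∈ cutPlane,
      gauss2F1 A B C z = ∑ n ∈ Finset.range N, hcoef A B C n * z ^ n +
        stieltjesConst A B C * z ^ N * stl A B C N 1 (z - 1) := by
  have hd : ∀ N : ℕ, 0 < (A + N).re → 0 < (B + N).re →
      DifferentiableOn ℂ (fun z => ∑ n ∈ Finset.range N, hcoef A B C n * z ^ n +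
        stieltjesConst A B C * z ^ N * stl A B C N 1 (z - 1)) cutPlane := by
    intro N hA hB z hz
    have := differentiableAt_stl_one hs (N := N) (by simpa using hA) (by simpa using hB) hz
    refine DifferentiableAt.differentiableWithinAt ?_
    exact DifferentiableAt.add (by fun_prop) (DifferentiableAt.mul (by fun_prop) this)
  have heq : ∀ N : ℕ, 0 < (A + N).re → 0 < (B + N).re →
      Set.EqOn (fun z => ∑ n ∈ Finset.range N, hcoef A B C n * z ^ n +
        stieltjesConst A B C * z ^ N * stl A B C N 1 (z - 1)) (fun z : ℂ => ₂F₁ A B C z)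
        (Metric.ball 0 1) := by
    intro N hA hB z hz
    rw [mem_ball_zero_iff] at hz
    exact (hyp_eq_stl hC hs hA hB hz).symm
  constructor
  · obtain ⟨N, hN⟩ := exists_nat_re_add_pos A B
    obtain ⟨hA, hB⟩ := hN N le_rfl
    exact ⟨_, hd N hA hB, heq N hA hB⟩
  · intro N hA hB z hz
    refine continuation_eq_of_segment isOpen_cutPlane (hd N hA hB) (heq N hA hB) (P₀ := 0)
      (Metric.ball_mem_nhds _ one_pos) fun t ht => ?_
    simpa using segment_mem_cutPlane hz ht

/-- Lowering the power of `1 + w` in the Stieltjes integral. -/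
theorem stl_recurrence {A B C : ℂ} (hs : -1 < (C - A - B).re) {N : ℤ}
    (hA : 0 < (A + N).re) (hB : 0 < (B + N).re) {z : ℂ} (hz : z ∈ cutPlane) :
    stl A B C N 1 (z - 1) = z * stl A B C (N + 1) 1 (z - 1) +
      ∫ w in Set.Ioi (0 : ℝ), rho A B C w * (1 + (w : ℂ)) ^ (-N - 1) := by
  have hne : ∀ w : ℝ, 0 < w → (w : ℂ) - (z - 1) ≠ 0 := by
    intro w hw h0
    have : 1 - z = -(w : ℂ) := by linear_combination h0
    rw [cutPlane, Set.mem_ofPred_eq, this, ← Complex.ofReal_neg,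
      Complex.ofReal_mem_slitPlane] at hz
    linarith
  have hI := (integral_rho_moment hs N hA hB).1
  obtain ⟨r, c, hr, hc, hd⟩ := exists_dist_ray_ge (v₀ := z - 1) (by simpa [cutPlane] using hz)
  have hI2 : IntegrableOn (fun w : ℝ => z * (rho A B C (1 * w) * (1 + 1 * (w : ℂ)) ^ (-(N + 1)) /
      ((w : ℂ) - (z - 1)))) (Set.Ioi 0) := by
    refine Integrable.const_mul ?_ z
    refine Integrable.mono' (hI.norm.const_mul c⁻¹) ?_ ?_
    · refine ContinuousOn.aestronglyMeasurable (fun w hw => ContinuousAt.continuousWithinAt ?_)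
        measurableSet_Ioi
      have hw' : 0 < w := hw
      have h1 : ContinuousAt (fun w : ℝ => (1 : ℂ) * (w : ℂ)) w := by fun_prop
      have h2 : ContinuousAt (rho A B C) ((1 : ℂ) * (w : ℂ)) :=
        (differentiableAt_rho hs (by simpa using hw')).continuousAt
      have h3 : ContinuousAt (fun w : ℝ => (1 + (1 : ℂ) * (w : ℂ)) ^ (-(N + 1))) w :=
        ContinuousAt.zpow₀ (by fun_prop) _ (Or.inl (by simpa using one_add_ofReal_ne_zero hw'))
      exact ((ContinuousAt.comp (f := fun w : ℝ => (1 : ℂ) * (w : ℂ)) h2 h1).mul h3).div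
        (by fun_prop) (hne w hw')
    · filter_upwards [ae_restrict_mem measurableSet_Ioi] with w hw
      have hw' : 0 < w := hw
      have h1 := hd (z - 1) (Metric.mem_ball_self hr) w hw'.le
      rw [norm_div, div_le_iff₀ (norm_pos_iff.2 (hne w hw')), one_mul,
        show -(N + 1) = -N - 1 by ring]
      have h2 : c * 1 ≤ ‖(w : ℂ) - (z - 1)‖ := le_trans (by gcongr; linarith) h1
      rw [mul_one] at h2
      calc ‖rho A B C w * (1 + (w : ℂ)) ^ (-N - 1)‖
          = c⁻¹ * ‖rho A B C w * (1 + (w : ℂ)) ^ (-N - 1)‖ * c := by field_simp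
        _ ≤ _ := by gcongr
  simp only [stl]
  rw [← integral_const_mul, ← integral_add hI2 hI]
  -- The pointwise identity is `1 + w = z + (w - (z - 1))`.
  refine setIntegral_congr_fun measurableSet_Ioi fun w hw => ?_
  have hw' : 0 < w := hw
  have h0 := one_add_ofReal_ne_zero hw'
  have h1 := hne w hw'
  simp only [one_mul]
  rw [show -(N + 1) = -N - 1 by ring, show -N = (-N - 1) + 1 by ring, zpow_add_one₀ h0,
    add_sub_cancel_right]
  field_simp
  ring

/-- The Stieltjes representation with a negative power of `z`. -/
theorem gauss_eq_stl_neg {A B C : ℂ} (hC : NonPole C) (hs : -1 < (C - A - B).re) (M : ℕ)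
    (hA : 0 < (A + (-(M : ℤ) : ℤ)).re) (hB : 0 < (B + (-(M : ℤ) : ℤ)).re) {z : ℂ}
    (hz : z ∈ cutPlane) :
    z ^ M * gauss2F1 A B C z = stieltjesConst A B C * stl A B C (-(M : ℤ)) 1 (z - 1) := by
  induction M with
  | zero =>
    rw [(gauss_spec_of_re hC hs).2 0 (by simpa using hA) (by simpa using hB) z hz]
    simp
  | succ M ih =>
    have hA' : 0 < (A + (-(M : ℤ) : ℤ)).re := by simp at hA ⊢; linarith
    have hB' : 0 < (B + (-(M : ℤ) : ℤ)).re := by simp at hB ⊢; linarith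
    rw [stl_recurrence hs hA hB hz, (integral_rho_moment hs _ hA hB).2]
    -- The moment of index `-(M + 1)` contains `1/Γ(-M) = 0`. So passing to a negative power creates
    -- no polynomial term.
    have h0 : (Complex.Gamma (((-((M + 1 : ℕ) : ℤ) : ℤ) : ℂ) + 1))⁻¹ = 0 := by
      rw [inv_eq_zero, Complex.Gamma_eq_zero_iff]
      exact ⟨M, by push_cast; ring⟩
    rw [h0, show (-((M + 1 : ℕ) : ℤ) + 1) = -(M : ℤ) by push_cast; ring]
    have := ih hA' hB'
    linear_combination z * this


/-! ### Growth of the continued Gauss function -/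

/-- Rotation of the ray is available only off the real axis. Continuity carries the bounds over to
the real points of the cut plane. -/
theorem le_of_le_off_real {f g : ℂ → ℝ} {z : ℂ} (hf : ContinuousAt f z) (hg : ContinuousAt g z)
    (h : ∀ᶠ w in 𝓝 z, w.im ≠ 0 → f w ≤ g w) : f z ≤ g z := by
  by_cases hz : z.im = 0
  · have ht : Tendsto (fun t : ℝ => z + t * Complex.I) (𝓝[>] 0) (𝓝 z) := by
      have : ContinuousAt (fun t : ℝ => z + t * Complex.I) 0 := by fun_prop
      have h2 := this.tendsto
      simp only [Complex.ofReal_zero, zero_mul, add_zero] at h2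
      exact h2.mono_left nhdsWithin_le_nhds
    refine le_of_tendsto_of_tendsto (hf.tendsto.comp ht) (hg.tendsto.comp ht) ?_
    filter_upwards [ht.eventually h, self_mem_nhdsWithin] with t h1 h2
    have h2' : 0 < t := h2
    exact h1 (by simp [hz, h2'.ne'])
  · exact h.self_of_nhds hz

theorem exists_sign_mul_pos {x : ℝ} (hx : x ≠ 0) : ∃ σ : ℝ, |σ| = 1 ∧ 0 < σ * x := by
  rcases hx.lt_or_gt with h | h
  · exact ⟨-1, by simp, by linarith⟩
  · exact ⟨1, by simp, by linarith⟩

theorem sub_one_ne_zero_of_mem_cutPlane {z : ℂ} (hz : z ∈ cutPlane) : z - 1 ≠ 0 := by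
  intro h
  have : 1 - z = 0 := by linear_combination -h
  rw [cutPlane, Set.mem_ofPred_eq, this] at hz
  exact Complex.zero_notMem_slitPlane hz

theorem continuousAt_const_mul_norm_rpow {z : ℂ} (hz : z ∈ cutPlane) (K e : ℝ) :
    ContinuousAt (fun z : ℂ => K * ‖z - 1‖ ^ e) z := by
  refine continuousAt_const.mul (ContinuousAt.rpow_const (by fun_prop) (Or.inl ?_))
  exact norm_ne_zero_iff.2 (sub_one_ne_zero_of_mem_cutPlane hz)

theorem exists_stl_one_bound_near {A B C : ℂ} (hs : -1 < (C - A - B).re) {N : ℤ} {m θ : ℝ}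
    (hmA : m < A.re) (hmB : m < B.re) (hθ0 : 0 ≤ θ) (hθ1 : θ ≤ 1) (hθs : 0 < (C - A - B).re + θ)
    (hθ : θ < m + N) :
    ∃ K : ℝ, 0 < K ∧ ∀ z ∈ cutPlane, ‖stl A B C N 1 (z - 1)‖ ≤ K * ‖z - 1‖ ^ (-θ) := by
  have hA : 0 < (A + N).re := by simp; linarith
  have hB : 0 < (B + N).re := by simp; linarith
  obtain ⟨K, hK, hb⟩ := exists_stl_bound_near hs hmA hmB hθ0 hθ1 hθs hθ
  refine ⟨K, hK, fun z hz => le_of_le_off_real (f := fun z => ‖stl A B C N 1 (z - 1)‖)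
    (differentiableAt_stl_one hs hA hB hz).continuousAt.norm
    (continuousAt_const_mul_norm_rpow hz _ _) ?_⟩
  refine Eventually.of_forall fun w hw => ?_
  obtain ⟨σ, hσ, h⟩ := exists_sign_mul_pos (x := (w - 1).im) (by simpa using hw)
  rw [stl_rotate hs hA hB hσ h]
  exact hb σ hσ _ (sub_one_ne_zero_of_mem_cutPlane (mem_cutPlane_of_im hw)) h.le

theorem exists_stl_one_bound_far {A B C : ℂ} (hs : -1 < (C - A - B).re) {N : ℤ} {m θ : ℝ}
    (hmA : m < A.re) (hmB : m < B.re) (hθ0 : 0 ≤ θ) (hθ1 : θ ≤ 1) (hθ : θ < m + N) :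
    ∃ K : ℝ, 0 < K ∧ ∀ z ∈ cutPlane, 2 ≤ ‖z - 1‖ →
      ‖stl A B C N 1 (z - 1)‖ ≤ K * ‖z - 1‖ ^ (-θ) := by
  have hA : 0 < (A + N).re := by simp; linarith
  have hB : 0 < (B + N).re := by simp; linarith
  obtain ⟨K, hK, hb⟩ := exists_stl_bound_far hs hmA hmB hθ0 hθ1 hθ
  refine ⟨K, hK, fun z hz h2 => le_of_le_off_real (f := fun z => ‖stl A B C N 1 (z - 1)‖)
    (differentiableAt_stl_one hs hA hB hz).continuousAt.norm
    (continuousAt_const_mul_norm_rpow hz _ _) ?_⟩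
  have hc : ContinuousAt (fun w : ℂ => ‖w - 1‖) z := by fun_prop
  filter_upwards [hc.eventually (lt_mem_nhds (show (1 : ℝ) < ‖z - 1‖ by linarith))] with w hw1 hw
  obtain ⟨σ, hσ, h⟩ := exists_sign_mul_pos (x := (w - 1).im) (by simpa using hw)
  rw [stl_rotate hs hA hB hσ h]
  exact hb σ hσ _ h.le hw1.le

theorem exists_gauss_bound_near {A B C : ℂ} (hC : NonPole C) (hs : -1 < (C - A - B).re) {θ : ℝ}
    (hθ0 : 0 ≤ θ) (hθ1 : θ ≤ 1) (hθs : 0 < (C - A - B).re + θ) :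
    ∃ K : ℝ, 0 < K ∧ ∀ z ∈ cutPlane, ‖z - 1‖ ≤ 2 →
      ‖gauss2F1 A B C z‖ ≤ K * ‖z - 1‖ ^ (-θ) := by
  -- The shift by `2` allows `m = 2 - N` below `Re A` and `Re B`, so that `m + N = 2` exceeds every
  -- `θ ≤ 1`.
  obtain ⟨N, hN⟩ := exists_nat_re_add_pos (A - 2) (B - 2)
  obtain ⟨hA, hB⟩ := hN N le_rfl
  simp only [Complex.add_re, Complex.sub_re, Complex.re_ofNat, Complex.natCast_re] at hA hB
  obtain ⟨K, hK, hb⟩ := exists_stl_one_bound_near (A := A) (B := B) hs (N := N) (m := 2 - N)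
    (by linarith) (by linarith) hθ0 hθ1 hθs (by simp; linarith)
  set S := ∑ n ∈ Finset.range N, ‖hcoef A B C n‖ * 3 ^ n
  have hS : 0 ≤ S := Finset.sum_nonneg fun n _ => by positivity
  refine ⟨S * 2 ^ θ + ‖stieltjesConst A B C‖ * 3 ^ N * K + 1, by positivity,
    fun z hz h2 => ?_⟩
  have hb0 : 0 < ‖z - 1‖ := norm_pos_iff.2 (sub_one_ne_zero_of_mem_cutPlane hz)
  have hz3 : ‖z‖ ≤ 3 := by
    have := norm_add_le (z - 1) 1
    simp at this; linarith
  rw [(gauss_spec_of_re hC hs).2 N (by simp; linarith) (by simp; linarith) z hz]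
  have h1 : ‖∑ n ∈ Finset.range N, hcoef A B C n * z ^ n‖ ≤ S := by
    refine (norm_sum_le _ _).trans (Finset.sum_le_sum fun n _ => ?_)
    rw [norm_mul, norm_pow]; gcongr
  have h3 : 1 ≤ 2 ^ θ * ‖z - 1‖ ^ (-θ) := by
    rw [Real.rpow_neg hb0.le, ← div_eq_mul_inv, one_le_div (Real.rpow_pos_of_pos hb0 _)]
    exact Real.rpow_le_rpow hb0.le h2 hθ0
  have h4 : ‖stieltjesConst A B C * z ^ N * stl A B C N 1 (z - 1)‖ ≤
      ‖stieltjesConst A B C‖ * 3 ^ N * (K * ‖z - 1‖ ^ (-θ)) := by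
    rw [norm_mul, norm_mul, norm_pow]
    have := hb z hz
    gcongr
  have h5 : 0 < ‖z - 1‖ ^ (-θ) := Real.rpow_pos_of_pos hb0 _
  calc _ ≤ S + ‖stieltjesConst A B C‖ * 3 ^ N * (K * ‖z - 1‖ ^ (-θ)) :=
        (norm_add_le _ _).trans (add_le_add h1 h4)
    _ ≤ S * (2 ^ θ * ‖z - 1‖ ^ (-θ)) + ‖stieltjesConst A B C‖ * 3 ^ N * (K * ‖z - 1‖ ^ (-θ)) := by
        gcongr
        nlinarith
    _ ≤ _ := by nlinarith

/-- Take `N = ⌈-m⌉` and `θ = N + m ∈ [0, 1)`, so that `|z|^N |z - 1|^(-θ)` has order `|z - 1|^(-m)`.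
For `N ≥ 0` the polynomial has degree below `N`, hence is of order at most `|z|^(-m)` too. For `N ≤
0` the representation with a negative power has no polynomial. The auxiliary `m'` gives the strict
inequality `θ < m' + N`. -/
theorem exists_gauss_bound_far_of_re {A B C : ℂ} (hC : NonPole C) (hs : -1 < (C - A - B).re) {m : ℝ}
    (hmA : m < A.re) (hmB : m < B.re) :
    ∃ K : ℝ, 0 < K ∧ ∀ z ∈ cutPlane, 2 ≤ ‖z - 1‖ →
      ‖gauss2F1 A B C z‖ ≤ K * ‖z - 1‖ ^ (-m) := by
  obtain ⟨m', hm, hm'⟩ := exists_between (lt_min hmA hmB)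
  have hmA' := hm'.trans_le (min_le_left _ _)
  have hmB' := hm'.trans_le (min_le_right _ _)
  have hM1 := Int.le_ceil (-m)
  have hM2 := Int.ceil_lt_add_one (-m)
  obtain ⟨K, hK, hb⟩ := exists_stl_one_bound_far hs (N := ⌈-m⌉) (m := m') (θ := ⌈-m⌉ + m)
    hmA' hmB' (by linarith) (by linarith) (by linarith)
  obtain ⟨n, hn | hn⟩ := Int.eq_nat_or_neg ⌈-m⌉
  · rw [hn] at hb hM1 hM2
    simp only [Int.cast_natCast] at hM1 hM2 hb
    set S := ∑ k ∈ Finset.range n, ‖hcoef A B C k‖ * 2 ^ k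
    have hS : 0 ≤ S := Finset.sum_nonneg fun n _ => by positivity
    refine ⟨S + ‖stieltjesConst A B C‖ * 2 ^ n * K + 1, by positivity, fun z hz h2 => ?_⟩
    have hb0 : 0 < ‖z - 1‖ := by linarith
    have hz3 : ‖z‖ ≤ 2 * ‖z - 1‖ := by
      have := norm_add_le (z - 1) 1
      simp at this; linarith
    rw [(gauss_spec_of_re hC hs).2 n (by simp; linarith) (by simp; linarith) z hz]
    have h5 : 0 < ‖z - 1‖ ^ (-m) := Real.rpow_pos_of_pos hb0 _
    have h1 : ‖∑ k ∈ Finset.range n, hcoef A B C k * z ^ k‖ ≤ S * ‖z - 1‖ ^ (-m) := by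
      rw [Finset.sum_mul]
      refine (norm_sum_le _ _).trans (Finset.sum_le_sum fun k hk => ?_)
      rw [norm_mul, norm_pow, mul_assoc]
      have h6 : ‖z - 1‖ ^ k ≤ ‖z - 1‖ ^ (-m) := by
        rw [← Real.rpow_natCast]
        refine Real.rpow_le_rpow_of_exponent_le (by linarith) ?_
        have : (k : ℝ) + 1 ≤ n := by exact_mod_cast Finset.mem_range.1 hk
        linarith
      gcongr
      calc ‖z‖ ^ k ≤ (2 * ‖z - 1‖) ^ k := by gcongr
        _ = 2 ^ k * ‖z - 1‖ ^ k := mul_pow _ _ _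
        _ ≤ _ := by gcongr
    have h4 : ‖stieltjesConst A B C * z ^ n * stl A B C n 1 (z - 1)‖ ≤
        ‖stieltjesConst A B C‖ * 2 ^ n * K * ‖z - 1‖ ^ (-m) := by
      rw [norm_mul, norm_mul, norm_pow]
      calc _ ≤ ‖stieltjesConst A B C‖ * (2 * ‖z - 1‖) ^ n * (K * ‖z - 1‖ ^ (-(n + m))) := by
            have := hb z hz h2
            gcongr
        _ = _ := by
            rw [mul_pow, show -m = -(n + m) + (n : ℝ) by ring, Real.rpow_add hb0,
              Real.rpow_natCast]
            ring
    refine (norm_add_le _ _).trans ((add_le_add h1 h4).trans ?_)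
    nlinarith
  · rw [hn] at hb hM1 hM2
    simp only [Int.cast_neg, Int.cast_natCast] at hM1 hM2 hb
    refine ⟨‖stieltjesConst A B C‖ * K * 2 ^ n + 1, by positivity, fun z hz h2 => ?_⟩
    have hb0 : 0 < ‖z - 1‖ := by linarith
    have hz3 : ‖z - 1‖ / 2 ≤ ‖z‖ := by
      have := norm_sub_le z 1
      simp at this; linarith
    have h5 : 0 < ‖z - 1‖ ^ (-m) := Real.rpow_pos_of_pos hb0 _
    have h6 := congrArg norm (gauss_eq_stl_neg hC hs n (by simp; linarith) (by simp; linarith) hz)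
    rw [norm_mul, norm_mul, norm_pow] at h6
    have h7 : (‖z - 1‖ / 2) ^ n * ‖gauss2F1 A B C z‖ ≤
        ‖stieltjesConst A B C‖ * (K * ‖z - 1‖ ^ (-(-n + m))) := by
      refine le_trans (by gcongr) (h6.le.trans ?_)
      have := hb z hz h2
      gcongr
    rw [div_pow, show -(-(n : ℝ) + m) = -m + (n : ℝ) by ring, Real.rpow_add hb0,
      Real.rpow_natCast, div_mul_eq_mul_div, div_le_iff₀ (by positivity)] at h7
    have h8 : 0 < ‖z - 1‖ ^ n := by positivity
    have h9 : ‖z - 1‖ ^ n * ‖gauss2F1 A B C z‖ ≤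
        ‖z - 1‖ ^ n * (‖stieltjesConst A B C‖ * K * 2 ^ n * ‖z - 1‖ ^ (-m)) := by
      refine h7.trans (le_of_eq ?_); ring
    have := le_of_mul_le_mul_left h9 h8
    nlinarith

/-- Growth of `₂F₁` on the cut plane, uniformly up to the cut. -/
theorem exists_gauss_bound_of_re {A B C : ℂ} (hC : NonPole C) (hs : -1 < (C - A - B).re) {m : ℝ}
    (hmA : m < A.re) (hmB : m < B.re) :
    ∃ θ K : ℝ, 0 ≤ θ ∧ θ < 1 ∧ 0 < K ∧ ∀ z ∈ cutPlane,
      ‖gauss2F1 A B C z‖ ≤ K * (‖z - 1‖ ^ (-θ) * (1 + ‖z - 1‖) ^ (θ - m)) := by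
  -- With `s = Re(C - A - B) > -1`, the number `(1 - s)/2` is below `1`, and adding it to `s` gives
  -- `(1 + s)/2 > 0`.
  obtain ⟨θ, hθ0, hθ1, hθs⟩ : ∃ θ : ℝ, 0 ≤ θ ∧ θ < 1 ∧ 0 < (C - A - B).re + θ := by
    refine ⟨max 0 ((1 - (C - A - B).re) / 2), le_max_left _ _, max_lt one_pos (by linarith), ?_⟩
    have := le_max_right 0 ((1 - (C - A - B).re) / 2)
    linarith
  obtain ⟨K₁, hK₁, h1⟩ := exists_gauss_bound_near hC hs hθ0 hθ1.le hθs
  obtain ⟨K₂, hK₂, h2⟩ := exists_gauss_bound_far_of_re hC hs hmA hmB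
  refine ⟨θ, K₁ * 3 ^ |(-(θ - m))| + K₂ * 2 ^ |θ - m|, hθ0, hθ1, by positivity, fun z hz => ?_⟩
  have hb0 : 0 < ‖z - 1‖ := norm_pos_iff.2 (sub_one_ne_zero_of_mem_cutPlane hz)
  have hb1 : 0 < 1 + ‖z - 1‖ := by linarith
  have hp : 0 < ‖z - 1‖ ^ (-θ) * (1 + ‖z - 1‖) ^ (θ - m) := by positivity
  rcases le_total ‖z - 1‖ 2 with h | h
  · have h3 := rpow_le_of_comparable (a := 1 + ‖z - 1‖) (b := 1) (k := 3) hb1 (by norm_num)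
      (by linarith) (by linarith) (-(θ - m))
    rw [Real.one_rpow, mul_one, Real.rpow_neg hb1.le, inv_le_iff_one_le_mul₀ (by positivity)] at h3
    calc _ ≤ K₁ * ‖z - 1‖ ^ (-θ) * 1 := by rw [mul_one]; exact h1 z hz h
      _ ≤ K₁ * ‖z - 1‖ ^ (-θ) * (3 ^ |-(θ - m)| * (1 + ‖z - 1‖) ^ (θ - m)) := by gcongr
      _ = K₁ * 3 ^ |-(θ - m)| * (‖z - 1‖ ^ (-θ) * (1 + ‖z - 1‖) ^ (θ - m)) := by ring
      _ ≤ _ := by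
          gcongr
          have : 0 < K₂ * 2 ^ |θ - m| := by positivity
          linarith
  · have h3 := rpow_le_of_comparable (a := ‖z - 1‖) (b := 1 + ‖z - 1‖) (k := 2) hb0 (by norm_num)
      (by linarith) (by linarith) (θ - m)
    calc _ ≤ K₂ * ‖z - 1‖ ^ (-m) := h2 z hz h
      _ = K₂ * (‖z - 1‖ ^ (-θ) * ‖z - 1‖ ^ (θ - m)) := by
          rw [← Real.rpow_add hb0]; congr 2; ring
      _ ≤ K₂ * (‖z - 1‖ ^ (-θ) * (2 ^ |θ - m| * (1 + ‖z - 1‖) ^ (θ - m))) := by gcongr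
      _ = K₂ * 2 ^ |θ - m| * (‖z - 1‖ ^ (-θ) * (1 + ‖z - 1‖) ^ (θ - m)) := by ring
      _ ≤ _ := by
          gcongr
          have : 0 < K₁ * 3 ^ |-(θ - m)| := by positivity
          linarith


/-! ### Boundary values on the cut -/

/-- After rotation the pole `(X - 1)/(1 - σ i)` is not on `[0, ∞)`, so the rotated integral is
continuous at the boundary point itself. -/
theorem tendsto_stl_boundary {A B C : ℂ} (hs : -1 < (C - A - B).re) {N : ℤ}
    (hA : 0 < (A + N).re) (hB : 0 < (B + N).re) {σ : ℝ} (hσ : |σ| = 1) {X : ℝ} (hX : 1 < X) :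
    Tendsto (fun z : ℂ => stl A B C N 1 (z - 1)) (𝓝[{z : ℂ | 0 < σ * z.im}] X)
      (𝓝 (stl A B C N (1 - σ * Complex.I) (((X : ℂ) - 1) / (1 - σ * Complex.I)))) := by
  have hσ2 : σ * σ = 1 := by rw [← abs_mul_abs_self, hσ, one_mul]
  have hne : (1 - (σ : ℂ) * Complex.I) ≠ 0 := by
    intro h
    have := congrArg Complex.re h
    simp at this
  have hdiv : ((X : ℂ) - 1) / (1 - σ * Complex.I) = ((X : ℂ) - 1) / 2 * (1 + σ * Complex.I) := by
    have hσ3 : (σ : ℂ) * σ = 1 := by exact_mod_cast hσ2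
    rw [div_eq_iff hne]
    linear_combination ((X : ℂ) - 1) / 2 * (σ * σ * Complex.I_mul_I - hσ3)
  have h1 : DifferentiableAt ℂ (fun q : ℂ × ℂ => stl A B C N q.1 q.2)
      ((1 - σ * Complex.I : ℂ), ((X : ℂ) - 1) / (1 - σ * Complex.I)) := by
    refine differentiableAt_stl hs hA hB (one_sub_I_mem_sector hσ) (Or.inr ?_)
    simp only
    rw [hdiv, show ((X : ℂ) - 1) / 2 * (1 + σ * Complex.I) =
      (((X - 1) / 2 : ℝ) : ℂ) * (1 + σ * Complex.I) by push_cast; ring, Complex.neg_im,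
      Complex.im_ofReal_mul]
    have hσ0 : σ ≠ 0 := by rintro rfl; simp at hσ
    have : (X - 1) / 2 ≠ 0 := by linarith
    simp [hσ0, sub_ne_zero.2 hX.ne']
  have h2 : ContinuousAt (fun z : ℂ => stl A B C N (1 - σ * Complex.I)
      ((z - 1) / (1 - σ * Complex.I))) X :=
    ContinuousAt.comp (f := fun z : ℂ => ((1 - σ * Complex.I : ℂ), (z - 1) / (1 - σ * Complex.I)))
      h1.continuousAt (by fun_prop)
  refine (h2.tendsto.mono_left nhdsWithin_le_nhds).congr' ?_
  filter_upwards [self_mem_nhdsWithin] with z hz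
  exact (stl_rotate hs hA hB hσ (by simpa using hz)).symm

theorem exists_tendsto_gauss_boundary {A B C : ℂ} (hC : NonPole C) (hs : -1 < (C - A - B).re)
    {σ : ℝ} (hσ : |σ| = 1) {X : ℝ} (hX : 1 < X) :
    ∃ L : ℂ, Tendsto (gauss2F1 A B C) (𝓝[{z : ℂ | 0 < σ * z.im}] X) (𝓝 L) := by
  obtain ⟨N, hN⟩ := exists_nat_re_add_pos A B
  obtain ⟨hA, hB⟩ := hN N le_rfl
  have h1 := tendsto_stl_boundary (A := A) (B := B) (C := C) hs (N := N) (by simpa using hA)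
    (by simpa using hB) hσ hX
  have h2 : ContinuousAt (fun z : ℂ => ∑ n ∈ Finset.range N, hcoef A B C n * z ^ n) X := by fun_prop
  have h3 : ContinuousAt (fun z : ℂ => stieltjesConst A B C * z ^ N) X := by fun_prop
  refine ⟨_, ((h2.tendsto.mono_left nhdsWithin_le_nhds).add
    ((h3.tendsto.mono_left nhdsWithin_le_nhds).mul h1)).congr' ?_⟩
  filter_upwards [self_mem_nhdsWithin] with z hz
  rw [(gauss_spec_of_re hC hs).2 N hA hB z (mem_cutPlane_of_im ?_)]
  intro h
  simp [h] at hz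

theorem tendsto_add_mul_I (σ X : ℝ) (hσ : |σ| = 1) :
    Tendsto (fun ε : ℝ => (X : ℂ) + σ * (ε * Complex.I)) (𝓝[>] 0)
      (𝓝[{z : ℂ | 0 < σ * z.im}] X) := by
  have hσ2 : σ * σ = 1 := by rw [← abs_mul_abs_self, hσ, one_mul]
  refine tendsto_nhdsWithin_iff.2 ⟨?_, ?_⟩
  · have : ContinuousAt (fun ε : ℝ => (X : ℂ) + σ * (ε * Complex.I)) 0 := by fun_prop
    have h2 := this.tendsto
    simp only [Complex.ofReal_zero, zero_mul, mul_zero, add_zero] at h2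
    exact h2.mono_left nhdsWithin_le_nhds
  · filter_upwards [self_mem_nhdsWithin] with ε hε
    have hε' : 0 < ε := hε
    show 0 < σ * ((X : ℂ) + σ * (ε * Complex.I)).im
    simp [← mul_assoc, hσ2, hε']

theorem tendsto_gauss_above {A B C : ℂ} (hC : NonPole C) (hs : -1 < (C - A - B).re)
    {X : ℝ} (hX : 1 < X) :
    Tendsto (gauss2F1 A B C) (𝓝[{z : ℂ | 0 < z.im}] X) (𝓝 (gauss2F1Above A B C X)) := by
  obtain ⟨L, hL⟩ := exists_tendsto_gauss_boundary hC hs (σ := 1) (by simp) hX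
  have h1 := hL.comp (tendsto_add_mul_I 1 X (by simp))
  have h2 : gauss2F1Above A B C X = L := by
    refine Tendsto.limUnder_eq (h1.congr fun ε => ?_)
    simp
  rw [h2]
  simpa using hL

theorem tendsto_gauss_below {A B C : ℂ} (hC : NonPole C) (hs : -1 < (C - A - B).re)
    {X : ℝ} (hX : 1 < X) :
    Tendsto (gauss2F1 A B C) (𝓝[{z : ℂ | z.im < 0}] X) (𝓝 (gauss2F1Below A B C X)) := by
  obtain ⟨L, hL⟩ := exists_tendsto_gauss_boundary hC hs (σ := -1) (by simp) hX
  have h1 := hL.comp (tendsto_add_mul_I (-1) X (by simp))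
  have h2 : gauss2F1Below A B C X = L := by
    refine Tendsto.limUnder_eq (h1.congr fun ε => ?_)
    simp [sub_eq_add_neg]
  rw [h2]
  simpa using hL

/-- The Plemelj jump of a Cauchy integral, from the Poisson kernel. -/
theorem tendsto_integral_poisson {h : ℝ → ℂ} (hh : IntegrableOn h (Set.Ioi 0)) {b : ℝ} (hb : 0 < b)
    (hc : ContinuousAt h b) :
    Tendsto (fun ε : ℝ => ∫ w in Set.Ioi (0 : ℝ), (h w * (ε / ((w - b) ^ 2 + ε ^ 2) : ℝ)))
      (𝓝[>] 0) (𝓝 (Real.pi * h b)) := by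
  have hg : Integrable (Set.indicator (Set.Ioi 0) h) := hh.integrable_indicator measurableSet_Ioi
  have hgc : ContinuousAt (Set.indicator (Set.Ioi 0) h) b := by
    refine hc.congr ?_
    filter_upwards [Ioi_mem_nhds hb] with w hw
    rw [Set.indicator_of_mem hw]
  have hpi := Real.pi_pos
  -- The Poisson kernel is the approximate identity generated by `π⁻¹ (1 + x²)⁻¹`, scaled by `ε⁻¹`.
  have key := tendsto_integral_comp_smul_smul_of_integrable' (μ := volume)
    (φ := fun x : ℝ => Real.pi⁻¹ * (1 + x ^ 2)⁻¹) (fun x => by positivity)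
    (by rw [integral_const_mul, integral_univ_inv_one_add_sq, inv_mul_cancel₀ hpi.ne'])
    (by
      simp only [Module.finrank_self, pow_one]
      refine squeeze_zero (g := fun x : ℝ => Real.pi⁻¹ * ‖x‖⁻¹) (fun x => by positivity)
        (fun x => ?_) ?_
      · rcases eq_or_ne x 0 with rfl | hx
        · simp
        · have h0 : 0 < ‖x‖ := norm_pos_iff.2 hx
          have h1 : x ^ 2 = ‖x‖ ^ 2 := by simp
          rw [h1, mul_left_comm]
          gcongr
          rw [← div_eq_mul_inv, div_le_iff₀ (by positivity)]
          have : ‖x‖⁻¹ * (1 + ‖x‖ ^ 2) = ‖x‖ + ‖x‖⁻¹ := by field_simp; ring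
          rw [this]
          have := inv_pos.2 h0
          linarith
      · have := tendsto_inv_atTop_zero.comp (tendsto_norm_cobounded_atTop (E := ℝ))
        simpa using this.const_mul Real.pi⁻¹) hg hgc
  rw [Set.indicator_of_mem (show b ∈ Set.Ioi (0 : ℝ) from hb)] at key
  have := (key.comp tendsto_inv_nhdsGT_zero).const_mul (Real.pi : ℂ)
  refine this.congr' ?_
  filter_upwards [self_mem_nhdsWithin] with ε hε
  have hε' : 0 < ε := hε
  simp only [Function.comp_apply]
  rw [← integral_const_mul, ← integral_indicator measurableSet_Ioi]
  congr 1
  funext w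
  by_cases hw : w ∈ Set.Ioi (0 : ℝ)
  · rw [Set.indicator_of_mem hw, Set.indicator_of_mem hw]
    simp only [Module.finrank_self, pow_one, smul_eq_mul, Complex.real_smul]
    have e : Real.pi * (ε⁻¹ * (Real.pi⁻¹ * (1 + (ε⁻¹ * (b - w)) ^ 2)⁻¹)) =
        ε / ((w - b) ^ 2 + ε ^ 2) := by
      have h1 : (1 + (ε⁻¹ * (b - w)) ^ 2) = ((w - b) ^ 2 + ε ^ 2) / ε ^ 2 := by
        field_simp; ring
      have h2 : 0 < (w - b) ^ 2 + ε ^ 2 := by positivity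
      rw [h1]
      field_simp
    rw [← e]
    push_cast
    ring
  · rw [Set.indicator_of_notMem hw, Set.indicator_of_notMem hw]
    simp

/-- The jump of `₂F₁` across the cut. -/
theorem gauss_jump {A B C : ℂ} (hC : NonPole C) (hs : -1 < (C - A - B).re) {X : ℝ} (hX : 1 < X) :
    gauss2F1Above A B C X - gauss2F1Below A B C X =
      2 * Real.pi * Complex.I * stieltjesConst A B C * rho A B C ((X - 1 : ℝ) : ℂ) := by
  obtain ⟨N, hN⟩ := exists_nat_re_add_pos A B
  obtain ⟨hA, hB⟩ := hN N le_rfl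
  obtain ⟨hA', hB'⟩ := hN (N + 1) (by omega)
  have hX0 : (0 : ℝ) < X - 1 := by linarith
  have hIm := (integral_rho_moment hs (N : ℤ) (by simpa using hA) (by simpa using hB)).1
  -- With `N + 1` terms split off instead of `N`, the numerator `h` is integrable on its own, being
  -- the integrand of the moment of index `N`.
  set h : ℝ → ℂ := fun w => rho A B C w * (1 + (w : ℂ)) ^ (-((N + 1 : ℕ) : ℤ)) with hh
  have hI : IntegrableOn h (Set.Ioi 0) := by
    refine hIm.congr_fun (fun w _ => ?_) measurableSet_Ioi
    simp only [hh]
    rw [show -((N + 1 : ℕ) : ℤ) = -(N : ℤ) - 1 by push_cast; ring]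
  have hcont : ∀ w : ℝ, 0 < w → ContinuousAt h w := fun w hw => by
    have h2 : ContinuousAt (rho A B C) (w : ℂ) :=
      (differentiableAt_rho hs (by simpa using hw)).continuousAt
    exact (ContinuousAt.comp (f := fun w : ℝ => (w : ℂ)) h2 (by fun_prop)).mul
      (ContinuousAt.zpow₀ (by fun_prop) _ (Or.inl (one_add_ofReal_ne_zero hw)))
  have hP := (tendsto_integral_poisson hI hX0 (hcont _ hX0)).const_mul (2 * Complex.I)
  have hlim : ∀ σ : ℝ, |σ| = 1 → ∃ ℓ : ℂ, Tendsto (fun z : ℂ => stl A B C (N + 1 : ℕ) 1 (z - 1))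
      (𝓝[{z : ℂ | 0 < σ * z.im}] X) (𝓝 ℓ) := fun σ hσ =>
    ⟨_, tendsto_stl_boundary hs (by simpa using hA') (by simpa using hB') hσ hX⟩
  obtain ⟨ℓ₁, h1⟩ := hlim 1 (by simp)
  obtain ⟨ℓ₂, h2⟩ := hlim (-1) (by simp)
  have h1' := h1.comp (tendsto_add_mul_I 1 X (by simp))
  have h2' := h2.comp (tendsto_add_mul_I (-1) X (by simp))
  -- The Cauchy kernels with poles at `X - 1 ± i ε` differ by `2 i ε / ((w - (X - 1))² + ε²)`, which
  -- is `2 i` times the Poisson kernel. The polynomial part has no jump.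
  have hℓ : ℓ₁ - ℓ₂ = 2 * Complex.I * (Real.pi * h (X - 1)) := by
    refine tendsto_nhds_unique (h1'.sub h2') (hP.congr' ?_)
    filter_upwards [self_mem_nhdsWithin] with ε hε
    have hε' : 0 < ε := hε
    simp only [Function.comp_apply, Complex.ofReal_one, one_mul, Complex.ofReal_neg, neg_mul]
    have hint : ∀ τ : ℝ, |τ| = ε → IntegrableOn (fun w : ℝ => rho A B C (1 * w) *
        (1 + 1 * (w : ℂ)) ^ (-((N + 1 : ℕ) : ℤ)) / (w - ((X : ℂ) + τ * Complex.I - 1)))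
        (Set.Ioi 0) := by
      intro τ hτ
      have hge : ∀ w : ℝ, ε ≤ ‖(w : ℂ) - ((X : ℂ) + τ * Complex.I - 1)‖ := fun w => by
        have := Complex.abs_im_le_norm ((w : ℂ) - ((X : ℂ) + τ * Complex.I - 1))
        simpa [hτ] using this
      have hne : ∀ w : ℝ, (w : ℂ) - ((X : ℂ) + τ * Complex.I - 1) ≠ 0 := fun w =>
        norm_pos_iff.1 (hε'.trans_le (hge w))
      simp only [one_mul]
      refine Integrable.mono' (hI.norm.const_mul ε⁻¹) ?_ ?_
      · refine ContinuousOn.aestronglyMeasurable (fun w hw => ContinuousAt.continuousWithinAt ?_)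
          measurableSet_Ioi
        exact (hcont w hw).div (by fun_prop) (hne w)
      · refine Eventually.of_forall fun w => ?_
        rw [norm_div, div_eq_inv_mul]
        have := hge w
        gcongr
    have e1 : (X : ℂ) + ε * Complex.I - 1 = X + (ε : ℝ) * Complex.I - 1 := rfl
    have e2 : (X : ℂ) + -(ε * Complex.I) - 1 = X + ((-ε : ℝ) : ℂ) * Complex.I - 1 := by
      push_cast; ring
    rw [e2, stl, stl, ← integral_sub (hint ε (abs_of_pos hε'))
      (hint (-ε) (by rw [abs_neg, abs_of_pos hε'])), ← integral_const_mul]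
    refine setIntegral_congr_fun measurableSet_Ioi fun w hw => ?_
    have hd : ((w : ℂ) - (X - 1)) ^ 2 + ε ^ 2 ≠ 0 := by
      have : (0 : ℝ) < (w - (X - 1)) ^ 2 + ε ^ 2 := by positivity
      exact_mod_cast this.ne'
    have hfac : ((w : ℂ) - (X + ε * Complex.I - 1)) * (w - (X + ((-ε : ℝ) : ℂ) * Complex.I - 1)) =
        ((w : ℂ) - (X - 1)) ^ 2 + ε ^ 2 := by
      push_cast
      linear_combination (-(ε : ℂ) ^ 2) * Complex.I_mul_I
    have hn1 : ((w : ℂ) - (X + ε * Complex.I - 1)) ≠ 0 := left_ne_zero_of_mul (hfac ▸ hd)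
    have hn2 : ((w : ℂ) - (X + ((-ε : ℝ) : ℂ) * Complex.I - 1)) ≠ 0 :=
      right_ne_zero_of_mul (hfac ▸ hd)
    simp only [one_mul]
    rw [div_sub_div _ _ hn1 hn2, hfac]
    simp only [hh]
    push_cast
    field_simp
    ring
  have hpoly : ContinuousAt (fun z : ℂ => ∑ n ∈ Finset.range (N + 1), hcoef A B C n * z ^ n) X := by
    fun_prop
  have hzp : ContinuousAt (fun z : ℂ => stieltjesConst A B C * z ^ (N + 1)) X := by fun_prop
  have hF : ∀ (σ : ℝ) (ℓ : ℂ), Tendsto (fun z : ℂ => stl A B C (N + 1 : ℕ) 1 (z - 1))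
      (𝓝[{z : ℂ | 0 < σ * z.im}] X) (𝓝 ℓ) → Tendsto (gauss2F1 A B C) (𝓝[{z : ℂ | 0 < σ * z.im}] X)
      (𝓝 (∑ n ∈ Finset.range (N + 1), hcoef A B C n * (X : ℂ) ^ n +
        stieltjesConst A B C * (X : ℂ) ^ (N + 1) * ℓ)) := by
    intro σ ℓ hl
    refine ((hpoly.tendsto.mono_left nhdsWithin_le_nhds).add
      ((hzp.tendsto.mono_left nhdsWithin_le_nhds).mul hl)).congr' ?_
    filter_upwards [self_mem_nhdsWithin] with z hz
    rw [(gauss_spec_of_re hC hs).2 (N + 1) hA' hB' z (mem_cutPlane_of_im ?_)]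
    intro h
    simp [h] at hz
  have hlimA := tendsto_nhds_unique ((tendsto_gauss_above hC hs hX).comp
    (by simpa using tendsto_add_mul_I 1 X (by simp)))
    ((hF 1 ℓ₁ h1).comp (tendsto_add_mul_I 1 X (by simp)) |>.congr fun ε => by simp)
  have hlimB := tendsto_nhds_unique ((tendsto_gauss_below hC hs hX).comp
    (by simpa using tendsto_add_mul_I (-1) X (by simp)))
    ((hF (-1) ℓ₂ h2).comp (tendsto_add_mul_I (-1) X (by simp)) |>.congr fun ε => by simp)
  rw [hlimA, hlimB]
  have hX1 : (X : ℂ) ≠ 0 := by exact_mod_cast (by linarith : X ≠ 0)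
  -- At `w = X - 1` the factor `(1 + w)^(-(N + 1))` cancels the factor `X^(N + 1)`, so the jump does
  -- not depend on `N`.
  have hfin : h (X - 1) * (X : ℂ) ^ (N + 1) = rho A B C ((X - 1 : ℝ) : ℂ) := by
    simp only [hh]
    push_cast
    rw [add_sub_cancel, mul_assoc, ← zpow_natCast (X : ℂ) (N + 1), ← zpow_add₀ hX1]
    simp
  linear_combination stieltjesConst A B C * (X : ℂ) ^ (N + 1) * hℓ +
    stieltjesConst A B C * 2 * Complex.I * Real.pi * hfin


/-! ### Continuation of the Gauss function for all parameters -/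

theorem one_sub_div_sub_one {z : ℂ} (hz : z - 1 ≠ 0) : 1 - z / (z - 1) = (1 - z)⁻¹ := by
  have : 1 - z ≠ 0 := fun h => hz (by linear_combination -h)
  field_simp
  ring

theorem div_sub_one_involutive {z : ℂ} (hz : z - 1 ≠ 0) :
    z / (z - 1) / (z / (z - 1) - 1) = z := by
  have : z / (z - 1) - 1 = (z - 1)⁻¹ := by field_simp; ring
  rw [this]; field_simp

theorem inv_cpow_neg {w : ℂ} (hw : w ∈ Complex.slitPlane) (e : ℂ) : w⁻¹ ^ (-e) = w ^ e := by
  rw [Complex.inv_cpow _ _ (Complex.slitPlane_arg_ne_pi hw), Complex.cpow_neg, inv_inv]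

/-- Pfaff's transformation is applied twice, the second time with respect to the other upper
parameter. The bound `‖z‖ < 1/3` gives `‖z / (z - 1)‖ < 1/2`, so both applications are inside their
range. -/
theorem euler_small (A B : ℂ) {C : ℂ} (hC : NonPole C) {z : ℂ} (hz : ‖z‖ < 1 / 3) :
    ₂F₁ A B C z = (1 - z) ^ (C - A - B) * ₂F₁ (C - A) (C - B) C z := by
  have hre : z.re < 1 / 2 := (Complex.re_le_norm z).trans_lt (by linarith)
  have hz1 : z - 1 ≠ 0 := sub_one_ne_zero_of_re_lt (by linarith)
  have hsl := one_sub_mem_slitPlane_of_re_lt (z := z) (by linarith)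
  have hn : 2 / 3 < ‖z - 1‖ := by
    have := norm_sub_norm_le 1 z
    rw [norm_one, norm_sub_rev] at this
    linarith
  have hw : ‖z / (z - 1)‖ < 1 / 2 := by
    rw [norm_div, div_lt_iff₀ (by linarith)]
    linarith
  have hwre : (z / (z - 1)).re < 1 / 2 := (Complex.re_le_norm _).trans_lt hw
  rw [pfaff A B hC (by linarith) hre, hyp_comm A (C - B),
    pfaff (C - B) A hC (by linarith) hwre, div_sub_one_involutive hz1, one_sub_div_sub_one hz1,
    inv_cpow_neg hsl, hyp_comm (C - A), ← mul_assoc,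
    ← Complex.cpow_add _ _ (Complex.slitPlane_ne_zero hsl)]
  congr 2
  ring

theorem ball_segment {z : ℂ} (hz : z ∈ Metric.ball (0 : ℂ) 1) {t : ℝ} (ht : t ∈ Set.Icc (0 : ℝ) 1) :
    (t : ℂ) * z ∈ Metric.ball (0 : ℂ) 1 := by
  rw [mem_ball_zero_iff] at hz ⊢
  rw [norm_mul, Complex.norm_real, Real.norm_eq_abs, abs_of_nonneg ht.1]
  have := norm_nonneg z
  nlinarith [ht.1, ht.2]

theorem differentiableAt_one_sub_cpow {z : ℂ} (hz : z ∈ cutPlane) (e : ℂ) :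
    DifferentiableAt ℂ (fun z => (1 - z) ^ e) z :=
  DifferentiableAt.cpow_const (by fun_prop) hz

/-- The Stieltjes representation needs `Re(C - A - B) > -1`. Otherwise Euler's transformation passes
to `C - A` and `C - B`, for which this quantity changes sign. -/
theorem hasContinuation_gauss (A B : ℂ) {C : ℂ} (hC : NonPole C) :
    HasContinuation (fun z : ℂ => ₂F₁ A B C z) (Metric.ball 0 1) cutPlane := by
  rcases lt_or_ge (-1) (C - A - B).re with hs | hs
  · exact (gauss_spec_of_re hC hs).1
  · have hs' : -1 < (C - (C - A) - (C - B)).re := by simp at hs ⊢; linarith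
    have h := continuation_spec (gauss_spec_of_re hC hs').1
    have hd : DifferentiableOn ℂ (fun z => (1 - z) ^ (C - A - B) *
        continuation (fun z : ℂ => ₂F₁ (C - A) (C - B) C z) (Metric.ball 0 1) cutPlane z)
        cutPlane := fun z hz =>
      (differentiableAt_one_sub_cpow hz _).differentiableWithinAt.mul (h.1 z hz)
    refine ⟨_, hd, fun z hz => ?_⟩
    refine eq_of_segment_subset Metric.isOpen_ball (hd.mono ball_subset_cutPlane)
      (differentiableOn_hyp A B hC) (P₀ := 0) (fun t ht => by simpa using ball_segment hz ht) ?_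
    filter_upwards [Metric.ball_mem_nhds (0 : ℂ) (show (0 : ℝ) < 1 / 3 by norm_num)] with w hw
    rw [mem_ball_zero_iff] at hw
    rw [euler_small A B hC hw, h.2 (by rw [mem_ball_zero_iff]; linarith)]

theorem gauss_differentiableOn (A B : ℂ) {C : ℂ} (hC : NonPole C) :
    DifferentiableOn ℂ (gauss2F1 A B C) cutPlane :=
  (continuation_spec (hasContinuation_gauss A B hC)).1

theorem gauss_differentiableAt (A B : ℂ) {C : ℂ} (hC : NonPole C) {z : ℂ} (hz : z ∈ cutPlane) :
    DifferentiableAt ℂ (gauss2F1 A B C) z :=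
  (gauss_differentiableOn A B hC).differentiableAt (isOpen_cutPlane.mem_nhds hz)

theorem gauss_eq_hyp (A B : ℂ) {C : ℂ} (hC : NonPole C) {z : ℂ} (hz : ‖z‖ < 1) :
    gauss2F1 A B C z = ₂F₁ A B C z :=
  (continuation_spec (hasContinuation_gauss A B hC)).2 (mem_ball_zero_iff.2 hz)

theorem gauss_eq_of_near (A B : ℂ) {C : ℂ} (hC : NonPole C) {D : Set ℂ} (hD : IsOpen D)
    (hDc : D ⊆ cutPlane) {g : ℂ → ℂ} (hg : DifferentiableOn ℂ g D)
    (h0 : ∀ᶠ z in 𝓝 0, ₂F₁ A B C z = g z) {z : ℂ}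
    (hseg : ∀ t ∈ Set.Icc (0 : ℝ) 1, (t : ℂ) * z ∈ D) : gauss2F1 A B C z = g z := by
  refine eq_of_segment_subset hD ((gauss_differentiableOn A B hC).mono hDc) hg (P₀ := 0)
    (fun t ht => by simpa using hseg t ht) ?_
  filter_upwards [h0, Metric.ball_mem_nhds (0 : ℂ) one_pos] with w h1 h2
  rw [gauss_eq_hyp A B hC (mem_ball_zero_iff.1 h2), h1]

theorem gauss_euler (A B : ℂ) {C : ℂ} (hC : NonPole C) {z : ℂ} (hz : z ∈ cutPlane) :
    gauss2F1 A B C z = (1 - z) ^ (C - A - B) * gauss2F1 (C - A) (C - B) C z := by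
  refine gauss_eq_of_near A B hC isOpen_cutPlane subset_rfl
    (g := fun z => (1 - z) ^ (C - A - B) * gauss2F1 (C - A) (C - B) C z)
    (fun w hw => ((differentiableAt_one_sub_cpow hw _).mul
      (gauss_differentiableAt _ _ hC hw)).differentiableWithinAt) ?_
    (fun t ht => segment_mem_cutPlane hz ht)
  filter_upwards [Metric.ball_mem_nhds (0 : ℂ) (show (0 : ℝ) < 1 / 3 by norm_num)] with w hw
  rw [mem_ball_zero_iff] at hw
  rw [euler_small A B hC hw, gauss_eq_hyp _ _ hC (by linarith)]

theorem gauss_pfaff (A B : ℂ) {C : ℂ} (hC : NonPole C) {z : ℂ} (hz : z.re < 1 / 2) :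
    gauss2F1 A B C z = (1 - z) ^ (-A) * ₂F₁ A (C - B) C (z / (z - 1)) := by
  refine gauss_eq_of_near A B hC isOpen_re_lt_half (fun w hw => mem_cutPlane_of_re ?_)
    (differentiableOn_pfaff A (C - B) hC) ?_ (fun t ht => ?_)
  · have : w.re < 1 / 2 := hw
    linarith
  · filter_upwards [Metric.ball_mem_nhds (0 : ℂ) (show (0 : ℝ) < 1 / 3 by norm_num)] with w hw
    rw [mem_ball_zero_iff] at hw
    exact pfaff A B hC (by linarith) ((Complex.re_le_norm w).trans_lt (by linarith))
  · show ((t : ℂ) * z).re < 1 / 2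
    rw [Complex.re_ofReal_mul]
    have := ht.1
    have := ht.2
    rcases le_total 0 z.re with h | h <;> nlinarith

/-- At infinity no condition on `C - A - B` is needed: in Euler's transformation the power of `1 -
z` compensates exactly for the shift of `m` by `Re(C - A - B)`. -/
theorem exists_gauss_bound_far (A B : ℂ) {C : ℂ} (hC : NonPole C) {m : ℝ}
    (hmA : m < A.re) (hmB : m < B.re) :
    ∃ K : ℝ, 0 < K ∧ ∀ z ∈ cutPlane, 2 ≤ ‖z - 1‖ →
      ‖gauss2F1 A B C z‖ ≤ K * ‖z - 1‖ ^ (-m) := by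
  rcases lt_or_ge (-1) (C - A - B).re with hs | hs
  · exact exists_gauss_bound_far_of_re hC hs hmA hmB
  · have hs' : -1 < (C - (C - A) - (C - B)).re := by simp at hs ⊢; linarith
    obtain ⟨K, hK, hb⟩ := exists_gauss_bound_far_of_re hC hs' (m := (C - A - B).re + m)
      (by simp; linarith) (by simp; linarith)
    refine ⟨Real.exp (Real.pi * |(C - A - B).im|) * K, by positivity, fun z hz h2 => ?_⟩
    have h0 : 0 < ‖z - 1‖ := by linarith
    rw [gauss_euler A B hC hz, norm_mul]
    calc _ ≤ (Real.exp (Real.pi * |(C - A - B).im|) * ‖1 - z‖ ^ (C - A - B).re) *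
          (K * ‖z - 1‖ ^ (-((C - A - B).re + m))) :=
          mul_le_mul (norm_cpow_le_mul (Complex.slitPlane_ne_zero hz) _) (hb z hz h2)
            (norm_nonneg _) (by positivity)
      _ = _ := by
          rw [norm_sub_rev, show -((C - A - B).re + m) = -m - (C - A - B).re by ring,
            Real.rpow_sub h0]
          have := (Real.rpow_pos_of_pos h0 (C - A - B).re).ne'
          field_simp


/-! ### Euler integrals of `₂F₁` and Olsson's function -/

theorem mul_cpow_of_arg {x y : ℂ} (hx : x ≠ 0) (hy : y ≠ 0)
    (h : x.arg + y.arg ∈ Set.Ioc (-Real.pi) Real.pi) (e : ℂ) : (x * y) ^ e = x ^ e * y ^ e := by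
  rw [Complex.cpow_def_of_ne_zero (mul_ne_zero hx hy), Complex.cpow_def_of_ne_zero hx,
    Complex.cpow_def_of_ne_zero hy, Complex.log_mul hx hy h, add_mul, Complex.exp_add]

theorem mul_cpow_of_re_pos {x y : ℂ} (hx : 0 < x.re) (hy : 0 < y.re) (e : ℂ) :
    (x * y) ^ e = x ^ e * y ^ e := by
  have h1 : |x.arg| < Real.pi / 2 := Complex.abs_arg_lt_pi_div_two_iff.2 (Or.inl hx)
  have h2 : |y.arg| < Real.pi / 2 := Complex.abs_arg_lt_pi_div_two_iff.2 (Or.inl hy)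
  rw [abs_lt] at h1 h2
  refine mul_cpow_of_arg ?_ ?_ ⟨by linarith, by linarith⟩ e
  · rintro rfl; simp at hx
  · rintro rfl; simp at hy

theorem ofReal_mul_cpow {r : ℝ} (hr : 0 < r) {y : ℂ} (hy : y ≠ 0) (e : ℂ) :
    ((r : ℂ) * y) ^ e = (r : ℂ) ^ e * y ^ e := by
  refine mul_cpow_of_arg (by exact_mod_cast hr.ne') hy ?_ e
  rw [Complex.arg_ofReal_of_nonneg hr.le, zero_add]
  exact Complex.arg_mem_Ioc y

theorem neg_ofReal_div_mem_cutPlane {y : ℂ} (hy : y ∈ Complex.slitPlane) {w : ℝ} (hw : 0 ≤ w) :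
    -(w : ℂ) / y ∈ cutPlane := by
  have hinv : y⁻¹ ∈ Complex.slitPlane := by
    rw [Complex.mem_slitPlane_iff_arg] at hy ⊢
    refine ⟨?_, inv_ne_zero hy.2⟩
    rw [Complex.arg_inv, if_neg hy.1]
    intro h
    have := Complex.neg_pi_lt_arg y
    linarith
  rw [cutPlane, Set.mem_ofPred_eq, neg_div, sub_neg_eq_add, div_eq_mul_inv,
    Complex.mem_slitPlane_iff]
  rw [Complex.mem_slitPlane_iff] at hinv
  simp only [Complex.add_re, Complex.one_re, Complex.add_im, Complex.one_im,
    Complex.re_ofReal_mul, Complex.im_ofReal_mul, zero_add]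
  rcases hw.eq_or_lt with rfl | h0
  · left; simp
  · rcases hinv with h | h
    · left; positivity
    · right; exact mul_ne_zero h0.ne' h

/-- Decay of `₂F₁` along rays to infinity, locally uniformly in the direction. -/
theorem exists_gauss_ray_bound (A B : ℂ) {C : ℂ} (hC : NonPole C) {m : ℝ}
    (hmA : m < A.re) (hmB : m < B.re) {S : Set ℂ} (hS : IsCompact S)
    (hsl : S ⊆ Complex.slitPlane) :
    ∃ K : ℝ, 0 < K ∧ ∀ y ∈ S, ∀ w : ℝ, 0 ≤ w →
      ‖gauss2F1 A B C (-(w : ℂ) / y)‖ ≤ K * (1 + w) ^ (-m) := by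
  obtain ⟨K₁, hK₁, h1⟩ := exists_gauss_bound_far A B hC hmA hmB
  obtain ⟨M₁, hM₁⟩ := hS.exists_bound_of_continuousOn (f := fun y : ℂ => y) continuousOn_id
  obtain ⟨M₂, hM₂⟩ := hS.exists_bound_of_continuousOn (f := fun y : ℂ => y⁻¹)
    (fun y hy => (continuousAt_inv₀ (Complex.slitPlane_ne_zero (hsl hy))).continuousWithinAt)
  set M := max 1 (max M₁ M₂)
  have hM : 1 ≤ M := le_max_left _ _
  have hMb : ∀ y ∈ S, ‖y‖ ≤ M ∧ ‖y⁻¹‖ ≤ M := fun y hy =>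
    ⟨(hM₁ y hy).trans ((le_max_left _ _).trans (le_max_right _ _)),
      (hM₂ y hy).trans ((le_max_right _ _).trans (le_max_right _ _))⟩
  -- For `w ≤ 3 M` compactness is enough. For `w ≥ 3 M` the argument has norm at least `3`, hence
  -- distance at least `2` from `1`, and the bound at infinity applies.
  have hcomp : IsCompact (S ×ˢ Set.Icc (0 : ℝ) (3 * M)) := hS.prod isCompact_Icc
  obtain ⟨K₂, h2⟩ := hcomp.exists_bound_of_continuousOn
    (f := fun p : ℂ × ℝ => gauss2F1 A B C (-(p.2 : ℂ) / p.1)) (by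
      rintro ⟨y, w⟩ ⟨hy, hw⟩
      refine ContinuousAt.continuousWithinAt ?_
      have hz := neg_ofReal_div_mem_cutPlane (hsl hy) hw.1
      refine ContinuousAt.comp (f := fun p : ℂ × ℝ => -(p.2 : ℂ) / p.1)
        (gauss_differentiableAt A B hC hz).continuousAt ?_
      exact ContinuousAt.div (by fun_prop) (by fun_prop) (Complex.slitPlane_ne_zero (hsl hy)))
  refine ⟨K₁ * (4 * M) ^ |(-m)| + |K₂| * (1 + 3 * M) ^ |m|, by positivity, fun y hy w hw => ?_⟩
  obtain ⟨hy1, hy2⟩ := hMb y hy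
  have hy0 := Complex.slitPlane_ne_zero (hsl hy)
  have hz := neg_ofReal_div_mem_cutPlane (hsl hy) hw
  have hw1 : 0 < 1 + w := by linarith
  have hp : 0 < (1 + w) ^ (-m) := by positivity
  have hnz : ‖-(w : ℂ) / y‖ = w * ‖y⁻¹‖ := by
    rw [div_eq_mul_inv, norm_mul, norm_neg, Complex.norm_real, Real.norm_eq_abs, abs_of_nonneg hw]
  rcases le_total w (3 * M) with h | h
  · have h3 := rpow_le_of_comparable (a := 1 + w) (b := 1) (k := 1 + 3 * M) hw1 (by linarith)
      (by linarith) (by nlinarith) m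
    rw [Real.one_rpow, mul_one] at h3
    have h4 : 1 ≤ (1 + 3 * M) ^ |m| * (1 + w) ^ (-m) := by
      rw [Real.rpow_neg hw1.le, ← div_eq_mul_inv, one_le_div (by positivity)]
      exact h3
    calc _ ≤ |K₂| * 1 := by rw [mul_one]; exact (h2 (y, w) ⟨hy, hw, h⟩).trans (le_abs_self _)
      _ ≤ |K₂| * ((1 + 3 * M) ^ |m| * (1 + w) ^ (-m)) := by gcongr
      _ ≤ _ := by
          rw [add_mul, mul_assoc]
          have : 0 ≤ K₁ * (4 * M) ^ |-m| * (1 + w) ^ (-m) := by positivity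
          linarith
  · have hyi : 1 ≤ M * ‖y⁻¹‖ := by
      have : 1 = ‖y‖ * ‖y⁻¹‖ := by rw [← norm_mul, mul_inv_cancel₀ hy0, norm_one]
      rw [this]; gcongr
    have hge : w ≤ M * ‖-(w : ℂ) / y‖ := by
      rw [hnz]
      nlinarith
    have h5 := norm_sub_norm_le (-(w : ℂ) / y) 1
    have h6 := norm_sub_le (-(w : ℂ) / y) 1
    rw [norm_one] at h5 h6
    have h7 : 3 ≤ ‖-(w : ℂ) / y‖ := by
      by_contra hlt
      push Not at hlt
      nlinarith
    have h8 : ‖-(w : ℂ) / y‖ ≤ M * w := by rw [hnz, mul_comm]; gcongr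
    have h9 := rpow_le_of_comparable (a := ‖-(w : ℂ) / y - 1‖) (b := 1 + w) (k := 4 * M)
      (by linarith) (by linarith) (by nlinarith) (by nlinarith) (-m)
    calc _ ≤ K₁ * ‖-(w : ℂ) / y - 1‖ ^ (-m) := h1 _ hz (by linarith)
      _ ≤ K₁ * ((4 * M) ^ |-m| * (1 + w) ^ (-m)) := by gcongr
      _ ≤ _ := by
          rw [add_mul, mul_assoc]
          have : 0 ≤ |K₂| * (1 + 3 * M) ^ |m| * (1 + w) ^ (-m) := by positivity
          linarith

/-- For `u ∈ (0, 1)` the argument runs over the ray `-w / y` with `w = (1 - u)/u > 0`. So the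
endpoint `u = 0` corresponds to `₂F₁` at infinity and `u = 1` to its value at `0`. -/
theorem inv_mul_one_sub_inv {u : ℝ} (hu : u ∈ Set.Ioo (0 : ℝ) 1) (y : ℂ) :
    y⁻¹ * (1 - (u : ℂ)⁻¹) = -(((1 - u) / u : ℝ) : ℂ) / y := by
  have h : (u : ℂ) ≠ 0 := by exact_mod_cast hu.1.ne'
  push_cast
  field_simp
  ring

theorem segment_mem_slitPlane {x : ℂ} (hx : x ∈ cutPlane) {u : ℝ} (hu : u ∈ Set.Icc (0 : ℝ) 1) :
    1 - x * u ∈ Complex.slitPlane := by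
  have := segment_mem_cutPlane hx hu
  rwa [cutPlane, Set.mem_ofPred_eq, mul_comm] at this

/-- The integrand of Olsson's function. -/
noncomputable def eulerKernel (a b₁ b₂ c₁ c₂ : ℂ) (P : ℂ × ℂ) (u : ℝ) : ℂ :=
  (u : ℂ) ^ (a - b₂ - 1) * (1 - (u : ℂ)) ^ (-a + b₂ + c₁ - 1) * (1 - P.1 * u) ^ (-b₁) *
    (P.2 ^ (-b₂) * gauss2F1 b₂ (b₂ - c₂ + 1) (-a + b₂ + c₁) (P.2⁻¹ * (1 - (u : ℂ)⁻¹)))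

theorem isOpen_olssonFPDomain : IsOpen olssonFPDomain :=
  (isOpen_cutPlane.preimage continuous_fst).inter
    (Complex.isOpen_slitPlane.preimage continuous_snd)

theorem continuousOn_eulerKernel {a b₁ b₂ c₁ c₂ : ℂ} (hC : NonPole (-a + b₂ + c₁)) {P : ℂ × ℂ}
    (hP : P ∈ olssonFPDomain) : ContinuousOn (eulerKernel a b₁ b₂ c₁ c₂ P) (Set.Ioo 0 1) := by
  intro u hu
  refine ContinuousAt.continuousWithinAt ?_
  have h0 : (u : ℂ) ≠ 0 := by exact_mod_cast hu.1.ne'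
  have h1 : (u : ℂ) ∈ Complex.slitPlane := by simpa using hu.1
  have h2 : (1 - u : ℂ) ∈ Complex.slitPlane := Or.inl (by simpa using hu.2)
  have h3 := segment_mem_slitPlane hP.1 ⟨hu.1.le, hu.2.le⟩
  have h4 : P.2⁻¹ * (1 - (u : ℂ)⁻¹) ∈ cutPlane := by
    rw [inv_mul_one_sub_inv hu]
    have : 0 < 1 - u := by linarith [hu.2]
    exact neg_ofReal_div_mem_cutPlane hP.2 (div_nonneg this.le hu.1.le)
  have h5 : ContinuousAt (fun u : ℝ => gauss2F1 b₂ (b₂ - c₂ + 1) (-a + b₂ + c₁)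
      (P.2⁻¹ * (1 - (u : ℂ)⁻¹))) u :=
    ContinuousAt.comp (f := fun u : ℝ => P.2⁻¹ * (1 - (u : ℂ)⁻¹))
      (gauss_differentiableAt _ _ hC h4).continuousAt
      (continuousAt_const.mul (continuousAt_const.sub
        (ContinuousAt.inv₀ (by fun_prop) h0)))
  unfold eulerKernel
  exact (((ContinuousAt.cpow (by fun_prop) (by fun_prop) h1).mul
    (ContinuousAt.cpow (by fun_prop) (by fun_prop) h2)).mul
    (ContinuousAt.cpow (by fun_prop) (by fun_prop) h3)).mul (continuousAt_const.mul h5)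

theorem differentiableAt_eulerKernel {a b₁ b₂ c₁ c₂ : ℂ} (hC : NonPole (-a + b₂ + c₁)) {P : ℂ × ℂ}
    (hP : P ∈ olssonFPDomain) {u : ℝ} (hu : u ∈ Set.Ioo (0 : ℝ) 1) :
    DifferentiableAt ℂ (fun P => eulerKernel a b₁ b₂ c₁ c₂ P u) P := by
  have h3 := segment_mem_slitPlane hP.1 ⟨hu.1.le, hu.2.le⟩
  have h4 : P.2⁻¹ * (1 - (u : ℂ)⁻¹) ∈ cutPlane := by
    rw [inv_mul_one_sub_inv hu]
    have : 0 < 1 - u := by linarith [hu.2]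
    exact neg_ofReal_div_mem_cutPlane hP.2 (div_nonneg this.le hu.1.le)
  have h6 : DifferentiableAt ℂ (fun P : ℂ × ℂ => P.2⁻¹ * (1 - (u : ℂ)⁻¹)) P :=
    DifferentiableAt.mul (DifferentiableAt.fun_inv (by fun_prop) (Complex.slitPlane_ne_zero hP.2))
      (by fun_prop)
  have h5 : DifferentiableAt ℂ (fun P : ℂ × ℂ => gauss2F1 b₂ (b₂ - c₂ + 1) (-a + b₂ + c₁)
      (P.2⁻¹ * (1 - (u : ℂ)⁻¹))) P :=
    DifferentiableAt.comp (f := fun P : ℂ × ℂ => P.2⁻¹ * (1 - (u : ℂ)⁻¹)) P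
      (gauss_differentiableAt _ _ hC h4) h6
  have h7 : DifferentiableAt ℂ (fun P : ℂ × ℂ => 1 - P.1 * (u : ℂ)) P := by fun_prop
  unfold eulerKernel
  exact (DifferentiableAt.mul (by fun_prop) (h7.cpow_const h3)).mul
    ((DifferentiableAt.cpow_const (by fun_prop) hP.2).mul h5)

/-- At `u = 0` the Gauss function contributes `u^m` for any `m < Re b₂, Re(b₂ - c₂ + 1)`. The
conditions on `Re a` and `Re(a - c₂ + 1)` allow such an `m` with `Re(a - b₂) + m > 0`, and then the
whole kernel is dominated by an integrable Beta weight, locally uniformly in the arguments. -/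
theorem exists_eulerKernel_bound {a c₁ c₂ : ℂ} (b₁ : ℂ) {b₂ : ℂ} (ha : 0 < a.re)
    (hB : 0 < (a - c₂ + 1).re) (hβ : 0 < (b₂ + c₁ - a).re) {P₀ : ℂ × ℂ}
    (hP₀ : P₀ ∈ olssonFPDomain) :
    ∃ r : ℝ, 0 < r ∧ Metric.ball P₀ r ⊆ olssonFPDomain ∧ ∃ h : ℝ → ℝ,
      IntegrableOn h (Set.Ioo 0 1) ∧ ∀ P ∈ Metric.ball P₀ r, ∀ u ∈ Set.Ioo (0 : ℝ) 1,
        ‖eulerKernel a b₁ b₂ c₁ c₂ P u‖ ≤ h u := by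
  have hC : NonPole (-a + b₂ + c₁) := nonPole_of_re_pos (by simp at hβ ⊢; linarith)
  obtain ⟨m, hm0, hm⟩ : ∃ m : ℝ, -(a - b₂).re < m ∧ m < min b₂.re (b₂ - c₂ + 1).re :=
    exists_between (lt_min (by simp; linarith) (by simp at hB ⊢; linarith))
  obtain ⟨r, hr, hball⟩ := Metric.nhds_basis_closedBall.mem_iff.1
    (isOpen_olssonFPDomain.mem_nhds hP₀)
  have hcomp : IsCompact (Metric.closedBall P₀ r) := isCompact_closedBall _ _
  obtain ⟨K₁, hK₁, h1⟩ := exists_gauss_ray_bound b₂ (b₂ - c₂ + 1) hC (hm.trans_le (min_le_left _ _))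
    (hm.trans_le (min_le_right _ _)) (hcomp.image continuous_snd)
    (by rintro _ ⟨P, hP, rfl⟩; exact (hball hP).2)
  obtain ⟨K₂, h2⟩ := hcomp.exists_bound_of_continuousOn (f := fun P : ℂ × ℂ => P.2 ^ (-b₂))
    (fun P hP => ContinuousAt.continuousWithinAt
      (ContinuousAt.cpow (by fun_prop) (by fun_prop) (hball hP).2))
  obtain ⟨K₃, h3⟩ := (hcomp.prod (isCompact_Icc (a := (0 : ℝ)) (b := 1))).exists_bound_of_continuousOn
    (f := fun p : (ℂ × ℂ) × ℝ => (1 - p.1.1 * p.2) ^ (-b₁))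
    (fun p hp => ContinuousAt.continuousWithinAt
      (ContinuousAt.cpow (by fun_prop) (by fun_prop)
        (segment_mem_slitPlane (hball hp.1).1 hp.2)))
  refine ⟨r, hr, Metric.ball_subset_closedBall.trans hball,
    fun u => |K₃| * |K₂| * K₁ * (u ^ ((a - b₂).re + m - 1) * (1 - u) ^ ((-a + b₂ + c₁).re - 1)),
    (integrableOn_beta (by linarith) (by simp at hβ ⊢; linarith)).const_mul _,
    fun P hP u hu => ?_⟩
  have hP' := Metric.ball_subset_closedBall hP
  have hu1 : 0 < 1 - u := by linarith [hu.2]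
  have hu0 := hu.1
  have e1 : 1 + (1 - u) / u = u⁻¹ := by field_simp; ring
  have h1' := h1 P.2 ⟨P, hP', rfl⟩ ((1 - u) / u) (by positivity)
  rw [e1, Real.inv_rpow hu0.le, Real.rpow_neg hu0.le, inv_inv] at h1'
  have h2' := (h2 P hP').trans (le_abs_self _)
  have h3' := (h3 (P, u) ⟨hP', hu.1.le, hu.2.le⟩).trans (le_abs_self _)
  rw [eulerKernel, inv_mul_one_sub_inv hu, norm_mul, norm_mul, norm_beta_weight hu, norm_mul]
  calc _ ≤ u ^ ((a - b₂).re - 1) * (1 - u) ^ ((-a + b₂ + c₁).re - 1) * |K₃| *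
        (|K₂| * (K₁ * u ^ m)) := by gcongr
    _ = _ := by
        beta_reduce
        rw [show (a - b₂).re + m - 1 = ((a - b₂).re - 1) + m by ring, Real.rpow_add hu0]
        ring

theorem integrableOn_eulerKernel {a c₁ c₂ : ℂ} (b₁ : ℂ) {b₂ : ℂ} (ha : 0 < a.re)
    (hB : 0 < (a - c₂ + 1).re) (hβ : 0 < (b₂ + c₁ - a).re) {P : ℂ × ℂ}
    (hP : P ∈ olssonFPDomain) : IntegrableOn (eulerKernel a b₁ b₂ c₁ c₂ P) (Set.Ioo 0 1) := by
  have hC : NonPole (-a + b₂ + c₁) := nonPole_of_re_pos (by simp at hβ ⊢; linarith)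
  obtain ⟨r, hr, -, h, hh, hb⟩ := exists_eulerKernel_bound b₁ ha hB hβ hP
  refine Integrable.mono' hh
    ((continuousOn_eulerKernel hC hP).aestronglyMeasurable measurableSet_Ioo) ?_
  filter_upwards [ae_restrict_mem measurableSet_Ioo] with u hu
  exact hb P (Metric.mem_ball_self hr) u hu

theorem differentiableOn_integral_eulerKernel {a c₁ c₂ : ℂ} (b₁ : ℂ) {b₂ : ℂ} (ha : 0 < a.re)
    (hB : 0 < (a - c₂ + 1).re) (hβ : 0 < (b₂ + c₁ - a).re) :
    DifferentiableOn ℂ (fun P => ∫ u in Set.Ioo (0 : ℝ) 1, eulerKernel a b₁ b₂ c₁ c₂ P u)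
      olssonFPDomain := by
  intro P hP
  have hC : NonPole (-a + b₂ + c₁) := nonPole_of_re_pos (by simp at hβ ⊢; linarith)
  obtain ⟨r, hr, hsub, h, hh, hb⟩ := exists_eulerKernel_bound b₁ ha hB hβ hP
  refine (differentiableAt_integral_of_dominated hr (fun Q hQ =>
    (continuousOn_eulerKernel hC (hsub hQ)).aestronglyMeasurable measurableSet_Ioo) ?_ ?_
    hh).differentiableWithinAt
  · filter_upwards [ae_restrict_mem measurableSet_Ioo] with u hu Q hQ
    exact (differentiableAt_eulerKernel hC (hsub hQ) hu).differentiableWithinAt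
  · filter_upwards [ae_restrict_mem measurableSet_Ioo] with u hu Q hQ
    exact hb Q hQ u hu

/-- Pfaff's transformation in the integrand. -/
theorem cpow_mul_gauss_eq (A B : ℂ) {C : ℂ} (hC : NonPole C) {y : ℂ} (hy : 0 < y.re) {u : ℝ}
    (hu : u ∈ Set.Ioo (0 : ℝ) 1) :
    y ^ (-A) * gauss2F1 A B C (y⁻¹ * (1 - (u : ℂ)⁻¹)) = (u : ℂ) ^ A *
      ((1 - u * (1 - y)) ^ (-A) * ₂F₁ A (C - B) C ((1 - (u : ℂ)) / (1 - u * (1 - y)))) := by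
  have hu0 := hu.1
  have hu1 : 0 < 1 - u := by linarith [hu.2]
  have hu0' : (u : ℂ) ≠ 0 := by exact_mod_cast hu0.ne'
  have hy0 : y ≠ 0 := by rintro rfl; simp at hy
  set w : ℝ := (1 - u) / u with hw
  have hwpos : 0 < w := by positivity
  have hyinv : 0 < (y⁻¹).re := by
    rw [Complex.inv_re]
    exact div_pos hy (Complex.normSq_pos.2 hy0)
  have hz1 : 1 - -(w : ℂ) / y = 1 + (w : ℂ) * y⁻¹ := by field_simp; ring
  have hre1 : 0 < (1 + (w : ℂ) * y⁻¹).re := by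
    simp only [Complex.add_re, Complex.one_re, Complex.re_ofReal_mul]
    positivity
  have hprod : y * (1 + (w : ℂ) * y⁻¹) = ((u⁻¹ : ℝ) : ℂ) * (1 - u * (1 - y)) := by
    rw [hw]; push_cast; field_simp; ring
  have hq0 : (1 - u * (1 - y) : ℂ) ≠ 0 := by
    intro h
    rw [h, mul_zero] at hprod
    rcases mul_eq_zero.1 hprod with h | h
    · exact hy0 h
    · rw [h] at hre1; simp at hre1
  have hz2 : -(w : ℂ) / y / (-(w : ℂ) / y - 1) = (1 - (u : ℂ)) / (1 - u * (1 - y)) := by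
    have e : -(w : ℂ) / y - 1 = -(1 + (w : ℂ) * y⁻¹) := by rw [← hz1]; ring
    have h1 : (1 + (w : ℂ) * y⁻¹) ≠ 0 := by intro h; rw [h] at hre1; simp at hre1
    rw [e, div_div, mul_neg, hprod, neg_div_neg_eq, hw]
    push_cast
    field_simp
  rw [inv_mul_one_sub_inv hu, gauss_pfaff A B hC, hz1, ← mul_assoc, ← mul_cpow_of_re_pos hy hre1,
    hprod, ofReal_mul_cpow (inv_pos.2 hu0) hq0, hz2, Complex.ofReal_inv,
    inv_cpow_neg (by simpa using hu0), mul_assoc]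
  · rw [neg_div, Complex.neg_re, div_eq_mul_inv, Complex.re_ofReal_mul]
    have : 0 < w * (y⁻¹).re := by positivity
    linarith

/-- Pfaff's transformation contributes a factor `u^(b₂)`, which raises the exponent `a - b₂ - 1` to
`a - 1`. The kernel becomes the Beta-type integrand with `A = b₂`, `P = a`, `Q = a - c₂ + 1` and `q
= 1 - y`. -/
theorem eulerKernel_eq_betaHypIntegrand {a c₁ c₂ : ℂ} (b₁ : ℂ) {b₂ : ℂ}
    (hC : NonPole (-a + b₂ + c₁)) {P : ℂ × ℂ} (hP : 0 < P.2.re) {u : ℝ}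
    (hu : u ∈ Set.Ioo (0 : ℝ) 1) : eulerKernel a b₁ b₂ c₁ c₂ P u =
      betaHypIntegrand b₂ (-a + b₂ + c₁ - (a - c₂ + 1) + a - b₂) (-a + b₂ + c₁) a b₁ P.1
        (1 - P.2) u := by
  have hu0 : (u : ℂ) ≠ 0 := by exact_mod_cast hu.1.ne'
  rw [eulerKernel, betaHypIntegrand, cpow_mul_gauss_eq b₂ _ hC hP hu,
    show a - 1 = (a - b₂ - 1) + b₂ by ring, Complex.cpow_add _ _ hu0,
    show -a + b₂ + c₁ - (a - c₂ + 1) + a - b₂ = -a + b₂ + c₁ - (b₂ - c₂ + 1) by ring]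
  ring

theorem betaHyp_term_eq {β P Q c E : ℂ} (b A : ℂ) (hP : NonPole P) (hQ : NonPole Q) (hc : NonPole c)
    (hE : NonPole E) (i j : ℕ) :
    Complex.Gamma β * Complex.Gamma (P + i + j) * Complex.Gamma (Q + i) *
      ((Complex.Gamma (c + i))⁻¹ * (Complex.Gamma (E + i + j))⁻¹) *
      (poch b i * poch A j / (i.factorial * j.factorial)) =
    Complex.Gamma β * Complex.Gamma P * Complex.Gamma Q *
      ((Complex.Gamma c)⁻¹ * (Complex.Gamma E)⁻¹) *
      (poch P (i + j) * poch Q i * poch b i * poch A j /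
        (poch E (i + j) * poch c i * i.factorial * j.factorial)) := by
  have n1 := poch_ne_zero hc i
  have n2 := poch_ne_zero hE (i + j)
  have f1 : (i.factorial : ℂ) ≠ 0 := by exact_mod_cast i.factorial_ne_zero
  have f2 : (j.factorial : ℂ) ≠ 0 := by exact_mod_cast j.factorial_ne_zero
  rw [inv_Gamma_eq_poch_mul c i, inv_Gamma_eq_poch_mul E (i + j), add_assoc P, add_assoc E,
    ← Nat.cast_add, Gamma_add_nat hP, Gamma_add_nat hQ]
  generalize (Complex.Gamma (c + i))⁻¹ = y1
  generalize (Complex.Gamma (E + ((i + j : ℕ) : ℂ)))⁻¹ = y2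
  field_simp

theorem integral_eulerKernel_of_mem_disc {a c₁ c₂ : ℂ} (b₁ : ℂ) {b₂ : ℂ} (ha : 0 < a.re)
    (hB : 0 < (a - c₂ + 1).re) (hβ : 0 < (b₂ + c₁ - a).re) (hc₁ : NonPole c₁)
    (hE : NonPole (a + b₂ - c₂ + 1)) {P : ℂ × ℂ} (hP : P ∈ olssonFPDisc) :
    ∫ u in Set.Ioo (0 : ℝ) 1, eulerKernel a b₁ b₂ c₁ c₂ P u =
      Complex.Gamma (-a + b₂ + c₁) * Complex.Gamma a * Complex.Gamma (a - c₂ + 1) *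
        ((Complex.Gamma c₁)⁻¹ * (Complex.Gamma (a + b₂ - c₂ + 1))⁻¹) *
        olssonFPSeries a b₁ b₂ c₁ c₂ P := by
  have hβ' : 0 < (-a + b₂ + c₁).re := by simp at hβ ⊢; linarith
  have hyre : 0 < P.2.re := by
    have h1 := Complex.abs_re_le_norm (P.2 - 1)
    have h2 := hP.2
    rw [Complex.sub_re, Complex.one_re, abs_le] at h1
    linarith
  have hq : ‖1 - P.2‖ < 1 := by rw [norm_sub_rev]; exact hP.2
  have hS := (hasSum_betaHyp (A := b₂) (β := -a + b₂ + c₁) (P := a) (Q := a - c₂ + 1) (b := b₁)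
    (x := P.1) (q := 1 - P.2) hβ' ha hB hP.1 hq).2
  rw [setIntegral_congr_fun measurableSet_Ioo fun u hu =>
    eulerKernel_eq_betaHypIntegrand b₁ (nonPole_of_re_pos hβ') hyre hu, ← hS.tsum_eq,
    olssonFPSeries, ← tsum_mul_left]
  refine tsum_congr fun p => ?_
  have e1 : ((p.1 : ℤ) + (p.2 : ℤ)) = ((p.1 + p.2 : ℕ) : ℤ) := by push_cast; rfl
  rw [e1, show a + (-a + b₂ + c₁) - b₂ = c₁ by ring,
    show a - c₂ + 1 + b₂ = a + b₂ - c₂ + 1 by ring,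
    betaHyp_term_eq b₁ b₂ (nonPole_of_re_pos ha) (nonPole_of_re_pos hB) hc₁ hE]
  simp only [pochZ_natCast]
  ring

/-- Olsson's function as an Euler integral. -/
theorem olsson_euler {a c₁ c₂ : ℂ} (b₁ : ℂ) {b₂ : ℂ} (ha : 0 < a.re)
    (hB : 0 < (a - c₂ + 1).re) (hβ : 0 < (b₂ + c₁ - a).re) (hc₁ : NonPole c₁)
    (hE : NonPole (a + b₂ - c₂ + 1)) :
    HasContinuation (olssonFPSeries a b₁ b₂ c₁ c₂) olssonFPDisc olssonFPDomain ∧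
    ∀ P ∈ olssonFPDomain, ∫ u in Set.Ioo (0 : ℝ) 1, eulerKernel a b₁ b₂ c₁ c₂ P u =
      Complex.Gamma (-a + b₂ + c₁) * Complex.Gamma a * Complex.Gamma (a - c₂ + 1) *
        ((Complex.Gamma c₁)⁻¹ * (Complex.Gamma (a + b₂ - c₂ + 1))⁻¹) *
        olssonFP a b₁ b₂ c₁ c₂ P.1 P.2 := by
  have hβ' : 0 < (-a + b₂ + c₁).re := by simp at hβ ⊢; linarith
  have hκ0 : Complex.Gamma (-a + b₂ + c₁) * Complex.Gamma a * Complex.Gamma (a - c₂ + 1) *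
        ((Complex.Gamma c₁)⁻¹ * (Complex.Gamma (a + b₂ - c₂ + 1))⁻¹) ≠ 0 :=
    mul_ne_zero (mul_ne_zero (mul_ne_zero (nonPole_of_re_pos hβ').Gamma_ne_zero
      (nonPole_of_re_pos ha).Gamma_ne_zero) (nonPole_of_re_pos hB).Gamma_ne_zero)
      (mul_ne_zero (inv_ne_zero hc₁.Gamma_ne_zero) (inv_ne_zero hE.Gamma_ne_zero))
  have hdisc := fun P (hP : P ∈ olssonFPDisc) =>
    integral_eulerKernel_of_mem_disc b₁ ha hB hβ hc₁ hE hP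
  generalize Complex.Gamma (-a + b₂ + c₁) * Complex.Gamma a * Complex.Gamma (a - c₂ + 1) *
        ((Complex.Gamma c₁)⁻¹ * (Complex.Gamma (a + b₂ - c₂ + 1))⁻¹) = κ at *
  have hd := (differentiableOn_integral_eulerKernel (c₁ := c₁) b₁ ha hB hβ).const_mul κ⁻¹
  have heq : Set.EqOn (fun P => κ⁻¹ * ∫ u in Set.Ioo (0 : ℝ) 1, eulerKernel a b₁ b₂ c₁ c₂ P u)
      (olssonFPSeries a b₁ b₂ c₁ c₂) olssonFPDisc := by
    intro P hP
    beta_reduce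
    rw [hdisc P hP, inv_mul_cancel_left₀ hκ0]
  refine ⟨⟨_, hd, heq⟩, fun P hP => ?_⟩
  have hdo : IsOpen olssonFPDisc :=
    (isOpen_lt (f := fun P : ℂ × ℂ => ‖P.1‖) (by fun_prop) continuous_const).inter
      (isOpen_lt (f := fun P : ℂ × ℂ => ‖P.2 - 1‖) (by fun_prop) continuous_const)
  -- The domain is star-shaped about `(0, 1)`: the plane cut along `[1, ∞)` about `0`, and the plane
  -- cut along `(-∞, 0]` about `1`.
  have := continuation_eq_of_segment isOpen_olssonFPDomain hd heq (P₀ := ((0 : ℂ), (1 : ℂ)))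
    (P := P) (hdo.mem_nhds (by simp [olssonFPDisc])) (fun t ht => by
      constructor
      · simpa [cutPlane] using segment_mem_cutPlane hP.1 ht
      · have := segment_mem_cutPlane (z := 1 - P.2) (by simpa [cutPlane] using hP.2) ht
        rw [cutPlane, Set.mem_ofPred_eq] at this
        convert this using 1
        simp; ring)
  rw [olssonFP, show (P.1, P.2) = P from rfl, this, mul_inv_cancel_left₀ hκ0]


/-! ### The integrals over the segments -/

theorem ofReal_mem_olssonFPDomain {x y : ℝ} (hx : x < 1) (hy : 0 < y) :
    ((x : ℂ), (y : ℂ)) ∈ olssonFPDomain :=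
  ⟨mem_cutPlane_of_re (by simpa using hx), Complex.ofReal_mem_slitPlane.2 hy⟩

theorem integrandI₁_eq (a b₁ b₂ c₁ c₂ : ℂ) (x : ℝ) {y : ℝ} (hy : 0 < y) (u : ℝ) :
    integrandI₁ a b₁ b₂ c₁ c₂ x y u = (y : ℂ) ^ b₂ * eulerKernel a b₁ b₂ c₁ c₂ ((x : ℂ), (y : ℂ)) u := by
  have h : (y : ℂ) ^ b₂ * (y : ℂ) ^ (-b₂) = 1 := by
    rw [← Complex.cpow_add _ _ (by exact_mod_cast hy.ne'), add_neg_cancel, Complex.cpow_zero]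
  rw [integrandI₁, eulerKernel]
  linear_combination -((u : ℂ) ^ (a - b₂ - 1) * (1 - u : ℂ) ^ (-a + b₂ + c₁ - 1) *
    (1 - x * u : ℂ) ^ (-b₁) *
    gauss2F1 b₂ (b₂ - c₂ + 1) (-a + b₂ + c₁) ((y : ℂ)⁻¹ * (1 - (u : ℂ)⁻¹))) * h

theorem segmentI₁_eq {a b₁ b₂ c₁ c₂ : ℂ} {x y : ℝ} (hx : x < 1) (hy : 0 < y) (hc₁ : NonPole c₁)
    (ha : 0 < a.re) (hB : 0 < (a - c₂ + 1).re) (hβ : 0 < (b₂ + c₁ - a).re)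
    (hE : NonPole (a + b₂ - c₂ + 1)) :
    IntervalIntegrable (integrandI₁ a b₁ b₂ c₁ c₂ x y) volume 0 1 ∧
      HasContinuation (olssonFPSeries a b₁ b₂ c₁ c₂) olssonFPDisc olssonFPDomain ∧
      segmentI₁ a b₁ b₂ c₁ c₂ x y = const₁ a b₂ c₂ * olssonFP a b₁ b₂ c₁ c₂ x y := by
  have hP := ofReal_mem_olssonFPDomain hx hy
  obtain ⟨hcont, hint⟩ := olsson_euler b₁ ha hB hβ hc₁ hE
  have hI := integrableOn_eulerKernel b₁ ha hB hβ hP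
  have hC : NonPole (-a + b₂ + c₁) := nonPole_of_re_pos (by simp at hβ ⊢; linarith)
  have hfun : integrandI₁ a b₁ b₂ c₁ c₂ x y = fun u =>
      (y : ℂ) ^ b₂ * eulerKernel a b₁ b₂ c₁ c₂ ((x : ℂ), (y : ℂ)) u :=
    funext fun u => integrandI₁_eq a b₁ b₂ c₁ c₂ x hy u
  refine ⟨?_, hcont, ?_⟩
  · rw [intervalIntegrable_iff_integrableOn_Ioo_of_le zero_le_one, hfun]
    exact hI.const_mul _
  · rw [segmentI₁, hfun, intervalIntegral.integral_const_mul,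
      intervalIntegral.integral_of_le zero_le_one, integral_Ioc_eq_integral_Ioo, hint _ hP, const₁]
    have h : (y : ℂ) ^ (-b₂) * (y : ℂ) ^ b₂ = 1 := by
      rw [← Complex.cpow_add _ _ (by exact_mod_cast hy.ne'), neg_add_cancel, Complex.cpow_zero]
    have h1 := hc₁.Gamma_ne_zero
    have h2 := hC.Gamma_ne_zero
    simp only [div_eq_mul_inv, mul_inv]
    generalize (Complex.Gamma (a - b₂))⁻¹ = z1
    generalize (Complex.Gamma (a + b₂ - c₂ + 1))⁻¹ = z2
    generalize olssonFP a b₁ b₂ c₁ c₂ x y = z3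
    generalize (y : ℂ) ^ (-b₂) = z4 at *
    generalize (y : ℂ) ^ b₂ = z5 at *
    field_simp
    linear_combination Complex.Gamma a * Complex.Gamma (a - c₂ + 1) * z1 * z2 * z3 * h

theorem ofReal_cpow_eq_exp {r : ℝ} (hr : 0 < r) (e : ℂ) :
    (r : ℂ) ^ e = Complex.exp (e * (Real.log r : ℂ)) := by
  rw [Complex.cpow_def_of_ne_zero (by exact_mod_cast hr.ne'), ← Complex.ofReal_log hr.le, mul_comm]

/-- Pfaff's transformation makes the density a Gauss function of negative argument. This is why the
jump integral is again of Olsson's type. -/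
theorem rho_eq_gauss (A B C : ℂ) (hs : -1 < (C - A - B).re) {w : ℝ} (hw : 0 < w) :
    rho A B C w = (w : ℂ) ^ (C - A - B) * ((1 + w : ℝ) : ℂ) ^ (1 - C) *
      gauss2F1 (1 - B) (1 - A) (C - A - B + 1) (-(w : ℂ)) := by
  have h1 : (0 : ℝ) < 1 + w := by linarith
  have h1' : ((1 + w : ℝ) : ℂ) ≠ 0 := by exact_mod_cast h1.ne'
  rw [gauss_pfaff _ _ (nonPole_add_one_of_re hs) (by simp; linarith), rho, hyp_comm (C - B),
    show C - A - B + 1 - (1 - A) = C - B by ring, ← neg_div_neg_eq (w : ℂ),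
    show -(1 + (w : ℂ)) = -w - 1 by ring, sub_neg_eq_add,
    show 1 + (w : ℂ) = ((1 + w : ℝ) : ℂ) by push_cast; rfl,
    show -(C - B) = (1 - C) + -(1 - B) by ring, Complex.cpow_add _ _ h1']
  ring

/-- The jump is a multiple of the density at `X - 1 = (y - 1)(1 - v)/(y v)`, and the density
contains a Gauss function at `-(X - 1)` with upper parameters `c₂ - b₂` and `1 - b₂`. This is the
Gauss factor of Olsson's kernel after `b₂` is replaced by `c₂ - b₂` and `y` by `y/(y - 1)`. -/
theorem integrandI₂_eq {a b₁ b₂ c₁ c₂ : ℂ} (x : ℝ) {y v : ℝ} (hy : 1 < y)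
    (hv : v ∈ Set.Ioo (0 : ℝ) 1) (hC : NonPole (-a + b₂ + c₁))
    (hs : 0 < (c₁ + c₂ - a - b₂).re) :
    integrandI₂ a b₁ b₂ c₁ c₂ x y (v / (1 - y)) =
      2 * Real.pi * Complex.I * stieltjesConst b₂ (b₂ - c₂ + 1) (-a + b₂ + c₁) *
        (((y - 1 : ℝ) : ℂ) ^ (1 - a) * (y : ℂ) ^ b₂) *
        eulerKernel a b₁ (c₂ - b₂) c₁ c₂ ((((x / (1 - y) : ℝ) : ℂ)), ((y / (y - 1) : ℝ) : ℂ)) v := by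
  have hs' : -1 < (-a + b₂ + c₁ - b₂ - (b₂ - c₂ + 1)).re := by simp at hs ⊢; linarith
  have hy0 : 0 < y := by linarith
  have hT : 0 < y - 1 := by linarith
  have hT' : (1 - y) ≠ 0 := by linarith
  have hv0 := hv.1
  have hv1 : 0 < 1 - v := by linarith [hv.2]
  have hvy : 0 < v + (y - 1) := by linarith
  have hX : y⁻¹ * (1 - (v / (1 - y))⁻¹) = (v + (y - 1)) / (y * v) := by field_simp; ring
  have hX1 : 1 < (v + (y - 1)) / (y * v) := by
    rw [one_lt_div (by positivity)]; nlinarith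
  have hw : (v + (y - 1)) / (y * v) - 1 = (y - 1) * (1 - v) / (y * v) := by field_simp; ring
  have hw0 : 0 < (y - 1) * (1 - v) / (y * v) := by positivity
  have hw1 : 1 + (y - 1) * (1 - v) / (y * v) = (v + (y - 1)) / (y * v) := by linarith
  have e1 : (-((v / (1 - y) : ℝ) : ℂ)) = ((v / (y - 1) : ℝ) : ℂ) := by
    rw [← Complex.ofReal_neg]; congr 1; rw [← div_neg]; congr 1; ring
  have e2 : (1 - ((v / (1 - y) : ℝ) : ℂ)) = (((v + (y - 1)) / (y - 1) : ℝ) : ℂ) := by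
    rw [← Complex.ofReal_one, ← Complex.ofReal_sub]; congr 1
    have := hT.ne'
    field_simp; ring
  have e3 : (1 - (x : ℂ) * ((v / (1 - y) : ℝ) : ℂ)) = 1 - ((x / (1 - y) : ℝ) : ℂ) * v := by
    push_cast; ring
  have e4 : (((y / (y - 1) : ℝ) : ℂ))⁻¹ * (1 - (v : ℂ)⁻¹) =
      -(((y - 1) * (1 - v) / (y * v) : ℝ) : ℂ) := by
    have := hT.ne'
    rw [← Complex.ofReal_inv, ← Complex.ofReal_inv, ← Complex.ofReal_one, ← Complex.ofReal_sub,
      ← Complex.ofReal_mul, ← Complex.ofReal_neg]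
    congr 1
    field_simp; ring
  have e5 : (1 - (v : ℂ)) = ((1 - v : ℝ) : ℂ) := by push_cast; rfl
  simp only [integrandI₂, eulerKernel]
  rw [hX, gauss_jump hC hs' hX1, hw, rho_eq_gauss _ _ _ hs' hw0, hw1, e1, e2, e3, e4, e5,
    show c₂ - b₂ - c₂ + 1 = 1 - b₂ by ring, show 1 - (b₂ - c₂ + 1) = c₂ - b₂ by ring,
    show -a + b₂ + c₁ - b₂ - (b₂ - c₂ + 1) + 1 = -a + (c₂ - b₂) + c₁ by ring]
  generalize gauss2F1 (c₂ - b₂) (1 - b₂) (-a + (c₂ - b₂) + c₁) _ = G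
  generalize (1 - ((x / (1 - y) : ℝ) : ℂ) * v) ^ (-b₁) = D
  generalize stieltjesConst b₂ (b₂ - c₂ + 1) (-a + b₂ + c₁) = κ
  -- All bases are positive reals. Writing the powers as exponentials reduces the identity to one
  -- between linear combinations of `log v`, `log (1 - v)`, `log y`, `log (y - 1)` and `log (v + y -
  -- 1)`.
  have key : ((v / (y - 1) : ℝ) : ℂ) ^ (a - b₂ - 1) *
      (((v + (y - 1)) / (y - 1) : ℝ) : ℂ) ^ (-a + b₂ + c₁ - 1) *
      ((((y - 1) * (1 - v) / (y * v) : ℝ) : ℂ) ^ (-a + b₂ + c₁ - b₂ - (b₂ - c₂ + 1)) *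
        (((v + (y - 1)) / (y * v) : ℝ) : ℂ) ^ (1 - (-a + b₂ + c₁))) =
      ((y - 1 : ℝ) : ℂ) ^ (1 - a) * (y : ℂ) ^ b₂ * ((v : ℂ) ^ (a - (c₂ - b₂) - 1) *
        ((1 - v : ℝ) : ℂ) ^ (-a + (c₂ - b₂) + c₁ - 1) * ((y / (y - 1) : ℝ) : ℂ) ^ (-(c₂ - b₂))) := by
    rw [ofReal_cpow_eq_exp (by positivity), ofReal_cpow_eq_exp (by positivity),
      ofReal_cpow_eq_exp hw0, ofReal_cpow_eq_exp (by positivity), ofReal_cpow_eq_exp hT,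
      ofReal_cpow_eq_exp hy0, ofReal_cpow_eq_exp hv0, ofReal_cpow_eq_exp hv1,
      ofReal_cpow_eq_exp (by positivity)]
    rw [Real.log_div hv0.ne' hT.ne', Real.log_div hvy.ne' hT.ne',
      Real.log_div (by positivity) (by positivity), Real.log_mul hT.ne' hv1.ne',
      Real.log_mul hy0.ne' hv0.ne', Real.log_div hvy.ne' (by positivity),
      Real.log_mul hy0.ne' hv0.ne', Real.log_div hy0.ne' hT.ne']
    simp only [← Complex.exp_add]
    congr 1
    push_cast
    ring
  linear_combination 2 * Real.pi * Complex.I * κ * G * D * key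

theorem segmentI₂_eq {a b₁ b₂ c₁ c₂ : ℂ} {x y : ℝ} (hxy : 1 < x + y) (hx : x < 0)
    (hc₁ : NonPole c₁)
    (ha : 0 < a.re) (hB : 0 < (a - c₂ + 1).re) (hs : 0 < (c₁ + c₂ - a - b₂).re)
    (hE : NonPole (a - b₂ + 1)) (hC : NonPole (-a + b₂ + c₁)) :
    IntervalIntegrable (integrandI₂ a b₁ b₂ c₁ c₂ x y) volume (1 - y)⁻¹ 0 ∧
      HasContinuation (olssonFPSeries a b₁ (c₂ - b₂) c₁ c₂) olssonFPDisc olssonFPDomain ∧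
      segmentI₂ a b₁ b₂ c₁ c₂ x y = const₂ a b₂ c₂ * (y - 1 : ℂ) ^ (-a) *
        olssonFP a b₁ (c₂ - b₂) c₁ c₂ (x / (1 - y)) (y / (y - 1)) := by
  have hy : 1 < y := by linarith
  have hT : 0 < y - 1 := by linarith
  have hT0 : (1 - y) ≠ 0 := by linarith
  have hTc : ((y - 1 : ℝ) : ℂ) ≠ 0 := by exact_mod_cast hT.ne'
  have hx' : x / (1 - y) < 1 := by
    rw [div_lt_one_of_neg (by linarith)]; linarith
  have hy' : 0 < y / (y - 1) := by positivity
  have hP := ofReal_mem_olssonFPDomain hx' hy'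
  have hβ : 0 < (c₂ - b₂ + c₁ - a).re := by simp at hs ⊢; linarith
  have hE' : NonPole (a + (c₂ - b₂) - c₂ + 1) := by
    rwa [show a + (c₂ - b₂) - c₂ + 1 = a - b₂ + 1 by ring]
  obtain ⟨hcont, hint⟩ := olsson_euler b₁ ha hB hβ hc₁ hE'
  have hI := integrableOn_eulerKernel b₁ ha hB hβ hP
  set K := eulerKernel a b₁ (c₂ - b₂) c₁ c₂ ((((x / (1 - y) : ℝ) : ℂ)), ((y / (y - 1) : ℝ) : ℂ))
    with hK
  obtain ⟨Q, hQ⟩ : ∃ Q : ℂ, Q = 2 * Real.pi * Complex.I *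
    stieltjesConst b₂ (b₂ - c₂ + 1) (-a + b₂ + c₁) *
        (((y - 1 : ℝ) : ℂ) ^ (1 - a) * (y : ℂ) ^ b₂) := ⟨_, rfl⟩
  have hle : (1 - y)⁻¹ ≤ 0 := by rw [inv_nonpos]; linarith
  have hpt : Set.EqOn (fun u : ℝ => Q * K (u * (1 - y))) (integrandI₂ a b₁ b₂ c₁ c₂ x y)
      (Set.Ioo (1 - y)⁻¹ 0) := by
    intro u hu
    have h1 : u * (1 - y) ∈ Set.Ioo (0 : ℝ) 1 := by
      refine ⟨by nlinarith [hu.2], ?_⟩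
      have := mul_lt_mul_of_neg_right hu.1 (show 1 - y < 0 by linarith)
      rwa [inv_mul_cancel₀ hT0] at this
    have := integrandI₂_eq (b₁ := b₁) x hy h1 hC hs
    rw [mul_div_cancel_right₀ _ hT0] at this
    simp only
    rw [this, hQ]
  -- The limits are reversed because `v = u (1 - y)` decreases in `u`.
  have hKi : IntervalIntegrable K volume 1 0 := by
    refine IntervalIntegrable.symm ?_
    rwa [intervalIntegrable_iff_integrableOn_Ioo_of_le zero_le_one]
  have hKi' := (hKi.comp_mul_right (c := 1 - y)).const_mul Q
  rw [zero_div, one_div] at hKi'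
  refine ⟨?_, hcont, ?_⟩
  · rw [intervalIntegrable_iff_integrableOn_Ioo_of_le hle] at hKi' ⊢
    exact hKi'.congr_fun hpt measurableSet_Ioo
  · have hval : ∫ u in ((1 - y)⁻¹)..(0 : ℝ), integrandI₂ a b₁ b₂ c₁ c₂ x y u =
        Q * (((y - 1 : ℝ) : ℂ)⁻¹ * ∫ v in Set.Ioo (0 : ℝ) 1, K v) := by
      rw [intervalIntegral.integral_of_le hle, integral_Ioc_eq_integral_Ioo,
        ← setIntegral_congr_fun measurableSet_Ioo hpt, ← integral_Ioc_eq_integral_Ioo,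
        ← intervalIntegral.integral_of_le hle, intervalIntegral.integral_const_mul,
        intervalIntegral.integral_comp_mul_right K hT0, inv_mul_cancel₀ hT0, zero_mul,
        intervalIntegral.integral_symm, intervalIntegral.integral_of_le zero_le_one,
        integral_Ioc_eq_integral_Ioo, Complex.real_smul]
      congr 1
      rw [show (1 - y)⁻¹ = -(y - 1)⁻¹ by rw [← inv_neg]; congr 1; ring]
      push_cast
      ring
    -- The jump contributes `2πi` and `Γ(-a + b₂ + c₁)`, which cancel against the prefactor; `Γ(-a +
    -- (c₂ - b₂) + c₁)` cancels between the jump and the Euler integral, and so does `Γ(c₁)`. The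
    -- factors `1/Γ(b₂)` and `1/Γ(b₂ - c₂ + 1)` may vanish and are kept as inverses.
    rw [segmentI₂, hval, hint _ hP, hQ, const₂, stieltjesConst]
    have h : (y : ℂ) ^ (-b₂) * (y : ℂ) ^ b₂ = 1 := by
      rw [← Complex.cpow_add _ _ (by exact_mod_cast (by linarith : y ≠ 0)), neg_add_cancel,
        Complex.cpow_zero]
    have h' : ((y - 1 : ℝ) : ℂ) ^ (1 - a) * ((y - 1 : ℝ) : ℂ)⁻¹ = (y - 1 : ℂ) ^ (-a) := by
      rw [sub_eq_add_neg 1 a, Complex.cpow_add _ _ hTc, Complex.cpow_one, mul_comm,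
        inv_mul_cancel_left₀ hTc]
      push_cast; rfl
    have e1 : ((x / (1 - y) : ℝ) : ℂ) = (x : ℂ) / (1 - y) := by push_cast; rfl
    have e2 : ((y / (y - 1) : ℝ) : ℂ) = (y : ℂ) / (y - 1) := by push_cast; rfl
    have h1 := hc₁.Gamma_ne_zero
    have h2 := hC.Gamma_ne_zero
    have h3 : Complex.Gamma (-a + (c₂ - b₂) + c₁) ≠ 0 :=
      (nonPole_of_re_pos (by simp at hs ⊢; linarith)).Gamma_ne_zero
    have h4 : (2 * Real.pi * Complex.I : ℂ) ≠ 0 := Complex.two_pi_I_ne_zero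
    simp only
    rw [e1, e2, show -a + b₂ + c₁ - b₂ - (b₂ - c₂ + 1) + 1 = -a + (c₂ - b₂) + c₁ by ring,
      show a + (c₂ - b₂) - c₂ + 1 = a - b₂ + 1 by ring, show -a + b₂ + 1 = b₂ - a + 1 by ring,
      ← h']
    simp only [div_eq_mul_inv, mul_inv]
    generalize (Complex.Gamma (a - b₂ + 1))⁻¹ = z1
    generalize (Complex.Gamma b₂)⁻¹ = z2
    generalize (Complex.Gamma (b₂ - c₂ + 1))⁻¹ = z6
    generalize olssonFP a b₁ (c₂ - b₂) c₁ c₂ _ _ = z3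
    generalize (y : ℂ) ^ (-b₂) = z4 at *
    generalize (y : ℂ) ^ b₂ = z5 at *
    generalize ((y - 1 : ℝ) : ℂ) ^ (1 - a) = z7
    generalize ((y - 1 : ℝ) : ℂ)⁻¹ = z8
    generalize Complex.Gamma (-a + (c₂ - b₂) + c₁) = g1 at *
    generalize Complex.Gamma (-a + b₂ + c₁) = g2 at *
    generalize Complex.Gamma c₁ = g3 at *
    generalize Complex.Gamma (b₂ - a + 1) = g4 at *
    have h5 : g1⁻¹ * g1 = 1 := inv_mul_cancel₀ h3
    have h6 : g2⁻¹ * g2 = 1 := inv_mul_cancel₀ h2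
    have h7 : g3 * g3⁻¹ = 1 := mul_inv_cancel₀ h1
    have hpi : (Real.pi : ℂ) * (Real.pi : ℂ)⁻¹ = 1 :=
      mul_inv_cancel₀ (by exact_mod_cast Real.pi_ne_zero)
    have hII : Complex.I * Complex.I⁻¹ = 1 := mul_inv_cancel₀ Complex.I_ne_zero
    calc _ = (z4 * z5) * (g1⁻¹ * g1) * (g2⁻¹ * g2) * (g3 * g3⁻¹) *
          ((Real.pi : ℂ) * (Real.pi : ℂ)⁻¹) * (Complex.I * Complex.I⁻¹) *
          (g4 * Complex.Gamma a * Complex.Gamma (a - c₂ + 1) * (z2 * z1 * z6) *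
            (z7 * z8) * z3) := by ring
      _ = _ := by rw [h, h5, h6, h7, hpi, hII]; ring

theorem exists_gauss_limits {A B C : ℂ} (hC : NonPole C) (hs : -1 < (C - A - B).re) {X : ℝ}
    (hX : 1 < X) : ∃ L₁ L₂ : ℂ,
      Tendsto (fun ε : ℝ => gauss2F1 A B C (X + ε * Complex.I)) (𝓝[>] (0 : ℝ)) (𝓝 L₁) ∧
      Tendsto (fun ε : ℝ => gauss2F1 A B C (X - ε * Complex.I)) (𝓝[>] (0 : ℝ)) (𝓝 L₂) := by
  obtain ⟨L₁, h1⟩ := exists_tendsto_gauss_boundary hC hs (σ := 1) (by simp) hX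
  obtain ⟨L₂, h2⟩ := exists_tendsto_gauss_boundary hC hs (σ := -1) (by simp) hX
  refine ⟨L₁, L₂, (h1.comp (tendsto_add_mul_I 1 X (by simp))).congr fun ε => by simp,
    (h2.comp (tendsto_add_mul_I (-1) X (by simp))).congr fun ε => by simp [sub_eq_add_neg]⟩


/-! ### Continuation of Horn's function -/

theorem differentiableAt_doubleSeries {c : ℕ × ℕ → ℂ} {X Y : ℝ}
    (hs : Summable fun k : ℕ × ℕ => ‖c k‖ * X ^ k.1 * Y ^ k.2) {P : ℂ × ℂ} (h1 : ‖P.1‖ < X)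
    (h2 : ‖P.2‖ < Y) : DifferentiableAt ℂ (fun P : ℂ × ℂ => ∑' k, c k * P.1 ^ k.1 * P.2 ^ k.2) P := by
  refine differentiableAt_tsum_of_dominated (r := min (X - ‖P.1‖) (Y - ‖P.2‖))
    (lt_min (by linarith) (by linarith)) (fun k => by fun_prop) (fun k Q hQ => ?_) hs
  rw [mem_ball_iff_norm] at hQ
  have hQ1 : ‖Q.1‖ ≤ X := by
    have h3 : ‖(Q - P).1‖ < X - ‖P.1‖ := (norm_fst_le _).trans_lt (hQ.trans_le (min_le_left _ _))
    have := norm_le_norm_add_norm_sub' Q.1 P.1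
    rw [Prod.fst_sub] at h3
    linarith
  have hQ2 : ‖Q.2‖ ≤ Y := by
    have h3 : ‖(Q - P).2‖ < Y - ‖P.2‖ := (norm_snd_le _).trans_lt (hQ.trans_le (min_le_right _ _))
    have := norm_le_norm_add_norm_sub' Q.2 P.2
    rw [Prod.snd_sub] at h3
    linarith
  have hX0 : 0 ≤ X := (norm_nonneg _).trans h1.le
  rw [norm_mul, norm_mul, norm_pow, norm_pow]
  gcongr

/-! ### Coefficient bounds for the `H₂` series and its Pfaff transform -/

theorem rpow_le_natPow {n : ℕ} {e : ℝ} {σ : ℕ} (h : e ≤ σ) :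
    ((n : ℝ) + 1) ^ e ≤ ((n : ℝ) + 1) ^ σ := by
  rw [← Real.rpow_natCast]
  exact Real.rpow_le_rpow_of_exponent_le (by linarith [(Nat.cast_nonneg n : (0 : ℝ) ≤ n)]) h

/-- The bound holds for all sufficiently large natural exponents, so bounds for several Pochhammer
symbols can be given a common exponent. -/
theorem exists_norm_poch_le_pow (s : ℂ) : ∃ (K : ℝ) (σ₀ : ℕ), 0 < K ∧ ∀ σ : ℕ, σ₀ ≤ σ → ∀ n : ℕ,
    ‖poch s n‖ ≤ K * (n.factorial * ((n : ℝ) + 1) ^ σ) := by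
  obtain ⟨K, hK, h⟩ := exists_norm_poch_le s
  obtain ⟨σ₀, hσ⟩ := exists_nat_ge (s.re - 1)
  refine ⟨K, σ₀, hK, fun σ hle n => (h n).trans ?_⟩
  have := rpow_le_natPow (n := n) (hσ.trans (Nat.cast_le.2 hle))
  gcongr

theorem exists_le_norm_poch_pow {s : ℂ} (hs : NonPole s) : ∃ (K : ℝ) (σ₀ : ℕ), 0 < K ∧
    ∀ σ : ℕ, σ₀ ≤ σ → ∀ n : ℕ, n.factorial ≤ K * ((n : ℝ) + 1) ^ σ * ‖poch s n‖ := by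
  obtain ⟨K, hK, h⟩ := exists_le_norm_poch hs
  obtain ⟨σ₀, hσ⟩ := exists_nat_ge (-(s.re - 1))
  refine ⟨K, σ₀, hK, fun σ hle n => ?_⟩
  have h1 := rpow_le_natPow (n := n) (hσ.trans (Nat.cast_le.2 hle))
  have hn : (0 : ℝ) < n + 1 := by positivity
  have h2 : ((n : ℝ) + 1) ^ (s.re - 1) * ((n : ℝ) + 1) ^ (-(s.re - 1)) = 1 := by
    rw [← Real.rpow_add hn, add_neg_cancel, Real.rpow_zero]
  calc (n.factorial : ℝ) = n.factorial * ((n : ℝ) + 1) ^ (s.re - 1) *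
        ((n : ℝ) + 1) ^ (-(s.re - 1)) := by rw [mul_assoc, h2, mul_one]
    _ ≤ K * ‖poch s n‖ * ((n : ℝ) + 1) ^ σ := by
        have := h n
        gcongr
    _ = _ := by ring

theorem exists_pow_mul_geometric_le (σ : ℕ) {r r' : ℝ} (hr : 0 ≤ r) (hrr : r < r') :
    ∃ K : ℝ, 0 < K ∧ ∀ n : ℕ, ((n : ℝ) + 1) ^ σ * r ^ n ≤ K * r' ^ n := by
  have hr' : 0 < r' := hr.trans_lt hrr
  obtain ⟨q, hq, hq1⟩ := exists_between ((div_lt_one hr').2 hrr)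
  have hq0 : 0 < q := (div_nonneg hr hr'.le).trans_lt hq
  have ht := (tendsto_pow_const_mul_const_pow_of_lt_one σ hq0.le hq1).comp (tendsto_add_atTop_nat 1)
  obtain ⟨K, hK⟩ := ht.bddAbove_range
  refine ⟨max K 1 / q, by positivity, fun n => ?_⟩
  have h1 := hK ⟨n, rfl⟩
  simp only [Function.comp_apply, Nat.cast_add, Nat.cast_one] at h1
  have h2 : ((n : ℝ) + 1) ^ σ * q ^ n ≤ max K 1 / q := by
    rw [le_div_iff₀ hq0, mul_assoc, ← pow_succ]
    exact h1.trans (le_max_left _ _)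
  have h3 : r ≤ q * r' := by rw [div_lt_iff₀ hr'] at hq; exact hq.le
  calc ((n : ℝ) + 1) ^ σ * r ^ n ≤ ((n : ℝ) + 1) ^ σ * (q * r') ^ n := by gcongr
    _ = ((n : ℝ) + 1) ^ σ * q ^ n * r' ^ n := by rw [mul_pow]; ring
    _ ≤ _ := by gcongr

theorem nonPole_one_sub {α : ℂ} (hα : ∀ n : ℤ, α ≠ n) : NonPole (1 - α) := by
  intro n hn
  apply hα (n + 1)
  push_cast
  linear_combination -hn

theorem nonPole_of_not_int {α : ℂ} (hα : ∀ n : ℤ, α ≠ n) : NonPole α := by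
  intro n hn
  apply hα (-n)
  rw [hn]; push_cast; rfl

/-- For `j ≤ i` one uses `(i - j)! j! ≤ i!`; for `i ≤ j` the symbol is of order `1/(j - i)!` and
`j!/(j - i)! = i! (j choose i)`. Polynomial factors are absorbed in the powers. Since `α` is not an
integer, `(1 - α)_n` never vanishes. -/
theorem exists_norm_pochZ_le {α : ℂ} (hα : ∀ n : ℤ, α ≠ n) : ∃ (K : ℝ) (σ₀ : ℕ), 0 < K ∧
    ∀ σ : ℕ, σ₀ ≤ σ → ∀ i j : ℕ, ‖pochZ α ((i : ℤ) - j)‖ * j.factorial ≤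
      K * (((i : ℝ) + 1) ^ σ * ((j : ℝ) + 1) ^ σ) * i.factorial * (1 + j.choose i) := by
  obtain ⟨K₁, σ₁, hK₁, h1⟩ := exists_norm_poch_le_pow α
  obtain ⟨K₂, σ₂, hK₂, h2⟩ := exists_le_norm_poch_pow (nonPole_one_sub hα)
  refine ⟨K₁ + K₂, max σ₁ σ₂, by positivity, fun σ hσ i j => ?_⟩
  have hi1 : (1 : ℝ) ≤ ((i : ℝ) + 1) ^ σ :=
    one_le_pow₀ (by linarith [(Nat.cast_nonneg i : (0 : ℝ) ≤ i)])
  have hj1 : (1 : ℝ) ≤ ((j : ℝ) + 1) ^ σ :=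
    one_le_pow₀ (by linarith [(Nat.cast_nonneg j : (0 : ℝ) ≤ j)])
  rcases le_total j i with h | h
  · obtain ⟨n, rfl⟩ := Nat.exists_eq_add_of_le h
    rw [show (((j + n : ℕ) : ℤ) - j) = (n : ℤ) by push_cast; ring, pochZ_natCast]
    have h3 : ((j.factorial * n.factorial : ℕ) : ℝ) ≤ (j + n).factorial := by
      exact_mod_cast Nat.le_of_dvd (Nat.factorial_pos _) (Nat.factorial_mul_factorial_dvd_factorial_add j n)
    have h4 : ((n : ℝ) + 1) ^ σ ≤ (((j + n : ℕ) : ℝ) + 1) ^ σ := by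
      push_cast
      gcongr
      linarith [(Nat.cast_nonneg j : (0 : ℝ) ≤ j)]
    calc ‖poch α n‖ * j.factorial ≤ K₁ * (n.factorial * ((n : ℝ) + 1) ^ σ) * j.factorial := by
          have := h1 σ ((le_max_left _ _).trans hσ) n
          gcongr
      _ = K₁ * (((n : ℝ) + 1) ^ σ * 1) * ((j.factorial * n.factorial : ℕ) : ℝ) * (1 + 0) := by
          push_cast; ring
      _ ≤ _ := by gcongr <;> linarith
  · obtain ⟨n, rfl⟩ := Nat.exists_eq_add_of_le h
    rw [show ((i : ℤ) - ((i + n : ℕ) : ℤ)) = -(n : ℤ) by push_cast; ring, pochZ_neg_natCast]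
    have hp : 0 < ‖poch (1 - α) n‖ := norm_pos_iff.2 (poch_ne_zero (nonPole_one_sub hα) n)
    have h3 : ((i + n).factorial : ℝ) = (i + n).choose i * i.factorial * n.factorial := by
      have := Nat.choose_mul_factorial_mul_factorial (Nat.le_add_right i n)
      rw [Nat.add_sub_cancel_left] at this
      exact_mod_cast this.symm
    have h4 : ((n : ℝ) + 1) ^ σ ≤ (((i + n : ℕ) : ℝ) + 1) ^ σ := by
      push_cast
      gcongr
      linarith [(Nat.cast_nonneg i : (0 : ℝ) ≤ i)]
    have h5 : ‖(-1) ^ n / poch (1 - α) n‖ * n.factorial ≤ K₂ * ((n : ℝ) + 1) ^ σ := by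
      rw [norm_div, norm_pow, norm_neg, norm_one, one_pow, one_div, inv_mul_le_iff₀ hp, mul_comm]
      exact h2 σ ((le_max_right _ _).trans hσ) n
    calc _ = ‖(-1) ^ n / poch (1 - α) n‖ * n.factorial * i.factorial * (i + n).choose i := by
          rw [h3]; ring
      _ ≤ K₂ * ((n : ℝ) + 1) ^ σ * i.factorial * (i + n).choose i := by gcongr
      _ = K₂ * (1 * ((n : ℝ) + 1) ^ σ) * i.factorial * (0 + (i + n).choose i) := by ring
      _ ≤ _ := by gcongr <;> linarith

/-- The coefficients of Horn's `H₂`. -/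
noncomputable def hornCoef (a b c d e : ℂ) (k : ℕ × ℕ) : ℂ :=
  pochZ a ((k.1 : ℤ) - (k.2 : ℤ)) * pochZ b k.1 * pochZ c k.2 * pochZ d k.2 /
    (pochZ e k.1 * (k.1.factorial : ℂ) * (k.2.factorial : ℂ))

theorem exists_norm_hornCoef_le {a : ℂ} (ha : ∀ n : ℤ, a ≠ n) (b c d : ℂ) {e : ℂ} (he : NonPole e) :
    ∃ (K : ℝ) (σ : ℕ), 0 < K ∧ ∀ k : ℕ × ℕ, ‖hornCoef a b c d e k‖ ≤
      K * (((k.1 : ℝ) + 1) ^ σ * ((k.2 : ℝ) + 1) ^ σ) * (1 + k.2.choose k.1) := by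
  obtain ⟨K₁, σ₁, hK₁, h1⟩ := exists_norm_pochZ_le ha
  obtain ⟨K₂, σ₂, hK₂, h2⟩ := exists_norm_poch_le_pow b
  obtain ⟨K₃, σ₃, hK₃, h3⟩ := exists_norm_poch_le_pow c
  obtain ⟨K₄, σ₄, hK₄, h4⟩ := exists_norm_poch_le_pow d
  obtain ⟨K₅, σ₅, hK₅, h5⟩ := exists_le_norm_poch_pow he
  set σ := σ₁ + σ₂ + σ₃ + σ₄ + σ₅ with hσ
  refine ⟨K₁ * K₂ * K₃ * K₄ * K₅, 3 * σ, by positivity, fun k => ?_⟩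
  obtain ⟨i, j⟩ := k
  have h1 := h1 σ (by omega) i j
  have h2 := h2 σ (by omega) i
  have h3 := h3 σ (by omega) j
  have h4 := h4 σ (by omega) j
  have h5 := h5 σ (by omega) i
  have hp : 0 < ‖poch e i‖ := norm_pos_iff.2 (poch_ne_zero he i)
  have hi : (0 : ℝ) < i.factorial := by positivity
  have hj : (0 : ℝ) < j.factorial := by positivity
  simp only [hornCoef, pochZ_natCast]
  rw [norm_div, norm_mul, norm_mul, norm_mul, norm_mul, norm_mul, Complex.norm_natCast,
    Complex.norm_natCast, div_le_iff₀ (by positivity)]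
  refine le_of_mul_le_mul_right ?_ hj
  calc _ = (‖pochZ a ((i : ℤ) - j)‖ * j.factorial) * ‖poch b i‖ * ‖poch c j‖ * ‖poch d j‖ := by ring
    _ ≤ (K₁ * (((i : ℝ) + 1) ^ σ * ((j : ℝ) + 1) ^ σ) * i.factorial * (1 + j.choose i)) *
        (K₂ * (i.factorial * ((i : ℝ) + 1) ^ σ)) * (K₃ * (j.factorial * ((j : ℝ) + 1) ^ σ)) *
        (K₄ * (j.factorial * ((j : ℝ) + 1) ^ σ)) := by gcongr
    _ = K₁ * K₂ * K₃ * K₄ * (((i : ℝ) + 1) ^ σ * ((j : ℝ) + 1) ^ σ) * i.factorial *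
        (1 + j.choose i) * ((i : ℝ) + 1) ^ σ * (j.factorial * ((j : ℝ) + 1) ^ σ) *
        (j.factorial * ((j : ℝ) + 1) ^ σ) * i.factorial := by ring
    _ ≤ K₁ * K₂ * K₃ * K₄ * (((i : ℝ) + 1) ^ σ * ((j : ℝ) + 1) ^ σ) * i.factorial *
        (1 + j.choose i) * ((i : ℝ) + 1) ^ σ * (j.factorial * ((j : ℝ) + 1) ^ σ) *
        (j.factorial * ((j : ℝ) + 1) ^ σ) * (K₅ * ((i : ℝ) + 1) ^ σ * ‖poch e i‖) := by gcongr
    _ = _ := by rw [show 3 * σ = σ + σ + σ by ring, pow_add, pow_add, pow_add, pow_add]; ring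

/-- By the binomial theorem the sum over `i` is `(Y (1 + X))^j`. This is the origin of the condition
`|y| (1 + |x|) < 1` in the convergence region. -/
theorem summable_choose_mul {X Y : ℝ} (hX : 0 ≤ X) (hY : 0 ≤ Y) (h : Y * (1 + X) < 1) :
    Summable fun k : ℕ × ℕ => (k.2.choose k.1 : ℝ) * X ^ k.1 * Y ^ k.2 := by
  have h1 : Summable fun k : ℕ × ℕ => (k.1.choose k.2 : ℝ) * X ^ k.2 * Y ^ k.1 := by
    refine summable_prod_of_hasSum (S := fun j => (Y * (1 + X)) ^ j) (fun k => by positivity)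
      (fun j => ?_) (summable_geometric_of_lt_one (by positivity) h)
    have : (Y * (1 + X)) ^ j = ∑ i ∈ Finset.range (j + 1), (j.choose i : ℝ) * X ^ i * Y ^ j := by
      rw [mul_pow, add_comm 1 X, add_pow, Finset.mul_sum]
      refine Finset.sum_congr rfl fun i _ => ?_
      rw [one_pow]; ring
    rw [this]
    refine hasSum_sum_of_ne_finset_zero fun i hi => ?_
    rw [Nat.choose_eq_zero_of_lt (by simpa using hi)]
    simp
  exact (Equiv.prodComm ℕ ℕ).summable_iff.1 h1

theorem summable_hornCoef {a : ℂ} (ha : ∀ n : ℤ, a ≠ n) (b c d : ℂ) {e : ℂ} (he : NonPole e)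
    {X Y : ℝ} (hX : 0 ≤ X) (hY : 0 ≤ Y) (hX1 : X < 1) (hXY : Y * (1 + X) < 1) :
    Summable fun k : ℕ × ℕ => ‖hornCoef a b c d e k‖ * X ^ k.1 * Y ^ k.2 := by
  obtain ⟨K, σ, hK, hb⟩ := exists_norm_hornCoef_le ha b c d he
  -- Both radii are enlarged slightly inside the convergence region, so that the geometric gain
  -- absorbs the polynomial factors.
  obtain ⟨X', hX', hX1', hXY'⟩ : ∃ X' : ℝ, X < X' ∧ X' < 1 ∧ Y * (1 + X') < 1 := by
    have hc : ContinuousAt (fun X' : ℝ => Y * (1 + X')) X := by fun_prop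
    have h1 := (hc.eventually (gt_mem_nhds hXY)).filter_mono (nhdsWithin_le_nhds (s := Set.Ioi X))
    have h2 : ∀ᶠ X' in 𝓝[>] X, X' < 1 := (gt_mem_nhds hX1).filter_mono nhdsWithin_le_nhds
    obtain ⟨X', h3, h4, h5⟩ := (h1.and (h2.and self_mem_nhdsWithin)).exists
    exact ⟨X', h5, h4, h3⟩
  obtain ⟨Y', hY', hXY''⟩ : ∃ Y' : ℝ, Y < Y' ∧ Y' * (1 + X') < 1 := by
    obtain ⟨Y', h1, h2⟩ := exists_between ((lt_div_iff₀ (by linarith : 0 < 1 + X')).2 hXY')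
    exact ⟨Y', h1, (lt_div_iff₀ (by linarith)).1 h2⟩
  obtain ⟨K₁, hK₁, h1⟩ := exists_pow_mul_geometric_le σ hX hX'
  obtain ⟨K₂, hK₂, h2⟩ := exists_pow_mul_geometric_le σ hY hY'
  have hX0' : 0 ≤ X' := by linarith
  have hY0' : 0 ≤ Y' := by linarith
  have hY1' : Y' < 1 := by nlinarith
  have hs1 : Summable fun k : ℕ × ℕ => X' ^ k.1 * Y' ^ k.2 :=
    (summable_geometric_of_lt_one hX0' hX1').mul_of_nonneg
      (summable_geometric_of_lt_one hY0' hY1') (fun _ => by positivity) (fun _ => by positivity)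
  have hs := (hs1.add (summable_choose_mul hX0' hY0' hXY'')).mul_left (K * K₁ * K₂)
  refine Summable.of_nonneg_of_le (fun k => by positivity) (fun k => ?_) hs
  calc ‖hornCoef a b c d e k‖ * X ^ k.1 * Y ^ k.2
      ≤ K * (((k.1 : ℝ) + 1) ^ σ * ((k.2 : ℝ) + 1) ^ σ) * (1 + k.2.choose k.1) *
        X ^ k.1 * Y ^ k.2 := by
        have := hb k
        gcongr
    _ = K * (1 + k.2.choose k.1) * ((((k.1 : ℝ) + 1) ^ σ * X ^ k.1) *
        (((k.2 : ℝ) + 1) ^ σ * Y ^ k.2)) := by ring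
    _ ≤ K * (1 + k.2.choose k.1) * ((K₁ * X' ^ k.1) * (K₂ * Y' ^ k.2)) := by
        have := h1 k.1
        have := h2 k.2
        gcongr
    _ = _ := by ring

/-- The coefficients of the expansion of `H₂` in powers of `x / (x - 1)` and `y`. -/
noncomputable def hornCoefPfaff (a b c d e : ℂ) (k : ℕ × ℕ) : ℂ :=
  pochZ a (-(k.2 : ℤ)) * poch c k.2 * poch d k.2 / k.2.factorial * hcoef b (e - a + k.2) e k.1

theorem exists_norm_hornCoefPfaff_le {a : ℂ} (ha : ∀ n : ℤ, a ≠ n) (b c d : ℂ) {e : ℂ}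
    (he : NonPole e) : ∃ (K : ℝ) (σ : ℕ), 0 < K ∧ ∀ k : ℕ × ℕ, ‖hornCoefPfaff a b c d e k‖ ≤
      K * (((k.1 : ℝ) + 1) ^ σ * ((k.2 : ℝ) + 1) ^ σ) *
        (‖poch ((‖e - a‖ + k.2 : ℝ) : ℂ) k.1‖ / k.1.factorial) := by
  obtain ⟨K₁, σ₁, hK₁, h1⟩ := exists_norm_pochZ_le ha
  obtain ⟨K₂, σ₂, hK₂, h2⟩ := exists_norm_poch_le_pow b
  obtain ⟨K₃, σ₃, hK₃, h3⟩ := exists_norm_poch_le_pow c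
  obtain ⟨K₄, σ₄, hK₄, h4⟩ := exists_norm_poch_le_pow d
  obtain ⟨K₅, σ₅, hK₅, h5⟩ := exists_le_norm_poch_pow he
  set σ := σ₁ + σ₂ + σ₃ + σ₄ + σ₅ with hσ
  refine ⟨K₁ * 2 * K₂ * K₃ * K₄ * K₅, 3 * σ, by positivity, fun k => ?_⟩
  obtain ⟨i, j⟩ := k
  have h1 := h1 σ (by omega) 0 j
  have h2 := h2 σ (by omega) i
  have h3 := h3 σ (by omega) j
  have h4 := h4 σ (by omega) j
  have h5 := h5 σ (by omega) i
  clear_value σ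
  simp only [Nat.cast_zero, zero_sub, zero_add, one_pow, one_mul, Nat.factorial_zero, Nat.cast_one,
    mul_one, Nat.choose_zero_right] at h1
  have hp : 0 < ‖poch e i‖ := norm_pos_iff.2 (poch_ne_zero he i)
  have hi : (0 : ℝ) < i.factorial := by positivity
  have hj : (0 : ℝ) < j.factorial := by positivity
  have h6 : ‖poch (e - a + j) i‖ ≤ ‖poch ((‖e - a‖ + j : ℝ) : ℂ) i‖ := by
    refine norm_poch_le ((norm_add_le _ _).trans ?_) i
    rw [Complex.norm_natCast]
  simp only [hornCoefPfaff, hcoef]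
  have hi1 : (1 : ℝ) ≤ ((i : ℝ) + 1) ^ σ :=
    one_le_pow₀ (by linarith [(Nat.cast_nonneg i : (0 : ℝ) ≤ i)])
  rw [norm_mul, norm_div, norm_div, norm_mul, norm_mul, norm_mul, norm_mul, Complex.norm_natCast,
    Complex.norm_natCast, div_mul_div_comm, div_le_iff₀ (by positivity)]
  set W := ‖poch ((‖e - a‖ + j : ℝ) : ℂ) i‖
  refine le_of_mul_le_mul_right ?_ (mul_pos hj hi)
  calc _ = (‖pochZ a (-(j : ℤ))‖ * j.factorial) * ‖poch c j‖ * ‖poch d j‖ *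
        (‖poch b i‖ * ‖poch (e - a + j) i‖) * i.factorial := by ring
    _ ≤ (K₁ * ((j : ℝ) + 1) ^ σ * (1 + 1)) *
        (K₃ * (j.factorial * ((j : ℝ) + 1) ^ σ)) * (K₄ * (j.factorial * ((j : ℝ) + 1) ^ σ)) *
        (K₂ * (i.factorial * ((i : ℝ) + 1) ^ σ) * W) *
        (K₅ * ((i : ℝ) + 1) ^ σ * ‖poch e i‖) := by gcongr
    _ = (K₁ * 2 * K₂ * K₃ * K₄ * K₅) * ((1 * (((i : ℝ) + 1) ^ σ * ((i : ℝ) + 1) ^ σ)) *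
        ((j : ℝ) + 1) ^ (3 * σ)) * W * (j.factorial * j.factorial) * i.factorial * ‖poch e i‖ := by
        rw [show 3 * σ = σ + σ + σ by ring, pow_add, pow_add]; ring
    _ ≤ (K₁ * 2 * K₂ * K₃ * K₄ * K₅) * ((((i : ℝ) + 1) ^ σ * (((i : ℝ) + 1) ^ σ *
        ((i : ℝ) + 1) ^ σ)) * ((j : ℝ) + 1) ^ (3 * σ)) * W * (j.factorial * j.factorial) *
        i.factorial * ‖poch e i‖ := by gcongr
    _ = _ := by
        have e3 : ∀ x : ℝ, x ^ (3 * σ) = x ^ σ * (x ^ σ * x ^ σ) := fun x => by ring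
        rw [e3, e3]
        field_simp

/-- For fixed `j` the majorant sums over `i` to `(1 - X)^(-‖e - a‖ - j)`, which leaves a geometric
series in `Y/(1 - X)`. Hence the region `X + Y < 1`. -/
theorem summable_hornCoefPfaff {a : ℂ} (ha : ∀ n : ℤ, a ≠ n) (b c d : ℂ) {e : ℂ} (he : NonPole e)
    {X Y : ℝ} (hX : 0 ≤ X) (hY : 0 ≤ Y) (hXY : X + Y < 1) :
    Summable fun k : ℕ × ℕ => ‖hornCoefPfaff a b c d e k‖ * X ^ k.1 * Y ^ k.2 := by
  obtain ⟨K, σ, hK, hb⟩ := exists_norm_hornCoefPfaff_le ha b c d he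
  obtain ⟨X', hX', hXY'⟩ := exists_between (show X < 1 - Y by linarith)
  obtain ⟨Y', hY', hXY''⟩ := exists_between (show Y < 1 - X' by linarith)
  obtain ⟨K₁, hK₁, h1⟩ := exists_pow_mul_geometric_le σ hX hX'
  obtain ⟨K₂, hK₂, h2⟩ := exists_pow_mul_geometric_le σ hY hY'
  have hX0' : 0 ≤ X' := by linarith
  have hY0' : 0 ≤ Y' := by linarith
  have hX1' : 0 < 1 - X' := by linarith
  have hs1 : Summable fun k : ℕ × ℕ => (‖poch ((‖e - a‖ + k.1 : ℝ) : ℂ) k.2‖ / k.2.factorial) *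
      X' ^ k.2 * Y' ^ k.1 := by
    refine summable_prod_of_hasSum (S := fun j => (1 - X') ^ (-‖e - a‖) * (Y' / (1 - X')) ^ j)
      (fun k => by positivity) (fun j => ?_)
      ((summable_geometric_of_lt_one (by positivity) ((div_lt_one hX1').2 hXY'')).mul_left _)
    have := (hasSum_norm_poch (x := ‖e - a‖ + j) (by positivity) hX0' (by linarith)).mul_right
      (Y' ^ j)
    refine (congrArg (HasSum _) ?_).mp this
    rw [neg_add, Real.rpow_add hX1', Real.rpow_neg hX1'.le (j : ℝ), Real.rpow_natCast, div_pow]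
    field_simp
  have hs := (((Equiv.prodComm ℕ ℕ).summable_iff.2 hs1)).mul_left (K * K₁ * K₂)
  refine Summable.of_nonneg_of_le (fun k => by positivity) (fun k => ?_) hs
  simp only [Function.comp_apply, Equiv.prodComm_apply, Prod.fst_swap, Prod.snd_swap]
  set W := ‖poch ((‖e - a‖ + k.2 : ℝ) : ℂ) k.1‖ / k.1.factorial
  calc ‖hornCoefPfaff a b c d e k‖ * X ^ k.1 * Y ^ k.2
      ≤ K * (((k.1 : ℝ) + 1) ^ σ * ((k.2 : ℝ) + 1) ^ σ) * W *
        X ^ k.1 * Y ^ k.2 := by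
        have := hb k
        gcongr
    _ = K * W * ((((k.1 : ℝ) + 1) ^ σ * X ^ k.1) * (((k.2 : ℝ) + 1) ^ σ * Y ^ k.2)) := by ring
    _ ≤ K * W * ((K₁ * X' ^ k.1) * (K₂ * Y' ^ k.2)) := by
        have := h1 k.1
        have := h2 k.2
        gcongr
    _ = _ := by ring

theorem isOpen_hornH2Disc : IsOpen hornH2Disc :=
  (isOpen_lt (f := fun P : ℂ × ℂ => ‖P.1‖) (by fun_prop) continuous_const).inter
    (isOpen_lt (f := fun P : ℂ × ℂ => ‖P.2‖ * (‖P.1‖ + 1)) (by fun_prop) continuous_const)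

theorem isOpen_hornH2Domain : IsOpen hornH2Domain :=
  isOpen_hornH2Disc.union (isOpen_lt (f := fun P : ℂ × ℂ => ‖P.1‖ + ‖P.2‖ * ‖1 - P.1‖)
    (g := fun P : ℂ × ℂ => ‖1 - P.1‖) (by fun_prop) (by fun_prop))

/-! ### Pfaff's transformation of the `H₂` series and its continuation -/

theorem pochZ_sub {a : ℂ} (ha : ∀ n : ℤ, a ≠ n) (i j : ℕ) :
    pochZ a ((i : ℤ) - j) = pochZ a (-(j : ℤ)) * poch (a - j) i := by
  induction i with
  | zero => simp
  | succ i ih =>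
    rw [poch_succ, ← mul_assoc, ← ih]
    rcases le_or_gt j i with h | h
    · obtain ⟨n, rfl⟩ := Nat.exists_eq_add_of_le h
      rw [show (((j + n + 1 : ℕ) : ℤ) - j) = ((n + 1 : ℕ) : ℤ) by push_cast; ring,
        show (((j + n : ℕ) : ℤ) - j) = (n : ℤ) by push_cast; ring, pochZ_natCast, pochZ_natCast,
        poch_succ]
      push_cast; ring
    · obtain ⟨n, rfl⟩ := Nat.exists_eq_add_of_lt h
      rw [show (((i + 1 : ℕ) : ℤ) - ((i + n + 1 : ℕ) : ℤ)) = -(n : ℤ) by push_cast; ring,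
        show ((i : ℤ) - ((i + n + 1 : ℕ) : ℤ)) = -((n + 1 : ℕ) : ℤ) by push_cast; ring,
        pochZ_neg_natCast, pochZ_neg_natCast, poch_succ, pow_succ]
      have h1 := poch_ne_zero (nonPole_one_sub ha) n
      have h2 : (1 - a + n : ℂ) ≠ 0 := by
        intro h0
        exact nonPole_one_sub ha n (by linear_combination h0)
      field_simp
      push_cast; ring

theorem hornCoef_eq {a : ℂ} (ha : ∀ n : ℤ, a ≠ n) (b c d e : ℂ) (i j : ℕ) :
    hornCoef a b c d e (i, j) = pochZ a (-(j : ℤ)) * poch c j * poch d j / j.factorial *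
      hcoef b (a - j) e i := by
  simp only [hornCoef, pochZ_natCast]
  rw [pochZ_sub ha, hcoef, div_mul_div_comm]
  congr 1 <;> ring

/-- For fixed `j` the sum over `i` is a multiple of `₂F₁(b, a - j; e; x)`, and Pfaff's
transformation is applied to each of these functions. -/
theorem hornSeries_pfaff {a : ℂ} (ha : ∀ n : ℤ, a ≠ n) (b c d : ℂ) {e : ℂ} (he : NonPole e)
    {P : ℂ × ℂ} (h1 : P ∈ hornH2Disc) (h2 : ‖P.1‖ + ‖P.2‖ * ‖1 - P.1‖ < ‖1 - P.1‖) :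
    ∑' k, hornCoef a b c d e k * P.1 ^ k.1 * P.2 ^ k.2 = (1 - P.1) ^ (-b) *
      ∑' k, hornCoefPfaff a b c d e k * (P.1 / (P.1 - 1)) ^ k.1 * P.2 ^ k.2 := by
  have hlt : ‖P.1‖ < ‖1 - P.1‖ := by
    have : 0 ≤ ‖P.2‖ * ‖1 - P.1‖ := by positivity
    linarith
  have hre := norm_lt_norm_one_sub_iff.1 hlt
  have h0 : 0 < ‖1 - P.1‖ := (norm_nonneg _).trans_lt hlt
  have hw : ‖P.1 / (P.1 - 1)‖ < 1 := norm_div_sub_one_lt hre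
  have hsum : ‖P.1 / (P.1 - 1)‖ + ‖P.2‖ < 1 := by
    rw [norm_div, norm_sub_rev P.1 1, div_add' _ _ _ h0.ne', div_lt_one h0]
    exact h2
  have hS1 : Summable fun k : ℕ × ℕ => hornCoef a b c d e k * P.1 ^ k.1 * P.2 ^ k.2 := by
    refine Summable.of_norm ?_
    simpa using summable_hornCoef ha b c d he (norm_nonneg P.1) (norm_nonneg P.2) h1.1
      (by rw [add_comm]; exact h1.2)
  have hS2 : Summable fun k : ℕ × ℕ =>
      hornCoefPfaff a b c d e k * (P.1 / (P.1 - 1)) ^ k.1 * P.2 ^ k.2 := by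
    refine Summable.of_norm ?_
    simpa using summable_hornCoefPfaff ha b c d he (norm_nonneg (P.1 / (P.1 - 1)))
      (norm_nonneg P.2) hsum
  have hswap : ∀ {f : ℕ × ℕ → ℂ}, Summable f → ∑' k, f k = ∑' j, ∑' i, f (i, j) := by
    intro f hf
    rw [← (Equiv.prodComm ℕ ℕ).tsum_eq]
    exact ((Equiv.prodComm ℕ ℕ).summable_iff.2 hf).tsum_prod
  rw [hswap hS1, hswap hS2, ← tsum_mul_left]
  refine tsum_congr fun j => ?_
  have e1 : ∀ i : ℕ, hornCoef a b c d e (i, j) * P.1 ^ i * P.2 ^ j =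
      pochZ a (-(j : ℤ)) * poch c j * poch d j / j.factorial * P.2 ^ j *
        (hcoef b (a - j) e i * P.1 ^ i) := fun i => by rw [hornCoef_eq ha]; ring
  have e2 : ∀ i : ℕ, hornCoefPfaff a b c d e (i, j) * (P.1 / (P.1 - 1)) ^ i * P.2 ^ j =
      pochZ a (-(j : ℤ)) * poch c j * poch d j / j.factorial * P.2 ^ j *
        (hcoef b (e - a + j) e i * (P.1 / (P.1 - 1)) ^ i) := fun i => by
    rw [hornCoefPfaff]; ring
  simp only [e1, e2]
  rw [tsum_mul_left, tsum_mul_left, ← hyp_eq_tsum, ← hyp_eq_tsum, pfaff b (a - j) he h1.1 hre,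
    show e - (a - j) = e - a + j by ring]
  ring

/-- The domain is the union of two open sets. On one the original series is holomorphic, on the
other the transformed series in `x/(x - 1)` and `y`. They agree on the overlap, so they can be
glued. -/
theorem hasContinuation_hornH2 {a : ℂ} (ha : ∀ n : ℤ, a ≠ n) (b c d : ℂ) {e : ℂ} (he : NonPole e) :
    HasContinuation (hornH2Series a b c d e) hornH2Disc hornH2Domain := by
  classical
  have hser : ∀ P, hornH2Series a b c d e P =
      ∑' k, hornCoef a b c d e k * P.1 ^ k.1 * P.2 ^ k.2 := fun P => rfl
  have hd1 : ∀ P ∈ hornH2Disc, DifferentiableAt ℂ (hornH2Series a b c d e) P := by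
    intro P hP
    obtain ⟨X, hX, hX1, hXY⟩ : ∃ X : ℝ, ‖P.1‖ < X ∧ X < 1 ∧ ‖P.2‖ * (1 + X) < 1 := by
      have hc : ContinuousAt (fun X' : ℝ => ‖P.2‖ * (1 + X')) ‖P.1‖ := by fun_prop
      have hP2 : ‖P.2‖ * (1 + ‖P.1‖) < 1 := by rw [add_comm]; exact hP.2
      have h1 := (hc.eventually (gt_mem_nhds hP2)).filter_mono
        (nhdsWithin_le_nhds (s := Set.Ioi ‖P.1‖))
      have h2 : ∀ᶠ X' in 𝓝[>] ‖P.1‖, X' < 1 := (gt_mem_nhds hP.1).filter_mono nhdsWithin_le_nhds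
      obtain ⟨X', h3, h4, h5⟩ := (h1.and (h2.and self_mem_nhdsWithin)).exists
      exact ⟨X', h5, h4, h3⟩
    have hX0 := (norm_nonneg P.1).trans_lt hX
    obtain ⟨Y, hY, hXY'⟩ := exists_between ((lt_div_iff₀ (by linarith : 0 < 1 + X)).2 hXY)
    have hY0 := (norm_nonneg P.2).trans_lt hY
    exact differentiableAt_doubleSeries (summable_hornCoef ha b c d he hX0.le hY0.le hX1
      ((lt_div_iff₀ (by linarith)).1 hXY')) hX hY
  set g : ℂ × ℂ → ℂ := fun P => (1 - P.1) ^ (-b) *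
      ∑' k, hornCoefPfaff a b c d e k * (P.1 / (P.1 - 1)) ^ k.1 * P.2 ^ k.2 with hg
  have hd2 : ∀ P : ℂ × ℂ, ‖P.1‖ + ‖P.2‖ * ‖1 - P.1‖ < ‖1 - P.1‖ → DifferentiableAt ℂ g P := by
    intro P h2
    have hlt : ‖P.1‖ < ‖1 - P.1‖ := by
      have : 0 ≤ ‖P.2‖ * ‖1 - P.1‖ := by positivity
      linarith
    have hre := norm_lt_norm_one_sub_iff.1 hlt
    have h0 : 0 < ‖1 - P.1‖ := (norm_nonneg _).trans_lt hlt
    have hsum : ‖P.1 / (P.1 - 1)‖ + ‖P.2‖ < 1 := by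
      rw [norm_div, norm_sub_rev P.1 1, div_add' _ _ _ h0.ne', div_lt_one h0]
      exact h2
    obtain ⟨X, hX, hXY⟩ := exists_between (show ‖P.1 / (P.1 - 1)‖ < 1 - ‖P.2‖ by linarith)
    obtain ⟨Y, hY, hXY'⟩ := exists_between (show ‖P.2‖ < 1 - X by linarith)
    have hX0 := (norm_nonneg _).trans_lt hX
    have hY0 := (norm_nonneg _).trans_lt hY
    have h3 := differentiableAt_doubleSeries (P := (P.1 / (P.1 - 1), P.2))
      (summable_hornCoefPfaff ha b c d he hX0.le hY0.le (by linarith)) hX hY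
    have h4 : DifferentiableAt ℂ (fun P : ℂ × ℂ => (P.1 / (P.1 - 1), P.2)) P := by
      refine DifferentiableAt.prodMk ?_ (by fun_prop)
      simp only [div_eq_mul_inv]
      exact DifferentiableAt.mul (by fun_prop)
        (DifferentiableAt.fun_inv (by fun_prop) (sub_one_ne_zero_of_re_lt hre))
    have h5 : DifferentiableAt ℂ (fun P : ℂ × ℂ => 1 - P.1) P := by fun_prop
    exact (h5.cpow_const (one_sub_mem_slitPlane_of_re_lt hre)).mul
      (DifferentiableAt.comp (f := fun P : ℂ × ℂ => (P.1 / (P.1 - 1), P.2)) P h3 h4)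
  refine ⟨fun P => if P ∈ hornH2Disc then hornH2Series a b c d e P else g P, fun P hP => ?_,
    fun P hP => if_pos hP⟩
  refine DifferentiableAt.differentiableWithinAt ?_
  by_cases h : P ∈ hornH2Disc
  · refine (hd1 P h).congr_of_eventuallyEq ?_
    filter_upwards [isOpen_hornH2Disc.mem_nhds h] with Q hQ
    exact if_pos hQ
  · have h2 : ‖P.1‖ + ‖P.2‖ * ‖1 - P.1‖ < ‖1 - P.1‖ := hP.resolve_left h
    refine (hd2 P h2).congr_of_eventuallyEq ?_
    have ho : IsOpen {P : ℂ × ℂ | ‖P.1‖ + ‖P.2‖ * ‖1 - P.1‖ < ‖1 - P.1‖} :=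
      isOpen_lt (by fun_prop) (by fun_prop)
    filter_upwards [ho.mem_nhds h2] with Q hQ
    by_cases hQ1 : Q ∈ hornH2Disc
    · rw [if_pos hQ1, hser, hornSeries_pfaff ha b c d he hQ1 hQ]
    · rw [if_neg hQ1]


/-! ### The double loop -/

theorem circleThrough_eq (P Q s : ℝ) : circleThrough P Q s =
    ((P + Q) / 2 : ℝ) + ((P - Q) / 2 : ℝ) * Complex.exp (2 * Real.pi * s * Complex.I) := by
  simp only [circleThrough, circleMap]
  push_cast
  rfl

theorem hasDerivAt_circleThrough (P Q s : ℝ) : HasDerivAt (circleThrough P Q)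
    (((P - Q) / 2 : ℝ) * (Complex.exp (2 * Real.pi * s * Complex.I) * (2 * Real.pi * Complex.I)))
    s := by
  have h1 : HasDerivAt (fun s : ℝ => (2 * Real.pi * s * Complex.I : ℂ)) (2 * Real.pi * Complex.I) s := by
    have := ((Complex.ofRealCLM.hasDerivAt (x := s)).const_mul (2 * Real.pi : ℂ)).mul_const Complex.I
    simpa using this
  have h2 := ((h1.cexp).const_mul (((P - Q) / 2 : ℝ) : ℂ)).const_add (((P + Q) / 2 : ℝ) : ℂ)
  exact h2.congr_of_eventuallyEq (Eventually.of_forall fun s => circleThrough_eq P Q s)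

theorem deriv_circleThrough (P Q s : ℝ) : deriv (circleThrough P Q) s =
    ((P - Q) / 2 : ℝ) * (Complex.exp (2 * Real.pi * s * Complex.I) * (2 * Real.pi * Complex.I)) :=
  (hasDerivAt_circleThrough P Q s).deriv

theorem continuous_circleThrough (P Q : ℝ) : Continuous (circleThrough P Q) :=
  continuous_iff_continuousAt.2 fun s => (hasDerivAt_circleThrough P Q s).continuousAt

theorem continuous_deriv_circleThrough (P Q : ℝ) : Continuous (deriv (circleThrough P Q)) := by
  have : deriv (circleThrough P Q) = fun s : ℝ => ((P - Q) / 2 : ℝ) *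
      (Complex.exp (2 * Real.pi * s * Complex.I) * (2 * Real.pi * Complex.I)) :=
    funext fun s => deriv_circleThrough P Q s
  rw [this]
  fun_prop

theorem exp_two_pi_sub_nat (s : ℝ) (n : ℤ) : Complex.exp (2 * Real.pi * ((s - n : ℝ) : ℂ) * Complex.I) =
    Complex.exp (2 * Real.pi * s * Complex.I) := by
  have h : (2 * Real.pi * ((s - n : ℝ) : ℂ) * Complex.I) =
      2 * Real.pi * s * Complex.I - n * (2 * Real.pi * Complex.I) := by push_cast; ring
  rw [h, Complex.exp_periodic.sub_int_mul_eq]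

theorem circleThrough_sub_int (P Q s : ℝ) (n : ℤ) :
    circleThrough P Q (s - n) = circleThrough P Q s := by
  rw [circleThrough_eq, circleThrough_eq, exp_two_pi_sub_nat]

theorem deriv_circleThrough_sub_int (P Q s : ℝ) (n : ℤ) :
    deriv (circleThrough P Q) (s - n) = deriv (circleThrough P Q) s := by
  rw [deriv_circleThrough, deriv_circleThrough, exp_two_pi_sub_nat]

theorem norm_exp_neg_two_pi (s : ℝ) : ‖Complex.exp (-(2 * Real.pi * s * Complex.I))‖ = 1 := by
  rw [Complex.norm_exp]; simp

/-- The continuous logarithm along the circle `A + ρ e^{2πis}`, which winds around `0`. -/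
noncomputable def windLog (A ρ s : ℝ) : ℂ :=
  (Real.log ρ : ℂ) + 2 * Real.pi * s * Complex.I +
    Complex.log (1 + ((A / ρ : ℝ) : ℂ) * Complex.exp (-(2 * Real.pi * s * Complex.I)))

/-- Because `|A| < ρ`, the last logarithm in `windLog` stays in the right half plane. It is
therefore smooth and periodic, and the winding sits entirely in the term `2πis`. -/
theorem windLog_arg_mem {A ρ : ℝ} (hρ : 0 < ρ) (hA : |A| < ρ) (s : ℝ) :
    0 < (1 + ((A / ρ : ℝ) : ℂ) * Complex.exp (-(2 * Real.pi * s * Complex.I))).re := by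
  have h1 : ‖((A / ρ : ℝ) : ℂ) * Complex.exp (-(2 * Real.pi * s * Complex.I))‖ < 1 := by
    rw [norm_mul, norm_exp_neg_two_pi, mul_one, Complex.norm_real, Real.norm_eq_abs, abs_div,
      abs_of_pos hρ, div_lt_one hρ]
    exact hA
  have h2 := (abs_lt.1 ((Complex.abs_re_le_norm _).trans_lt h1)).1
  rw [Complex.add_re, Complex.one_re]
  linarith

theorem windLog_sub_int (A ρ s : ℝ) (n : ℤ) :
    windLog A ρ (s - n) = windLog A ρ s - n * (2 * Real.pi * Complex.I) := by
  rw [windLog, windLog, Complex.exp_neg, Complex.exp_neg, exp_two_pi_sub_nat]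
  push_cast; ring

theorem exp_windLog {A ρ : ℝ} (hρ : 0 < ρ) (hA : |A| < ρ) (s : ℝ) :
    Complex.exp (windLog A ρ s) = A + ρ * Complex.exp (2 * Real.pi * s * Complex.I) := by
  have h0 : (1 + ((A / ρ : ℝ) : ℂ) * Complex.exp (-(2 * Real.pi * s * Complex.I))) ≠ 0 := by
    intro h
    have := windLog_arg_mem hρ hA s
    rw [h] at this; simp at this
  have hρ' : (ρ : ℂ) ≠ 0 := by exact_mod_cast hρ.ne'
  rw [windLog, Complex.exp_add, Complex.exp_add, Complex.exp_log h0, ← Complex.ofReal_exp,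
    Real.exp_log hρ, Complex.exp_neg]
  have h1 := Complex.exp_ne_zero (2 * Real.pi * s * Complex.I)
  push_cast
  field_simp
  ring

theorem windLog_zero {A ρ : ℝ} (hρ : 0 < ρ) (hA : |A| < ρ) :
    windLog A ρ 0 = Complex.log ((A + ρ : ℝ) : ℂ) := by
  have h1 : 0 < 1 + A / ρ := by
    have := windLog_arg_mem hρ hA 0
    simpa using this
  have h2 : 0 < A + ρ := by linarith [(abs_lt.1 hA).1]
  rw [windLog]
  simp only [Complex.ofReal_zero, mul_zero, zero_mul, neg_zero, Complex.exp_zero, mul_one, add_zero]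
  rw [← Complex.ofReal_one, ← Complex.ofReal_add, ← Complex.ofReal_log h1.le,
    ← Complex.ofReal_log h2.le, ← Complex.ofReal_add, ← Real.log_mul hρ.ne' h1.ne']
  congr 2
  field_simp
  ring

theorem hasDerivAt_windLog {A ρ : ℝ} (hρ : 0 < ρ) (hA : |A| < ρ) (s : ℝ) :
    HasDerivAt (windLog A ρ)
      (ρ * (Complex.exp (2 * Real.pi * s * Complex.I) * (2 * Real.pi * Complex.I)) /
        (A + ρ * Complex.exp (2 * Real.pi * s * Complex.I))) s := by
  have hre := windLog_arg_mem hρ hA s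
  have hexp := exp_windLog hρ hA s
  have h0 : (1 + ((A / ρ : ℝ) : ℂ) * Complex.exp (-(2 * Real.pi * s * Complex.I))) ≠ 0 := by
    intro h
    rw [h] at hre; simp at hre
  have h00 : (A + ρ * Complex.exp (2 * Real.pi * s * Complex.I) : ℂ) ≠ 0 := by
    rw [← hexp]; exact Complex.exp_ne_zero _
  have hρ' : (ρ : ℂ) ≠ 0 := by exact_mod_cast hρ.ne'
  have h1 : HasDerivAt (fun s : ℝ => (2 * Real.pi * s * Complex.I : ℂ)) (2 * Real.pi * Complex.I) s := by
    have := ((Complex.ofRealCLM.hasDerivAt (x := s)).const_mul (2 * Real.pi : ℂ)).mul_const Complex.I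
    simpa using this
  have h2 := (h1.neg.cexp.const_mul ((A / ρ : ℝ) : ℂ)).const_add 1
  have h3 := (h1.const_add (Real.log ρ : ℂ)).add (h2.clog_real (Or.inl hre))
  refine h3.congr_deriv ?_
  have e1 : Complex.exp (-(2 * Real.pi * s * Complex.I)) =
      (Complex.exp (2 * Real.pi * s * Complex.I))⁻¹ := Complex.exp_neg _
  have h5 := Complex.exp_ne_zero (2 * Real.pi * s * Complex.I)
  simp only [Pi.neg_apply, e1] at h0 ⊢
  push_cast at h0 ⊢
  generalize Complex.exp (2 * Real.pi * s * Complex.I) = E at *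
  have h6 : (1 + (A : ℂ) / ρ * E⁻¹) = (A + ρ * E) / (ρ * E) := by field_simp; ring
  rw [h6]
  field_simp
  ring

theorem windLog_im_mem {A ρ : ℝ} (hρ : 0 < ρ) (hA : |A| < ρ) (s : ℝ) :
    |(windLog A ρ s).im - 2 * Real.pi * s| < Real.pi / 2 := by
  have h := Complex.abs_arg_lt_pi_div_two_iff.2 (Or.inl (windLog_arg_mem hρ hA s))
  have e : (windLog A ρ s).im - 2 * Real.pi * s =
      (1 + ((A / ρ : ℝ) : ℂ) * Complex.exp (-(2 * Real.pi * s * Complex.I))).arg := by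
    rw [windLog, Complex.add_im, Complex.log_im]
    simp
  rw [e]
  exact h

/-! #### Logarithms along pieces of a path -/

/-- At the corners of a loop `deriv` may take its default value. The pieces are therefore compared
on open intervals only, which does not affect the integrals. -/
theorem integral_logDeriv_piece {γ δ L : ℝ → ℂ} {a b : ℝ} (heq : ∀ s ∈ Set.Ioo a b, γ s = δ s)
    (hL : ∀ s, HasDerivAt L (deriv δ s / δ s) s) (hc : Continuous fun s => deriv δ s / δ s)
    {t : ℝ} (ht : t ∈ Set.Icc a b) :
    IntervalIntegrable (fun s => deriv γ s / γ s) volume a t ∧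
      ∫ s in a..t, deriv γ s / γ s = L t - L a := by
  have hE : Set.EqOn (fun s => deriv δ s / δ s) (fun s => deriv γ s / γ s) (Set.Ioo a t) := by
    intro s hs
    have hs' : s ∈ Set.Ioo a b := ⟨hs.1, hs.2.trans_le ht.2⟩
    have h1 : γ =ᶠ[𝓝 s] δ := by
      filter_upwards [isOpen_Ioo.mem_nhds hs'] with r hr using heq r hr
    simp only
    rw [h1.deriv_eq, heq s hs']
  have hi : IntervalIntegrable (fun s => deriv δ s / δ s) volume a t := hc.intervalIntegrable _ _
  constructor
  · rw [intervalIntegrable_iff_integrableOn_Ioo_of_le ht.1] at hi ⊢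
    exact hi.congr_fun hE measurableSet_Ioo
  · rw [← intervalIntegral.integral_eq_sub_of_hasDerivAt (fun s _ => hL s) hi,
      intervalIntegral.integral_of_le ht.1, intervalIntegral.integral_of_le ht.1,
      integral_Ioc_eq_integral_Ioo, integral_Ioc_eq_integral_Ioo]
    exact (setIntegral_congr_fun measurableSet_Ioo hE).symm

theorem logAlong_step {γ δ L : ℝ → ℂ} {a b : ℝ} (hab : a ≤ b)
    (hi : IntervalIntegrable (fun s => deriv γ s / γ s) volume 0 a) (ha : logAlong γ a = L a)
    (heq : ∀ s ∈ Set.Ioo a b, γ s = δ s)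
    (hL : ∀ s, HasDerivAt L (deriv δ s / δ s) s) (hc : Continuous fun s => deriv δ s / δ s) :
    IntervalIntegrable (fun s => deriv γ s / γ s) volume 0 b ∧
      ∀ t ∈ Set.Icc a b, logAlong γ t = L t := by
  refine ⟨hi.trans (integral_logDeriv_piece heq hL hc ⟨hab, le_rfl⟩).1, fun t ht => ?_⟩
  obtain ⟨h1, h2⟩ := integral_logDeriv_piece heq hL hc ht
  rw [logAlong, ← intervalIntegral.integral_add_adjacent_intervals hi h1, h2, ← add_assoc]
  rw [logAlong] at ha
  rw [ha]; ring

/-- Each piece has a known logarithm up to an additive constant; the conditions at `1`, `2`, `3` fix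
these constants by continuity at the corners. -/
theorem logAlong_four_pieces {γ : ℝ → ℂ} {δ₀ δ₁ δ₂ δ₃ L₀ L₁ L₂ L₃ : ℝ → ℂ}
    (h₀ : ∀ s ∈ Set.Ioo (0 : ℝ) 1, γ s = δ₀ s) (h₁ : ∀ s ∈ Set.Ioo (1 : ℝ) 2, γ s = δ₁ s)
    (h₂ : ∀ s ∈ Set.Ioo (2 : ℝ) 3, γ s = δ₂ s) (h₃ : ∀ s ∈ Set.Ioo (3 : ℝ) 4, γ s = δ₃ s)
    (hL₀ : ∀ s, HasDerivAt L₀ (deriv δ₀ s / δ₀ s) s) (hL₁ : ∀ s, HasDerivAt L₁ (deriv δ₁ s / δ₁ s) s)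
    (hL₂ : ∀ s, HasDerivAt L₂ (deriv δ₂ s / δ₂ s) s) (hL₃ : ∀ s, HasDerivAt L₃ (deriv δ₃ s / δ₃ s) s)
    (hc₀ : Continuous fun s => deriv δ₀ s / δ₀ s) (hc₁ : Continuous fun s => deriv δ₁ s / δ₁ s)
    (hc₂ : Continuous fun s => deriv δ₂ s / δ₂ s) (hc₃ : Continuous fun s => deriv δ₃ s / δ₃ s)
    (e₀ : Complex.log (γ 0) = L₀ 0) (e₁ : L₀ 1 = L₁ 1) (e₂ : L₁ 2 = L₂ 2) (e₃ : L₂ 3 = L₃ 3) :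
    (∀ t ∈ Set.Icc (0 : ℝ) 1, logAlong γ t = L₀ t) ∧ (∀ t ∈ Set.Icc (1 : ℝ) 2, logAlong γ t = L₁ t) ∧
    (∀ t ∈ Set.Icc (2 : ℝ) 3, logAlong γ t = L₂ t) ∧
    (∀ t ∈ Set.Icc (3 : ℝ) 4, logAlong γ t = L₃ t) := by
  obtain ⟨i1, p1⟩ := logAlong_step zero_le_one (IntervalIntegrable.refl) (by simp [logAlong, e₀])
    h₀ hL₀ hc₀
  obtain ⟨i2, p2⟩ := logAlong_step (by norm_num : (1 : ℝ) ≤ 2) i1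
    (by rw [p1 1 (by norm_num), e₁]) h₁ hL₁ hc₁
  obtain ⟨i3, p3⟩ := logAlong_step (by norm_num : (2 : ℝ) ≤ 3) i2
    (by rw [p2 2 (by norm_num), e₂]) h₂ hL₂ hc₂
  obtain ⟨i4, p4⟩ := logAlong_step (by norm_num : (3 : ℝ) ≤ 4) i3
    (by rw [p3 3 (by norm_num), e₃]) h₃ hL₃ hc₃
  exact ⟨p1, p2, p3, p4⟩

/-! #### Reduction to single loops -/

/-- The loop around `1`. -/
noncomputable def loopOneIntegrand (p R : ℝ) (α β : ℂ) (g : ℂ → ℂ) (s : ℝ) : ℂ :=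
  Complex.exp ((α - 1) * Complex.log (circleThrough p R s) +
    (β - 1) * windLog (1 - (p + R) / 2) ((R - p) / 2) s) * g (circleThrough p R s) *
    deriv (circleThrough p R) s

/-- The loop around `0`. -/
noncomputable def loopZeroIntegrand (p r : ℝ) (α β : ℂ) (g : ℂ → ℂ) (s : ℝ) : ℂ :=
  Complex.exp ((α - 1) * windLog ((p + -r) / 2) ((p - -r) / 2) s +
    (β - 1) * Complex.log (1 - circleThrough p (-r) s)) * g (circleThrough p (-r) s) *
    deriv (circleThrough p (-r)) s

theorem circleThrough_re_mem {P Q : ℝ} (s : ℝ) : min P Q ≤ (circleThrough P Q s).re ∧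
    (circleThrough P Q s).re ≤ max P Q := by
  have h : (circleThrough P Q s).re = (P + Q) / 2 + (P - Q) / 2 * Real.cos (2 * Real.pi * s) := by
    rw [circleThrough_eq, Complex.add_re, Complex.ofReal_re, Complex.re_ofReal_mul]
    congr 2
    rw [← Complex.exp_ofReal_mul_I_re]
    push_cast; rfl
  rw [h]
  have h1 := Real.neg_one_le_cos (2 * Real.pi * s)
  have h2 := Real.cos_le_one (2 * Real.pi * s)
  rcases le_total P Q with hPQ | hPQ
  · rw [min_eq_left hPQ, max_eq_right hPQ]
    constructor <;> nlinarith
  · rw [min_eq_right hPQ, max_eq_left hPQ]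
    constructor <;> nlinarith


/-! ### Branches of the logarithms of `u` and `1 - u` along the double loop -/

/-- A function with a continuous logarithm along it. -/
def HasLogAlong (δ L : ℝ → ℂ) : Prop :=
  (∀ s, HasDerivAt L (deriv δ s / δ s) s) ∧ Continuous fun s => deriv δ s / δ s

theorem HasLogAlong.add_const {δ L : ℝ → ℂ} (h : HasLogAlong δ L) (C : ℂ) :
    HasLogAlong δ fun s => L s + C :=
  ⟨fun s => (h.1 s).add_const C, h.2⟩

theorem HasLogAlong.reflect {δ L : ℝ → ℂ} (h : HasLogAlong δ L) :
    HasLogAlong (fun s => δ (-s)) fun s => L (-s) := by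
  have e : ∀ s, deriv (fun s => δ (-s)) s / δ (-s) = -(deriv δ (-s) / δ (-s)) := fun s => by
    rw [deriv_comp_neg, neg_div]
  constructor
  · intro s
    rw [e]
    have := (h.1 (-s)).scomp s (hasDerivAt_neg s)
    refine (this.congr_deriv (by simp)).congr_of_eventuallyEq (Eventually.of_forall fun _ => rfl)
  · simp only [e]
    exact (h.2.comp continuous_neg).neg

theorem hasLogAlong_of_slitPlane {δ δ' : ℝ → ℂ} (h : ∀ s, HasDerivAt δ (δ' s) s)
    (hc : Continuous δ') (hs : ∀ s, δ s ∈ Complex.slitPlane) :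
    HasLogAlong δ fun s => Complex.log (δ s) := by
  have e : deriv δ = δ' := funext fun s => (h s).deriv
  refine ⟨fun s => ?_, ?_⟩
  · rw [e]
    exact (h s).clog_real (hs s)
  · rw [e]
    exact hc.div (continuous_iff_continuousAt.2 fun s => (h s).continuousAt)
      fun s => Complex.slitPlane_ne_zero (hs s)

theorem hasLogAlong_windLog {δ : ℝ → ℂ} {A ρ : ℝ} (hρ : 0 < ρ) (hA : |A| < ρ)
    (h : ∀ s, δ s = A + ρ * Complex.exp (2 * Real.pi * s * Complex.I))
    (h' : ∀ s, deriv δ s = ρ * (Complex.exp (2 * Real.pi * s * Complex.I) * (2 * Real.pi * Complex.I))) :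
    HasLogAlong δ (windLog A ρ) := by
  refine ⟨fun s => ?_, ?_⟩
  · rw [h, h']
    exact hasDerivAt_windLog hρ hA s
  · simp only [h, h']
    refine Continuous.div (by fun_prop) (by fun_prop) fun s => ?_
    rw [← exp_windLog hρ hA]
    exact Complex.exp_ne_zero _

/-- Admissible parameters of the double loop. -/
structure LoopParams (p r R : ℝ) : Prop where
  p_pos : 0 < p
  p_lt : p < 1
  R_gt : 1 < R
  r_pos : 0 < r

variable {p r R : ℝ}

theorem LoopParams.center_one (h : LoopParams p r R) : |1 - (p + R) / 2| < (R - p) / 2 := by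
  have := h.p_lt
  have := h.R_gt
  rw [abs_lt]; constructor <;> linarith

theorem LoopParams.center_zero (h : LoopParams p r R) : |(p + -r) / 2| < (p - -r) / 2 := by
  have := h.p_pos
  have := h.r_pos
  rw [abs_lt]; constructor <;> linarith

theorem LoopParams.radius_one (h : LoopParams p r R) : 0 < (R - p) / 2 := by
  linarith [h.p_lt, h.R_gt]

theorem LoopParams.radius_zero (h : LoopParams p r R) : 0 < (p - -r) / 2 := by
  linarith [h.p_pos, h.r_pos]

theorem LoopParams.re_circle_one (h : LoopParams p r R) (s : ℝ) : 0 < (circleThrough p R s).re := by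
  have := (circleThrough_re_mem (P := p) (Q := R) s).1
  rw [min_eq_left (h.p_lt.trans h.R_gt).le] at this
  exact h.p_pos.trans_le this

theorem LoopParams.re_circle_zero (h : LoopParams p r R) (s : ℝ) :
    0 < (1 - circleThrough p (-r) s).re := by
  have := (circleThrough_re_mem (P := p) (Q := -r) s).2
  rw [max_eq_left (by linarith [h.p_pos, h.r_pos])] at this
  rw [Complex.sub_re, Complex.one_re]
  linarith [h.p_lt]

theorem deriv_one_sub_circle (P Q s : ℝ) :
    deriv (fun s => 1 - circleThrough P Q s) s = -deriv (circleThrough P Q) s := by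
  rw [deriv_const_sub]

theorem LoopParams.hasLog_one (h : LoopParams p r R) :
    HasLogAlong (circleThrough p R) fun s => Complex.log (circleThrough p R s) :=
  hasLogAlong_of_slitPlane (hasDerivAt_circleThrough p R) (by fun_prop)
    fun s => Or.inl (h.re_circle_one s)

theorem LoopParams.hasLog_one_sub_zero (h : LoopParams p r R) :
    HasLogAlong (fun s => 1 - circleThrough p (-r) s)
      fun s => Complex.log (1 - circleThrough p (-r) s) :=
  hasLogAlong_of_slitPlane (fun s => (hasDerivAt_circleThrough p (-r) s).const_sub 1) (by fun_prop)
    fun s => Or.inl (h.re_circle_zero s)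

theorem LoopParams.one_sub_circle_one (p R s : ℝ) : 1 - circleThrough p R s =
    ((1 - (p + R) / 2 : ℝ) : ℂ) + ((R - p) / 2 : ℝ) * Complex.exp (2 * Real.pi * s * Complex.I) := by
  rw [circleThrough_eq]; push_cast; ring

theorem LoopParams.hasLog_one_sub_one (h : LoopParams p r R) :
    HasLogAlong (fun s => 1 - circleThrough p R s) (windLog (1 - (p + R) / 2) ((R - p) / 2)) :=
  hasLogAlong_windLog h.radius_one h.center_one (LoopParams.one_sub_circle_one p R) fun s => by
    rw [deriv_one_sub_circle, deriv_circleThrough]; push_cast; ring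

theorem LoopParams.hasLog_zero (h : LoopParams p r R) :
    HasLogAlong (circleThrough p (-r)) (windLog ((p + -r) / 2) ((p - -r) / 2)) :=
  hasLogAlong_windLog h.radius_zero h.center_zero (circleThrough_eq p (-r))
    (deriv_circleThrough p (-r))

theorem circleThrough_zero (P Q : ℝ) : circleThrough P Q 0 = P := by
  rw [circleThrough_eq]
  simp only [Complex.ofReal_zero, mul_zero, zero_mul, Complex.exp_zero, mul_one]
  push_cast; ring

theorem circleThrough_int (P Q : ℝ) (n : ℤ) : circleThrough P Q n = P := by
  have := circleThrough_sub_int P Q n n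
  rw [sub_self, circleThrough_zero] at this
  exact this.symm

theorem windLog_int (A ρ : ℝ) (n : ℤ) : windLog A ρ n = windLog A ρ 0 + n * (2 * Real.pi * Complex.I) := by
  have := windLog_sub_int A ρ n n
  rw [sub_self] at this
  rw [this]; ring

theorem LoopParams.windLog_one_zero (h : LoopParams p r R) :
    windLog (1 - (p + R) / 2) ((R - p) / 2) 0 = Complex.log (1 - p) := by
  rw [windLog_zero h.radius_one h.center_one]
  congr 1; push_cast; ring

theorem LoopParams.windLog_zero_zero (h : LoopParams p r R) :
    windLog ((p + -r) / 2) ((p - -r) / 2) 0 = Complex.log p := by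
  rw [windLog_zero h.radius_zero h.center_zero]
  congr 1; push_cast; ring

theorem doubleLoop_piece₀ (p r R : ℝ) : ∀ s ∈ Set.Ioo (0 : ℝ) 1,
    doubleLoop p r R s = circleThrough p R s := fun s hs => by
  rw [doubleLoop, if_pos hs.2.le]

theorem doubleLoop_piece₁ (p r R : ℝ) : ∀ s ∈ Set.Ioo (1 : ℝ) 2,
    doubleLoop p r R s = circleThrough p (-r) s := fun s hs => by
  rw [doubleLoop, if_neg (not_le.2 hs.1), if_pos hs.2.le]

theorem doubleLoop_piece₂ (p r R : ℝ) : ∀ s ∈ Set.Ioo (2 : ℝ) 3,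
    doubleLoop p r R s = circleThrough p R (-s) := fun s hs => by
  rw [doubleLoop, if_neg (not_le.2 (by linarith [hs.1])), if_neg (not_le.2 hs.1), if_pos hs.2.le]

theorem doubleLoop_piece₃ (p r R : ℝ) : ∀ s ∈ Set.Ioo (3 : ℝ) 4,
    doubleLoop p r R s = circleThrough p (-r) (-s) := fun s hs => by
  rw [doubleLoop, if_neg (not_le.2 (by linarith [hs.1])), if_neg (not_le.2 (by linarith [hs.1])),
    if_neg (not_le.2 hs.1)]

theorem doubleLoop_zero (p r R : ℝ) : doubleLoop p r R 0 = p := by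
  rw [doubleLoop, if_pos zero_le_one, circleThrough_zero]

/-- The value of `windLog` at an integer `n` is its value at `0` plus `2πin`, and the added
constants restore continuity at the corners. Altogether `log u` gains `2πi` on the second circle and
loses it on the fourth. For instance at `t = 3` the last branch is `log p - 6πi + 8πi = log p +
2πi`. -/
theorem LoopParams.logAlong_u (h : LoopParams p r R) :
    (∀ t ∈ Set.Icc (0 : ℝ) 1, logAlong (doubleLoop p r R) t = Complex.log (circleThrough p R t)) ∧
    (∀ t ∈ Set.Icc (1 : ℝ) 2, logAlong (doubleLoop p r R) t =
      windLog ((p + -r) / 2) ((p - -r) / 2) t + -(2 * Real.pi * Complex.I)) ∧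
    (∀ t ∈ Set.Icc (2 : ℝ) 3, logAlong (doubleLoop p r R) t =
      Complex.log (circleThrough p R (-t)) + 2 * Real.pi * Complex.I) ∧
    (∀ t ∈ Set.Icc (3 : ℝ) 4, logAlong (doubleLoop p r R) t =
      windLog ((p + -r) / 2) ((p - -r) / 2) (-t) + 4 * (2 * Real.pi * Complex.I)) := by
  have H₁ := h.hasLog_zero.add_const (-(2 * Real.pi * Complex.I))
  have H₂ := h.hasLog_one.reflect.add_const (2 * Real.pi * Complex.I)
  have H₃ := h.hasLog_zero.reflect.add_const (4 * (2 * Real.pi * Complex.I))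
  refine logAlong_four_pieces (doubleLoop_piece₀ p r R) (doubleLoop_piece₁ p r R)
    (doubleLoop_piece₂ p r R) (doubleLoop_piece₃ p r R) h.hasLog_one.1 H₁.1 H₂.1 H₃.1
    h.hasLog_one.2 H₁.2 H₂.2 H₃.2 ?_ ?_ ?_ ?_
  · rw [doubleLoop_zero, circleThrough_zero]
  · have := circleThrough_int p R 1
    have h2 := windLog_int ((p + -r) / 2) ((p - -r) / 2) 1
    simp only [Int.cast_one] at this h2
    rw [this, h2, h.windLog_zero_zero]; ring
  · have := circleThrough_int p R (-2)
    have h2 := windLog_int ((p + -r) / 2) ((p - -r) / 2) 2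
    simp only [Int.cast_neg, Int.cast_ofNat] at this h2
    rw [this, h2, h.windLog_zero_zero]; ring
  · have := circleThrough_int p R (-3)
    have h2 := windLog_int ((p + -r) / 2) ((p - -r) / 2) (-3)
    simp only [Int.cast_neg, Int.cast_ofNat] at this h2
    rw [this, h2, h.windLog_zero_zero]; ring

/-- Here the first circle adds `2πi` and the third one removes it. The constant `6πi` on the third
piece compensates for `windLog` at `-2`, where `2πi` must already be present. -/
theorem LoopParams.logAlong_one_sub (h : LoopParams p r R) :
    (∀ t ∈ Set.Icc (0 : ℝ) 1, logAlong (fun s => 1 - doubleLoop p r R s) t =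
      windLog (1 - (p + R) / 2) ((R - p) / 2) t) ∧
    (∀ t ∈ Set.Icc (1 : ℝ) 2, logAlong (fun s => 1 - doubleLoop p r R s) t =
      Complex.log (1 - circleThrough p (-r) t) + 2 * Real.pi * Complex.I) ∧
    (∀ t ∈ Set.Icc (2 : ℝ) 3, logAlong (fun s => 1 - doubleLoop p r R s) t =
      windLog (1 - (p + R) / 2) ((R - p) / 2) (-t) + 3 * (2 * Real.pi * Complex.I)) ∧
    (∀ t ∈ Set.Icc (3 : ℝ) 4, logAlong (fun s => 1 - doubleLoop p r R s) t =
      Complex.log (1 - circleThrough p (-r) (-t))) := by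
  have H₁ := h.hasLog_one_sub_zero.add_const (2 * Real.pi * Complex.I)
  have H₂ := h.hasLog_one_sub_one.reflect.add_const (3 * (2 * Real.pi * Complex.I))
  have H₃ := h.hasLog_one_sub_zero.reflect
  refine logAlong_four_pieces (δ₀ := fun s => 1 - circleThrough p R s)
    (δ₁ := fun s => 1 - circleThrough p (-r) s) (δ₂ := fun s => 1 - circleThrough p R (-s))
    (δ₃ := fun s => 1 - circleThrough p (-r) (-s))
    (fun s hs => by rw [doubleLoop_piece₀ p r R s hs])
    (fun s hs => by rw [doubleLoop_piece₁ p r R s hs])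
    (fun s hs => by rw [doubleLoop_piece₂ p r R s hs])
    (fun s hs => by rw [doubleLoop_piece₃ p r R s hs]) h.hasLog_one_sub_one.1 H₁.1 H₂.1 H₃.1
    h.hasLog_one_sub_one.2 H₁.2 H₂.2 H₃.2 ?_ ?_ ?_ ?_
  · rw [doubleLoop_zero, h.windLog_one_zero]
  · have := circleThrough_int p (-r) 1
    have h2 := windLog_int (1 - (p + R) / 2) ((R - p) / 2) 1
    simp only [Int.cast_one] at this h2
    rw [this, h2, h.windLog_one_zero]; ring
  · have := circleThrough_int p (-r) 2
    have h2 := windLog_int (1 - (p + R) / 2) ((R - p) / 2) (-2)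
    simp only [Int.cast_neg, Int.cast_ofNat] at this h2
    rw [this, h2, h.windLog_one_zero]; ring
  · have := circleThrough_int p (-r) (-3)
    have h2 := windLog_int (1 - (p + R) / 2) ((R - p) / 2) (-3)
    simp only [Int.cast_neg, Int.cast_ofNat] at this h2
    rw [this, h2, h.windLog_one_zero]; ring

theorem HasLogAlong.continuous {δ L : ℝ → ℂ} (h : HasLogAlong δ L) : Continuous L :=
  continuous_iff_continuousAt.2 fun s => (h.1 s).continuousAt

theorem LoopParams.continuous_loopOneIntegrand (h : LoopParams p r R) (α β : ℂ) {g : ℂ → ℂ}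
    (hg : Continuous fun s => g (circleThrough p R s)) :
    Continuous (loopOneIntegrand p R α β g) := by
  have h1 := h.hasLog_one.continuous
  have h2 := h.hasLog_one_sub_one.continuous
  have h3 := continuous_deriv_circleThrough p R
  exact (((continuous_const.mul h1).add (continuous_const.mul h2)).cexp.mul hg).mul h3

theorem LoopParams.continuous_loopZeroIntegrand (h : LoopParams p r R) (α β : ℂ) {g : ℂ → ℂ}
    (hg : Continuous fun s => g (circleThrough p (-r) s)) :
    Continuous (loopZeroIntegrand p r α β g) := by
  have h1 := h.hasLog_one_sub_zero.continuous
  have h2 := h.hasLog_zero.continuous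
  have h3 := continuous_deriv_circleThrough p (-r)
  exact (((continuous_const.mul h2).add (continuous_const.mul h1)).cexp.mul hg).mul h3

theorem loopOneIntegrand_sub_int (p R : ℝ) (α β : ℂ) (g : ℂ → ℂ) (s : ℝ) (n : ℤ) :
    loopOneIntegrand p R α β g (s - n) =
      Complex.exp (-(n * (2 * Real.pi * Complex.I * (β - 1)))) * loopOneIntegrand p R α β g s := by
  rw [loopOneIntegrand, loopOneIntegrand, circleThrough_sub_int, deriv_circleThrough_sub_int,
    windLog_sub_int]
  have e : ∀ l w : ℂ, Complex.exp ((α - 1) * l + (β - 1) * (w - n * (2 * Real.pi * Complex.I))) =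
      Complex.exp (-(n * (2 * Real.pi * Complex.I * (β - 1)))) *
        Complex.exp ((α - 1) * l + (β - 1) * w) := fun l w => by
    rw [← Complex.exp_add]; congr 1; ring
  rw [e]; ring

theorem loopZeroIntegrand_sub_int (p r : ℝ) (α β : ℂ) (g : ℂ → ℂ) (s : ℝ) (n : ℤ) :
    loopZeroIntegrand p r α β g (s - n) =
      Complex.exp (-(n * (2 * Real.pi * Complex.I * (α - 1)))) * loopZeroIntegrand p r α β g s := by
  rw [loopZeroIntegrand, loopZeroIntegrand, circleThrough_sub_int, deriv_circleThrough_sub_int,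
    windLog_sub_int]
  have e : ∀ l w : ℂ, Complex.exp ((α - 1) * (w - n * (2 * Real.pi * Complex.I)) + (β - 1) * l) =
      Complex.exp (-(n * (2 * Real.pi * Complex.I * (α - 1)))) *
        Complex.exp ((α - 1) * w + (β - 1) * l) := fun l w => by
    rw [← Complex.exp_add]; congr 1; ring
  rw [e]; ring

theorem integral_congr_Ioo {f g : ℝ → ℂ} {a b : ℝ} (hab : a ≤ b) (h : Set.EqOn g f (Set.Ioo a b)) :
    ∫ s in a..b, f s = ∫ s in a..b, g s := by
  rw [intervalIntegral.integral_of_le hab, intervalIntegral.integral_of_le hab,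
    integral_Ioc_eq_integral_Ioo, integral_Ioc_eq_integral_Ioo]
  exact (setIntegral_congr_fun measurableSet_Ioo h).symm

theorem intervalIntegrable_congr_Ioo {f g : ℝ → ℂ} {a b : ℝ} (hab : a ≤ b) (hg : Continuous g)
    (h : Set.EqOn g f (Set.Ioo a b)) : IntervalIntegrable f volume a b := by
  have := hg.intervalIntegrable (μ := volume) a b
  rw [intervalIntegrable_iff_integrableOn_Ioo_of_le hab] at this ⊢
  exact this.congr_fun h measurableSet_Ioo

theorem deriv_eq_of_Ioo {γ δ : ℝ → ℂ} {a b : ℝ} (h : ∀ s ∈ Set.Ioo a b, γ s = δ s) {s : ℝ}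
    (hs : s ∈ Set.Ioo a b) : deriv γ s = deriv δ s := by
  have : γ =ᶠ[𝓝 s] δ := by
    filter_upwards [isOpen_Ioo.mem_nhds hs] with t ht using h t ht
  exact this.deriv_eq

/-- The double loop integral in terms of simple loops around `1` and `0`. -/
theorem LoopParams.doubleLoopIntegral_eq (h : LoopParams p r R) (α β : ℂ) {g : ℂ → ℂ}
    (hg1 : Continuous fun s => g (circleThrough p R s))
    (hg0 : Continuous fun s => g (circleThrough p (-r) s)) :
    doubleLoopIntegral p r R α β g =
      (1 - Complex.exp (2 * Real.pi * Complex.I * α)) * (∫ s in (0 : ℝ)..1,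
        loopOneIntegrand p R α β g s) -
      (1 - Complex.exp (2 * Real.pi * Complex.I * β)) * ∫ s in (0 : ℝ)..1,
        loopZeroIntegrand p r α β g s := by
  obtain ⟨u₀, u₁, u₂, u₃⟩ := h.logAlong_u
  obtain ⟨v₀, v₁, v₂, v₃⟩ := h.logAlong_one_sub
  have c1 := h.continuous_loopOneIntegrand α β hg1
  have c0 := h.continuous_loopZeroIntegrand α β hg0
  set F : ℝ → ℂ := fun t => Complex.exp ((α - 1) * logAlong (doubleLoop p r R) t +
        (β - 1) * logAlong (fun s => 1 - doubleLoop p r R s) t) *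
      g (doubleLoop p r R t) * deriv (doubleLoop p r R) t with hF
  have hα : ∀ z : ℂ, Complex.exp (2 * Real.pi * Complex.I * (z - 1)) =
      Complex.exp (2 * Real.pi * Complex.I * z) := fun z => by
    rw [mul_sub, mul_one]
    exact Complex.exp_periodic.sub_eq _
  -- Relative to the simple loops the four pieces carry the factors `1`, `e^(2πiβ)`, `-e^(2πiα)` and
  -- `-1`. The signs come from reversed orientation, and the phases from the argument that the other
  -- variable has gained in the meantime.
  have E₀ : Set.EqOn (loopOneIntegrand p R α β g) F (Set.Ioo 0 1) := by
    intro t ht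
    simp only [hF]
    rw [u₀ t ⟨ht.1.le, ht.2.le⟩, v₀ t ⟨ht.1.le, ht.2.le⟩, doubleLoop_piece₀ p r R t ht,
      deriv_eq_of_Ioo (doubleLoop_piece₀ p r R) ht, loopOneIntegrand]
  have E₁ : Set.EqOn (fun t => Complex.exp (2 * Real.pi * Complex.I * β) *
      loopZeroIntegrand p r α β g (t - 1)) F (Set.Ioo 1 2) := by
    intro t ht
    simp only [hF]
    have := loopZeroIntegrand_sub_int p r α β g t 1
    rw [Int.cast_one] at this
    rw [this, u₁ t ⟨ht.1.le, ht.2.le⟩, v₁ t ⟨ht.1.le, ht.2.le⟩, doubleLoop_piece₁ p r R t ht,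
      deriv_eq_of_Ioo (doubleLoop_piece₁ p r R) ht, loopZeroIntegrand, ← mul_assoc, ← mul_assoc,
      ← mul_assoc, ← mul_assoc, ← hα β, ← Complex.exp_add, ← Complex.exp_add]
    congr 3
    push_cast; ring
  have E₂ : Set.EqOn (fun t => -Complex.exp (2 * Real.pi * Complex.I * α) *
      loopOneIntegrand p R α β g (3 - t)) F (Set.Ioo 2 3) := by
    intro t ht
    simp only [hF]
    have := loopOneIntegrand_sub_int p R α β g (-t) (-3)
    rw [Int.cast_neg, Int.cast_ofNat, sub_neg_eq_add, neg_add_eq_sub] at this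
    rw [this, u₂ t ⟨ht.1.le, ht.2.le⟩, v₂ t ⟨ht.1.le, ht.2.le⟩, doubleLoop_piece₂ p r R t ht,
      deriv_eq_of_Ioo (doubleLoop_piece₂ p r R) ht, loopOneIntegrand, deriv_comp_neg, ← hα α,
      neg_mul, mul_neg, neg_inj, ← mul_assoc, ← mul_assoc, ← mul_assoc, ← mul_assoc,
      ← Complex.exp_add, ← Complex.exp_add]
    congr 3
    push_cast; ring
  have E₃ : Set.EqOn (fun t => -loopZeroIntegrand p r α β g (4 - t)) F (Set.Ioo 3 4) := by
    intro t ht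
    simp only [hF]
    have := loopZeroIntegrand_sub_int p r α β g (-t) (-4)
    rw [Int.cast_neg, Int.cast_ofNat, sub_neg_eq_add, neg_add_eq_sub] at this
    rw [this, u₃ t ⟨ht.1.le, ht.2.le⟩, v₃ t ⟨ht.1.le, ht.2.le⟩, doubleLoop_piece₃ p r R t ht,
      deriv_eq_of_Ioo (doubleLoop_piece₃ p r R) ht, loopZeroIntegrand, deriv_comp_neg,
      mul_neg, neg_inj, ← mul_assoc, ← mul_assoc, ← Complex.exp_add]
    congr 3
    push_cast; ring
  have I₀ := intervalIntegrable_congr_Ioo zero_le_one c1 E₀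
  have I₁ := intervalIntegrable_congr_Ioo (by norm_num) (by fun_prop) E₁
  have I₂ := intervalIntegrable_congr_Ioo (by norm_num) (by fun_prop) E₂
  have I₃ := intervalIntegrable_congr_Ioo (by norm_num) (by fun_prop) E₃
  rw [doubleLoopIntegral, ← intervalIntegral.integral_add_adjacent_intervals ((I₀.trans I₁).trans I₂) I₃,
    ← intervalIntegral.integral_add_adjacent_intervals (I₀.trans I₁) I₂,
    ← intervalIntegral.integral_add_adjacent_intervals I₀ I₁, integral_congr_Ioo zero_le_one E₀,
    integral_congr_Ioo (by norm_num) E₁, integral_congr_Ioo (by norm_num) E₂,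
    integral_congr_Ioo (by norm_num) E₃]
  simp only [intervalIntegral.integral_const_mul, intervalIntegral.integral_neg]
  rw [intervalIntegral.integral_comp_sub_right (loopZeroIntegrand p r α β g),
    intervalIntegral.integral_comp_sub_left (loopOneIntegrand p R α β g),
    intervalIntegral.integral_comp_sub_left (loopZeroIntegrand p r α β g)]
  norm_num
  ring


/-! #### Deforming paths in a half plane onto the real axis -/

theorem isOpen_halfPlane (σ : ℝ) : IsOpen {z : ℂ | 0 < σ * z.im} :=
  isOpen_lt continuous_const (continuous_const.mul Complex.continuous_im)

theorem convex_halfPlane (σ : ℝ) : Convex ℝ {z : ℂ | 0 < σ * z.im} := by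
  have := (convex_Ioi (0 : ℝ)).linear_preimage (σ • Complex.imLm)
  exact this

/-- The half plane is convex, so `f` has a primitive there, and both integrals are the same
difference of its values. The shift by `σ ε i` puts the path and the real segment strictly inside
the half plane. -/
theorem integral_shift_eq {σ ε : ℝ} {f : ℂ → ℂ} (hf : DifferentiableOn ℂ f {z : ℂ | 0 < σ * z.im})
    {γ γ' : ℝ → ℂ} (hγ : ∀ s, HasDerivAt γ (γ' s) s) (hγ' : Continuous γ') {a b P Q : ℝ}
    (ha : γ a = P) (hb : γ b = Q)
    (hab : a ≤ b) (hs : ∀ s ∈ Set.Icc a b, 0 < σ * ((γ s).im + σ * ε)) (hε : 0 < σ * (σ * ε)) :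
    ∫ s in a..b, f (γ s + σ * ε * Complex.I) * γ' s =
      ∫ u in P..Q, f (u + σ * ε * Complex.I) := by
  obtain ⟨G, hG⟩ := (convex_halfPlane σ).exists_forall_hasDerivWithinAt hf
  have hG' : ∀ z ∈ {z : ℂ | 0 < σ * z.im}, HasDerivAt G (f z) z := fun z hz =>
    (hG z hz).hasDerivAt ((isOpen_halfPlane σ).mem_nhds hz)
  have im_shift : ∀ z : ℂ, (z + σ * ε * Complex.I).im = z.im + σ * ε := fun z => by simp
  have hcf := hf.continuousOn
  have hcγ : Continuous γ := continuous_iff_continuousAt.2 fun s => (hγ s).continuousAt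
  have h1 : ∫ s in a..b, f (γ s + σ * ε * Complex.I) * γ' s =
      G (γ b + σ * ε * Complex.I) - G (γ a + σ * ε * Complex.I) := by
    refine intervalIntegral.integral_eq_sub_of_hasDerivAt (f := fun s => G (γ s + σ * ε * Complex.I))
      (fun s hs' => ?_) (ContinuousOn.intervalIntegrable ?_)
    · rw [Set.uIcc_of_le hab] at hs'
      refine HasDerivAt.comp_of_eq s (h₂ := G) (hG' _ ?_) ((hγ s).add_const _) rfl
      change 0 < σ * Complex.im _
      rw [im_shift]; exact hs s hs'
    · rw [Set.uIcc_of_le hab]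
      refine (hcf.comp (by fun_prop) fun s hs' => ?_).mul hγ'.continuousOn
      change 0 < σ * Complex.im _
      rw [im_shift]; exact hs s hs'
  have hmem : ∀ u : ℝ, 0 < σ * (u + σ * ε * Complex.I : ℂ).im := fun u => by
    rw [im_shift, Complex.ofReal_im, zero_add]; exact hε
  have h2 : ∫ u in P..Q, f (u + σ * ε * Complex.I) =
      G (Q + σ * ε * Complex.I) - G (P + σ * ε * Complex.I) := by
    refine intervalIntegral.integral_eq_sub_of_hasDerivAt
      (f := fun u : ℝ => G (u + σ * ε * Complex.I))
      (fun u _ => ?_) (ContinuousOn.intervalIntegrable ?_)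
    · have := HasDerivAt.comp_of_eq u (h₂ := G) (hG' _ (hmem u))
        ((Complex.ofRealCLM.hasDerivAt (x := u)).add_const _) rfl
      exact this.congr_deriv (by simp)
    · exact hcf.comp (by fun_prop) fun u _ => hmem u
  rw [h1, h2, ha, hb]

theorem im_shift_pos {σ ε : ℝ} (hσ : σ * σ = 1) (hε : 0 < ε) {z : ℂ} (hz : 0 ≤ σ * z.im) :
    0 < σ * (z + σ * ε * Complex.I).im := by
  have : (z + σ * ε * Complex.I).im = z.im + σ * ε := by simp
  rw [this, mul_add, ← mul_assoc, hσ, one_mul]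
  linarith

/-- Moving further into the half plane increases the distance to every real point. Hence weights
with nonpositive exponents at real singularities decrease under the shift, and their unshifted
values dominate uniformly in `ε`. -/
theorem norm_le_norm_shift {σ ε : ℝ} (_hσ : σ * σ = 1) (hε : 0 < ε) {z : ℂ} (hz : 0 ≤ σ * z.im) :
    ‖z‖ ≤ ‖z + σ * ε * Complex.I‖ := by
  have h1 : (z + σ * ε * Complex.I).im = z.im + σ * ε := by simp
  have h2 : (z + σ * ε * Complex.I).re = z.re := by simp
  rw [← sq_le_sq₀ (norm_nonneg _) (norm_nonneg _), Complex.sq_norm, Complex.sq_norm,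
    Complex.normSq_apply, Complex.normSq_apply, h1, h2]
  nlinarith [mul_nonneg hz hε.le]

/-- The shifted identity is passed to the limit `ε → 0` by dominated convergence on both sides. On
the real segment only almost everywhere information is used, since the boundary function is singular
at isolated points. -/
theorem integral_eq_of_halfPlane {σ : ℝ} (hσ : σ * σ = 1) {f : ℂ → ℂ}
    (hf : DifferentiableOn ℂ f {z : ℂ | 0 < σ * z.im})
    {γ γ' : ℝ → ℂ} (hγ : ∀ s, HasDerivAt γ (γ' s) s) (hγ' : Continuous γ') {a b P Q : ℝ}
    (ha : γ a = P) (hb : γ b = Q) (hab : a ≤ b) (hs : ∀ s ∈ Set.Icc a b, 0 ≤ σ * (γ s).im)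
    {fγ fr : ℝ → ℂ} {Bγ Br : ℝ → ℝ} (hBγ : ContinuousOn Bγ (Set.Icc a b))
    (hBr : IntervalIntegrable Br volume P Q)
    (hdγ : ∀ ε ∈ Set.Ioo (0 : ℝ) 1, ∀ s ∈ Set.Icc a b, ‖f (γ s + σ * ε * Complex.I)‖ ≤ Bγ s)
    (hlγ : ∀ s ∈ Set.Ioo a b, Tendsto (fun ε : ℝ => f (γ s + σ * ε * Complex.I)) (𝓝[>] 0) (𝓝 (fγ s)))
    (hdr : ∀ ε ∈ Set.Ioo (0 : ℝ) 1, ∀ᵐ u : ℝ, u ∈ Set.uIoc P Q →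
      ‖f (u + σ * ε * Complex.I)‖ ≤ Br u)
    (hlr : ∀ᵐ u : ℝ, u ∈ Set.uIoc P Q →
      Tendsto (fun ε : ℝ => f (u + σ * ε * Complex.I)) (𝓝[>] 0) (𝓝 (fr u))) :
    IntervalIntegrable fr volume P Q ∧ ∫ s in a..b, fγ s * γ' s = ∫ u in P..Q, fr u := by
  have hcf := hf.continuousOn
  have hcγ : Continuous γ := continuous_iff_continuousAt.2 fun s => (hγ s).continuousAt
  have hev : ∀ᶠ ε : ℝ in 𝓝[>] 0, ε ∈ Set.Ioo (0 : ℝ) 1 := Ioo_mem_nhdsGT one_pos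
  have hcr : ∀ ε ∈ Set.Ioo (0 : ℝ) 1, Continuous fun u : ℝ => f (u + σ * ε * Complex.I) :=
    fun ε hε => by
    rw [← continuousOn_univ]
    refine hcf.comp (by fun_prop) fun u _ => im_shift_pos hσ hε.1 (by simp)
  have hmr : ∀ᶠ ε : ℝ in 𝓝[>] 0, AEStronglyMeasurable (fun u : ℝ => f (u + σ * ε * Complex.I))
      (volume.restrict (Set.uIoc P Q)) := hev.mono fun ε hε => (hcr ε hε).aestronglyMeasurable
  have T1 : Tendsto (fun ε : ℝ => ∫ u in P..Q, f (u + σ * ε * Complex.I)) (𝓝[>] 0)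
      (𝓝 (∫ u in P..Q, fr u)) :=
    intervalIntegral.tendsto_integral_filter_of_dominated_convergence Br hmr
      (hev.mono hdr) hBr hlr
  have T2 : Tendsto (fun ε : ℝ => ∫ s in a..b, f (γ s + σ * ε * Complex.I) * γ' s) (𝓝[>] 0)
      (𝓝 (∫ s in a..b, fγ s * γ' s)) := by
    refine intervalIntegral.tendsto_integral_filter_of_dominated_convergence
      (fun s => Bγ s * ‖γ' s‖) (hev.mono fun ε hε => ?_) (hev.mono fun ε hε => ?_) ?_ ?_
    · rw [Set.uIoc_of_le hab]
      refine ContinuousOn.aestronglyMeasurable ?_ measurableSet_Ioc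
      refine (hcf.comp (by fun_prop) fun s hs' => ?_).mul hγ'.continuousOn
      exact im_shift_pos hσ hε.1 (hs s ⟨hs'.1.le, hs'.2⟩)
    · refine Eventually.of_forall fun s hs' => ?_
      rw [Set.uIoc_of_le hab] at hs'
      rw [norm_mul]
      exact mul_le_mul_of_nonneg_right (hdγ ε hε s ⟨hs'.1.le, hs'.2⟩) (norm_nonneg _)
    · refine ContinuousOn.intervalIntegrable ?_
      rw [Set.uIcc_of_le hab]
      exact hBγ.mul hγ'.norm.continuousOn
    · have : ∀ᵐ s : ℝ, s ≠ b := Measure.ae_ne volume b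
      filter_upwards [this] with s hsb hs'
      rw [Set.uIoc_of_le hab] at hs'
      exact (hlγ s ⟨hs'.1, lt_of_le_of_ne hs'.2 hsb⟩).mul_const _
  refine ⟨?_, tendsto_nhds_unique (T2.congr' ?_) T1⟩
  · rw [intervalIntegrable_iff] at hBr ⊢
    have hlr' : ∀ᵐ u : ℝ ∂volume.restrict (Set.uIoc P Q),
        Tendsto (fun ε : ℝ => f (u + σ * ε * Complex.I)) (𝓝[>] 0) (𝓝 (fr u)) :=
      (ae_restrict_iff' measurableSet_uIoc).2 hlr
    -- Measurability of the boundary function is obtained along a sequence; `n + 2` keeps its terms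
    -- strictly below `1`, where the bounds hold.
    have hε : Tendsto (fun n : ℕ => 1 / ((n : ℝ) + 2)) atTop (𝓝[>] 0) := by
      refine tendsto_nhdsWithin_iff.2 ⟨?_, Eventually.of_forall fun n => by
        show (0 : ℝ) < _; positivity⟩
      have := (tendsto_const_div_atTop_nhds_zero_nat (1 : ℝ)).comp (tendsto_add_atTop_nat 2)
      refine this.congr fun n => by simp
    have hεm : ∀ n : ℕ, 1 / ((n : ℝ) + 2) ∈ Set.Ioo (0 : ℝ) 1 := fun n =>
      ⟨by positivity, by
        rw [div_lt_one (by positivity)]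
        linarith [(Nat.cast_nonneg n : (0 : ℝ) ≤ n)]⟩
    refine Integrable.mono' hBr (aestronglyMeasurable_of_tendsto_ae atTop
      (fun n : ℕ => (hcr _ (hεm n)).aestronglyMeasurable)
      (hlr'.mono fun u hu => hu.comp hε)) ?_
    have hdr' : ∀ᵐ u : ℝ ∂volume.restrict (Set.uIoc P Q), ∀ n : ℕ,
        ‖f (u + σ * (1 / ((n : ℝ) + 2) : ℝ) * Complex.I)‖ ≤ Br u :=
      ae_all_iff.2 fun n => (ae_restrict_iff' measurableSet_uIoc).2 (hdr _ (hεm n))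
    filter_upwards [hlr', hdr'] with u h1 h2
    exact le_of_tendsto (h1.comp hε).norm (Eventually.of_forall h2)
  · refine hev.mono fun ε hε => integral_shift_eq hf hγ hγ' ha hb hab (fun s hs' => ?_) ?_
    · have := im_shift_pos hσ hε.1 (hs s hs')
      simpa using this
    · rw [← mul_assoc, hσ, one_mul]; exact hε.1

/-- A weight with three singularities on the real axis. -/
noncomputable def weight (e₀ e₁ e₂ q : ℝ) (z : ℂ) : ℝ :=
  ‖z‖ ^ e₀ * ‖1 - z‖ ^ e₁ * ‖z + q‖ ^ e₂

theorem weight_shift_le {e₀ e₁ e₂ q : ℝ} (h₀ : e₀ ≤ 0) (h₁ : e₁ ≤ 0) (h₂ : e₂ ≤ 0) {σ ε : ℝ}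
    (hσ : σ * σ = 1) (hε : 0 < ε) {z : ℂ} (hz : 0 ≤ σ * z.im) (z0 : z ≠ 0) (z1 : z ≠ 1)
    (zq : z + q ≠ 0) :
    weight e₀ e₁ e₂ q (z + σ * ε * Complex.I) ≤ weight e₀ e₁ e₂ q z := by
  have n0 := norm_pos_iff.2 z0
  have n1 := norm_pos_iff.2 (sub_ne_zero.2 z1.symm)
  have nq := norm_pos_iff.2 zq
  have i0 := norm_le_norm_shift hσ hε hz
  have i1 : ‖1 - z‖ ≤ ‖1 - (z + σ * ε * Complex.I)‖ := by
    rw [norm_sub_rev 1 z, norm_sub_rev 1, add_sub_right_comm]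
    exact norm_le_norm_shift hσ hε (by simpa using hz)
  have iq : ‖z + q‖ ≤ ‖z + σ * ε * Complex.I + q‖ := by
    rw [add_right_comm]
    exact norm_le_norm_shift hσ hε (by simpa using hz)
  rw [weight, weight]
  refine mul_le_mul (mul_le_mul ?_ ?_ (by positivity) (by positivity)) ?_ (by positivity)
    (by positivity)
  · exact Real.rpow_le_rpow_of_nonpos n0 i0 h₀
  · exact Real.rpow_le_rpow_of_nonpos n1 i1 h₁
  · exact Real.rpow_le_rpow_of_nonpos nq iq h₂

theorem intervalIntegrable_norm_add_rpow {e : ℝ} (he : -1 < e) (c a b : ℝ) :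
    IntervalIntegrable (fun u : ℝ => ‖(u : ℂ) + c‖ ^ e) volume a b := by
  have := (intervalIntegral.intervalIntegrable_cpow' (a := a + c) (b := b + c) (r := (e : ℂ))
    (by simpa using he)).norm.comp_add_right c
  simp only [Complex.norm_cpow_real, add_sub_cancel_right, Complex.ofReal_add] at this
  exact this

theorem continuousAt_norm_rpow {f : ℝ → ℂ} {u : ℝ} (hf : ContinuousAt f u) (h : f u ≠ 0) (e : ℝ) :
    ContinuousAt (fun u => ‖f u‖ ^ e) u :=
  hf.norm.rpow_const (Or.inl (norm_ne_zero_iff.2 h))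

/-- The points `-q/2` and `1/2` separate the three singularities, so on each piece one factor is
integrable and the others are continuous. -/
theorem intervalIntegrable_weight {e₀ e₁ e₂ q : ℝ} (h₀ : -1 < e₀) (h₁ : -1 < e₁) (h₂ : -1 < e₂)
    (hq : 0 < q) (a b : ℝ) :
    IntervalIntegrable (fun u : ℝ => weight e₀ e₁ e₂ q u) volume a b := by
  have k0 : ∀ u : ℝ, u ≠ 0 → ContinuousAt (fun u : ℝ => ‖(u : ℂ)‖ ^ e₀) u := fun u hu =>
    continuousAt_norm_rpow (by fun_prop) (by exact_mod_cast hu) e₀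
  have k1 : ∀ u : ℝ, u ≠ 1 → ContinuousAt (fun u : ℝ => ‖1 - (u : ℂ)‖ ^ e₁) u := fun u hu =>
    continuousAt_norm_rpow (f := fun u : ℝ => 1 - (u : ℂ)) (by fun_prop)
      (sub_ne_zero.2 (by exact_mod_cast hu.symm)) e₁
  have k2 : ∀ u : ℝ, u ≠ -q → ContinuousAt (fun u : ℝ => ‖(u : ℂ) + q‖ ^ e₂) u := fun u hu =>
    continuousAt_norm_rpow (f := fun u : ℝ => (u : ℂ) + q) (by fun_prop)
      (by intro h; apply hu; have : u + q = 0 := by exact_mod_cast h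
          linarith) e₂
  have i0 : ∀ a b, IntervalIntegrable (fun u : ℝ => ‖(u : ℂ)‖ ^ e₀) volume a b := fun a b => by
    simpa using intervalIntegrable_norm_add_rpow h₀ 0 a b
  have i1 : ∀ a b, IntervalIntegrable (fun u : ℝ => ‖1 - (u : ℂ)‖ ^ e₁) volume a b := fun a b => by
    refine (intervalIntegrable_norm_add_rpow h₁ (-1) a b).congr fun u _ => ?_
    rw [norm_sub_rev]; push_cast; rw [sub_eq_add_neg]
  have i2 : ∀ a b, IntervalIntegrable (fun u : ℝ => ‖(u : ℂ) + q‖ ^ e₂) volume a b :=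
    intervalIntegrable_norm_add_rpow h₂ q
  have A : ∀ a b : ℝ, a ≤ -q / 2 → b ≤ -q / 2 →
      IntervalIntegrable (fun u : ℝ => weight e₀ e₁ e₂ q u) volume a b := fun a b ha hb =>
    (i2 a b).continuousOn_mul fun u hu => by
      have : u ≤ -q / 2 := hu.2.trans (max_le ha hb)
      exact ((k0 u (by intro h; linarith)).mul (k1 u (by intro h; linarith))).continuousWithinAt
  have B : ∀ a b : ℝ, -q / 2 ≤ a → -q / 2 ≤ b → a ≤ 1 / 2 → b ≤ 1 / 2 →
      IntervalIntegrable (fun u : ℝ => weight e₀ e₁ e₂ q u) volume a b := fun a b ha hb ha' hb' => by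
    refine ((i0 a b).mul_continuousOn (g := fun u : ℝ => ‖1 - (u : ℂ)‖ ^ e₁) fun u hu => ?_).mul_continuousOn
      fun u hu => ?_
    · have : u ≤ 1 / 2 := hu.2.trans (max_le ha' hb')
      exact (k1 u (by intro h; linarith)).continuousWithinAt
    · have : -q / 2 ≤ u := (le_min ha hb).trans hu.1
      exact (k2 u (by intro h; linarith)).continuousWithinAt
  have C : ∀ a b : ℝ, 1 / 2 ≤ a → 1 / 2 ≤ b →
      IntervalIntegrable (fun u : ℝ => weight e₀ e₁ e₂ q u) volume a b := fun a b ha hb => by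
    refine ((i1 a b).continuousOn_mul (g := fun u : ℝ => ‖(u : ℂ)‖ ^ e₀) fun u hu => ?_).mul_continuousOn
      fun u hu => ?_
    · have : 1 / 2 ≤ u := (le_min ha hb).trans hu.1
      exact (k0 u (by intro h; linarith)).continuousWithinAt
    · have : 1 / 2 ≤ u := (le_min ha hb).trans hu.1
      exact (k2 u (by intro h; linarith)).continuousWithinAt
  have D : ∀ b, IntervalIntegrable (fun u : ℝ => weight e₀ e₁ e₂ q u) volume (-q / 2) b := fun b => by
    rcases le_total b (-q / 2) with h | h
    · exact A _ _ le_rfl h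
    rcases le_total b (1 / 2) with h' | h'
    · exact B _ _ le_rfl h (by linarith) h'
    · exact (B _ (1 / 2) le_rfl (by linarith) (by linarith) le_rfl).trans (C _ _ le_rfl h')
  exact (D a).symm.trans (D b)

/-- On bounded sets positive exponents can be replaced by `0`. All exponents of the weight are then
nonpositive, as the monotonicity under the shift requires. -/
theorem rpow_le_min_zero {x M : ℝ} (hx : 0 < x) (hxM : x ≤ M) (hM : 1 ≤ M) (e : ℝ) :
    x ^ e ≤ M ^ |e| * x ^ min e 0 := by
  rcases le_total e 0 with h | h
  · rw [min_eq_left h]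
    exact le_mul_of_one_le_left (by positivity) (Real.one_le_rpow hM (abs_nonneg e))
  · rw [min_eq_right h, Real.rpow_zero, mul_one, abs_of_nonneg h]
    exact Real.rpow_le_rpow hx.le hxM h


/-! ### Boundary values of the integrand on the real axis -/

/-- The boundary value of the principal power `z ^ s` at real `v`, from the half plane
`0 < σ * z.im`. -/
noncomputable def boundaryPow (σ : ℝ) (s : ℂ) (v : ℝ) : ℂ :=
  if v < 0 then ((-v : ℝ) : ℂ) ^ s * Complex.exp (σ * Real.pi * Complex.I * s) else (v : ℂ) ^ s

theorem boundaryPow_of_pos (σ : ℝ) (s : ℂ) {v : ℝ} (hv : 0 < v) : boundaryPow σ s v = (v : ℂ) ^ s :=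
  if_neg hv.le.not_gt

theorem boundaryPow_of_neg (σ : ℝ) (s : ℂ) {v : ℝ} (hv : v < 0) : boundaryPow σ s v =
    ((-v : ℝ) : ℂ) ^ s * Complex.exp (σ * Real.pi * Complex.I * s) :=
  if_pos hv

theorem tendsto_boundaryPow {σ : ℝ} (hσ : σ * σ = 1) (s : ℂ) {v : ℝ} (hv : v ≠ 0) :
    Tendsto (fun z : ℂ => z ^ s) (𝓝[{z : ℂ | 0 < σ * z.im}] (v : ℂ)) (𝓝 (boundaryPow σ s v)) := by
  rcases lt_or_gt_of_ne hv with h | h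
  · rw [boundaryPow_of_neg σ s h]
    have hlog : Tendsto Complex.log (𝓝[{z : ℂ | 0 < σ * z.im}] (v : ℂ))
        (𝓝 (Real.log (-v) + σ * Real.pi * Complex.I)) := by
      have hn : ‖(v : ℂ)‖ = -v := by rw [Complex.norm_real, Real.norm_eq_abs, abs_of_neg h]
      rcases mul_self_eq_one_iff.1 hσ with rfl | rfl
      · have := Complex.tendsto_log_nhdsWithin_im_nonneg_of_re_neg_of_im_zero (z := (v : ℂ))
          (by simpa using h) (by simp)
        rw [hn] at this
        simp only [Complex.ofReal_one, one_mul]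
        exact this.mono_left (nhdsWithin_mono _ fun z hz => (show 0 < z.im from hz).le)
      · have := Complex.tendsto_log_nhdsWithin_im_neg_of_re_neg_of_im_zero (z := (v : ℂ))
          (by simpa using h) (by simp)
        rw [hn] at this
        simp only [neg_mul, one_mul, Left.neg_pos_iff, Complex.ofReal_neg, Complex.ofReal_one]
        exact this
    have h1 : (((-v : ℝ) : ℂ)) ^ s * Complex.exp (σ * Real.pi * Complex.I * s) =
        Complex.exp ((Real.log (-v) + σ * Real.pi * Complex.I) * s) := by
      rw [Complex.cpow_def_of_ne_zero (by exact_mod_cast (neg_pos.2 h).ne'), ← Complex.exp_add,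
        Complex.ofReal_log (neg_pos.2 h).le]
      congr 1; ring
    rw [h1]
    refine ((Complex.continuous_exp.tendsto _).comp (hlog.mul_const s)).congr' ?_
    filter_upwards [self_mem_nhdsWithin] with z hz
    have hz0 : z ≠ 0 := fun h0 => by
      rw [h0] at hz; simp at hz
    rw [Complex.cpow_def_of_ne_zero hz0, Function.comp_apply]
  · rw [boundaryPow_of_pos σ s h]
    have : ContinuousAt (fun z : ℂ => z ^ s) v :=
      continuousAt_id.cpow continuousAt_const (Or.inl (by simpa using h))
    exact this.tendsto.mono_left nhdsWithin_le_nhds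

/-- The map `z ↦ 1 - z` exchanges the two half planes, which changes the sign `σ`. -/
theorem tendsto_boundaryPow_one_sub {σ : ℝ} (hσ : σ * σ = 1) (s : ℂ) {v : ℝ} (hv : v ≠ 1) :
    Tendsto (fun z : ℂ => (1 - z) ^ s) (𝓝[{z : ℂ | 0 < σ * z.im}] (v : ℂ))
      (𝓝 (boundaryPow (-σ) s (1 - v))) := by
  refine (tendsto_boundaryPow (σ := -σ) (by linarith) s (sub_ne_zero.2 hv.symm)).comp
    (tendsto_nhdsWithin_iff.2 ⟨?_, ?_⟩)
  · have : ContinuousAt (fun z : ℂ => 1 - z) v := by fun_prop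
    have := this.tendsto.mono_left (nhdsWithin_le_nhds (s := {z : ℂ | 0 < σ * z.im}))
    simpa using this
  · filter_upwards [self_mem_nhdsWithin] with z hz
    simpa using hz

/-- A function on the plane cut along the real axis, with boundary values `gb 1` from above and
`gb (-1)` from below and with power singularities at `0` and `-q`. -/
structure BoundaryData (r q m θ : ℝ) (g : ℂ → ℂ) (gb : ℝ → ℝ → ℂ) : Prop where
  q_pos : 0 < q
  θ_nonneg : 0 ≤ θ
  θ_lt : θ < 1
  diff : ∀ z : ℂ, z.im ≠ 0 → DifferentiableAt ℂ g z
  bound : ∀ M : ℝ, ∃ K : ℝ, 0 ≤ K ∧ ∀ z : ℂ, z.im ≠ 0 → -r ≤ z.re → ‖z‖ ≤ M →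
    ‖g z‖ ≤ K * (‖z‖ ^ m * ‖z + q‖ ^ (-θ))
  tendsto : ∀ σ : ℝ, σ * σ = 1 → ∀ u : ℝ, -r ≤ u → u ≠ 0 → u ≠ -q →
    Tendsto g (𝓝[{z : ℂ | 0 < σ * z.im}] (u : ℂ)) (𝓝 (gb σ u))
  eq_pos : ∀ σ : ℝ, σ * σ = 1 → ∀ u : ℝ, 0 < u → gb σ u = g u
  eq_lt : ∀ u : ℝ, -r ≤ u → u < -q → gb 1 u = gb (-1) u

/-- The integrand of the Pochhammer type integrals, with principal powers. -/
noncomputable def eulerIntegrand (α β : ℂ) (g : ℂ → ℂ) (z : ℂ) : ℂ :=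
  z ^ (α - 1) * (1 - z) ^ (β - 1) * g z

/-- The boundary values of `eulerIntegrand`. -/
noncomputable def boundaryIntegrand (α β : ℂ) (gb : ℝ → ℝ → ℂ) (σ u : ℝ) : ℂ :=
  boundaryPow σ (α - 1) u * boundaryPow (-σ) (β - 1) (1 - u) * gb σ u

variable {r q m θ : ℝ} {g : ℂ → ℂ} {gb : ℝ → ℝ → ℂ} {α β : ℂ}

theorem mem_slitPlane_of_im_ne_zero {z : ℂ} (hz : z.im ≠ 0) : z ∈ Complex.slitPlane ∧
    1 - z ∈ Complex.slitPlane :=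
  ⟨Or.inr hz, Or.inr (by simpa using hz)⟩

theorem im_ne_zero_of_halfPlane {σ : ℝ} {z : ℂ} (hz : 0 < σ * z.im) : z.im ≠ 0 := by
  rintro h; rw [h, mul_zero] at hz; exact hz.false

theorem BoundaryData.differentiableAt_eulerIntegrand (h : BoundaryData r q m θ g gb) (α β : ℂ) {z : ℂ}
    (hz : z.im ≠ 0) : DifferentiableAt ℂ (eulerIntegrand α β g) z := by
  obtain ⟨h1, h2⟩ := mem_slitPlane_of_im_ne_zero hz
  have d1 : DifferentiableAt ℂ (fun z : ℂ => z ^ (α - 1)) z :=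
    differentiableAt_id.cpow_const h1
  have d2 : DifferentiableAt ℂ (fun z : ℂ => (1 - z) ^ (β - 1)) z :=
    (differentiableAt_id.const_sub 1).cpow_const h2
  exact (d1.mul d2).mul (h.diff z hz)

theorem BoundaryData.exists_bound (h : BoundaryData r q m θ g gb) (α β : ℂ) (M : ℝ) :
    ∃ K : ℝ, 0 ≤ K ∧ ∀ z : ℂ, z.im ≠ 0 → -r ≤ z.re → ‖z‖ ≤ M → ‖eulerIntegrand α β g z‖ ≤
      K * weight (min (α.re - 1 + m) 0) (min (β.re - 1) 0) (-θ) q z := by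
  obtain ⟨K, hK, hb⟩ := h.bound M
  set N : ℝ := max (M + 1) 1 with hN
  have hN1 : 1 ≤ N := le_max_right _ _
  have hN2 : M + 1 ≤ N := le_max_left _ _
  refine ⟨Real.exp (Real.pi * |α.im|) * Real.exp (Real.pi * |β.im|) * K * N ^ |α.re - 1 + m| *
    N ^ |β.re - 1|, by positivity, fun z hz hr hM => ?_⟩
  obtain ⟨h1, h2⟩ := mem_slitPlane_of_im_ne_zero hz
  have z0 := Complex.slitPlane_ne_zero h1
  have z1 := Complex.slitPlane_ne_zero h2
  have n0 := norm_pos_iff.2 z0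
  have n1 := norm_pos_iff.2 z1
  have a1 := norm_cpow_le_mul z0 (α - 1)
  have a2 := norm_cpow_le_mul z1 (β - 1)
  simp only [Complex.sub_re, Complex.sub_im, Complex.one_re, Complex.one_im, sub_zero] at a1 a2
  have a3 := hb z hz hr hM
  have b1 := rpow_le_min_zero n0 (hM.trans (by linarith)) hN1 (α.re - 1 + m)
  have b2 := rpow_le_min_zero n1 (((norm_sub_le _ _).trans (by
    rw [norm_one]; linarith)) : ‖1 - z‖ ≤ N) hN1 (β.re - 1)
  rw [eulerIntegrand, norm_mul, norm_mul, weight]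
  calc ‖z ^ (α - 1)‖ * ‖(1 - z) ^ (β - 1)‖ * ‖g z‖
      ≤ (Real.exp (Real.pi * |α.im|) * ‖z‖ ^ (α.re - 1)) *
        (Real.exp (Real.pi * |β.im|) * ‖1 - z‖ ^ (β.re - 1)) *
        (K * (‖z‖ ^ m * ‖z + q‖ ^ (-θ))) := by gcongr
    _ = Real.exp (Real.pi * |α.im|) * Real.exp (Real.pi * |β.im|) * K *
        ‖z‖ ^ (α.re - 1 + m) * ‖1 - z‖ ^ (β.re - 1) * ‖z + q‖ ^ (-θ) := by
      rw [Real.rpow_add n0]; ring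
    _ ≤ Real.exp (Real.pi * |α.im|) * Real.exp (Real.pi * |β.im|) * K *
        (N ^ |α.re - 1 + m| * ‖z‖ ^ min (α.re - 1 + m) 0) *
        (N ^ |β.re - 1| * ‖1 - z‖ ^ min (β.re - 1) 0) * ‖z + q‖ ^ (-θ) := by gcongr
    _ = _ := by ring

theorem BoundaryData.tendsto_eulerIntegrand (h : BoundaryData r q m θ g gb) (α β : ℂ) {σ : ℝ}
    (hσ : σ * σ = 1) {u : ℝ} (hr : -r ≤ u) (h0 : u ≠ 0) (h1 : u ≠ 1) (hq : u ≠ -q) :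
    Tendsto (eulerIntegrand α β g) (𝓝[{z : ℂ | 0 < σ * z.im}] (u : ℂ))
      (𝓝 (boundaryIntegrand α β gb σ u)) :=
  ((tendsto_boundaryPow hσ (α - 1) h0).mul (tendsto_boundaryPow_one_sub hσ (β - 1) h1)).mul
    (h.tendsto σ hσ u hr h0 hq)

theorem ae_ne_three (q : ℝ) : ∀ᵐ u : ℝ, u ≠ 0 ∧ u ≠ 1 ∧ u ≠ -q := by
  filter_upwards [Measure.ae_ne volume (0 : ℝ), Measure.ae_ne volume (1 : ℝ),
    Measure.ae_ne volume (-q)] with u h0 h1 hq using ⟨h0, h1, hq⟩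

/-- The same weight dominates the integrand on the path and on the segment. The conditions `Re α + m
> 0`, `Re β > 0` and `θ < 1` make it integrable at the real singularities `0`, `1` and `-q`, while
the path itself avoids all three. -/
theorem BoundaryData.integral_path (h : BoundaryData r q m θ g gb) (hα : 0 < α.re + m)
    (hβ : 0 < β.re) {σ : ℝ} (hσ : σ * σ = 1) {γ γ' : ℝ → ℂ} (hγ : ∀ s, HasDerivAt γ (γ' s) s)
    (hγ' : Continuous γ') {a b P Q : ℝ} (hab : a ≤ b) (ha : γ a = P) (hb : γ b = Q)
    (hs : ∀ s ∈ Set.Ioo a b, 0 < σ * (γ s).im)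
    (hre : ∀ s, -r ≤ (γ s).re) (h0 : ∀ s, γ s ≠ 0) (h1 : ∀ s, γ s ≠ 1) (hq : ∀ s, γ s + q ≠ 0) :
    IntervalIntegrable (boundaryIntegrand α β gb σ) volume P Q ∧
      ∫ s in a..b, eulerIntegrand α β g (γ s) * γ' s = ∫ u in P..Q, boundaryIntegrand α β gb σ u := by
  have hcγ : Continuous γ := continuous_iff_continuousAt.2 fun s => (hγ s).continuousAt
  obtain ⟨C, hC⟩ := (isCompact_Icc (a := a) (b := b)).exists_bound_of_continuousOn hcγ.continuousOn
  have hPr : -r ≤ P := by have := hre a; rwa [ha, Complex.ofReal_re] at this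
  have hQr : -r ≤ Q := by have := hre b; rwa [hb, Complex.ofReal_re] at this
  have hs' : ∀ s ∈ Set.Icc a b, 0 ≤ σ * (γ s).im := fun s hs' => by
    rcases eq_or_lt_of_le hs'.1 with rfl | h2
    · rw [ha]; simp
    rcases eq_or_lt_of_le hs'.2 with rfl | h3
    · rw [hb]; simp
    exact (hs s ⟨h2, h3⟩).le
  obtain ⟨K, hK, hbd⟩ := h.exists_bound α β (max C (max |P| |Q|) + 1)
  have k0 : -1 < min (α.re - 1 + m) 0 := lt_min (by linarith) (by norm_num)
  have k1 : -1 < min (β.re - 1) 0 := lt_min (by linarith) (by norm_num)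
  have hsh : ∀ ε ∈ Set.Ioo (0 : ℝ) 1, ∀ z : ℂ, 0 ≤ σ * z.im → -r ≤ z.re →
      ‖z‖ ≤ max C (max |P| |Q|) → z ≠ 0 → z ≠ 1 → z + q ≠ 0 →
      ‖eulerIntegrand α β g (z + σ * ε * Complex.I)‖ ≤
        K * weight (min (α.re - 1 + m) 0) (min (β.re - 1) 0) (-θ) q z := by
    intro ε hε z hz hr hM z0 z1 zq
    have := im_shift_pos hσ hε.1 hz
    refine (hbd _ (im_ne_zero_of_halfPlane this) (by simpa using hr) ?_).trans
      (mul_le_mul_of_nonneg_left (weight_shift_le (min_le_right _ _) (min_le_right _ _)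
        (by linarith [h.θ_nonneg]) hσ hε.1 hz z0 z1 zq) hK)
    refine (norm_add_le _ _).trans (add_le_add hM ?_)
    have hσ1 : ‖(σ : ℂ)‖ = 1 := by
      rw [Complex.norm_real, Real.norm_eq_abs, ← sq_eq_sq₀ (abs_nonneg _) zero_le_one, sq_abs]
      linarith
    rw [norm_mul, norm_mul, hσ1, Complex.norm_real, Complex.norm_I, Real.norm_eq_abs,
      abs_of_pos hε.1]
    linarith [hε.2]
  have hto : ∀ z : ℂ, 0 ≤ σ * z.im → Tendsto (fun ε : ℝ => z + σ * ε * Complex.I) (𝓝[>] 0)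
      (𝓝[{z : ℂ | 0 < σ * z.im}] z) := fun z hz => by
    refine tendsto_nhdsWithin_iff.2 ⟨?_, ?_⟩
    · have : ContinuousAt (fun ε : ℝ => z + σ * ε * Complex.I) 0 := by fun_prop
      have := this.tendsto.mono_left (nhdsWithin_le_nhds (s := Set.Ioi 0))
      simpa using this
    · filter_upwards [self_mem_nhdsWithin] with ε hε using im_shift_pos hσ hε hz
  have hdiff : DifferentiableOn ℂ (eulerIntegrand α β g) {z : ℂ | 0 < σ * z.im} := fun z hz =>
    (h.differentiableAt_eulerIntegrand α β (im_ne_zero_of_halfPlane hz)).differentiableWithinAt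
  refine integral_eq_of_halfPlane hσ hdiff
    hγ hγ' ha hb hab hs'
    (Bγ := fun s => K * weight (min (α.re - 1 + m) 0) (min (β.re - 1) 0) (-θ) q (γ s))
    (Br := fun u : ℝ => K * weight (min (α.re - 1 + m) 0) (min (β.re - 1) 0) (-θ) q u) ?_
    ((intervalIntegrable_weight k0 k1 (by linarith [h.θ_lt]) h.q_pos P Q).const_mul K)
    (fun ε hε s hs'' => hsh ε hε _ (hs' s hs'') (hre s) ((hC s hs'').trans (le_max_left _ _))
      (h0 s) (h1 s) (hq s)) (fun s hs'' => ?_) (fun ε hε => ?_) ?_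
  · have c0 := hcγ.norm.rpow_const (p := min (α.re - 1 + m) 0) fun s =>
      Or.inl (norm_ne_zero_iff.2 (h0 s))
    have c1 := (continuous_const.sub hcγ).norm.rpow_const (p := min (β.re - 1) 0) fun s =>
      Or.inl (norm_ne_zero_iff.2 (sub_ne_zero.2 (h1 s).symm))
    have c2 := (hcγ.add_const (q : ℂ)).norm.rpow_const (p := -θ) fun s =>
      Or.inl (norm_ne_zero_iff.2 (hq s))
    exact (((c0.mul c1).mul c2).const_mul K).continuousOn
  · have hc := (h.differentiableAt_eulerIntegrand α β
      (im_ne_zero_of_halfPlane (hs s hs''))).continuousAt.tendsto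
    exact (hc.mono_left nhdsWithin_le_nhds).comp (hto _ (hs s hs'').le)
  · filter_upwards [ae_ne_three q] with u ⟨u0, u1, uq⟩ hu
    have hu' := Set.uIoc_subset_uIcc hu
    refine hsh ε hε u (by simp) ?_ ?_ (by exact_mod_cast u0) (by exact_mod_cast u1)
      (by intro h2; apply uq; have : u + q = 0 := by exact_mod_cast h2
          linarith)
    · rw [Complex.ofReal_re]; exact (le_min hPr hQr).trans hu'.1
    · rw [Complex.norm_real, Real.norm_eq_abs]
      refine le_trans ?_ (le_max_right _ _)
      rcases Set.mem_uIcc.1 hu' with ⟨h1, h2⟩ | ⟨h1, h2⟩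
      · exact abs_le_max_abs_abs h1 h2
      · rw [max_comm]; exact abs_le_max_abs_abs h1 h2
  · filter_upwards [ae_ne_three q] with u ⟨u0, u1, uq⟩ hu
    have hu' := Set.uIoc_subset_uIcc hu
    exact (h.tendsto_eulerIntegrand α β hσ ((le_min hPr hQr).trans hu'.1) u0 u1 uq).comp
      (hto u (by simp))


/-! #### Shrinking the double loop -/

theorem im_circleThrough (P Q s : ℝ) :
    (circleThrough P Q s).im = (P - Q) / 2 * Real.sin (2 * Real.pi * s) := by
  rw [circleThrough_eq, Complex.add_im, Complex.ofReal_im, Complex.im_ofReal_mul, zero_add]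
  congr 1
  rw [← Complex.exp_ofReal_mul_I_im]
  push_cast; rfl

theorem sin_two_pi_pos {s : ℝ} (hs : s ∈ Set.Ioo (0 : ℝ) (1 / 2)) : 0 < Real.sin (2 * Real.pi * s) :=
  Real.sin_pos_of_pos_of_lt_pi (by have := hs.1; positivity)
    (by nlinarith [hs.2, Real.pi_pos])

theorem sin_two_pi_neg {s : ℝ} (hs : s ∈ Set.Ioo (1 / 2 : ℝ) 1) : Real.sin (2 * Real.pi * s) < 0 := by
  have := Real.sin_pos_of_pos_of_lt_pi (x := 2 * Real.pi * s - Real.pi)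
    (by nlinarith [hs.1, Real.pi_pos]) (by nlinarith [hs.2, Real.pi_pos])
  rw [Real.sin_sub_pi] at this
  linarith

theorem im_exp_windLog {A ρ : ℝ} (hρ : 0 < ρ) (hA : |A| < ρ) (s : ℝ) :
    Real.exp (windLog A ρ s).re * Real.sin (windLog A ρ s).im = ρ * Real.sin (2 * Real.pi * s) := by
  rw [← Complex.exp_im, exp_windLog hρ hA, Complex.add_im, Complex.ofReal_im,
    Complex.im_ofReal_mul, zero_add]
  congr 1
  rw [← Complex.exp_ofReal_mul_I_im]
  push_cast; rfl

/-- The imaginary part lies within `π/2` of `2πs`, and its sine has the sign of `sin 2πs`. On the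
first half of the circle these two facts force it into the principal range. -/
theorem windLog_eq_log {A ρ : ℝ} (hρ : 0 < ρ) (hA : |A| < ρ) {s : ℝ}
    (hs : s ∈ Set.Ioo (0 : ℝ) (1 / 2)) :
    windLog A ρ s = Complex.log (A + ρ * Complex.exp (2 * Real.pi * s * Complex.I)) := by
  obtain ⟨h1, h2⟩ := abs_lt.1 (windLog_im_mem hρ hA s)
  have hπ := Real.pi_pos
  have h3 := sin_two_pi_pos hs
  have h4 := im_exp_windLog hρ hA s
  have h5 : 0 < 2 * Real.pi * s := by have := hs.1; positivity
  have h6 : 2 * Real.pi * s < Real.pi := by nlinarith [hs.2]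
  rw [← exp_windLog hρ hA, Complex.log_exp (by linarith)]
  by_contra! h
  have h7 := Real.sin_pos_of_pos_of_lt_pi (x := (windLog A ρ s).im - Real.pi) (by linarith)
    (by linarith)
  rw [Real.sin_sub_pi] at h7
  nlinarith [Real.exp_pos (windLog A ρ s).re]

theorem windLog_eq_log_add {A ρ : ℝ} (hρ : 0 < ρ) (hA : |A| < ρ) {s : ℝ}
    (hs : s ∈ Set.Ioo (1 / 2 : ℝ) 1) :
    windLog A ρ s = Complex.log (A + ρ * Complex.exp (2 * Real.pi * s * Complex.I)) +
      2 * Real.pi * Complex.I := by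
  obtain ⟨h1, h2⟩ := abs_lt.1 (windLog_im_mem hρ hA s)
  have hπ := Real.pi_pos
  have h3 := sin_two_pi_neg hs
  have h4 := im_exp_windLog hρ hA s
  have h5 : Real.pi < 2 * Real.pi * s := by nlinarith [hs.1]
  have h6 : 2 * Real.pi * s < 2 * Real.pi := by nlinarith [hs.2]
  have e : (windLog A ρ s - 2 * Real.pi * Complex.I).im = (windLog A ρ s).im - 2 * Real.pi := by
    simp
  rw [← exp_windLog hρ hA, ← Complex.exp_periodic.sub_eq (windLog A ρ s), Complex.log_exp]
  · ring
  · rw [e]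
    by_contra! h
    have h7 := Real.sin_nonneg_of_nonneg_of_le_pi (x := (windLog A ρ s).im) (by linarith)
      (by linarith)
    nlinarith [Real.exp_pos (windLog A ρ s).re]
  · rw [e]; linarith

theorem exp_log_combination {u : ℂ} (h0 : u ≠ 0) (h1 : 1 - u ≠ 0) (α β G : ℂ) :
    Complex.exp ((α - 1) * Complex.log u + (β - 1) * Complex.log (1 - u)) * G =
      u ^ (α - 1) * (1 - u) ^ (β - 1) * G := by
  rw [Complex.cpow_def_of_ne_zero h0, Complex.cpow_def_of_ne_zero h1, ← Complex.exp_add]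
  congr 2; ring

variable {p r R q m θ : ℝ} {g : ℂ → ℂ} {gb : ℝ → ℝ → ℂ} {α β : ℂ}

theorem LoopParams.circle_one_ne (h : LoopParams p r R) (s : ℝ) :
    circleThrough p R s ≠ 0 ∧ circleThrough p R s ≠ 1 := by
  constructor
  · intro h0
    have := h.re_circle_one s
    rw [h0] at this; simp at this
  · have := exp_windLog h.radius_one h.center_one s
    rw [← LoopParams.one_sub_circle_one] at this
    intro h1
    rw [h1, sub_self] at this
    exact Complex.exp_ne_zero _ this

theorem LoopParams.circle_zero_ne (h : LoopParams p r R) (s : ℝ) :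
    circleThrough p (-r) s ≠ 0 ∧ circleThrough p (-r) s ≠ 1 := by
  constructor
  · have := exp_windLog h.radius_zero h.center_zero s
    rw [← circleThrough_eq] at this
    intro h1
    rw [h1] at this
    exact Complex.exp_ne_zero _ this
  · intro h0
    have := h.re_circle_zero s
    rw [h0] at this; simp at this

theorem LoopParams.circle_zero_add_ne (h : LoopParams p r R) (hq : 0 < q) (hqr : q < r) (s : ℝ) :
    circleThrough p (-r) s + q ≠ 0 := by
  have hp := h.p_pos
  have := exp_windLog (A := (p + -r) / 2 + q) h.radius_zero
    (abs_lt.2 ⟨by linarith, by linarith⟩) s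
  intro h1
  have e : circleThrough p (-r) s + q = (((p + -r) / 2 + q : ℝ) : ℂ) +
      ((p - -r) / 2 : ℝ) * Complex.exp (2 * Real.pi * s * Complex.I) := by
    rw [circleThrough_eq]; push_cast; ring
  rw [← e, h1] at this
  exact Complex.exp_ne_zero _ this

theorem circleThrough_half (P Q : ℝ) : circleThrough P Q (1 / 2) = Q := by
  rw [circleThrough_eq]
  have : (2 * Real.pi * ((1 / 2 : ℝ) : ℂ) * Complex.I) = Real.pi * Complex.I := by push_cast; ring
  rw [this, Complex.exp_pi_mul_I]
  push_cast; ring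

theorem circleThrough_one (P Q : ℝ) : circleThrough P Q 1 = P := by
  have := circleThrough_int P Q 1
  rwa [Int.cast_one] at this

theorem exp_two_pi_sub_one (z : ℂ) : Complex.exp (2 * Real.pi * Complex.I * (z - 1)) =
    Complex.exp (2 * Real.pi * Complex.I * z) := by
  rw [mul_sub, mul_one]
  exact Complex.exp_periodic.sub_eq _

/-- The loop around `1` in terms of boundary values. -/
theorem LoopParams.integral_loopOne_boundary (h : LoopParams p r R) (H : BoundaryData r q m θ g gb)
    (hα : 0 < α.re + m) (hβ : 0 < β.re)
    (hg : Continuous fun s => g (circleThrough p R s)) :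
    (∀ σ, σ * σ = 1 → IntervalIntegrable (boundaryIntegrand α β gb σ) volume p R) ∧
    ∫ s in (0 : ℝ)..1, loopOneIntegrand p R α β g s =
      ∫ u in p..R, (boundaryIntegrand α β gb (-1) u -
        Complex.exp (2 * Real.pi * Complex.I * β) * boundaryIntegrand α β gb 1 u) := by
  have hpR := h.p_lt.trans h.R_gt
  have hqne : ∀ s, circleThrough p R s + q ≠ 0 := fun s h0 => by
    have := h.re_circle_one s
    have h1 := congrArg Complex.re h0
    simp only [Complex.add_re, Complex.ofReal_re, Complex.zero_re] at h1
    linarith [H.q_pos]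
  have hre : ∀ s, -r ≤ (circleThrough p R s).re := fun s => by
    linarith [h.re_circle_one s, h.r_pos]
  -- Starting at `p < R`, the positively oriented circle around `1` runs first through the lower
  -- half plane. On its second half the power of `1 - u` has left the principal branch, which
  -- produces `e^(2πiβ)`.
  obtain ⟨i₁, e₁⟩ := H.integral_path hα hβ (σ := -1) (by norm_num)
    (fun s => (hasDerivAt_circleThrough p R s).differentiableAt.hasDerivAt)
    (continuous_deriv_circleThrough p R) (by norm_num : (0 : ℝ) ≤ 1 / 2)
    (circleThrough_zero p R) (circleThrough_half p R)
    (fun s hs => by rw [im_circleThrough]; nlinarith [sin_two_pi_pos hs]) hre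
    (fun s => (h.circle_one_ne s).1) (fun s => (h.circle_one_ne s).2) hqne
  obtain ⟨i₂, e₂⟩ := H.integral_path hα hβ (σ := 1) (by norm_num)
    (fun s => (hasDerivAt_circleThrough p R s).differentiableAt.hasDerivAt)
    (continuous_deriv_circleThrough p R) (by norm_num : (1 / 2 : ℝ) ≤ 1)
    (circleThrough_half p R) (circleThrough_one p R)
    (fun s hs => by rw [im_circleThrough]; nlinarith [sin_two_pi_neg hs]) hre
    (fun s => (h.circle_one_ne s).1) (fun s => (h.circle_one_ne s).2) hqne
  have hne : ∀ s, 1 - circleThrough p R s ≠ 0 := fun s => sub_ne_zero.2 (h.circle_one_ne s).2.symm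
  have E₁ : Set.EqOn (fun s => eulerIntegrand α β g (circleThrough p R s) *
      deriv (circleThrough p R) s) (loopOneIntegrand p R α β g) (Set.Ioo 0 (1 / 2)) := fun s hs => by
    simp only [loopOneIntegrand, eulerIntegrand]
    rw [windLog_eq_log h.radius_one h.center_one hs, ← LoopParams.one_sub_circle_one,
      exp_log_combination (h.circle_one_ne s).1 (hne s)]
  have E₂ : Set.EqOn (fun s => Complex.exp (2 * Real.pi * Complex.I * β) *
      (eulerIntegrand α β g (circleThrough p R s) * deriv (circleThrough p R) s))
      (loopOneIntegrand p R α β g) (Set.Ioo (1 / 2) 1) := fun s hs => by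
    simp only [loopOneIntegrand, eulerIntegrand]
    rw [windLog_eq_log_add h.radius_one h.center_one hs, ← LoopParams.one_sub_circle_one,
      ← exp_log_combination (h.circle_one_ne s).1 (hne s), ← exp_two_pi_sub_one, mul_add (β - 1),
      ← add_assoc, Complex.exp_add _ ((β - 1) * (2 * Real.pi * Complex.I)),
      mul_comm (β - 1) (2 * Real.pi * Complex.I)]
    ring
  have hc := h.continuous_loopOneIntegrand α β hg
  refine ⟨fun σ hσ => ?_, ?_⟩
  · rcases mul_self_eq_one_iff.1 hσ with rfl | rfl
    exacts [i₂.symm, i₁]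
  rw [← intervalIntegral.integral_add_adjacent_intervals (hc.intervalIntegrable 0 (1 / 2))
    (hc.intervalIntegrable (1 / 2) 1), integral_congr_Ioo (by norm_num) E₁,
    integral_congr_Ioo (by norm_num) E₂, intervalIntegral.integral_const_mul, e₁, e₂,
    intervalIntegral.integral_sub i₁ (i₂.symm.const_mul _), intervalIntegral.integral_const_mul,
    intervalIntegral.integral_symm p R]
  ring

/-- The loop around `0` in terms of boundary values. -/
theorem LoopParams.integral_loopZero_boundary (h : LoopParams p r R) (H : BoundaryData r q m θ g gb)
    (hqr : q < r) (hα : 0 < α.re + m) (hβ : 0 < β.re)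
    (hg : Continuous fun s => g (circleThrough p (-r) s)) :
    (∀ σ, σ * σ = 1 → IntervalIntegrable (boundaryIntegrand α β gb σ) volume (-r) p) ∧
    ∫ s in (0 : ℝ)..1, loopZeroIntegrand p r α β g s =
      ∫ u in (-r)..p, (Complex.exp (2 * Real.pi * Complex.I * α) *
        boundaryIntegrand α β gb (-1) u - boundaryIntegrand α β gb 1 u) := by
  have hp := h.p_pos
  have hr := h.r_pos
  have hqne := h.circle_zero_add_ne H.q_pos hqr
  have hre : ∀ s, -r ≤ (circleThrough p (-r) s).re := fun s => by
    have := (circleThrough_re_mem (P := p) (Q := -r) s).1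
    rwa [min_eq_right (by linarith)] at this
  obtain ⟨i₁, e₁⟩ := H.integral_path hα hβ (σ := 1) (by norm_num)
    (fun s => (hasDerivAt_circleThrough p (-r) s).differentiableAt.hasDerivAt)
    (continuous_deriv_circleThrough p (-r)) (by norm_num : (0 : ℝ) ≤ 1 / 2)
    (circleThrough_zero p (-r)) (circleThrough_half p (-r))
    (fun s hs => by rw [im_circleThrough]; nlinarith [sin_two_pi_pos hs]) hre
    (fun s => (h.circle_zero_ne s).1) (fun s => (h.circle_zero_ne s).2) hqne
  obtain ⟨i₂, e₂⟩ := H.integral_path hα hβ (σ := -1) (by norm_num)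
    (fun s => (hasDerivAt_circleThrough p (-r) s).differentiableAt.hasDerivAt)
    (continuous_deriv_circleThrough p (-r)) (by norm_num : (1 / 2 : ℝ) ≤ 1)
    (circleThrough_half p (-r)) (circleThrough_one p (-r))
    (fun s hs => by rw [im_circleThrough]; nlinarith [sin_two_pi_neg hs]) hre
    (fun s => (h.circle_zero_ne s).1) (fun s => (h.circle_zero_ne s).2) hqne
  have hne : ∀ s, 1 - circleThrough p (-r) s ≠ 0 := fun s => sub_ne_zero.2 (h.circle_zero_ne s).2.symm
  have E₁ : Set.EqOn (fun s => eulerIntegrand α β g (circleThrough p (-r) s) *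
      deriv (circleThrough p (-r)) s) (loopZeroIntegrand p r α β g) (Set.Ioo 0 (1 / 2)) :=
    fun s hs => by
    simp only [loopZeroIntegrand, eulerIntegrand]
    rw [windLog_eq_log h.radius_zero h.center_zero hs, ← circleThrough_eq,
      exp_log_combination (h.circle_zero_ne s).1 (hne s)]
  have E₂ : Set.EqOn (fun s => Complex.exp (2 * Real.pi * Complex.I * α) *
      (eulerIntegrand α β g (circleThrough p (-r) s) * deriv (circleThrough p (-r)) s))
      (loopZeroIntegrand p r α β g) (Set.Ioo (1 / 2) 1) := fun s hs => by
    simp only [loopZeroIntegrand, eulerIntegrand]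
    rw [windLog_eq_log_add h.radius_zero h.center_zero hs, ← circleThrough_eq,
      ← exp_log_combination (h.circle_zero_ne s).1 (hne s), ← exp_two_pi_sub_one, mul_add (α - 1),
      add_right_comm, Complex.exp_add _ ((α - 1) * (2 * Real.pi * Complex.I)),
      mul_comm (α - 1) (2 * Real.pi * Complex.I)]
    ring
  have hc := h.continuous_loopZeroIntegrand α β hg
  refine ⟨fun σ hσ => ?_, ?_⟩
  · rcases mul_self_eq_one_iff.1 hσ with rfl | rfl
    exacts [i₁.symm, i₂]
  rw [← intervalIntegral.integral_add_adjacent_intervals (hc.intervalIntegrable 0 (1 / 2))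
    (hc.intervalIntegrable (1 / 2) 1), integral_congr_Ioo (by norm_num) E₁,
    integral_congr_Ioo (by norm_num) E₂, intervalIntegral.integral_const_mul, e₁, e₂,
    intervalIntegral.integral_sub (i₂.const_mul _) i₁.symm, intervalIntegral.integral_const_mul,
    intervalIntegral.integral_symm (-r) p]
  ring

theorem BoundaryData.boundaryIntegrand_of_mem (H : BoundaryData r q m θ g gb) {σ u : ℝ}
    (hσ : σ * σ = 1) (hu : u ∈ Set.Ioo (0 : ℝ) 1) :
    boundaryIntegrand α β gb σ u = eulerIntegrand α β g u := by
  rw [boundaryIntegrand, eulerIntegrand, boundaryPow_of_pos _ _ hu.1,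
    boundaryPow_of_pos _ _ (sub_pos.2 hu.2), H.eq_pos σ hσ u hu.1]
  push_cast; rfl

/-- On `(1, R)` the boundary values from the two sides differ exactly by the factor `e^(2πiβ)`, so
the contributions cancel. On `(p, 1)` both sides give the principal integrand, which leaves the
factor `1 - e^(2πiβ)`. -/
theorem LoopParams.integral_loopOne (h : LoopParams p r R) (H : BoundaryData r q m θ g gb)
    (hα : 0 < α.re + m) (hβ : 0 < β.re) (hg : Continuous fun s => g (circleThrough p R s)) :
    IntervalIntegrable (fun u : ℝ => eulerIntegrand α β g u) volume p 1 ∧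
    ∫ s in (0 : ℝ)..1, loopOneIntegrand p R α β g s =
      (1 - Complex.exp (2 * Real.pi * Complex.I * β)) * ∫ u in p..1, eulerIntegrand α β g u := by
  obtain ⟨hi, he⟩ := h.integral_loopOne_boundary H hα hβ hg
  have hp := h.p_lt
  have hR := h.R_gt
  have m1 : (1 : ℝ) ∈ Set.uIcc p R := Set.mem_uIcc.2 (Or.inl ⟨hp.le, hR.le⟩)
  have j : ∀ σ, σ * σ = 1 → IntervalIntegrable (boundaryIntegrand α β gb σ) volume p 1 ∧
      IntervalIntegrable (boundaryIntegrand α β gb σ) volume 1 R := fun σ hσ =>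
    ⟨(hi σ hσ).mono_set (Set.uIcc_subset_uIcc_left m1),
      (hi σ hσ).mono_set (Set.uIcc_subset_uIcc_right m1)⟩
  have a := j (-1) (by norm_num)
  have b := j 1 (by norm_num)
  have E₁ : Set.EqOn (fun u : ℝ => (1 - Complex.exp (2 * Real.pi * Complex.I * β)) *
      eulerIntegrand α β g u) (fun u => boundaryIntegrand α β gb (-1) u -
        Complex.exp (2 * Real.pi * Complex.I * β) * boundaryIntegrand α β gb 1 u) (Set.Ioo p 1) :=
    fun u hu => by
    have hu' : u ∈ Set.Ioo (0 : ℝ) 1 := ⟨h.p_pos.trans hu.1, hu.2⟩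
    beta_reduce
    rw [H.boundaryIntegrand_of_mem (by norm_num) hu', H.boundaryIntegrand_of_mem (by norm_num) hu']
    ring
  have E₂ : Set.EqOn (fun _ : ℝ => (0 : ℂ)) (fun u => boundaryIntegrand α β gb (-1) u -
        Complex.exp (2 * Real.pi * Complex.I * β) * boundaryIntegrand α β gb 1 u) (Set.Ioo 1 R) :=
    fun u hu => by
    have hu0 : 0 < u := one_pos.trans hu.1
    simp only [boundaryIntegrand]
    rw [H.eq_pos _ (by norm_num) u hu0, H.eq_pos _ (by norm_num) u hu0,
      boundaryPow_of_neg _ _ (sub_neg.2 hu.1), boundaryPow_of_neg _ _ (sub_neg.2 hu.1),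
      boundaryPow_of_pos _ _ hu0, boundaryPow_of_pos _ _ hu0, ← exp_two_pi_sub_one]
    have e : Complex.exp (((-(-1) : ℝ) : ℂ) * Real.pi * Complex.I * (β - 1)) =
        Complex.exp (2 * Real.pi * Complex.I * (β - 1)) *
        Complex.exp (((-1 : ℝ) : ℂ) * Real.pi * Complex.I * (β - 1)) := by
      rw [← Complex.exp_add]; congr 1; push_cast; ring
    rw [e]; ring
  refine ⟨?_, ?_⟩
  · have := a.1
    rw [intervalIntegrable_iff_integrableOn_Ioo_of_le hp.le] at this ⊢
    exact this.congr_fun (fun u hu => H.boundaryIntegrand_of_mem (by norm_num)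
      ⟨h.p_pos.trans hu.1, hu.2⟩) measurableSet_Ioo
  · rw [he, ← intervalIntegral.integral_add_adjacent_intervals (a.1.sub (b.1.const_mul _))
      (a.2.sub (b.2.const_mul _)), integral_congr_Ioo hp.le E₁, integral_congr_Ioo hR.le E₂,
      intervalIntegral.integral_const_mul, intervalIntegral.integral_zero, add_zero]

/-- The jump integrand on the negative axis. -/
noncomputable def jumpIntegrand (α β : ℂ) (gb : ℝ → ℝ → ℂ) (u : ℝ) : ℂ :=
  (-u : ℂ) ^ (α - 1) * (1 - u : ℂ) ^ (β - 1) * (gb 1 u - gb (-1) u)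

/-- On `(0, p)` both sides give the principal integrand. On the negative axis the two phases of the
power of `u` combine to the same number `-e^(iπα)`, so only the jump of `g` survives, and it
vanishes to the left of `-q`. -/
theorem LoopParams.integral_loopZero (h : LoopParams p r R) (H : BoundaryData r q m θ g gb)
    (hqr : q < r) (hα : 0 < α.re + m) (hβ : 0 < β.re)
    (hg : Continuous fun s => g (circleThrough p (-r) s)) :
    IntervalIntegrable (fun u : ℝ => eulerIntegrand α β g u) volume 0 p ∧
    ∫ s in (0 : ℝ)..1, loopZeroIntegrand p r α β g s =
      Complex.exp (Real.pi * Complex.I * α) * (∫ u in (-q)..0, jumpIntegrand α β gb u) -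
      (1 - Complex.exp (2 * Real.pi * Complex.I * α)) * ∫ u in (0 : ℝ)..p, eulerIntegrand α β g u := by
  obtain ⟨hi, he⟩ := h.integral_loopZero_boundary H hqr hα hβ hg
  have hp := h.p_pos
  have hp1 := h.p_lt
  have hr := h.r_pos
  have hq := H.q_pos
  have mono : ∀ σ, σ * σ = 1 → ∀ a b : ℝ, -r ≤ a → a ≤ b → b ≤ p →
      IntervalIntegrable (boundaryIntegrand α β gb σ) volume a b := fun σ hσ a b ha hab hb =>
    (hi σ hσ).mono_set (by
      rw [Set.uIcc_of_le hab, Set.uIcc_of_le (by linarith)]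
      exact Set.Icc_subset_Icc ha hb)
  have J : ∀ a b : ℝ, -r ≤ a → a ≤ b → b ≤ p → IntervalIntegrable (fun u =>
      Complex.exp (2 * Real.pi * Complex.I * α) * boundaryIntegrand α β gb (-1) u -
        boundaryIntegrand α β gb 1 u) volume a b := fun a b ha hab hb =>
    ((mono (-1) (by norm_num) a b ha hab hb).const_mul _).sub (mono 1 (by norm_num) a b ha hab hb)
  have E₀ : Set.EqOn (fun u : ℝ => (Complex.exp (2 * Real.pi * Complex.I * α) - 1) *
      eulerIntegrand α β g u) (fun u => Complex.exp (2 * Real.pi * Complex.I * α) *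
        boundaryIntegrand α β gb (-1) u - boundaryIntegrand α β gb 1 u) (Set.Ioo 0 p) :=
    fun u hu => by
    have hu' : u ∈ Set.Ioo (0 : ℝ) 1 := ⟨hu.1, hu.2.trans hp1⟩
    beta_reduce
    rw [H.boundaryIntegrand_of_mem (by norm_num) hu', H.boundaryIntegrand_of_mem (by norm_num) hu']
    ring
  have E₁ : Set.EqOn (fun u : ℝ => Complex.exp (Real.pi * Complex.I * α) * jumpIntegrand α β gb u)
      (fun u => Complex.exp (2 * Real.pi * Complex.I * α) *
        boundaryIntegrand α β gb (-1) u - boundaryIntegrand α β gb 1 u) (Set.Ioo (-r) 0) :=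
    fun u hu => by
    have hu1 : 0 < 1 - u := by linarith [hu.2]
    simp only [boundaryIntegrand, jumpIntegrand]
    rw [boundaryPow_of_neg _ _ hu.2, boundaryPow_of_neg _ _ hu.2, boundaryPow_of_pos _ _ hu1,
      boundaryPow_of_pos _ _ hu1]
    have e1 : Complex.exp (2 * Real.pi * Complex.I * α) *
        Complex.exp (((-1 : ℝ) : ℂ) * Real.pi * Complex.I * (α - 1)) =
        -Complex.exp (Real.pi * Complex.I * α) := by
      rw [← Complex.exp_add, ← neg_one_mul (Complex.exp (Real.pi * Complex.I * α)),
        ← Complex.exp_pi_mul_I, ← Complex.exp_add]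
      congr 1; push_cast; ring
    have e2 : Complex.exp (((1 : ℝ) : ℂ) * Real.pi * Complex.I * (α - 1)) =
        -Complex.exp (Real.pi * Complex.I * α) := by
      rw [← neg_one_mul, ← inv_neg_one, ← Complex.exp_pi_mul_I, ← Complex.exp_neg, ← Complex.exp_add]
      congr 1; push_cast; ring
    rw [e2]
    push_cast
    push_cast at e1
    linear_combination (-(-(u : ℂ)) ^ (α - 1) * (1 - (u : ℂ)) ^ (β - 1) * gb (-1) u) * e1
  have E₂ : Set.EqOn (fun _ : ℝ => (0 : ℂ)) (fun u => Complex.exp (2 * Real.pi * Complex.I * α) *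
        boundaryIntegrand α β gb (-1) u - boundaryIntegrand α β gb 1 u) (Set.Ioo (-r) (-q)) :=
    fun u hu => by
    rw [← E₁ ⟨hu.1, by linarith [hu.2]⟩]
    simp only [jumpIntegrand]
    rw [H.eq_lt u hu.1.le hu.2, sub_self, mul_zero, mul_zero]
  refine ⟨?_, ?_⟩
  · have := mono 1 (by norm_num) 0 p (by linarith) hp.le le_rfl
    rw [intervalIntegrable_iff_integrableOn_Ioo_of_le hp.le] at this ⊢
    exact this.congr_fun (fun u hu => H.boundaryIntegrand_of_mem (by norm_num)
      ⟨hu.1, hu.2.trans hp1⟩) measurableSet_Ioo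
  · rw [he, ← intervalIntegral.integral_add_adjacent_intervals
      (J (-r) 0 le_rfl (by linarith) hp.le) (J 0 p (by linarith) hp.le le_rfl),
      ← intervalIntegral.integral_add_adjacent_intervals
      (J (-r) (-q) le_rfl (by linarith) (by linarith)) (J (-q) 0 (by linarith) (by linarith) hp.le),
      integral_congr_Ioo (by linarith) E₂, integral_congr_Ioo hp.le E₀,
      integral_congr_Ioo (by linarith) (E₁.mono (Set.Ioo_subset_Ioo_left (by linarith))),
      intervalIntegral.integral_const_mul, intervalIntegral.integral_const_mul,
      intervalIntegral.integral_zero]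
    ring

/-- Shrinking the double loop onto the segments `[0, 1]` and `[-q, 0]`. -/
theorem LoopParams.doubleLoopIntegral_eq_segments (h : LoopParams p r R)
    (H : BoundaryData r q m θ g gb) (hqr : q < r) (hα : 0 < α.re + m) (hβ : 0 < β.re)
    (hg1 : Continuous fun s => g (circleThrough p R s))
    (hg0 : Continuous fun s => g (circleThrough p (-r) s)) :
    doubleLoopIntegral p r R α β g =
      (1 - Complex.exp (2 * Real.pi * Complex.I * α)) *
        (1 - Complex.exp (2 * Real.pi * Complex.I * β)) *
          (∫ u in (0 : ℝ)..1, eulerIntegrand α β g u) -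
      (1 - Complex.exp (2 * Real.pi * Complex.I * β)) * Complex.exp (Real.pi * Complex.I * α) *
        ∫ u in (-q)..0, jumpIntegrand α β gb u := by
  obtain ⟨i1, e1⟩ := h.integral_loopOne H hα hβ hg1
  obtain ⟨i0, e0⟩ := h.integral_loopZero H hqr hα hβ hg0
  rw [h.doubleLoopIntegral_eq α β hg1 hg0, e1, e0,
    ← intervalIntegral.integral_add_adjacent_intervals i0 i1]
  ring


/-! #### The kernel of the double loop integral -/

/-- The holomorphic factor in the integrand of the double loop integral. -/
noncomputable def loopKernel (b A B C X Y u : ℂ) : ℂ :=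
  (1 - X * u) ^ (-b) * gauss2F1 A B C (Y * (1 - u⁻¹))

/-- The boundary values of the Gauss function on the real axis. -/
noncomputable def gaussBoundary (A B C : ℂ) (σ X : ℝ) : ℂ :=
  if 1 < X then (if σ = 1 then gauss2F1Above A B C X else gauss2F1Below A B C X)
  else gauss2F1 A B C X

theorem tendsto_gaussBoundary {A B C : ℂ} (hC : NonPole C) (hs : -1 < (C - A - B).re) {σ X : ℝ}
    (hσ : σ * σ = 1) (hX : X ≠ 1) :
    Tendsto (gauss2F1 A B C) (𝓝[{z : ℂ | 0 < σ * z.im}] (X : ℂ)) (𝓝 (gaussBoundary A B C σ X)) := by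
  rcases lt_or_gt_of_ne hX with h | h
  · rw [gaussBoundary, if_neg h.not_gt]
    exact (gauss_differentiableAt A B hC (mem_cutPlane_of_re (by simpa using h))
      ).continuousAt.tendsto.mono_left nhdsWithin_le_nhds
  · rw [gaussBoundary, if_pos h]
    rcases mul_self_eq_one_iff.1 hσ with rfl | rfl
    · rw [if_pos rfl]
      simpa only [one_mul] using tendsto_gauss_above hC hs h
    · rw [if_neg (by norm_num)]
      simpa only [neg_mul, one_mul, Left.neg_pos_iff] using tendsto_gauss_below hC hs h

theorem im_mul_one_sub_inv (Y : ℝ) (u : ℂ) :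
    ((Y : ℂ) * (1 - u⁻¹)).im = Y * (u.im / Complex.normSq u) := by
  rw [Complex.im_ofReal_mul, Complex.sub_im, Complex.one_im, Complex.inv_im]
  ring

theorem sub_one_mul_one_sub_inv {y : ℝ} (hy : 1 < y) {u : ℂ} (hu : u ≠ 0) :
    ((y⁻¹ : ℝ) : ℂ) * (1 - u⁻¹) - 1 =
      -(((y - 1) / y : ℝ) : ℂ) * ((u + ((y - 1)⁻¹ : ℝ)) / u) := by
  have h1 : (y : ℂ) ≠ 0 := by exact_mod_cast (by linarith : y ≠ 0)
  have h2 : (y : ℂ) - 1 ≠ 0 := by exact_mod_cast (sub_pos.2 hy).ne'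
  push_cast
  field_simp
  ring

/-- With `q = 1/(y - 1)` the distance of the argument from `1` is a constant times `|u + q|/|u|`.
The bound for `₂F₁` then becomes `|u|^m |u + q|^(-θ)` times a power of `|u| + κ |u + q|`, where `κ =
(y - 1)/y`; this sum is comparable with `1` on bounded sets because `|u| + |u + q| ≥ q`. -/
theorem exists_gauss_bound_loop {A B C : ℂ} (hC : NonPole C) (hs : -1 < (C - A - B).re) {m : ℝ}
    (hmA : m < A.re) (hmB : m < B.re) {y : ℝ} (hy : 1 < y) :
    ∃ θ : ℝ, 0 ≤ θ ∧ θ < 1 ∧ ∀ M : ℝ, ∃ K : ℝ, 0 ≤ K ∧ ∀ u : ℂ, u.im ≠ 0 → ‖u‖ ≤ M →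
      ‖gauss2F1 A B C (((y⁻¹ : ℝ) : ℂ) * (1 - u⁻¹))‖ ≤
        K * (‖u‖ ^ m * ‖u + ((y - 1)⁻¹ : ℝ)‖ ^ (-θ)) := by
  obtain ⟨θ, K, h0, h1, hK, hb⟩ := exists_gauss_bound_of_re hC hs hmA hmB
  have hy0 : 0 < y := by linarith
  set q : ℝ := (y - 1)⁻¹ with hqd
  have hq : 0 < q := inv_pos.2 (sub_pos.2 hy)
  set κ : ℝ := (y - 1) / y with hκd
  have hκ : 0 < κ := div_pos (sub_pos.2 hy) hy0
  have hκ1 : κ ≤ 1 := (div_le_one hy0).2 (by linarith)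
  refine ⟨θ, h0, h1, fun M => ?_⟩
  set k : ℝ := max 1 (max (2 * |M| + q) (κ * q)⁻¹) with hk
  have k1 : 1 ≤ k := le_max_left _ _
  have k2 : 2 * |M| + q ≤ k := (le_max_left _ _).trans (le_max_right _ _)
  have k3 : (κ * q)⁻¹ ≤ k := (le_max_right _ _).trans (le_max_right _ _)
  refine ⟨K * κ ^ (-θ) * k ^ |θ - m|, by positivity, fun u hu hM => ?_⟩
  have u0 : u ≠ 0 := Complex.slitPlane_ne_zero (Or.inr hu)
  have n0 := norm_pos_iff.2 u0
  have uq : u + (q : ℂ) ≠ 0 := Complex.slitPlane_ne_zero (Or.inr (by simpa using hu))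
  have nq := norm_pos_iff.2 uq
  have hz : ((y⁻¹ : ℝ) : ℂ) * (1 - u⁻¹) ∈ cutPlane := by
    refine mem_cutPlane_of_im ?_
    rw [im_mul_one_sub_inv]
    exact mul_ne_zero (inv_pos.2 hy0).ne' (div_ne_zero hu (Complex.normSq_pos.2 u0).ne')
  have hn : ‖((y⁻¹ : ℝ) : ℂ) * (1 - u⁻¹) - 1‖ = κ * ‖u + (q : ℂ)‖ / ‖u‖ := by
    rw [sub_one_mul_one_sub_inv hy u0, norm_mul, norm_neg, norm_div, Complex.norm_real,
      Real.norm_eq_abs, ← hκd, abs_of_pos hκ, mul_div_assoc]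
  refine (hb _ hz).trans ?_
  rw [hn]
  set S : ℝ := ‖u‖ + κ * ‖u + (q : ℂ)‖ with hS
  have hS0 : 0 < S := by positivity
  have e1 : 1 + κ * ‖u + (q : ℂ)‖ / ‖u‖ = S / ‖u‖ := by rw [hS]; field_simp
  have hS1 : S ≤ k * 1 := by
    have h2 : ‖u + (q : ℂ)‖ ≤ M + q := (norm_add_le _ _).trans (add_le_add hM (by
      rw [Complex.norm_real, Real.norm_eq_abs, abs_of_pos hq]))
    have h3 : κ * ‖u + (q : ℂ)‖ ≤ ‖u + (q : ℂ)‖ := mul_le_of_le_one_left nq.le hκ1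
    linarith [le_abs_self M]
  have hS2 : 1 ≤ k * S := by
    have h2 : q ≤ ‖u + (q : ℂ)‖ + ‖u‖ := by
      have := norm_sub_le (u + (q : ℂ)) u
      rwa [add_sub_cancel_left, Complex.norm_real, Real.norm_eq_abs, abs_of_pos hq] at this
    have h3 : κ * q ≤ S := by
      have : κ * ‖u‖ ≤ ‖u‖ := mul_le_of_le_one_left n0.le hκ1
      nlinarith [mul_le_mul_of_nonneg_left h2 hκ.le]
    calc 1 = (κ * q)⁻¹ * (κ * q) := (inv_mul_cancel₀ (by positivity)).symm
      _ ≤ k * S := mul_le_mul k3 h3 (by positivity) (by positivity)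
  have b1 := rpow_le_of_comparable hS0 k1 hS1 hS2 (θ - m)
  rw [Real.one_rpow, mul_one] at b1
  rw [e1, Real.div_rpow (by positivity) n0.le, Real.div_rpow hS0.le n0.le,
    Real.mul_rpow hκ.le nq.le]
  have e2 : ‖u‖ ^ m * (‖u‖ ^ (-θ) * ‖u‖ ^ (θ - m)) = 1 := by
    rw [← Real.rpow_add n0, ← Real.rpow_add n0]
    have : m + (-θ + (θ - m)) = 0 := by ring
    rw [this, Real.rpow_zero]
  have p1 : 0 < ‖u‖ ^ (-θ) := by positivity
  have p2 : 0 < ‖u‖ ^ (θ - m) := by positivity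
  calc K * (κ ^ (-θ) * ‖u + (q : ℂ)‖ ^ (-θ) / ‖u‖ ^ (-θ) * (S ^ (θ - m) / ‖u‖ ^ (θ - m)))
      = K * (κ ^ (-θ) * ‖u + (q : ℂ)‖ ^ (-θ) / ‖u‖ ^ (-θ) * (S ^ (θ - m) / ‖u‖ ^ (θ - m))) *
        (‖u‖ ^ m * (‖u‖ ^ (-θ) * ‖u‖ ^ (θ - m))) := by rw [e2, mul_one]
    _ = K * κ ^ (-θ) * S ^ (θ - m) * (‖u‖ ^ m * ‖u + (q : ℂ)‖ ^ (-θ)) := by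
      field_simp
    _ ≤ _ := by gcongr

/-- The condition `r < (-x)⁻¹` keeps `Re(1 - x u) ≥ 1 + x r > 0`, so the branch point `x⁻¹` stays at
a positive distance. -/
theorem exists_bound_one_sub_cpow (b : ℂ) {x r : ℝ} (hx : x < 0) (hxr : r < (-x)⁻¹) (M : ℝ) :
    ∃ K : ℝ, 0 ≤ K ∧ ∀ u : ℂ, -r ≤ u.re → ‖u‖ ≤ M → ‖(1 - (x : ℂ) * u) ^ (-b)‖ ≤ K := by
  have hδ : 0 < 1 + x * r := by
    have := mul_lt_mul_of_pos_left hxr (neg_pos.2 hx)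
    rw [mul_inv_cancel₀ (neg_pos.2 hx).ne'] at this
    linarith
  set k : ℝ := max 1 (max (1 + -x * M) (1 + x * r)⁻¹) with hk
  have k1 : 1 ≤ k := le_max_left _ _
  have k2 : 1 + -x * M ≤ k := (le_max_left _ _).trans (le_max_right _ _)
  have k3 : (1 + x * r)⁻¹ ≤ k := (le_max_right _ _).trans (le_max_right _ _)
  refine ⟨Real.exp (Real.pi * |(-b).im|) * k ^ |(-b).re|, by positivity, fun u hu hM => ?_⟩
  have h1 : 1 + x * r ≤ ‖1 - (x : ℂ) * u‖ := by
    refine le_trans ?_ (Complex.re_le_norm _)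
    rw [Complex.sub_re, Complex.one_re, Complex.re_ofReal_mul]
    nlinarith
  have h2 : ‖1 - (x : ℂ) * u‖ ≤ k * 1 := by
    refine (norm_sub_le _ _).trans ?_
    rw [norm_one, norm_mul, Complex.norm_real, Real.norm_eq_abs, abs_of_neg hx, mul_one]
    refine le_trans ?_ k2
    have := mul_le_mul_of_nonneg_left hM (neg_pos.2 hx).le
    linarith
  have h3 : 1 ≤ k * ‖1 - (x : ℂ) * u‖ := by
    calc 1 = (1 + x * r)⁻¹ * (1 + x * r) := (inv_mul_cancel₀ hδ.ne').symm
      _ ≤ _ := mul_le_mul k3 h1 hδ.le (by positivity)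
  have h4 := rpow_le_of_comparable (hδ.trans_le h1) k1 h2 h3 (-b).re
  rw [Real.one_rpow, mul_one] at h4
  exact (norm_cpow_le_mul (norm_pos_iff.1 (hδ.trans_le h1)) _).trans
    (mul_le_mul_of_nonneg_left h4 (Real.exp_pos _).le)

theorem one_add_mul_pos {x r t v : ℝ} (hx : x < 0) (hxr : r < (-x)⁻¹) (ht0 : 0 ≤ t) (ht1 : t ≤ 1)
    (hv : -r ≤ v) : 0 < 1 - t * x * v := by
  have := mul_lt_mul_of_pos_left hxr (neg_pos.2 hx)
  rw [mul_inv_cancel₀ (neg_pos.2 hx).ne'] at this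
  have h1 : -(x * v) ≥ x * r := by nlinarith
  have h2 := mul_le_mul_of_nonneg_left h1 ht0
  rcases eq_or_lt_of_le ht0 with rfl | h
  · simp
  · nlinarith [mul_pos h (by linarith : 0 < 1 + x * r)]

/-- The map `u ↦ y⁻¹ (1 - u⁻¹)` preserves the upper and the lower half plane. On the real axis it
enters the cut `(1, ∞)` precisely for `-(y - 1)⁻¹ < u < 0`, so only there do the two boundary values
of the Gauss function have to be distinguished. -/
theorem boundaryData_loopKernel (b : ℂ) {A B C : ℂ} (hC : NonPole C) (hs : -1 < (C - A - B).re)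
    {m : ℝ} (hmA : m < A.re) (hmB : m < B.re) {x y r : ℝ} (hx : x < 0) (hy : 1 < y)
    (hxr : r < (-x)⁻¹) :
    ∃ θ, BoundaryData r (y - 1)⁻¹ m θ (loopKernel b A B C x (y : ℂ)⁻¹) fun σ u =>
      (1 - x * u : ℂ) ^ (-b) * gaussBoundary A B C σ (y⁻¹ * (1 - u⁻¹)) := by
  obtain ⟨θ, h0, h1, hb⟩ := exists_gauss_bound_loop hC hs hmA hmB hy
  have hy0 : 0 < y := by linarith
  have hy1 : 0 < y - 1 := sub_pos.2 hy
  have hslit : ∀ u : ℂ, -r ≤ u.re → 1 - (x : ℂ) * u ∈ Complex.slitPlane := fun u hu => by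
    left
    rw [Complex.sub_re, Complex.one_re, Complex.re_ofReal_mul]
    have := one_add_mul_pos hx hxr zero_le_one le_rfl hu
    rwa [one_mul] at this
  have hval : ∀ u : ℝ, u ≠ 0 → y⁻¹ * (1 - u⁻¹) - 1 = -((y - 1) / y) * ((u + (y - 1)⁻¹) / u) :=
    fun u hu => by
    have := sub_one_mul_one_sub_inv hy (u := (u : ℂ)) (by exact_mod_cast hu)
    exact_mod_cast this
  refine ⟨θ, inv_pos.2 hy1, h0, h1, fun u hu => ?_, fun M => ?_, fun σ hσ u hr u0 uq => ?_,
    fun σ hσ u hu => ?_, fun u hr hu => ?_⟩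
  · have u0 : u ≠ 0 := Complex.slitPlane_ne_zero (Or.inr hu)
    have hz : (y : ℂ)⁻¹ * (1 - u⁻¹) ∈ cutPlane := by
      refine mem_cutPlane_of_im ?_
      rw [← Complex.ofReal_inv, im_mul_one_sub_inv]
      exact mul_ne_zero (inv_pos.2 hy0).ne' (div_ne_zero hu (Complex.normSq_pos.2 u0).ne')
    have d1 : DifferentiableAt ℂ (fun u : ℂ => (1 - (x : ℂ) * u) ^ (-b)) u := by
      refine DifferentiableAt.cpow_const (f := fun u : ℂ => 1 - (x : ℂ) * u) (by fun_prop) ?_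
      right
      rw [Complex.sub_im, Complex.one_im, Complex.im_ofReal_mul, zero_sub, neg_ne_zero]
      exact mul_ne_zero hx.ne hu
    have d2 : DifferentiableAt ℂ (fun u : ℂ => (y : ℂ)⁻¹ * (1 - u⁻¹)) u := by fun_prop (disch := exact u0)
    exact d1.mul ((gauss_differentiableAt A B hC hz).comp u d2)
  · obtain ⟨K₁, hK₁, hb₁⟩ := exists_bound_one_sub_cpow b hx hxr M
    obtain ⟨K₂, hK₂, hb₂⟩ := hb M
    refine ⟨K₁ * K₂, mul_nonneg hK₁ hK₂, fun u hu hr hM => ?_⟩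
    have := hb₂ u hu hM
    rw [Complex.ofReal_inv] at this
    rw [loopKernel, norm_mul, mul_assoc]
    exact mul_le_mul (hb₁ u hr hM) this (norm_nonneg _) hK₁
  · have u0' : (u : ℂ) ≠ 0 := by exact_mod_cast u0
    have c1 : ContinuousAt (fun u : ℂ => (1 - (x : ℂ) * u) ^ (-b)) u :=
      ContinuousAt.cpow (by fun_prop) (by fun_prop) (hslit u (by simpa using hr))
    have hX : y⁻¹ * (1 - u⁻¹) ≠ 1 := by
      rw [← sub_ne_zero, hval u u0]
      refine mul_ne_zero (neg_ne_zero.2 (div_pos hy1 hy0).ne') (div_ne_zero ?_ u0)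
      intro h; apply uq; linarith
    refine (c1.tendsto.mono_left nhdsWithin_le_nhds).mul
      ((tendsto_gaussBoundary hC hs hσ hX).comp (tendsto_nhdsWithin_iff.2 ⟨?_, ?_⟩))
    · have c2 : ContinuousAt (fun u : ℂ => (y : ℂ)⁻¹ * (1 - u⁻¹)) u := by
        fun_prop (disch := exact u0')
      have := c2.tendsto.mono_left (nhdsWithin_le_nhds (s := {z : ℂ | 0 < σ * z.im}))
      simpa using this
    · filter_upwards [self_mem_nhdsWithin] with z hz
      have z0 : z ≠ 0 := Complex.slitPlane_ne_zero (Or.inr (im_ne_zero_of_halfPlane hz))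
      change 0 < σ * Complex.im _
      rw [← Complex.ofReal_inv, im_mul_one_sub_inv]
      have e : σ * (y⁻¹ * (z.im / Complex.normSq z)) = y⁻¹ * ((σ * z.im) / Complex.normSq z) := by ring
      rw [e]
      exact mul_pos (inv_pos.2 hy0) (div_pos hz (Complex.normSq_pos.2 z0))
  · rw [gaussBoundary, if_neg, loopKernel]
    · push_cast; rfl
    · have := hval u hu.ne'
      have h2 : 0 < ((y - 1) / y) * ((u + (y - 1)⁻¹) / u) := by positivity
      linarith
  · have hu0 : u < 0 := hu.trans (neg_neg_iff_pos.2 (inv_pos.2 hy1))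
    have h3 : ¬ 1 < y⁻¹ * (1 - u⁻¹) := by
      have := hval u hu0.ne
      have h2 : 0 < ((y - 1) / y) * ((u + (y - 1)⁻¹) / u) :=
        mul_pos (div_pos hy1 hy0) (div_pos_of_neg_of_neg (by linarith) hu0)
      linarith
    simp only [gaussBoundary, if_neg h3]

variable {p r R : ℝ}

theorem re_circle_zero_ge (h : LoopParams p r R) (s : ℝ) : -r ≤ (circleThrough p (-r) s).re := by
  have := (circleThrough_re_mem (P := p) (Q := -r) s).1
  rwa [min_eq_right (by linarith [h.p_pos, h.r_pos])] at this

/-- If the value were real and at least `1`, then `-u⁻¹` would be real and at least `y - 1`, hence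
`u ∈ [-(y - 1)⁻¹, 0)`. The factor `t` is the deformation parameter of the later continuation and
only moves the value further from the cut. -/
theorem mul_one_sub_inv_mem_cutPlane {y t : ℝ} (hy : 1 < y) (ht0 : 0 ≤ t) (ht1 : t ≤ 1) {u : ℂ}
    (hu : ∀ v : ℝ, 0 < v → v ≤ (y - 1)⁻¹ → u + v ≠ 0) :
    (t : ℂ) * (y : ℂ)⁻¹ * (1 - u⁻¹) ∈ cutPlane := by
  by_contra hz
  have h1 : ¬ (0 < (1 - (t : ℂ) * (y : ℂ)⁻¹ * (1 - u⁻¹)).re ∨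
    (1 - (t : ℂ) * (y : ℂ)⁻¹ * (1 - u⁻¹)).im ≠ 0) := hz
  push Not at h1
  obtain ⟨hre, him⟩ := h1
  set z : ℂ := (t : ℂ) * (y : ℂ)⁻¹ * (1 - u⁻¹) with hzd
  have hzr : z = (z.re : ℂ) := by
    apply Complex.ext
    · simp
    · rw [Complex.sub_im, Complex.one_im, zero_sub, neg_eq_zero] at him
      simpa using him
  rw [Complex.sub_re, Complex.one_re] at hre
  set ρ : ℝ := z.re
  have hρ : 1 ≤ ρ := by linarith
  have ht : 0 < t := by
    refine lt_of_le_of_ne ht0 fun h => ?_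
    rw [hzd, ← h, Complex.ofReal_zero, zero_mul, zero_mul] at hzr
    have : (ρ : ℂ) = 0 := hzr.symm
    have : ρ = 0 := by exact_mod_cast this
    linarith
  have hy0 : 0 < y := by linarith
  have hw : y - 1 ≤ ρ * y / t - 1 := by
    have : y ≤ ρ * y / t := by rw [le_div_iff₀ ht]; nlinarith
    linarith
  have hw0 : 0 < ρ * y / t - 1 := by linarith
  refine hu (ρ * y / t - 1)⁻¹ (inv_pos.2 hw0) (inv_anti₀ (by linarith) hw) ?_
  have t0 : (t : ℂ) ≠ 0 := by exact_mod_cast ht.ne'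
  have y0 : (y : ℂ) ≠ 0 := by exact_mod_cast hy0.ne'
  have e : u⁻¹ = -((ρ * y / t - 1 : ℝ) : ℂ) := by
    push_cast
    have h2 : (t : ℂ) * (y : ℂ)⁻¹ * (1 - u⁻¹) = ρ := hzr
    generalize u⁻¹ = w at h2
    field_simp at h2 ⊢
    linear_combination -h2
  rw [← inv_inv u, e, Complex.ofReal_inv, inv_neg, neg_add_cancel]

/-- The points on the two circles stay away from the cuts of the kernel. -/
theorem LoopParams.kernel_mem (h : LoopParams p r R) {x y t : ℝ} (hx : x < 0) (hy : 1 < y)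
    (hqr : (y - 1)⁻¹ < r) (hxr : r < (-x)⁻¹) (ht0 : 0 ≤ t) (ht1 : t ≤ 1) (s : ℝ) :
    (1 - (t : ℂ) * x * circleThrough p R s ∈ Complex.slitPlane ∧
      (t : ℂ) * (y : ℂ)⁻¹ * (1 - (circleThrough p R s)⁻¹) ∈ cutPlane) ∧
    (1 - (t : ℂ) * x * circleThrough p (-r) s ∈ Complex.slitPlane ∧
      (t : ℂ) * (y : ℂ)⁻¹ * (1 - (circleThrough p (-r) s)⁻¹) ∈ cutPlane) := by
  have hslit : ∀ u : ℂ, -r ≤ u.re → 1 - (t : ℂ) * x * u ∈ Complex.slitPlane := fun u hu => by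
    left
    rw [← Complex.ofReal_mul, Complex.sub_re, Complex.one_re, Complex.re_ofReal_mul]
    exact one_add_mul_pos hx hxr ht0 ht1 hu
  refine ⟨⟨hslit _ (by linarith [h.re_circle_one s, h.r_pos]),
    mul_one_sub_inv_mem_cutPlane hy ht0 ht1 fun v hv _ h0 => ?_⟩,
    hslit _ (re_circle_zero_ge h s), mul_one_sub_inv_mem_cutPlane hy ht0 ht1 fun v hv hv' =>
      h.circle_zero_add_ne hv (hv'.trans_lt hqr) s⟩
  have := h.re_circle_one s
  have h1 := congrArg Complex.re h0
  simp only [Complex.add_re, Complex.ofReal_re, Complex.zero_re] at h1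
  linarith

theorem continuousAt_loopKernel (b A B : ℂ) {C X Y u : ℂ} (hC : NonPole C) (hu : u ≠ 0)
    (h1 : 1 - X * u ∈ Complex.slitPlane) (h2 : Y * (1 - u⁻¹) ∈ cutPlane) :
    ContinuousAt (loopKernel b A B C X Y) u := by
  have c1 : ContinuousAt (fun u : ℂ => (1 - X * u) ^ (-b)) u :=
    ContinuousAt.cpow (by fun_prop) (by fun_prop) h1
  have c2 : ContinuousAt (fun u : ℂ => Y * (1 - u⁻¹)) u := by fun_prop (disch := exact hu)
  exact c1.mul (ContinuousAt.comp (f := fun u : ℂ => Y * (1 - u⁻¹))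
    (gauss_differentiableAt A B hC h2).continuousAt c2)

theorem LoopParams.continuous_kernel (h : LoopParams p r R) (b A B : ℂ) {C : ℂ} (hC : NonPole C)
    {x y t : ℝ} (hx : x < 0) (hy : 1 < y) (hqr : (y - 1)⁻¹ < r) (hxr : r < (-x)⁻¹)
    (ht0 : 0 ≤ t) (ht1 : t ≤ 1) :
    (Continuous fun s => loopKernel b A B C (t * x) (t * (y : ℂ)⁻¹) (circleThrough p R s)) ∧
    Continuous fun s => loopKernel b A B C (t * x) (t * (y : ℂ)⁻¹) (circleThrough p (-r) s) := by
  constructor <;> refine continuous_iff_continuousAt.2 fun s => ?_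
  · obtain ⟨⟨h1, h2⟩, -⟩ := h.kernel_mem hx hy hqr hxr ht0 ht1 s
    exact ContinuousAt.comp (f := circleThrough p R)
      (continuousAt_loopKernel b A B hC (h.circle_one_ne s).1 h1 h2)
      (continuous_circleThrough p R).continuousAt
  · obtain ⟨-, ⟨h1, h2⟩⟩ := h.kernel_mem hx hy hqr hxr ht0 ht1 s
    exact ContinuousAt.comp (f := circleThrough p (-r))
      (continuousAt_loopKernel b A B hC (h.circle_zero_ne s).1 h1 h2)
      (continuous_circleThrough p (-r)).continuousAt

theorem one_sub_exp_ne_zero {α : ℂ} (hα : ∀ n : ℤ, α ≠ n) :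
    1 - Complex.exp (2 * Real.pi * Complex.I * α) ≠ 0 := by
  intro h
  obtain ⟨n, hn⟩ := Complex.exp_eq_one_iff.1 (sub_eq_zero.1 h).symm
  refine hα n ?_
  have := Complex.two_pi_I_ne_zero
  exact mul_left_cancel₀ this (by rw [hn]; ring)

/-- The reflection formula, which turns the normalisation of the double loop into that of the
integral over the negative segment. -/
theorem neg_exp_div_Gamma {α : ℂ} (hα : ∀ n : ℤ, α ≠ n) :
    -(Complex.exp (Real.pi * Complex.I * α)) / ((1 - Complex.exp (2 * Real.pi * Complex.I * α)) *
      Complex.Gamma α) = Complex.Gamma (1 - α) / (2 * Real.pi * Complex.I) := by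
  have h1 := Complex.Gamma_mul_Gamma_one_sub α
  have h0 := one_sub_exp_ne_zero hα
  have h2 : Complex.sin (Real.pi * α) * (2 * Complex.I) * Complex.exp (Real.pi * Complex.I * α) =
      -(1 - Complex.exp (2 * Real.pi * Complex.I * α)) := by
    have e : Complex.exp (2 * Real.pi * Complex.I * α) =
        Complex.exp (Real.pi * Complex.I * α) * Complex.exp (Real.pi * Complex.I * α) := by
      rw [← Complex.exp_add]; congr 1; ring
    have e1 : Real.pi * α * Complex.I = Real.pi * Complex.I * α := by ring
    have e2 := Complex.exp_neg (Real.pi * Complex.I * α)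
    have e3 := Complex.exp_ne_zero (Real.pi * Complex.I * α)
    rw [Complex.sin, neg_mul, e1, e2, e]
    field_simp
    linear_combination (1 - Complex.exp (Real.pi * Complex.I * α) ^ 2) * Complex.I_sq
  have hs : Complex.sin (Real.pi * α) ≠ 0 := by
    intro h3
    rw [h3, zero_mul, zero_mul] at h2
    exact h0 (neg_eq_zero.1 h2.symm)
  have hΓ := (nonPole_of_not_int hα).Gamma_ne_zero
  have hπ : (Real.pi : ℂ) ≠ 0 := by exact_mod_cast Real.pi_ne_zero
  rw [eq_div_iff hs] at h1
  rw [div_eq_div_iff (mul_ne_zero h0 hΓ) Complex.two_pi_I_ne_zero]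
  linear_combination (2 * Complex.I * Complex.exp (Real.pi * Complex.I * α)) * h1 -
    Complex.Gamma α * Complex.Gamma (1 - α) * h2

/-- The double loop integral as the sum of the two integrals over segments. -/
theorem loopI_eq_segments {a b₁ b₂ c₁ c₂ : ℂ} {x y : ℝ} (hx : x < 0) (hxy : 1 < x + y)
    (hα : ∀ n : ℤ, a - b₂ ≠ n) (hβ : ∀ n : ℤ, -a + b₂ + c₁ ≠ n) (h1 : 0 < a.re)
    (h2 : 0 < (a - c₂ + 1).re) (h3 : 0 < (b₂ + c₁ - a).re) (h4 : 0 < (c₁ + c₂ - a - b₂).re)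
    (h : LoopParams p r R) (hqr : (y - 1)⁻¹ < r) (hxr : r < (-x)⁻¹) :
    loopI p r R a b₁ b₂ c₁ c₂ x y =
      segmentI₁ a b₁ b₂ c₁ c₂ x y + segmentI₂ a b₁ b₂ c₁ c₂ x y := by
  have hy : 1 < y := by linarith
  have hC := nonPole_of_not_int hβ
  simp only [Complex.add_re, Complex.sub_re, Complex.one_re] at h2 h3 h4
  -- The lower bound on `m` gives integrability at `u = 0`, the upper bound the growth of `₂F₁` at
  -- infinity. The interval is nonempty because `Re a` and `Re(a - c₂ + 1)` are positive.
  obtain ⟨m, hm1, hm2⟩ := exists_between (a₁ := -(a - b₂).re) (a₂ := min b₂.re (b₂ - c₂ + 1).re) (by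
    rw [lt_min_iff]
    simp only [Complex.add_re, Complex.sub_re, Complex.one_re]
    constructor <;> linarith)
  obtain ⟨hmA, hmB⟩ := lt_min_iff.1 hm2
  obtain ⟨θ, H⟩ := boundaryData_loopKernel b₁ (A := b₂) (B := b₂ - c₂ + 1) hC (by
    simp only [Complex.add_re, Complex.sub_re, Complex.neg_re, Complex.one_re]; linarith)
    hmA hmB hx hy hxr
  obtain ⟨k1, k0⟩ := h.continuous_kernel b₁ b₂ (b₂ - c₂ + 1) hC hx hy hqr hxr zero_le_one le_rfl
  simp only [Complex.ofReal_one, one_mul] at k1 k0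
  have key := h.doubleLoopIntegral_eq_segments (α := a - b₂) (β := -a + b₂ + c₁) H hqr
    (by linarith) (by simp only [Complex.add_re, Complex.neg_re]; linarith) k1 k0
  have e1 : ∫ u in (0 : ℝ)..1, eulerIntegrand (a - b₂) (-a + b₂ + c₁)
      (loopKernel b₁ b₂ (b₂ - c₂ + 1) (-a + b₂ + c₁) x (y : ℂ)⁻¹) u =
      ∫ u in (0 : ℝ)..1, integrandI₁ a b₁ b₂ c₁ c₂ x y u := by
    congr 1; funext u
    rw [eulerIntegrand, loopKernel, integrandI₁, ← mul_assoc]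
  have e2 : ∫ u in (-(y - 1)⁻¹)..(0 : ℝ), jumpIntegrand (a - b₂) (-a + b₂ + c₁) (fun σ u =>
      (1 - x * u : ℂ) ^ (-b₁) * gaussBoundary b₂ (b₂ - c₂ + 1) (-a + b₂ + c₁) σ
        (y⁻¹ * (1 - u⁻¹))) u =
      ∫ u in ((1 - y)⁻¹)..(0 : ℝ), integrandI₂ a b₁ b₂ c₁ c₂ x y u := by
    rw [← inv_neg, neg_sub]
    have hq : (1 - y)⁻¹ ≤ 0 := inv_nonpos.2 (by linarith)
    refine (integral_congr_Ioo hq fun u hu => ?_).symm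
    have hu0 : u < 0 := hu.2
    have hX : 1 < y⁻¹ * (1 - u⁻¹) := by
      have h5 : u⁻¹ < 1 - y := by
        have := inv_lt_inv_of_neg hu0 (inv_lt_zero.2 (by linarith : 1 - y < 0)) |>.2 hu.1
        rwa [inv_inv] at this
      have := mul_lt_mul_of_pos_left (by linarith : y < 1 - u⁻¹) (inv_pos.2 (by linarith : 0 < y))
      rwa [inv_mul_cancel₀ (by linarith)] at this
    simp only [jumpIntegrand, integrandI₂, gaussBoundary, if_pos hX, if_true,
      if_neg (by norm_num : ¬ (-1 : ℝ) = 1)]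
    ring
  have k := neg_exp_div_Gamma hα
  have nα := one_sub_exp_ne_zero hα
  have nβ := one_sub_exp_ne_zero hβ
  have hΓ := (nonPole_of_not_int hα).Gamma_ne_zero
  have hΓβ := hC.Gamma_ne_zero
  have e3 : -a + b₂ + 1 = 1 - (a - b₂) := by ring
  change Complex.Gamma c₁ / (Complex.Gamma (a - b₂) * Complex.Gamma (-a + b₂ + c₁)) *
    ((y : ℂ) ^ (-b₂) /
      ((1 - Complex.exp (2 * Real.pi * Complex.I * (a - b₂))) *
        (1 - Complex.exp (2 * Real.pi * Complex.I * (-a + b₂ + c₁))))) *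
    doubleLoopIntegral p r R (a - b₂) (-a + b₂ + c₁)
      (loopKernel b₁ b₂ (b₂ - c₂ + 1) (-a + b₂ + c₁) x (y : ℂ)⁻¹) = _
  rw [key, e1, e2, segmentI₁, segmentI₂, e3]
  have h2πI := Complex.two_pi_I_ne_zero
  generalize (∫ u in (0 : ℝ)..1, integrandI₁ a b₁ b₂ c₁ c₂ x y u) = J₁
  generalize (∫ u in ((1 - y)⁻¹)..(0 : ℝ), integrandI₂ a b₁ b₂ c₁ c₂ x y u) = J₂
  have e4 : Complex.Gamma c₁ * Complex.Gamma (1 - (a - b₂)) / Complex.Gamma (-a + b₂ + c₁) *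
      ((y : ℂ) ^ (-b₂) / (2 * Real.pi * Complex.I)) * J₂ = Complex.Gamma c₁ /
      Complex.Gamma (-a + b₂ + c₁) * (y : ℂ) ^ (-b₂) * J₂ *
      (Complex.Gamma (1 - (a - b₂)) / (2 * Real.pi * Complex.I)) := by ring
  rw [e4, ← k]
  generalize 1 - Complex.exp (2 * Real.pi * Complex.I * (a - b₂)) = E₁ at nα ⊢
  generalize 1 - Complex.exp (2 * Real.pi * Complex.I * (-a + b₂ + c₁)) = E₂ at nβ ⊢
  generalize Complex.Gamma (a - b₂) = G₁ at hΓ ⊢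
  generalize Complex.Gamma (-a + b₂ + c₁) = G₂ at hΓβ ⊢
  generalize (y : ℂ) ^ (-b₂) = Y
  field_simp
  ring


/-! #### Pochhammer's beta integral -/

/-- The combination of loops around `1` and `0` that makes up the double loop integral. -/
noncomputable def loopPair (p r R : ℝ) (α β : ℂ) (g : ℂ → ℂ) : ℂ :=
  (1 - Complex.exp (2 * Real.pi * Complex.I * α)) * (∫ s in (0 : ℝ)..1,
    loopOneIntegrand p R α β g s) -
  (1 - Complex.exp (2 * Real.pi * Complex.I * β)) * ∫ s in (0 : ℝ)..1,
    loopZeroIntegrand p r α β g s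

theorem exp_two_pi_add_int (α : ℂ) (k : ℤ) : Complex.exp (2 * Real.pi * Complex.I * (α + k)) =
    Complex.exp (2 * Real.pi * Complex.I * α) := by
  have : 2 * Real.pi * Complex.I * (α + k) = 2 * Real.pi * Complex.I * α +
      k * (2 * Real.pi * Complex.I) := by ring
  rw [this]
  exact Complex.exp_periodic.int_mul k _

variable {p r R : ℝ}

theorem exp_shift_int {u v l w : ℂ} (hl : Complex.exp l = u) (hw : Complex.exp w = v) (α β : ℂ)
    (k : ℤ) (j : ℕ) : Complex.exp ((α - 1) * l + (β - 1) * w) * (u ^ k * v ^ j) =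
      Complex.exp ((α + k - 1) * l + (β + j - 1) * w) * 1 := by
  rw [← hl, ← hw, ← Complex.exp_int_mul, ← Complex.exp_nat_mul, ← Complex.exp_add,
    ← Complex.exp_add, mul_one]
  congr 1; ring

theorem LoopParams.exp_logs (h : LoopParams p r R) (s : ℝ) :
    (Complex.exp (Complex.log (circleThrough p R s)) = circleThrough p R s ∧
      Complex.exp (windLog (1 - (p + R) / 2) ((R - p) / 2) s) = 1 - circleThrough p R s) ∧
    Complex.exp (windLog ((p + -r) / 2) ((p - -r) / 2) s) = circleThrough p (-r) s ∧
      Complex.exp (Complex.log (1 - circleThrough p (-r) s)) = 1 - circleThrough p (-r) s :=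
  ⟨⟨Complex.exp_log (h.circle_one_ne s).1, by
    rw [exp_windLog h.radius_one h.center_one, LoopParams.one_sub_circle_one]⟩, by
    rw [exp_windLog h.radius_zero h.center_zero, circleThrough_eq],
    Complex.exp_log (sub_ne_zero.2 (h.circle_zero_ne s).2.symm)⟩

/-- Powers of `u` and `1 - u` in the integrand shift the exponents. -/
theorem LoopParams.loopPair_pow (h : LoopParams p r R) (α β : ℂ) (k : ℤ) (j : ℕ) :
    loopPair p r R α β (fun u => u ^ k * (1 - u) ^ j) =
      loopPair p r R (α + k) (β + j) fun _ => 1 := by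
  have e1 : loopOneIntegrand p R α β (fun u => u ^ k * (1 - u) ^ j) =
      loopOneIntegrand p R (α + k) (β + j) fun _ => 1 := by
    funext s
    rw [loopOneIntegrand, loopOneIntegrand, exp_shift_int (h.exp_logs s).1.1 (h.exp_logs s).1.2]
  have e0 : loopZeroIntegrand p r α β (fun u => u ^ k * (1 - u) ^ j) =
      loopZeroIntegrand p r (α + k) (β + j) fun _ => 1 := by
    funext s
    rw [loopZeroIntegrand, loopZeroIntegrand, exp_shift_int (h.exp_logs s).2.1 (h.exp_logs s).2.2]
  have hj := exp_two_pi_add_int β j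
  rw [Int.cast_natCast] at hj
  rw [loopPair, loopPair, e1, e0, exp_two_pi_add_int, hj]

theorem hasDerivAt_exp_logs {δ L W δ' : ℝ → ℂ} {s : ℝ} (hL : HasDerivAt L (δ' s / δ s) s)
    (hW : HasDerivAt W (-δ' s / (1 - δ s)) s) (h0 : δ s ≠ 0) (h1 : 1 - δ s ≠ 0)
    (hl : Complex.exp (L s) = δ s) (hw : Complex.exp (W s) = 1 - δ s) (α β : ℂ) :
    HasDerivAt (fun s => Complex.exp (α * L s + β * W s))
      (Complex.exp ((α - 1) * L s + (β - 1) * W s) * (α * (1 - δ s) - β * δ s) * δ' s) s := by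
  refine ((hL.const_mul α).add (hW.const_mul β)).cexp.congr_deriv ?_
  have e : Complex.exp (α * L s + β * W s) =
      Complex.exp ((α - 1) * L s + (β - 1) * W s) * (δ s * (1 - δ s)) := by
    rw [← hl]
    nth_rewrite 2 [hl]
    rw [← hw, ← Complex.exp_add, ← Complex.exp_add]
    congr 1; ring
  simp only [Pi.add_apply]
  rw [e]
  field_simp
  ring

/-- The integrand is the derivative of `u^α (1 - u)^β`. Each simple loop gives a boundary term, a
multiple of `p^α (1 - p)^β` by `e^(2πiβ) - 1` or `e^(2πiα) - 1`, and the two terms cancel in the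
combination. -/
theorem LoopParams.loopPair_exact (h : LoopParams p r R) (α β : ℂ) :
    loopPair p r R α β (fun u => α * (1 - u) - β * u) = 0 := by
  have c1 := h.continuous_loopOneIntegrand α β (g := fun u => α * (1 - u) - β * u)
    (by have := continuous_circleThrough p R; fun_prop)
  have c0 := h.continuous_loopZeroIntegrand α β (g := fun u => α * (1 - u) - β * u)
    (by have := continuous_circleThrough p (-r); fun_prop)
  have i1 := intervalIntegral.integral_eq_sub_of_hasDerivAt (a := 0) (b := 1) (fun s _ =>
    hasDerivAt_exp_logs (δ := circleThrough p R) (h.hasLog_one.1 s)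
      ((h.hasLog_one_sub_one.1 s).congr_deriv (by rw [deriv_one_sub_circle]))
      (h.circle_one_ne s).1 (sub_ne_zero.2 (h.circle_one_ne s).2.symm) (h.exp_logs s).1.1
      (h.exp_logs s).1.2 α β) (c1.intervalIntegrable 0 1)
  have i0 := intervalIntegral.integral_eq_sub_of_hasDerivAt (a := 0) (b := 1) (fun s _ =>
    hasDerivAt_exp_logs (δ := circleThrough p (-r)) (h.hasLog_zero.1 s)
      ((h.hasLog_one_sub_zero.1 s).congr_deriv (by rw [deriv_one_sub_circle]))
      (h.circle_zero_ne s).1 (sub_ne_zero.2 (h.circle_zero_ne s).2.symm) (h.exp_logs s).2.1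
      (h.exp_logs s).2.2 α β) (c0.intervalIntegrable 0 1)
  have w : ∀ A ρ, windLog A ρ 1 = windLog A ρ 0 + 2 * Real.pi * Complex.I := fun A ρ => by
    have := windLog_int A ρ 1
    simpa only [Int.cast_one, one_mul] using this
  have x1 : ∀ l w γ : ℂ, Complex.exp (l + γ * (w + 2 * Real.pi * Complex.I)) =
      Complex.exp (2 * Real.pi * Complex.I * γ) * Complex.exp (l + γ * w) := fun l w γ => by
    rw [← Complex.exp_add]; congr 1; ring
  rw [circleThrough_one, circleThrough_zero, w, x1, h.windLog_one_zero] at i1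
  rw [circleThrough_one, circleThrough_zero, w, add_comm (α * _), add_comm (α * _), x1,
    h.windLog_zero_zero] at i0
  change (∫ s in (0 : ℝ)..1, loopOneIntegrand p R α β (fun u => α * (1 - u) - β * u) s) = _ at i1
  change (∫ s in (0 : ℝ)..1, loopZeroIntegrand p r α β (fun u => α * (1 - u) - β * u) s) = _ at i0
  rw [loopPair, i1, i0, add_comm (β * _)]
  ring

theorem LoopParams.loopPair_linear (h : LoopParams p r R) (α β x y : ℂ) {f g : ℂ → ℂ}
    (hf : ∀ s, ContinuousAt f (circleThrough p R s) ∧ ContinuousAt f (circleThrough p (-r) s))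
    (hg : ∀ s, ContinuousAt g (circleThrough p R s) ∧ ContinuousAt g (circleThrough p (-r) s)) :
    loopPair p r R α β (fun u => x * f u + y * g u) =
      x * loopPair p r R α β f + y * loopPair p r R α β g := by
  have cont : ∀ f : ℂ → ℂ, (∀ s, ContinuousAt f (circleThrough p R s) ∧
      ContinuousAt f (circleThrough p (-r) s)) →
      (IntervalIntegrable (loopOneIntegrand p R α β f) volume 0 1 ∧
      IntervalIntegrable (loopZeroIntegrand p r α β f) volume 0 1) := fun f hf =>
    ⟨(h.continuous_loopOneIntegrand α β (continuous_iff_continuousAt.2 fun s =>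
      ContinuousAt.comp (f := circleThrough p R) (hf s).1
        (continuous_circleThrough p R).continuousAt)).intervalIntegrable 0 1,
    (h.continuous_loopZeroIntegrand α β (continuous_iff_continuousAt.2 fun s =>
      ContinuousAt.comp (f := circleThrough p (-r)) (hf s).2
        (continuous_circleThrough p (-r)).continuousAt)).intervalIntegrable 0 1⟩
  have e1 : loopOneIntegrand p R α β (fun u => x * f u + y * g u) = fun s =>
      x * loopOneIntegrand p R α β f s + y * loopOneIntegrand p R α β g s := by
    funext s; simp only [loopOneIntegrand]; ring
  have e0 : loopZeroIntegrand p r α β (fun u => x * f u + y * g u) = fun s =>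
      x * loopZeroIntegrand p r α β f s + y * loopZeroIntegrand p r α β g s := by
    funext s; simp only [loopZeroIntegrand]; ring
  rw [loopPair, loopPair, loopPair, e1, e0,
    intervalIntegral.integral_add ((cont f hf).1.const_mul x) ((cont g hg).1.const_mul y),
    intervalIntegral.integral_add ((cont f hf).2.const_mul x) ((cont g hg).2.const_mul y)]
  simp only [intervalIntegral.integral_const_mul]
  ring

/-- Exactness and the decomposition `1 = (1 - u) + u` are two linear relations between the loop
integrals with shifted exponents; these are the recurrences of the Beta function. -/
theorem LoopParams.loopPair_recurrence (h : LoopParams p r R) (α β : ℂ) :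
    α * loopPair p r R α β (fun _ => 1) = (α + β) * loopPair p r R (α + 1) β (fun _ => 1) ∧
    β * loopPair p r R α β (fun _ => 1) = (α + β) * loopPair p r R α (β + 1) (fun _ => 1) := by
  have a := h.loopPair_pow α β 1 0
  have b := h.loopPair_pow α β 0 1
  simp only [zpow_one, zpow_zero, pow_zero, pow_one, mul_one, one_mul, Int.cast_one, Int.cast_zero,
    Nat.cast_zero, Nat.cast_one, add_zero] at a b
  have c := h.loopPair_linear α β α (-β) (f := fun u => 1 - u) (g := fun u => u)
    (fun s => ⟨by fun_prop, by fun_prop⟩) (fun s => ⟨by fun_prop, by fun_prop⟩)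
  have d := h.loopPair_linear α β 1 1 (f := fun u => 1 - u) (g := fun u => u)
    (fun s => ⟨by fun_prop, by fun_prop⟩) (fun s => ⟨by fun_prop, by fun_prop⟩)
  have e := h.loopPair_exact α β
  simp only [neg_mul, ← sub_eq_add_neg, one_mul, sub_add_cancel] at c d
  rw [e, a, b] at c
  rw [a, b] at d
  constructor
  · linear_combination α * d - c
  · linear_combination β * d + c

theorem LoopParams.loopPair_one_of_re_pos (h : LoopParams p r R) {α β : ℂ} (hα : 0 < α.re)
    (hβ : 0 < β.re) : loopPair p r R α β (fun _ => 1) =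
      (1 - Complex.exp (2 * Real.pi * Complex.I * α)) *
        (1 - Complex.exp (2 * Real.pi * Complex.I * β)) *
        (Complex.Gamma α * Complex.Gamma β * (Complex.Gamma (α + β))⁻¹) := by
  have hr := h.r_pos
  -- The constant function has no jump, so any `q ∈ (0, r)` serves; `r/2` is one.
  have H : BoundaryData r (r / 2) 0 0 (fun _ => 1) fun _ _ => 1 :=
    { q_pos := by positivity
      θ_nonneg := le_rfl
      θ_lt := one_pos
      diff := fun _ _ => differentiableAt_const _
      bound := fun _ => ⟨1, zero_le_one, fun z _ _ _ => by simp⟩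
      tendsto := fun _ _ _ _ _ _ => tendsto_const_nhds
      eq_pos := fun _ _ _ _ => rfl
      eq_lt := fun _ _ _ => rfl }
  have key := h.doubleLoopIntegral_eq_segments (α := α) (β := β) H (by linarith) (by simpa using hα)
    hβ continuous_const continuous_const
  rw [h.doubleLoopIntegral_eq α β continuous_const continuous_const] at key
  have hB : ∫ u in (0 : ℝ)..1, eulerIntegrand α β (fun _ => 1) u = Complex.betaIntegral α β := by
    simp only [eulerIntegrand, mul_one, Complex.betaIntegral]
  have hJ : ∫ u in (-(r / 2))..(0 : ℝ), jumpIntegrand α β (fun _ _ => 1) u = 0 := by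
    simp only [jumpIntegrand, sub_self, mul_zero, intervalIntegral.integral_zero]
  have hG : Complex.Gamma (α + β) ≠ 0 := Complex.Gamma_ne_zero_of_re_pos (by
    rw [Complex.add_re]; linarith)
  rw [loopPair, key, hB, hJ, Complex.Gamma_mul_Gamma_eq_betaIntegral hα hβ]
  field_simp
  ring

theorem inv_Gamma_eq_mul (z : ℂ) : (Complex.Gamma z)⁻¹ = z * (Complex.Gamma (z + 1))⁻¹ := by
  simpa only [one_div] using Complex.one_div_Gamma_eq_self_mul_one_div_Gamma_add_one z

theorem add_one_ne_int {α : ℂ} (hα : ∀ n : ℤ, α ≠ n) : ∀ n : ℤ, α + 1 ≠ n := fun n hn =>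
  hα (n - 1) (by push_cast; linear_combination hn)

theorem exp_two_pi_add_one (α : ℂ) : Complex.exp (2 * Real.pi * Complex.I * (α + 1)) =
    Complex.exp (2 * Real.pi * Complex.I * α) := by
  simpa only [Int.cast_one] using exp_two_pi_add_int α 1

/-- Pochhammer's integral for the beta function. -/
theorem LoopParams.loopPair_one (h : LoopParams p r R) {α β : ℂ} (hα : ∀ n : ℤ, α ≠ n)
    (hβ : ∀ n : ℤ, β ≠ n) : loopPair p r R α β (fun _ => 1) =
      (1 - Complex.exp (2 * Real.pi * Complex.I * α)) *
        (1 - Complex.exp (2 * Real.pi * Complex.I * β)) *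
        (Complex.Gamma α * Complex.Gamma β * (Complex.Gamma (α + β))⁻¹) := by
  -- The recurrences lower `Re α` first, with `Re β > 0`, and afterwards `Re β` for the given `α`.
  -- Only division by `α` or `β` occurs, and neither is an integer. The factor `α + β` is absorbed
  -- in `1/Γ(α + β)` and may vanish.
  have A : ∀ n : ℕ, ∀ α : ℂ, (∀ n : ℤ, α ≠ n) → 0 < α.re + n → ∀ β : ℂ, 0 < β.re →
      loopPair p r R α β (fun _ => 1) = (1 - Complex.exp (2 * Real.pi * Complex.I * α)) *
        (1 - Complex.exp (2 * Real.pi * Complex.I * β)) *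
        (Complex.Gamma α * Complex.Gamma β * (Complex.Gamma (α + β))⁻¹) := by
    intro n
    induction n with
    | zero => exact fun α _ h1 β hβ => h.loopPair_one_of_re_pos (by simpa using h1) hβ
    | succ n ih =>
      intro α hα h1 β hβ
      have h0 : α ≠ 0 := by simpa using hα 0
      have := ih (α + 1) (add_one_ne_int hα) (by
        rw [Complex.add_re, Complex.one_re]; push_cast at h1; linarith) β hβ
      rw [Complex.Gamma_add_one α h0, exp_two_pi_add_one, add_right_comm] at this
      refine mul_left_cancel₀ h0 ?_
      rw [(h.loopPair_recurrence α β).1, this, inv_Gamma_eq_mul (α + β)]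
      ring
  have B : ∀ n : ℕ, ∀ β : ℂ, (∀ n : ℤ, β ≠ n) → 0 < β.re + n →
      loopPair p r R α β (fun _ => 1) = (1 - Complex.exp (2 * Real.pi * Complex.I * α)) *
        (1 - Complex.exp (2 * Real.pi * Complex.I * β)) *
        (Complex.Gamma α * Complex.Gamma β * (Complex.Gamma (α + β))⁻¹) := by
    intro n
    induction n with
    | zero =>
      intro β _ h1
      obtain ⟨N, hN⟩ := exists_nat_gt (-α.re)
      exact A N α hα (by linarith) β (by simpa using h1)
    | succ n ih =>
      intro β hβ h1
      have h0 : β ≠ 0 := by simpa using hβ 0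
      have := ih (β + 1) (add_one_ne_int hβ) (by
        rw [Complex.add_re, Complex.one_re]; push_cast at h1; linarith)
      rw [Complex.Gamma_add_one β h0, exp_two_pi_add_one, ← add_assoc] at this
      refine mul_left_cancel₀ h0 ?_
      rw [(h.loopPair_recurrence α β).2, this, inv_Gamma_eq_mul (α + β)]
      ring
  obtain ⟨N, hN⟩ := exists_nat_gt (-β.re)
  exact B N β hβ (by linarith)

theorem Gamma_add_sub_nat {α : ℂ} (hα : ∀ n : ℤ, α ≠ n) (i j : ℕ) :
    Complex.Gamma (α + ((i : ℤ) - (j : ℤ) : ℤ)) = pochZ α ((i : ℤ) - j) * Complex.Gamma α := by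
  have hj : ∀ n : ℤ, α - j ≠ n := fun n hn => hα (n + j) (by push_cast; linear_combination hn)
  have h1 := Gamma_add_nat (nonPole_of_not_int hj) i
  have h2 := Gamma_add_nat (nonPole_of_not_int hj) j
  have h3 := pochZ_sub hα j j
  rw [sub_self, show pochZ α 0 = 1 by simp [pochZ]] at h3
  rw [sub_add_cancel] at h2
  rw [pochZ_sub hα, h2]
  rw [show α + ((i : ℤ) - (j : ℤ) : ℤ) = α - j + i by push_cast; ring, h1]
  linear_combination (poch (α - j) i * Complex.Gamma (α - j)) * h3

/-- The values of the loop integrals of `u ^ (i - j) * (1 - u) ^ j`. -/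
theorem LoopParams.loopPair_monomial (h : LoopParams p r R) {α β : ℂ} (hα : ∀ n : ℤ, α ≠ n)
    (hβ : ∀ n : ℤ, β ≠ n) (i j : ℕ) :
    loopPair p r R α β (fun u => u ^ ((i : ℤ) - (j : ℤ)) * (1 - u) ^ j) =
      (1 - Complex.exp (2 * Real.pi * Complex.I * α)) *
        (1 - Complex.exp (2 * Real.pi * Complex.I * β)) *
        (pochZ α ((i : ℤ) - j) * Complex.Gamma α * (poch β j * Complex.Gamma β) *
          (Complex.Gamma (α + β + i))⁻¹) := by
  have hj := exp_two_pi_add_int β j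
  rw [Int.cast_natCast] at hj
  rw [h.loopPair_pow, h.loopPair_one (fun n hn => hα (n - ((i : ℤ) - j)) (by
    push_cast at hn ⊢; linear_combination hn)) (fun n hn => hβ (n - j) (by
    push_cast; linear_combination hn)), exp_two_pi_add_int, hj, Gamma_add_sub_nat hα,
    Gamma_add_nat (nonPole_of_not_int hβ)]
  congr 4
  push_cast; ring


/-! #### The series expansion of the double loop integral -/

theorem hasSum_integral_mul {ι : Type*} [Countable ι] {E D : ℝ → ℂ} (hE : Continuous E)
    (hD : Continuous D) {G : ι → ℝ → ℂ} {S : ℝ → ℂ} (hG : ∀ n, Continuous (G n)) {a : ι → ℝ}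
    (ha : Summable a) (hb : ∀ n, ∀ s ∈ Set.Icc (0 : ℝ) 1, ‖G n s‖ ≤ a n)
    (hs : ∀ s ∈ Set.Icc (0 : ℝ) 1, HasSum (fun n => G n s) (S s)) :
    HasSum (fun n => ∫ s in (0 : ℝ)..1, E s * G n s * D s) (∫ s in (0 : ℝ)..1, E s * S s * D s) := by
  have hI : ∀ s ∈ Set.uIoc (0 : ℝ) 1, s ∈ Set.Icc (0 : ℝ) 1 := fun s hs => by
    rw [Set.uIoc_of_le zero_le_one] at hs
    exact ⟨hs.1.le, hs.2⟩
  refine intervalIntegral.hasSum_integral_of_dominated_convergence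
    (fun n s => a n * (‖E s‖ * ‖D s‖)) (fun n => ((hE.mul (hG n)).mul hD).aestronglyMeasurable)
    (fun n => Eventually.of_forall fun s hs' => ?_)
    (Eventually.of_forall fun s _ => ha.mul_right _) ?_
    (Eventually.of_forall fun s hs' => ((hs s (hI s hs')).mul_left _).mul_right _)
  · rw [norm_mul, norm_mul]
    have := mul_le_mul_of_nonneg_right (hb n s (hI s hs')) (by positivity : 0 ≤ ‖E s‖ * ‖D s‖)
    linarith
  · simp only [tsum_mul_right]
    exact ((hE.norm.mul hD.norm).const_mul _).intervalIntegrable 0 1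

variable {p r R : ℝ}

theorem LoopParams.hasSum_loopPair (h : LoopParams p r R) (α β : ℂ) {ι : Type*} [Countable ι]
    {G : ι → ℂ → ℂ} {S : ℂ → ℂ} {a : ι → ℝ} (ha : Summable a) {D : Set ℂ}
    (hD : ∀ s ∈ Set.Icc (0 : ℝ) 1, circleThrough p R s ∈ D ∧ circleThrough p (-r) s ∈ D)
    (hG : ∀ n, ∀ u : ℂ, u ≠ 0 → ContinuousAt (G n) u)
    (hb : ∀ n, ∀ u ∈ D, ‖G n u‖ ≤ a n) (hs : ∀ u ∈ D, HasSum (fun n => G n u) (S u)) :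
    HasSum (fun n => loopPair p r R α β (G n)) (loopPair p r R α β S) := by
  have k1 := hasSum_integral_mul (E := fun s => Complex.exp ((α - 1) * Complex.log
      (circleThrough p R s) + (β - 1) * windLog (1 - (p + R) / 2) ((R - p) / 2) s))
    ((continuous_const.mul h.hasLog_one.continuous).add
      (continuous_const.mul h.hasLog_one_sub_one.continuous)).cexp
    (continuous_deriv_circleThrough p R) (G := fun n s => G n (circleThrough p R s))
    (S := fun s => S (circleThrough p R s)) (fun n => continuous_iff_continuousAt.2 fun s =>
      ContinuousAt.comp (f := circleThrough p R) (hG n _ (h.circle_one_ne s).1)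
        (continuous_circleThrough p R).continuousAt) ha
    (fun n s hs' => hb n _ (hD s hs').1) (fun s hs' => hs _ (hD s hs').1)
  have k0 := hasSum_integral_mul (E := fun s => Complex.exp ((α - 1) *
      windLog ((p + -r) / 2) ((p - -r) / 2) s + (β - 1) * Complex.log (1 - circleThrough p (-r) s)))
    ((continuous_const.mul h.hasLog_zero.continuous).add
      (continuous_const.mul h.hasLog_one_sub_zero.continuous)).cexp
    (continuous_deriv_circleThrough p (-r)) (G := fun n s => G n (circleThrough p (-r) s))
    (S := fun s => S (circleThrough p (-r) s)) (fun n => continuous_iff_continuousAt.2 fun s =>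
      ContinuousAt.comp (f := circleThrough p (-r)) (hG n _ (h.circle_zero_ne s).1)
        (continuous_circleThrough p (-r)).continuousAt) ha
    (fun n s hs' => hb n _ (hD s hs').2) (fun s hs' => hs _ (hD s hs').2)
  exact (k1.mul_left _).sub (k0.mul_left _)

theorem loopPair_const_mul (p r R : ℝ) (α β c : ℂ) (g : ℂ → ℂ) :
    loopPair p r R α β (fun u => c * g u) = c * loopPair p r R α β g := by
  have e1 : loopOneIntegrand p R α β (fun u => c * g u) = fun s =>
      c * loopOneIntegrand p R α β g s := by
    funext s; simp only [loopOneIntegrand]; ring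
  have e0 : loopZeroIntegrand p r α β (fun u => c * g u) = fun s =>
      c * loopZeroIntegrand p r α β g s := by
    funext s; simp only [loopZeroIntegrand]; ring
  rw [loopPair, loopPair, e1, e0, intervalIntegral.integral_const_mul,
    intervalIntegral.integral_const_mul]
  ring

theorem hasSum_prod_mul {f g : ℕ → ℂ} {a b : ℂ} (hf : HasSum f a) (hg : HasSum g b) :
    HasSum (fun k : ℕ × ℕ => f k.1 * g k.2) (a * b) :=
  HasSum.mul hf hg (summable_mul_of_summable_norm hf.summable.norm hg.summable.norm)

theorem summable_prod_mul {f g : ℕ → ℝ} (hf : Summable f) (hg : Summable g) (hf0 : ∀ i, 0 ≤ f i)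
    (hg0 : ∀ i, 0 ≤ g i) : Summable fun k : ℕ × ℕ => f k.1 * g k.2 :=
  hf.mul_of_nonneg hg hf0 hg0

theorem hasSum_loopKernel (b A B : ℂ) {C X Y u : ℂ} (hC : NonPole C) (hX : ‖X * u‖ < 1)
    (hY : ‖Y * (1 - u⁻¹)‖ < 1) :
    HasSum (fun k : ℕ × ℕ => (poch b k.1 / k.1.factorial * (X * u) ^ k.1) *
      (hcoef A B C k.2 * (Y * (1 - u⁻¹)) ^ k.2)) (loopKernel b A B C X Y u) := by
  have h1 := hasSum_binomial b hX
  have h2 := hasSum_hyp A B hC hY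
  rw [← gauss_eq_hyp A B hC hY] at h2
  have h3 := hasSum_prod_mul h1 h2
  exact h3

/-- Since `1 - u⁻¹ = -(1 - u)/u`, the hypergeometric index `j` lowers the power of `u` and raises
that of `1 - u`. The sign explains the argument `-1/y` of `H₂`. -/
theorem loopKernel_term_eq (b A B C X Y : ℂ) {u : ℂ} (hu : u ≠ 0) (i j : ℕ) :
    (poch b i / i.factorial * (X * u) ^ i) * (hcoef A B C j * (Y * (1 - u⁻¹)) ^ j) =
      poch b i / i.factorial * X ^ i * (hcoef A B C j * (-Y) ^ j) *
        (u ^ ((i : ℤ) - (j : ℤ)) * (1 - u) ^ j) := by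
  have e : Y * (1 - u⁻¹) = -Y * ((1 - u) * u⁻¹) := by field_simp; ring
  rw [e, mul_pow, mul_pow, mul_pow, zpow_sub₀ hu, zpow_natCast, zpow_natCast, inv_pow]
  ring

theorem summable_loopKernel_bound (b A B : ℂ) {C : ℂ} (hC : NonPole C) :
    Summable fun k : ℕ × ℕ => ‖poch b k.1 / k.1.factorial‖ * (1 / 2 : ℝ) ^ k.1 *
      (‖hcoef A B C k.2‖ * (1 / 2 : ℝ) ^ k.2) := by
  have h1 := (hasSum_binomial b (z := ((1 / 2 : ℝ) : ℂ)) (by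
    rw [Complex.norm_real]; norm_num)).summable.norm
  simp only [norm_mul, norm_pow, Complex.norm_real, Real.norm_eq_abs,
    abs_of_pos (by norm_num : (0 : ℝ) < 1 / 2)] at h1
  have h2 := summable_norm_hcoef A B hC (r := 1 / 2) (by norm_num) (by norm_num)
  have h3 := summable_prod_mul h1 h2 (fun i => by positivity) (fun i => by positivity)
  exact h3

theorem norm_loopKernel_term_le (b A B C : ℂ) {X Y u : ℂ} (hX : ‖X * u‖ ≤ 1 / 2)
    (hY : ‖Y * (1 - u⁻¹)‖ ≤ 1 / 2) (i j : ℕ) :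
    ‖(poch b i / i.factorial * (X * u) ^ i) * (hcoef A B C j * (Y * (1 - u⁻¹)) ^ j)‖ ≤
      ‖poch b i / i.factorial‖ * (1 / 2 : ℝ) ^ i * (‖hcoef A B C j‖ * (1 / 2 : ℝ) ^ j) := by
  rw [norm_mul, norm_mul, norm_mul, norm_pow, norm_pow]
  gcongr

theorem hornTerm_aux {P₁ P₂ : ℂ} (p₁ : P₁ ≠ 0) (p₂ : P₂ ≠ 0) (b A B F₁ F₂ Q G G₁ G₂ E X Y : ℂ) :
    b / F₁ * X * (A * B / (P₂ * F₂) * Y) * (E * (Q * G₁ * (P₂ * G₂) * G)) =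
      E * (G₁ * G₂ * (P₁ * G)) * (Q * b * A * B / (P₁ * F₁ * F₂) * X * Y) := by
  simp only [div_eq_mul_inv, mul_inv]
  linear_combination (b * F₁⁻¹ * X * A * B * F₂⁻¹ * Y * E * Q * G₁ * G₂ * G) *
    (mul_inv_cancel₀ p₂ - mul_inv_cancel₀ p₁)

theorem hornTerm_eq (b A B : ℂ) {α β : ℂ} (hc : NonPole (α + β)) (hC : NonPole β) (X Y E : ℂ)
    (i j : ℕ) : poch b i / i.factorial * X ^ i * (hcoef A B β j * Y ^ j) *
      (E * (pochZ α ((i : ℤ) - j) * Complex.Gamma α * (poch β j * Complex.Gamma β) *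
          (Complex.Gamma (α + β + i))⁻¹)) =
      E * (Complex.Gamma α * Complex.Gamma β / Complex.Gamma (α + β)) *
        (hornCoef α b A B (α + β) (i, j) * X ^ i * Y ^ j) := by
  rw [div_eq_mul_inv (Complex.Gamma α * Complex.Gamma β), inv_Gamma_eq_poch_mul (α + β) i, hcoef,
    hornTerm_aux (poch_ne_zero hc i) (poch_ne_zero hC j)]
  rfl

/-- The double loop integral is given by Horn's series for small arguments. -/
theorem LoopParams.loopPair_eq_hornH2Series (h : LoopParams p r R) (b A B : ℂ) {α β X Y : ℂ}
    (hα : ∀ n : ℤ, α ≠ n) (hβ : ∀ n : ℤ, β ≠ n) (hc : NonPole (α + β)) {D : Set ℂ}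
    (hD : ∀ s ∈ Set.Icc (0 : ℝ) 1, circleThrough p R s ∈ D ∧ circleThrough p (-r) s ∈ D)
    (hDu : ∀ u ∈ D, u ≠ 0 ∧ ‖X * u‖ ≤ 1 / 2 ∧ ‖Y * (1 - u⁻¹)‖ ≤ 1 / 2) :
    loopPair p r R α β (loopKernel b A B β X Y) =
      (1 - Complex.exp (2 * Real.pi * Complex.I * α)) *
        (1 - Complex.exp (2 * Real.pi * Complex.I * β)) *
        (Complex.Gamma α * Complex.Gamma β / Complex.Gamma (α + β)) *
        hornH2Series α b A B (α + β) (X, -Y) := by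
  have hC := nonPole_of_not_int hβ
  have hcont : ∀ k : ℕ × ℕ, ∀ u : ℂ, u ≠ 0 → ContinuousAt (fun u : ℂ =>
      poch b k.1 / k.1.factorial * X ^ k.1 * (hcoef A B β k.2 * (-Y) ^ k.2) *
        (u ^ ((k.1 : ℤ) - (k.2 : ℤ)) * (1 - u) ^ k.2)) u := fun k u hu =>
    continuousAt_const.mul ((continuousAt_zpow₀ u _ (Or.inl hu)).mul
      ((continuousAt_const.sub continuousAt_id).pow k.2))
  have key := h.hasSum_loopPair α β (S := loopKernel b A B β X Y)
    (summable_loopKernel_bound b A B hC) hD hcont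
    (fun k u hu => by
      rw [← loopKernel_term_eq b A B β X Y (hDu u hu).1]
      exact norm_loopKernel_term_le b A B β (hDu u hu).2.1 (hDu u hu).2.2 k.1 k.2)
    (fun u hu => by
      obtain ⟨u0, hX, hY⟩ := hDu u hu
      have := hasSum_loopKernel b A B hC (hX.trans_lt (by norm_num)) (hY.trans_lt (by norm_num))
      simp only [loopKernel_term_eq b A B β X Y u0] at this
      exact this)
  rw [← key.tsum_eq, hornH2Series, ← tsum_mul_left]
  refine tsum_congr fun k => ?_
  rw [loopPair_const_mul, h.loopPair_monomial hα hβ]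
  exact hornTerm_eq b A B hc hC X (-Y) _ k.1 k.2

/-! #### Holomorphic dependence on the arguments -/

/-- By compactness of `[0, 1]`, local regularity near each `(t₀, s)` holds on a common neighbourhood
of `t₀`. There the integrand is bounded, and the dominated integral is holomorphic. -/
theorem analyticAt_integral_of_tube {f : ℂ → ℝ → ℂ} {t₀ : ℂ}
    (h : ∀ s ∈ Set.Icc (0 : ℝ) 1, ∀ᶠ z : ℂ × ℝ in 𝓝 (t₀, s),
      ContinuousAt (fun z : ℂ × ℝ => f z.1 z.2) z ∧ DifferentiableAt ℂ (fun t => f t z.2) z.1) :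
    AnalyticAt ℂ (fun t => ∫ s in (0 : ℝ)..1, f t s) t₀ := by
  have hK : IsCompact (Set.Icc (0 : ℝ) 1) := isCompact_Icc
  have h' := hK.eventually_forall_of_forall_eventually (x₀ := t₀)
    (P := fun t s => ContinuousAt (fun z : ℂ × ℝ => f z.1 z.2) (t, s) ∧
      DifferentiableAt ℂ (fun t => f t s) t) h
  obtain ⟨ρ, hρ, hb⟩ := Metric.eventually_nhds_iff_ball.1 h'
  have hsub : Metric.closedBall t₀ (ρ / 2) ⊆ Metric.ball t₀ ρ :=
    Metric.closedBall_subset_ball (by linarith)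
  have hcont : ContinuousOn (fun z : ℂ × ℝ => f z.1 z.2)
      (Metric.closedBall t₀ (ρ / 2) ×ˢ Set.Icc (0 : ℝ) 1) := fun z hz =>
    (hb z.1 (hsub hz.1) z.2 hz.2).1.continuousWithinAt
  obtain ⟨K, hKb⟩ := ((isCompact_closedBall t₀ (ρ / 2)).prod hK).exists_bound_of_continuousOn hcont
  refine analyticAt_of_eventually_differentiableAt ?_
  filter_upwards [Metric.ball_mem_nhds t₀ (half_pos hρ)] with t₁ ht₁
  obtain ⟨δ, hδ, hball⟩ := Metric.isOpen_iff.1 Metric.isOpen_ball t₁ ht₁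
  have hball' : ∀ t ∈ Metric.ball t₁ δ, t ∈ Metric.closedBall t₀ (ρ / 2) := fun t ht =>
    Metric.ball_subset_closedBall (hball ht)
  simp only [intervalIntegral.integral_of_le (zero_le_one : (0 : ℝ) ≤ 1)]
  have hI : ∀ s ∈ Set.Ioc (0 : ℝ) 1, s ∈ Set.Icc (0 : ℝ) 1 := fun s hs => ⟨hs.1.le, hs.2⟩
  refine differentiableAt_integral_of_dominated (h := fun _ => K) hδ (fun t ht => ?_) ?_ ?_ ?_
  · refine ContinuousOn.aestronglyMeasurable (fun s hs => ?_) measurableSet_Ioc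
    have := (hb t (hsub (hball' t ht)) s (hI s hs)).1
    exact (ContinuousAt.comp (f := fun s : ℝ => (t, s)) this (by fun_prop)).continuousWithinAt
  · refine (ae_restrict_iff' measurableSet_Ioc).2 (Eventually.of_forall fun s hs t ht => ?_)
    exact (hb t (hsub (hball' t ht)) s (hI s hs)).2.differentiableWithinAt
  · refine (ae_restrict_iff' measurableSet_Ioc).2 (Eventually.of_forall fun s hs t ht => ?_)
    exact hKb (t, s) ⟨hball' t ht, hI s hs⟩
  · exact integrable_const K

theorem analyticAt_integral_loopKernel (b A B : ℂ) {C : ℂ} (hC : NonPole C) {E D c : ℝ → ℂ}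
    (hE : Continuous E) (hD : Continuous D) (hc : Continuous c) (X Y : ℂ) {t₀ : ℂ}
    (hne : ∀ s, c s ≠ 0)
    (h : ∀ s, 1 - t₀ * X * c s ∈ Complex.slitPlane ∧ t₀ * Y * (1 - (c s)⁻¹) ∈ cutPlane) :
    AnalyticAt ℂ (fun t => ∫ s in (0 : ℝ)..1, E s * loopKernel b A B C (t * X) (t * Y) (c s) * D s)
      t₀ := by
  refine analyticAt_integral_of_tube fun s _ => ?_
  have c1 : Continuous fun z : ℂ × ℝ => 1 - z.1 * X * c z.2 := by fun_prop
  have hi : Continuous fun s => (c s)⁻¹ := hc.inv₀ hne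
  have c2 : Continuous fun z : ℂ × ℝ => z.1 * Y * (1 - (c z.2)⁻¹) :=
    (continuous_fst.mul continuous_const).mul (continuous_const.sub (hi.comp continuous_snd))
  filter_upwards [c1.continuousAt.preimage_mem_nhds (Complex.isOpen_slitPlane.mem_nhds (h s).1),
    c2.continuousAt.preimage_mem_nhds (isOpen_cutPlane.mem_nhds (h s).2)] with z h1 h2
  have d := gauss_differentiableAt A B hC h2
  constructor
  · have k1 : ContinuousAt (fun z : ℂ × ℝ => (1 - z.1 * X * c z.2) ^ (-b)) z :=
      c1.continuousAt.cpow continuousAt_const h1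
    have k2 : ContinuousAt (fun z : ℂ × ℝ => gauss2F1 A B C (z.1 * Y * (1 - (c z.2)⁻¹))) z :=
      ContinuousAt.comp (f := fun z : ℂ × ℝ => z.1 * Y * (1 - (c z.2)⁻¹)) d.continuousAt
        c2.continuousAt
    exact ((hE.comp continuous_snd).continuousAt.mul (k1.mul k2)).mul
      (hD.comp continuous_snd).continuousAt
  · have k1 : DifferentiableAt ℂ (fun t : ℂ => (1 - t * X * c z.2) ^ (-b)) z.1 :=
      DifferentiableAt.cpow_const (f := fun t : ℂ => 1 - t * X * c z.2) (by fun_prop) h1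
    have k2 : DifferentiableAt ℂ (fun t : ℂ => gauss2F1 A B C (t * Y * (1 - (c z.2)⁻¹))) z.1 :=
      DifferentiableAt.comp (f := fun t : ℂ => t * Y * (1 - (c z.2)⁻¹)) z.1 d (by fun_prop)
    exact ((k1.mul k2).const_mul (E z.2)).mul_const (D z.2)

theorem LoopParams.analyticAt_loopPair (h : LoopParams p r R) (b A B α β : ℂ) {C : ℂ}
    (hC : NonPole C) {x y t : ℝ} (hx : x < 0) (hy : 1 < y) (hqr : (y - 1)⁻¹ < r)
    (hxr : r < (-x)⁻¹) (ht0 : 0 ≤ t) (ht1 : t ≤ 1) :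
    AnalyticAt ℂ (fun t : ℂ => loopPair p r R α β (loopKernel b A B C (t * x) (t * (y : ℂ)⁻¹))) t := by
  have k := h.kernel_mem hx hy hqr hxr ht0 ht1
  have k1 := analyticAt_integral_loopKernel b A B hC
    (((continuous_const (y := α - 1)).mul h.hasLog_one.continuous).add
      ((continuous_const (y := β - 1)).mul h.hasLog_one_sub_one.continuous)).cexp
    (continuous_deriv_circleThrough p R) (continuous_circleThrough p R) x (y : ℂ)⁻¹ (t₀ := t)
    (fun s => (h.circle_one_ne s).1) fun s => (k s).1
  have k0 := analyticAt_integral_loopKernel b A B hC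
    (((continuous_const (y := α - 1)).mul h.hasLog_zero.continuous).add
      ((continuous_const (y := β - 1)).mul h.hasLog_one_sub_zero.continuous)).cexp
    (continuous_deriv_circleThrough p (-r)) (continuous_circleThrough p (-r)) x (y : ℂ)⁻¹ (t₀ := t)
    (fun s => (h.circle_zero_ne s).1) fun s => (k s).2
  exact (analyticAt_const.mul k1).sub (analyticAt_const.mul k0)


/-! #### Horn's function as a double loop integral -/

theorem mem_hornH2Domain {x y t : ℝ} (hx : x < 0) (hxy : 1 < x + y) (ht0 : 0 ≤ t) (ht1 : t ≤ 1) :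
    ((t : ℂ) * x, -((t : ℂ) * (y : ℂ)⁻¹)) ∈ hornH2Domain := by
  right
  have hy : 0 < y := by linarith
  have htx : t * x ≤ 0 := mul_nonpos_of_nonneg_of_nonpos ht0 hx.le
  have e : (1 : ℂ) - (t : ℂ) * x = ((1 - t * x : ℝ) : ℂ) := by push_cast; rfl
  change ‖(t : ℂ) * x‖ + ‖-((t : ℂ) * (y : ℂ)⁻¹)‖ * ‖1 - (t : ℂ) * x‖ < ‖1 - (t : ℂ) * x‖
  rw [e, norm_neg, ← Complex.ofReal_mul, ← Complex.ofReal_inv, ← Complex.ofReal_mul,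
    Complex.norm_real, Complex.norm_real, Complex.norm_real, Real.norm_eq_abs, Real.norm_eq_abs,
    Real.norm_eq_abs, abs_of_nonpos htx, abs_of_nonneg (by positivity : 0 ≤ t * y⁻¹),
    abs_of_pos (by linarith : 0 < 1 - t * x)]
  have h1 : 1 - t * x < y := by nlinarith
  have h2 : t * y⁻¹ * (1 - t * x) < 1 := by
    have h3 : t * (1 - t * x) < y := by nlinarith
    rw [mul_right_comm, ← div_eq_mul_inv, div_lt_one hy]
    exact h3
  linarith

variable {p r R : ℝ}

theorem LoopParams.exists_bound_loops (h : LoopParams p r R) : ∃ M : ℝ,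
    ∀ s ∈ Set.Icc (0 : ℝ) 1, ∀ u : ℂ, u = circleThrough p R s ∨ u = circleThrough p (-r) s →
      u ≠ 0 ∧ ‖u‖ ≤ M ∧ ‖1 - u⁻¹‖ ≤ M := by
  have c1 := continuous_circleThrough p R
  have c0 := continuous_circleThrough p (-r)
  have d1 := c1.inv₀ fun s => (h.circle_one_ne s).1
  have d0 := c0.inv₀ fun s => (h.circle_zero_ne s).1
  have hc : Continuous fun s => ‖circleThrough p R s‖ + ‖1 - (circleThrough p R s)⁻¹‖ +
      ‖circleThrough p (-r) s‖ + ‖1 - (circleThrough p (-r) s)⁻¹‖ :=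
    ((c1.norm.add (continuous_const.sub d1).norm).add c0.norm).add (continuous_const.sub d0).norm
  obtain ⟨M, hM⟩ := (isCompact_Icc (a := (0 : ℝ)) (b := 1)).exists_bound_of_continuousOn
    hc.continuousOn
  refine ⟨M, fun s hs u hu => ?_⟩
  have h1 := (le_abs_self _).trans (hM s hs)
  have n1 := norm_nonneg (circleThrough p R s)
  have n2 := norm_nonneg (1 - (circleThrough p R s)⁻¹)
  have n3 := norm_nonneg (circleThrough p (-r) s)
  have n4 := norm_nonneg (1 - (circleThrough p (-r) s)⁻¹)
  rcases hu with rfl | rfl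
  · exact ⟨(h.circle_one_ne s).1, by linarith, by linarith⟩
  · exact ⟨(h.circle_zero_ne s).1, by linarith, by linarith⟩

theorem LoopParams.eventually_hornH2_eq (h : LoopParams p r R) (b A B : ℂ) {α β : ℂ}
    (hα : ∀ n : ℤ, α ≠ n) (hβ : ∀ n : ℤ, β ≠ n) (hc : NonPole (α + β)) (x y : ℝ) :
    ∀ᶠ t : ℝ in 𝓝[>] 0, loopPair p r R α β (loopKernel b A B β (t * x) (t * (y : ℂ)⁻¹)) =
      (1 - Complex.exp (2 * Real.pi * Complex.I * α)) *
        (1 - Complex.exp (2 * Real.pi * Complex.I * β)) *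
        (Complex.Gamma α * Complex.Gamma β / Complex.Gamma (α + β)) *
        hornH2 α b A B (α + β) (t * x) (-(t * (y : ℂ)⁻¹)) := by
  obtain ⟨M, hM⟩ := h.exists_bound_loops
  have k1 : ContinuousAt (fun t : ℝ => ‖(t : ℂ) * x‖ * M) 0 := by fun_prop
  have k2 : ContinuousAt (fun t : ℝ => ‖(t : ℂ) * (y : ℂ)⁻¹‖ * M) 0 := by fun_prop
  have k3 : ContinuousAt (fun t : ℝ => ((t : ℂ) * x, -((t : ℂ) * (y : ℂ)⁻¹))) 0 := by fun_prop
  -- Both arguments of the expansion tend to `0` with `t`, uniformly on the two circles. The bound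
  -- `1/2` is an arbitrary number below `1` that makes the double expansion dominated by a fixed
  -- summable series.
  have e1 := k1.tendsto.eventually_lt_const (u := 1 / 2) (by simp)
  have e2 := k2.tendsto.eventually_lt_const (u := 1 / 2) (by simp)
  have e3 := k3.preimage_mem_nhds (isOpen_hornH2Disc.mem_nhds (by simp [hornH2Disc]))
  filter_upwards [nhdsWithin_le_nhds e1, nhdsWithin_le_nhds e2, nhdsWithin_le_nhds e3]
    with t h1 h2 h3
  rw [hornH2, (continuation_spec (hasContinuation_hornH2 hα b A B hc)).2 h3]
  refine h.loopPair_eq_hornH2Series b A B hα hβ hc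
    (D := {u | ∃ s ∈ Set.Icc (0 : ℝ) 1, u = circleThrough p R s ∨ u = circleThrough p (-r) s})
    (fun s hs => ⟨⟨s, hs, Or.inl rfl⟩, ⟨s, hs, Or.inr rfl⟩⟩) ?_
  rintro u ⟨s, hs, hu⟩
  obtain ⟨u0, u1, u2⟩ := hM s hs u hu
  refine ⟨u0, ?_, ?_⟩
  · rw [norm_mul]
    exact (mul_le_mul_of_nonneg_left u1 (norm_nonneg _)).trans h1.le
  · rw [norm_mul]
    exact (mul_le_mul_of_nonneg_left u2 (norm_nonneg _)).trans h2.le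

/-- Both sides are analytic in the scaling parameter `t` on a neighbourhood of `[0, 1]`: the loop
avoids the scaled singularities, and `(t x, -t/y)` stays in the domain of `H₂`. They agree for small
`t > 0` by expansion, hence at `t = 1`. -/
theorem LoopParams.loopPair_eq_hornH2 (h : LoopParams p r R) (b A B : ℂ) {α β : ℂ}
    (hα : ∀ n : ℤ, α ≠ n) (hβ : ∀ n : ℤ, β ≠ n) (hc : NonPole (α + β)) {x y : ℝ}
    (hx : x < 0) (hxy : 1 < x + y) (hqr : (y - 1)⁻¹ < r) (hxr : r < (-x)⁻¹) :
    loopPair p r R α β (loopKernel b A B β x (y : ℂ)⁻¹) =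
      (1 - Complex.exp (2 * Real.pi * Complex.I * α)) *
        (1 - Complex.exp (2 * Real.pi * Complex.I * β)) *
        (Complex.Gamma α * Complex.Gamma β / Complex.Gamma (α + β)) *
        hornH2 α b A B (α + β) x (-(y : ℂ)⁻¹) := by
  have hd := (continuation_spec (hasContinuation_hornH2 hα b A B hc)).1
  have key := eq_at_one_of_analytic_on_segment
    (fun t ht => h.analyticAt_loopPair b A B α β (nonPole_of_not_int hβ) hx (by linarith) hqr hxr
      ht.1 ht.2)
    (g := fun t : ℂ => (1 - Complex.exp (2 * Real.pi * Complex.I * α)) *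
        (1 - Complex.exp (2 * Real.pi * Complex.I * β)) *
        (Complex.Gamma α * Complex.Gamma β / Complex.Gamma (α + β)) *
        hornH2 α b A B (α + β) (t * x) (-(t * (y : ℂ)⁻¹)))
    (fun t ht => ?_) (h.eventually_hornH2_eq b A B hα hβ hc x y)
  · simpa only [one_mul] using key
  · refine analyticAt_const.mul (analyticAt_of_eventually_differentiableAt ?_)
    have hc' : ContinuousAt (fun t : ℂ => (t * (x : ℂ), -(t * (y : ℂ)⁻¹))) t := by fun_prop
    filter_upwards [hc'.preimage_mem_nhds (isOpen_hornH2Domain.mem_nhds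
      (mem_hornH2Domain hx hxy ht.1 ht.2))] with w hw
    exact DifferentiableAt.comp (f := fun t : ℂ => (t * (x : ℂ), -(t * (y : ℂ)⁻¹))) w
      (hd.differentiableAt (isOpen_hornH2Domain.mem_nhds hw)) (by fun_prop)

theorem hornH2_eq_loopI {a b₁ b₂ c₁ c₂ : ℂ} {x y : ℝ} (hx : x < 0) (hxy : 1 < x + y)
    (hc₁ : NonPole c₁) (hα : ∀ n : ℤ, a - b₂ ≠ n) (hβ : ∀ n : ℤ, -a + b₂ + c₁ ≠ n)
    (h : LoopParams p r R) (hqr : (y - 1)⁻¹ < r) (hxr : r < (-x)⁻¹) :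
    (y : ℂ) ^ (-b₂) * hornH2 (a - b₂) b₁ b₂ (b₂ - c₂ + 1) c₁ x (-(y : ℂ)⁻¹) =
      loopI p r R a b₁ b₂ c₁ c₂ x y := by
  have hC := nonPole_of_not_int hβ
  have hsum : a - b₂ + (-a + b₂ + c₁) = c₁ := by ring
  obtain ⟨k1, k0⟩ := h.continuous_kernel b₁ b₂ (b₂ - c₂ + 1) hC hx (by linarith) hqr hxr
    zero_le_one le_rfl
  simp only [Complex.ofReal_one, one_mul] at k1 k0
  have e1 := h.doubleLoopIntegral_eq (a - b₂) (-a + b₂ + c₁) k1 k0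
  have e2 := h.loopPair_eq_hornH2 b₁ b₂ (b₂ - c₂ + 1) hα hβ (by rwa [hsum]) hx hxy hqr hxr
  rw [loopPair, ← e1, hsum] at e2
  have nα := one_sub_exp_ne_zero hα
  have nβ := one_sub_exp_ne_zero hβ
  have hΓ := (nonPole_of_not_int hα).Gamma_ne_zero
  have hΓβ := hC.Gamma_ne_zero
  have hΓc := hc₁.Gamma_ne_zero
  change _ = Complex.Gamma c₁ / (Complex.Gamma (a - b₂) * Complex.Gamma (-a + b₂ + c₁)) *
    ((y : ℂ) ^ (-b₂) /
      ((1 - Complex.exp (2 * Real.pi * Complex.I * (a - b₂))) *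
        (1 - Complex.exp (2 * Real.pi * Complex.I * (-a + b₂ + c₁))))) *
    doubleLoopIntegral p r R (a - b₂) (-a + b₂ + c₁)
      (loopKernel b₁ b₂ (b₂ - c₂ + 1) (-a + b₂ + c₁) x (y : ℂ)⁻¹)
  rw [e2]
  generalize hornH2 (a - b₂) b₁ b₂ (b₂ - c₂ + 1) c₁ x (-(y : ℂ)⁻¹) = H
  generalize 1 - Complex.exp (2 * Real.pi * Complex.I * (a - b₂)) = E₁ at nα ⊢
  generalize 1 - Complex.exp (2 * Real.pi * Complex.I * (-a + b₂ + c₁)) = E₂ at nβ ⊢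
  generalize Complex.Gamma (a - b₂) = G₁ at hΓ ⊢
  generalize Complex.Gamma (-a + b₂ + c₁) = G₂ at hΓβ ⊢
  generalize Complex.Gamma c₁ = G₃ at hΓc ⊢
  generalize (y : ℂ) ^ (-b₂) = Y
  field_simp

end HornOlsson

/-! ### Assembly of the four statements -/

theorem mainTheorem3 (a b₁ b₂ c₁ c₂ : ℂ) (x y : ℝ) (hx : x < 0) (hxy : 1 < x + y)
    (hc₁ : ∀ n : ℕ, c₁ ≠ -(n : ℂ)) :
    -- the evaluation of the double loop integral
    ((∀ n : ℤ, a - b₂ ≠ n) → (∀ n : ℤ, -a + b₂ + c₁ ≠ n) →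
      HasContinuation (hornH2Series (a - b₂) b₁ b₂ (b₂ - c₂ + 1) c₁) hornH2Disc hornH2Domain ∧
      ∀ p r R : ℝ, 0 < p → p < 1 → 1 < R → (y - 1)⁻¹ < r → r < (-x)⁻¹ →
        (y : ℂ) ^ (-b₂) * hornH2 (a - b₂) b₁ b₂ (b₂ - c₂ + 1) c₁ x (-(y : ℂ)⁻¹) =
          loopI p r R a b₁ b₂ c₁ c₂ x y) ∧
    -- the integral over `[0, 1]`, under the constraints at `u = 0` and `u = 1`
    (0 < a.re → 0 < (a - c₂ + 1).re → 0 < (b₂ + c₁ - a).re →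
      (∀ n : ℕ, a + b₂ - c₂ + 1 ≠ -(n : ℂ)) →
      IntervalIntegrable (integrandI₁ a b₁ b₂ c₁ c₂ x y) volume 0 1 ∧
      HasContinuation (olssonFPSeries a b₁ b₂ c₁ c₂) olssonFPDisc olssonFPDomain ∧
      segmentI₁ a b₁ b₂ c₁ c₂ x y = const₁ a b₂ c₂ * olssonFP a b₁ b₂ c₁ c₂ x y) ∧
    -- the integral over `[(1 - y)⁻¹, 0]`, under the constraints at `u = 0` and `u = (1 - y)⁻¹`
    (0 < a.re → 0 < (a - c₂ + 1).re → 0 < (c₁ + c₂ - a - b₂).re →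
      (∀ n : ℕ, a - b₂ + 1 ≠ -(n : ℂ)) → (∀ n : ℕ, -a + b₂ + 1 ≠ -(n : ℂ)) →
      (∀ n : ℕ, -a + b₂ + c₁ ≠ -(n : ℂ)) →
      (∀ X : ℝ, 1 < X → ∃ L₁ L₂ : ℂ,
        Tendsto (fun ε : ℝ => gauss2F1 b₂ (b₂ - c₂ + 1) (-a + b₂ + c₁) (X + ε * Complex.I))
          (𝓝[>] (0 : ℝ)) (𝓝 L₁) ∧
        Tendsto (fun ε : ℝ => gauss2F1 b₂ (b₂ - c₂ + 1) (-a + b₂ + c₁) (X - ε * Complex.I))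
          (𝓝[>] (0 : ℝ)) (𝓝 L₂)) ∧
      IntervalIntegrable (integrandI₂ a b₁ b₂ c₁ c₂ x y) volume (1 - y)⁻¹ 0 ∧
      HasContinuation (olssonFPSeries a b₁ (c₂ - b₂) c₁ c₂) olssonFPDisc olssonFPDomain ∧
      segmentI₂ a b₁ b₂ c₁ c₂ x y = const₂ a b₂ c₂ * (y - 1 : ℂ) ^ (-a) *
        olssonFP a b₁ (c₂ - b₂) c₁ c₂ (x / (1 - y)) (y / (y - 1))) ∧
    -- shrinking of the double loop, and the three-term relation
    ((∀ n : ℤ, a - b₂ ≠ n) → (∀ n : ℤ, -a + b₂ + c₁ ≠ n) →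
      0 < a.re → 0 < (a - c₂ + 1).re → 0 < (b₂ + c₁ - a).re → 0 < (c₁ + c₂ - a - b₂).re →
      (∀ p r R : ℝ, 0 < p → p < 1 → 1 < R → (y - 1)⁻¹ < r → r < (-x)⁻¹ →
        loopI p r R a b₁ b₂ c₁ c₂ x y =
          segmentI₁ a b₁ b₂ c₁ c₂ x y + segmentI₂ a b₁ b₂ c₁ c₂ x y) ∧
      ((∀ n : ℕ, a + b₂ - c₂ + 1 ≠ -(n : ℂ)) →
      (y : ℂ) ^ (-b₂) * hornH2 (a - b₂) b₁ b₂ (b₂ - c₂ + 1) c₁ x (-(y : ℂ)⁻¹) =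
        const₁ a b₂ c₂ * olssonFP a b₁ b₂ c₁ c₂ x y +
          const₂ a b₂ c₂ * (y - 1 : ℂ) ^ (-a) *
            olssonFP a b₁ (c₂ - b₂) c₁ c₂ (x / (1 - y)) (y / (y - 1)))) := by
  have hc : HornOlsson.NonPole c₁ := hc₁
  have hy : 1 < y := by linarith
  refine ⟨fun hα hβ => ⟨HornOlsson.hasContinuation_hornH2 hα _ _ _ hc, ?_⟩, ?_, ?_, ?_⟩
  · intro p r R hp hp1 hR hqr hxr
    exact HornOlsson.hornH2_eq_loopI hx hxy hc hα hβ
      ⟨hp, hp1, hR, (inv_pos.2 (sub_pos.2 hy)).trans hqr⟩ hqr hxr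
  · intro h1 h2 h3 hE
    exact HornOlsson.segmentI₁_eq (by linarith) (by linarith) hc h1 h2 h3 hE
  · intro h1 h2 h4 hE _ hC
    refine ⟨fun X hX => HornOlsson.exists_gauss_limits hC ?_ hX,
      HornOlsson.segmentI₂_eq hxy hx hc h1 h2 h4 hE hC⟩
    simp only [Complex.add_re, Complex.sub_re, Complex.neg_re, Complex.one_re] at h4 ⊢
    linarith
  · intro hα hβ h1 h2 h3 h4
    have hI : ∀ p r R : ℝ, 0 < p → p < 1 → 1 < R → (y - 1)⁻¹ < r → r < (-x)⁻¹ →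
        loopI p r R a b₁ b₂ c₁ c₂ x y =
          segmentI₁ a b₁ b₂ c₁ c₂ x y + segmentI₂ a b₁ b₂ c₁ c₂ x y :=
      fun p r R hp hp1 hR hqr hxr => HornOlsson.loopI_eq_segments hx hxy hα hβ h1 h2 h3 h4
        ⟨hp, hp1, hR, (inv_pos.2 (sub_pos.2 hy)).trans hqr⟩ hqr hxr
    refine ⟨hI, fun hE => ?_⟩
    -- An admissible radius exists because `x + y > 1` means `-x < y - 1`. The relation itself
    -- contains no loop parameters, so one choice is enough.
    obtain ⟨r, hqr, hxr⟩ := exists_between (a₁ := (y - 1)⁻¹) (a₂ := (-x)⁻¹)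
      (inv_strictAnti₀ (neg_pos.2 hx) (by linarith))
    have hE' : HornOlsson.NonPole (a - b₂ + 1) := fun n hn =>
      hα (-(n : ℤ) - 1) (by push_cast; linear_combination hn)
    rw [HornOlsson.hornH2_eq_loopI (p := 1 / 2) (r := r) (R := 2) hx hxy hc hα hβ
      ⟨by norm_num, by norm_num, by norm_num, (inv_pos.2 (sub_pos.2 hy)).trans hqr⟩ hqr hxr,
      hI _ _ _ (by norm_num) (by norm_num) (by norm_num) hqr hxr,
      (HornOlsson.segmentI₁_eq (by linarith) (by linarith) hc h1 h2 h3 hE).2.2,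
      (HornOlsson.segmentI₂_eq hxy hx hc h1 h2 h4 hE' (HornOlsson.nonPole_of_not_int hβ)).2.2]
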